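/- **Setting.** Let $\mathcal S\subseteq\{-1,0,1\}^2\setminus\{(0,0)\}$ be a set of small steps with weights $\omega_s>0$ ($s\in\mathcal S$), not contained in any closed half-plane bounded by a line through the origin. Put $\mathcal Q=\mathbb Z_{\ge0}^2$ and $S(x,y)=\sum_{(i,j)\in\mathcal S}\omega_{(i,j)}x^iy^j$. For $(u,v),(k,l)\in\mathcal Q$ let $q((u,v),(k,l);n)$ be the weighted number of lattice paths with $n$ steps from $(u,v)$ to $(k,l)$ that stay in $\mathcal Q$ (a path has as weight the product of the weights of its steps), and let $Q_{u,v}(x,y;t)=\sum_{n\ge0}t^n\sum_{k,l\ge0}q((u,v),(k,l);n)x^ky^l$. Let $\mathcal G$ be the group of birational transformations generated by $$\Phi(x,y)=\Bigl(x,\ \frac{\sum_i\omega_{(i,-1)}x^i}{y\sum_i\omega_{(i,1)}x^i}\Bigr),\qquad \Psi(x,y)=\Bigl(\frac{\sum_j\omega_{(-1,j)}y^j}{x\sum_j\omega_{(1,j)}y^j},\ y\Bigr).$$ The model is *orbit-summable* if $\mathcal G$ is finite and, for every $g\in\mathcal G$ with $g\ne\mathrm{id}$ and every starting point $(u,v)\in\mathcal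 Q$, each coefficient of $t^n$ in $g(xy)\,Q_{u,v}(g(x),g(y);t)$ has an expansion as a Laurent series in $x$ and $y$ (a power series in $x,y$ divided by a power of $xy$), and this expansion contains no monomial $x^iy^j$ with $i,j>0$. The drift of the model is $\sum_{(i,j)\in\mathcal S}\omega_{(i,j)}(i,j)$. A *dominant saddle point* is a point $(x_0,y_0)$, $x_0,y_0>0$, at which $S$ attains its minimum over $\mathbb R^+\times\mathbb R^+$. For $t>0$ and functions $f$ on $\mathcal Q$ (extended by $0$ outside $\mathcal Q$) let $\triangle f(x)=\sum_{s\in\mathcal S}\omega_sf(x-s)-tf(x)$ and $\tilde\triangle f(x)=\sum_{s\in\mathcal S}\omega_sf(x+s)-tf(x)$ for $x\in\mathcal Q$; these are again functions on $\mathcal Q$. A function $f(B,A)$ on $\mathcal Q\times\mathcal Q$ is *multivariate $t$-polyharmonic of order $p$* if $\triangle^j\tilde\triangle^{p-j}f=0$ for all $0\le j\le p$, where $\triangle$ acts on $B$ and $\tilde\triangle$ acts on $A$. **Theorem.** Suppose that the model is orbit-summable and that $(x_0,y_0)$ is a dominant saddle point. Put $\gamma=S(x_0,y_0)>0$. The points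 $(x,y)\in\mathbb C^2$ with $|x|=x_0$, $|y|=y_0$ and $|S(x,y)|=\gamma$ are finite in number; write them as $(\alpha_ix_0,\beta_iy_0)$, $1\le i\le r$ (each once, $(x_0,y_0)$ included), and let $\zeta_i=S(\alpha_ix_0,\beta_iy_0)/\gamma$. Then there are $c\in\mathbb N$ and real-valued functions $v_p(k,l,u,v)$, $p\ge1$, such that for all $(u,v),(k,l)\in\mathcal Q$ and all $m\in\mathbb N$, as $n\to\infty$, $$q((u,v),(k,l);n)=\frac{\gamma^n}{n^c}\left[\sum_{p=1}^{m-1}\frac{v_p(k,l,u,v)\sum_{i=1}^r\alpha_i^{u-k}\beta_i^{v-l}\zeta_i^n}{n^p}+\mathcal O\left(\frac1{n^m}\right)\right].$$ For every $p\ge1$ one has $v_p(k,l,u,v)=x_0^{u-k}y_0^{v-l}P_p(k,l,u,v)$ with a polynomial $P_p$ that has degree $c+2p-2$ in $(k,l)$, degree $c+2p-2$ in $(u,v)$, and total degree $2c+2p-2$. The function $v_p$ is a polynomial if and only if the drift is zero, and in this case $v_p=P_p$. Finally, $v_p$, as a function of the end point $(k,l)$ and the starting point $(u,v)$, is multivariate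 $\gamma$-polyharmonic of order $p$. -/

import Mathlib

open Filter Asymptotics

noncomputable section

namespace QuadrantWalk

/-- The nine vectors with coordinates in `{-1, 0, 1}`. -/
def stepBox : Finset (ℤ × ℤ) := Finset.Icc (-1) 1 ×ˢ Finset.Icc (-1) 1

/-- A weighted model with small steps. The allowed steps are the vectors of non-zero weight; they
have positive weight, are small and non-zero, and no closed half-plane bounded by a line through
the origin contains all of them. -/
structure Model where
  weight : ℤ × ℤ → ℝ
  weight_nonneg : ∀ s, 0 ≤ weight s
  small : ∀ s, weight s ≠ 0 → s ∈ stepBox ∧ s ≠ 0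
  nondegenerate : ∀ a b : ℝ, (a, b) ≠ (0, 0) →
    ∃ s, weight s ≠ 0 ∧ a * (s.1 : ℝ) + b * (s.2 : ℝ) < 0

/-- The quarter plane. -/
def InQuadrant (x : ℤ × ℤ) : Prop := 0 ≤ x.1 ∧ 0 ≤ x.2

instance : DecidablePred InQuadrant := fun x =>
  inferInstanceAs (Decidable (0 ≤ x.1 ∧ 0 ≤ x.2))

/-- The position after `i` steps of the path that starts at `A` and takes the steps
`σ 0, σ 1, …`. -/
def position (A : ℤ × ℤ) {n : ℕ} (σ : Fin n → ℤ × ℤ) (i : ℕ) : ℤ × ℤ :=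
  A + ∑ j : Fin n with j.val < i, σ j

open Classical in
/-- The weighted number `q(A, B; n)` of lattice paths of length `n` from `A` to `B` that stay in
the quarter plane; a path counts with the product of the weights of its steps. -/
def walks (M : Model) (A B : ℤ × ℤ) (n : ℕ) : ℝ :=
  ∑ σ ∈ Fintype.piFinset (fun _ : Fin n => stepBox) with
    (∀ i ≤ n, InQuadrant (position A σ i)) ∧ position A σ n = B,
    ∏ i, M.weight (σ i)

/-- The step polynomial `S(x, y) = ∑ ω_{(i,j)} x^i y^j`, evaluated in an extension field
of the reals. -/
def stepPoly (M : Model) {F : Type*} [Field F] [Algebra ℝ F] (x y : F) : F :=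
  ∑ s ∈ stepBox, algebraMap ℝ F (M.weight s) * x ^ s.1 * y ^ s.2

/-- The model has zero drift. -/
def ZeroDrift (M : Model) : Prop :=
  ∑ s ∈ stepBox, M.weight s * (s.1 : ℝ) = 0 ∧ ∑ s ∈ stepBox, M.weight s * (s.2 : ℝ) = 0

/-- `(x₀, y₀)` minimizes the step polynomial on the open positive quadrant. -/
def IsDominantSaddle (M : Model) (x₀ y₀ : ℝ) : Prop :=
  0 < x₀ ∧ 0 < y₀ ∧ ∀ x y : ℝ, 0 < x → 0 < y → stepPoly M x₀ y₀ ≤ stepPoly M x y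

/-- The saddle points associated with `(x₀, y₀)`, the point itself included: the points of the torus
`|x| = x₀, |y| = y₀` at which the step polynomial has modulus `S(x₀, y₀)`. -/
def saddlePoints (M : Model) (x₀ y₀ : ℝ) : Set (ℂ × ℂ) :=
  {z | ‖z.1‖ = x₀ ∧ ‖z.2‖ = y₀ ∧ ‖stepPoly M z.1 z.2‖ = stepPoly M x₀ y₀}

/-! ### The group of the model and orbit-summability -/

/-- The field `ℂ(x, y)`. -/
abbrev RatXY : Type := FractionRing (MvPolynomial (Fin 2) ℂ)

/-- The element `x` of `ℂ(x, y)`. -/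
def varX : RatXY := algebraMap (MvPolynomial (Fin 2) ℂ) RatXY (MvPolynomial.X 0)

/-- The element `y` of `ℂ(x, y)`. -/
def varY : RatXY := algebraMap (MvPolynomial (Fin 2) ℂ) RatXY (MvPolynomial.X 1)

/-- A real constant in `ℂ(x, y)`. -/
def const (r : ℝ) : RatXY := algebraMap (MvPolynomial (Fin 2) ℂ) RatXY (MvPolynomial.C (r : ℂ))

/-- The coefficient of `y^j` in the step polynomial, at `X`. -/
def rowSum (M : Model) (j : ℤ) (X : RatXY) : RatXY :=
  ∑ i ∈ Finset.Icc (-1 : ℤ) 1, const (M.weight (i, j)) * X ^ i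

/-- The coefficient of `x^i` in the step polynomial, at `Y`. -/
def colSum (M : Model) (i : ℤ) (Y : RatXY) : RatXY :=
  ∑ j ∈ Finset.Icc (-1 : ℤ) 1, const (M.weight (i, j)) * Y ^ j

/-- The transformation `Φ : (x, y) ↦ (x, y⁻¹ c(x) / a(x))`, where `a(x) y² + b(x) y + c(x)` is the
kernel `x y (1 - t S(x, y))`; in the quotient `c / a` the common factor `- t x` cancels. -/
def Phi (M : Model) (g : RatXY × RatXY) : RatXY × RatXY :=
  (g.1, g.2⁻¹ * (rowSum M (-1) g.1 / rowSum M 1 g.1))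

/-- The transformation `Ψ : (x, y) ↦ (x⁻¹ c̃(y) / ã(y), y)`. -/
def Psi (M : Model) (g : RatXY × RatXY) : RatXY × RatXY :=
  (g.1⁻¹ * (colSum M (-1) g.2 / colSum M 1 g.2), g.2)

/-- The group generated by the involutions `Φ` and `Ψ`. A birational transformation `g` of the plane
is recorded by the pair `(g(x), g(y))` of rational functions, that is, by its value at the generic
point `(x, y)`; the pair `(x, y)` is the identity. -/
inductive MemGroup (M : Model) : RatXY × RatXY → Prop
  | one : MemGroup M (varX, varY)
  | phi {g : RatXY × RatXY} : MemGroup M g → MemGroup M (Phi M g)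
  | psi {g : RatXY × RatXY} : MemGroup M g → MemGroup M (Psi M g)

/-- The coefficient of `t^n` in the generating function `Q_{u,v}(x, y; t)` of walks that start at
`(u, v)`, with `x`, `y` replaced by `X`, `Y`. (After `n` small steps the end point `(k, l)` satisfies
`k ≤ u + n` and `l ≤ v + n`, so that the sum is over all end points.) -/
def walkGF (M : Model) (u v n : ℕ) (X Y : RatXY) : RatXY :=
  ∑ k ∈ Finset.range (u + n + 1), ∑ l ∈ Finset.range (v + n + 1),
    const (walks M ((u : ℤ), (v : ℤ)) ((k : ℤ), (l : ℤ)) n) * X ^ k * Y ^ l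

/-- `(x y)^(-N) F(x, y)`, with `F` a formal power series, is the Laurent series of the rational
function `f`. -/
def IsLaurentExpansion (f : RatXY) (N : ℕ) (F : MvPowerSeries (Fin 2) ℂ) : Prop :=
  ∃ p d : MvPolynomial (Fin 2) ℂ, d ≠ 0 ∧
    f = algebraMap (MvPolynomial (Fin 2) ℂ) RatXY p / algebraMap (MvPolynomial (Fin 2) ℂ) RatXY d ∧
    (d : MvPowerSeries (Fin 2) ℂ) * F =
      ((p * (MvPolynomial.X 0 * MvPolynomial.X 1) ^ N : MvPolynomial (Fin 2) ℂ) :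
        MvPowerSeries (Fin 2) ℂ)

/-- The rational function `f` has a Laurent series in `x` and `y`, and this series contains no
monomial `x^i y^j` with `i > 0` and `j > 0`; that is, `[x^>][y^>] f = 0`. -/
def NoPositivePart (f : RatXY) : Prop :=
  ∃ (N : ℕ) (F : MvPowerSeries (Fin 2) ℂ), IsLaurentExpansion f N F ∧
    ∀ i j : ℕ, 0 < i → 0 < j →
      MvPowerSeries.coeff (Finsupp.single 0 (i + N) + Finsupp.single 1 (j + N)) F = 0

/-- The model is orbit-summable: its group is finite, and for every starting point `(u, v)` no term
`g(x y) Q_{u,v}(g(x), g(y); t)` of the orbit sum with `g ≠ id` contributes a monomial with positive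
exponents of both `x` and `y`. -/
def OrbitSummable (M : Model) : Prop :=
  {g | MemGroup M g}.Finite ∧
    ∀ g, MemGroup M g → g ≠ (varX, varY) →
      ∀ u v n : ℕ, NoPositivePart (g.1 * g.2 * walkGF M u v n g.1 g.2)

/-! ### Discrete polyharmonic functions -/

/-- The weights of the model with reversed steps. -/
def reverse (ω : ℤ × ℤ → ℝ) : ℤ × ℤ → ℝ := fun s => ω (-s)

/-- The discrete Laplacian `Δ f(x) = ∑ ω_s f(x - s) - t f(x)` with Dirichlet boundary conditions: it
acts on functions on the quarter plane, which are regarded as functions on `ℤ²` that are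
zero outside. -/
def laplacian (ω : ℤ × ℤ → ℝ) (t : ℝ) (f : ℤ × ℤ → ℝ) (x : ℤ × ℤ) : ℝ :=
  if InQuadrant x then ∑ s ∈ stepBox, ω s * f (x - s) - t * f x else 0

/-- The Laplacian in the first point. -/
def laplacianFst (ω : ℤ × ℤ → ℝ) (t : ℝ) (f : ℤ × ℤ → ℤ × ℤ → ℝ) : ℤ × ℤ → ℤ × ℤ → ℝ :=
  fun x y => laplacian ω t (fun z => f z y) x

/-- The adjoint Laplacian in the second point. -/
def adjointLaplacianSnd (ω : ℤ × ℤ → ℝ) (t : ℝ) (f : ℤ × ℤ → ℤ × ℤ → ℝ) :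
    ℤ × ℤ → ℤ × ℤ → ℝ :=
  fun x y => laplacian (reverse ω) t (fun z => f x z) y

/-- `f` is multivariate `t`-polyharmonic of order `p`: it vanishes outside the quarter plane in
either point, and any `k` Laplacians in the first point together with `p - k` adjoint
Laplacians in the second point annihilate it. -/
def IsMultivariatePolyharmonic (ω : ℤ × ℤ → ℝ) (t : ℝ) (p : ℕ)
    (f : ℤ × ℤ → ℤ × ℤ → ℝ) : Prop :=
  (∀ x y, ¬ InQuadrant x ∨ ¬ InQuadrant y → f x y = 0) ∧
    ∀ k ≤ p, ∀ x y,
      ((laplacianFst ω t)^[k] ((adjointLaplacianSnd ω t)^[p - k] f)) x y = 0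

/-- The value of a polynomial in four variables at `(k, l, u, v)`. -/
def evalAt (P : MvPolynomial (Fin 4) ℝ) (k l u v : ℕ) : ℝ :=
  MvPolynomial.eval ![(k : ℝ), (l : ℝ), (u : ℝ), (v : ℝ)] P

end QuadrantWalk

end

set_option autoImplicit false

noncomputable section

namespace QuadrantWalk

section

open MvPolynomial (X_ne_zero eval)
/-! ### Regularity and evaluation of rational functions -/

/-- The polynomial ring `ℂ[x, y]`. -/
abbrev PolyXY : Type := MvPolynomial (Fin 2) ℂ

/-- The inclusion of `ℂ[x, y]` in `ℂ(x, y)`. -/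
abbrev toRat : PolyXY →+* RatXY := algebraMap PolyXY RatXY

lemma toRat_injective : Function.Injective toRat := IsFractionRing.injective PolyXY RatXY

lemma toRat_ne_zero {p : PolyXY} (h : p ≠ 0) : toRat p ≠ 0 :=
  (map_ne_zero_iff _ toRat_injective).2 h

lemma ne_zero_of_eval_ne_zero {a : Fin 2 → ℂ} {d : PolyXY} (h : eval a d ≠ 0) :
    d ≠ 0 := by
  rintro rfl; simp at h

/-- The numerator of a rational function in lowest terms. -/
def ratNum (f : RatXY) : PolyXY := IsFractionRing.num PolyXY f

/-- The denominator of a rational function in lowest terms. -/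
def ratDen (f : RatXY) : PolyXY := IsFractionRing.den PolyXY f

lemma ratDen_ne_zero (f : RatXY) : ratDen f ≠ 0 := nonZeroDivisors.coe_ne_zero _

lemma isRelPrime_ratNum_ratDen (f : RatXY) : IsRelPrime (ratNum f) (ratDen f) :=
  IsFractionRing.num_den_reduced PolyXY f

lemma ratNum_div_ratDen (f : RatXY) : toRat (ratNum f) / toRat (ratDen f) = f :=
  IsFractionRing.mk'_num_den' PolyXY f

lemma ratDen_dvd {f : RatXY} {p d : PolyXY} (hd : d ≠ 0) (h : f = toRat p / toRat d) :
    ratDen f ∣ d := by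
  have h1 : ratNum f * d = p * ratDen f := by
    apply toRat_injective
    have h2 := ratNum_div_ratDen f
    have h3 := toRat_ne_zero (ratDen_ne_zero f)
    have h4 := toRat_ne_zero hd
    rw [h] at h2
    rw [map_mul, map_mul]
    rw [← h] at h2
    nth_rewrite 3 [h] at h2
    rwa [div_eq_div_iff h3 h4] at h2
  have h2 : ratDen f ∣ ratNum f * d := h1 ▸ Dvd.intro_left _ rfl
  exact (isRelPrime_ratNum_ratDen f).symm.dvd_of_dvd_mul_left h2

/-- The rational function `f` has no pole at `a`. -/
def IsReg (a : Fin 2 → ℂ) (f : RatXY) : Prop := eval a (ratDen f) ≠ 0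

/-- The value of a rational function at a point. -/
def ratEval (a : Fin 2 → ℂ) (f : RatXY) : ℂ :=
  eval a (ratNum f) / eval a (ratDen f)

lemma isReg_of_eq_div {a : Fin 2 → ℂ} {f : RatXY} {p d : PolyXY}
    (hd : eval a d ≠ 0) (h : f = toRat p / toRat d) : IsReg a f := by
  obtain ⟨e, he⟩ := ratDen_dvd (ne_zero_of_eval_ne_zero hd) h
  intro h0
  apply hd
  rw [he, map_mul, h0, zero_mul]

lemma ratEval_of_eq_div {a : Fin 2 → ℂ} {f : RatXY} {p d : PolyXY}
    (hd : eval a d ≠ 0) (h : f = toRat p / toRat d) :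
    ratEval a f = eval a p / eval a d := by
  have hr := isReg_of_eq_div hd h
  have h1 : ratNum f * d = p * ratDen f := by
    apply toRat_injective
    have h2 := ratNum_div_ratDen f
    have h3 := toRat_ne_zero (ratDen_ne_zero f)
    have h4 := toRat_ne_zero (ne_zero_of_eval_ne_zero hd)
    rw [map_mul, map_mul, ← div_eq_div_iff h3 h4, h2, ← h]
  rw [ratEval, div_eq_div_iff hr hd, ← map_mul, h1, map_mul]

lemma isReg_iff {a : Fin 2 → ℂ} {f : RatXY} :
    IsReg a f ↔ ∃ p d : PolyXY, eval a d ≠ 0 ∧ f = toRat p / toRat d :=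
  ⟨fun h => ⟨_, _, h, (ratNum_div_ratDen f).symm⟩, fun ⟨_, _, hd, h⟩ => isReg_of_eq_div hd h⟩

lemma isReg_toRat (a : Fin 2 → ℂ) (p : PolyXY) : IsReg a (toRat p) :=
  isReg_of_eq_div (d := 1) (p := p) (by simp) (by simp)

lemma ratEval_toRat (a : Fin 2 → ℂ) (p : PolyXY) :
    ratEval a (toRat p) = eval a p := by
  rw [ratEval_of_eq_div (d := 1) (p := p) (by simp) (by simp)]; simp

lemma isReg_add_aux {a : Fin 2 → ℂ} {f g : RatXY} (hf : IsReg a f)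
    (hg : IsReg a g) :
    IsReg a (f + g) ∧ ratEval a (f + g) = ratEval a f + ratEval a g := by
  obtain ⟨p, d, hd, rfl⟩ := isReg_iff.1 hf
  obtain ⟨q, e, he, rfl⟩ := isReg_iff.1 hg
  have h : toRat p / toRat d + toRat q / toRat e = toRat (p * e + d * q) / toRat (d * e) := by
    rw [div_add_div _ _ (toRat_ne_zero (ne_zero_of_eval_ne_zero hd))
      (toRat_ne_zero (ne_zero_of_eval_ne_zero he))]; simp
  have hde : eval a (d * e) ≠ 0 := by simp [hd, he]
  refine ⟨isReg_of_eq_div hde h, ?_⟩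
  rw [ratEval_of_eq_div hde h, ratEval_of_eq_div hd rfl, ratEval_of_eq_div he rfl,
    div_add_div _ _ hd he]
  simp

lemma isReg_mul_aux {a : Fin 2 → ℂ} {f g : RatXY} (hf : IsReg a f)
    (hg : IsReg a g) :
    IsReg a (f * g) ∧ ratEval a (f * g) = ratEval a f * ratEval a g := by
  obtain ⟨p, d, hd, rfl⟩ := isReg_iff.1 hf
  obtain ⟨q, e, he, rfl⟩ := isReg_iff.1 hg
  have h : toRat p / toRat d * (toRat q / toRat e) = toRat (p * q) / toRat (d * e) := by
    rw [div_mul_div_comm]; simp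
  have hde : eval a (d * e) ≠ 0 := by simp [hd, he]
  refine ⟨isReg_of_eq_div hde h, ?_⟩
  rw [ratEval_of_eq_div hde h, ratEval_of_eq_div hd rfl, ratEval_of_eq_div he rfl,
    div_mul_div_comm]
  simp

/-- The ring of rational functions without pole at `a`. -/
def regularRing (a : Fin 2 → ℂ) : Subalgebra PolyXY RatXY where
  carrier := {f | IsReg a f}
  mul_mem' hf hg := (isReg_mul_aux hf hg).1
  add_mem' hf hg := (isReg_add_aux hf hg).1
  algebraMap_mem' p := isReg_toRat a p

lemma IsReg.add {a : Fin 2 → ℂ} {f g : RatXY} (hf : IsReg a f)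
    (hg : IsReg a g) : IsReg a (f + g) := (isReg_add_aux hf hg).1

lemma IsReg.mul {a : Fin 2 → ℂ} {f g : RatXY} (hf : IsReg a f)
    (hg : IsReg a g) : IsReg a (f * g) := (isReg_mul_aux hf hg).1

lemma IsReg.neg {a : Fin 2 → ℂ} {f : RatXY} (hf : IsReg a f) :
    IsReg a (-f) := (regularRing a).neg_mem hf

lemma IsReg.sub {a : Fin 2 → ℂ} {f g : RatXY} (hf : IsReg a f)
    (hg : IsReg a g) : IsReg a (f - g) := (regularRing a).sub_mem hf hg

lemma IsReg.pow {a : Fin 2 → ℂ} {f : RatXY} (hf : IsReg a f) (n : ℕ) :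
    IsReg a (f ^ n) := (regularRing a).pow_mem hf n

lemma isReg_sum {a : Fin 2 → ℂ} {ι : Type*} {s : Finset ι} {f : ι → RatXY}
    (h : ∀ i ∈ s, IsReg a (f i)) : IsReg a (∑ i ∈ s, f i) :=
  (regularRing a).sum_mem h

lemma isReg_one (a : Fin 2 → ℂ) : IsReg a 1 := (regularRing a).one_mem

lemma algebraMap_complex (c : ℂ) : algebraMap ℂ RatXY c = toRat (MvPolynomial.C c) := rfl

lemma isReg_algebraMap (a : Fin 2 → ℂ) (c : ℂ) : IsReg a (algebraMap ℂ RatXY c) :=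
  isReg_toRat a _

lemma IsReg.smul {a : Fin 2 → ℂ} {f : RatXY} (hf : IsReg a f) (c : ℂ) :
    IsReg a (c • f) := by
  rw [Algebra.smul_def]; exact (isReg_algebraMap a c).mul hf

lemma ratEval_add {a : Fin 2 → ℂ} {f g : RatXY} (hf : IsReg a f) (hg : IsReg a g) :
    ratEval a (f + g) = ratEval a f + ratEval a g := (isReg_add_aux hf hg).2

lemma ratEval_mul {a : Fin 2 → ℂ} {f g : RatXY} (hf : IsReg a f) (hg : IsReg a g) :
    ratEval a (f * g) = ratEval a f * ratEval a g := (isReg_mul_aux hf hg).2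

@[simp] lemma ratEval_one (a : Fin 2 → ℂ) : ratEval a 1 = 1 := by
  rw [← map_one toRat, ratEval_toRat]; simp

@[simp] lemma ratEval_zero (a : Fin 2 → ℂ) : ratEval a 0 = 0 := by
  rw [← map_zero toRat, ratEval_toRat]; simp

@[simp] lemma ratEval_algebraMap (a : Fin 2 → ℂ) (c : ℂ) : ratEval a (algebraMap ℂ RatXY c) = c := by
  rw [algebraMap_complex, ratEval_toRat]; simp

lemma ratEval_smul {a : Fin 2 → ℂ} {f : RatXY} (hf : IsReg a f) (c : ℂ) :
    ratEval a (c • f) = c * ratEval a f := by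
  rw [Algebra.smul_def, ratEval_mul (isReg_algebraMap a c) hf, ratEval_algebraMap]

lemma ratEval_neg {a : Fin 2 → ℂ} {f : RatXY} (hf : IsReg a f) :
    ratEval a (-f) = -ratEval a f := by
  have h := ratEval_add hf hf.neg
  rw [add_neg_cancel, ratEval_zero] at h
  linear_combination -h

lemma ratEval_sub {a : Fin 2 → ℂ} {f g : RatXY} (hf : IsReg a f) (hg : IsReg a g) :
    ratEval a (f - g) = ratEval a f - ratEval a g := by
  rw [sub_eq_add_neg, ratEval_add hf hg.neg, ratEval_neg hg, sub_eq_add_neg]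

lemma ratEval_pow {a : Fin 2 → ℂ} {f : RatXY} (hf : IsReg a f) (n : ℕ) :
    ratEval a (f ^ n) = ratEval a f ^ n := by
  induction n with
  | zero => simp
  | succ n ih => rw [pow_succ, ratEval_mul (hf.pow n) hf, ih, pow_succ]

lemma ratEval_sum {a : Fin 2 → ℂ} {ι : Type*} {s : Finset ι} {f : ι → RatXY}
    (h : ∀ i ∈ s, IsReg a (f i)) : ratEval a (∑ i ∈ s, f i) = ∑ i ∈ s, ratEval a (f i) := by
  classical
  induction s using Finset.induction_on with
  | empty => simp
  | insert i s hi ih =>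
    rw [Finset.sum_insert hi, Finset.sum_insert hi,
      ratEval_add (h i (by simp)) (isReg_sum fun j hj => h j (by simp [hj])),
      ih fun j hj => h j (by simp [hj])]

lemma isReg_inv_aux {a : Fin 2 → ℂ} {f : RatXY} (hf : IsReg a f)
    (h0 : ratEval a f ≠ 0) : IsReg a f⁻¹ ∧ ratEval a f⁻¹ = (ratEval a f)⁻¹ := by
  obtain ⟨p, d, hd, rfl⟩ := isReg_iff.1 hf
  rw [ratEval_of_eq_div hd rfl] at h0
  have hp : eval a p ≠ 0 := fun h => h0 (by rw [h, zero_div])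
  have h : (toRat p / toRat d)⁻¹ = toRat d / toRat p := by rw [inv_div]
  exact ⟨isReg_of_eq_div hp h, by
    rw [ratEval_of_eq_div hp h, ratEval_of_eq_div hd rfl, inv_div]⟩

lemma IsReg.inv {a : Fin 2 → ℂ} {f : RatXY} (hf : IsReg a f)
    (h0 : ratEval a f ≠ 0) : IsReg a f⁻¹ := (isReg_inv_aux hf h0).1

lemma ratEval_inv {a : Fin 2 → ℂ} {f : RatXY} (hf : IsReg a f)
    (h0 : ratEval a f ≠ 0) : ratEval a f⁻¹ = (ratEval a f)⁻¹ := (isReg_inv_aux hf h0).2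

lemma IsReg.div {a : Fin 2 → ℂ} {f g : RatXY} (hf : IsReg a f) (hg : IsReg a g)
    (h0 : ratEval a g ≠ 0) : IsReg a (f / g) := by
  rw [div_eq_mul_inv]; exact hf.mul (hg.inv h0)

lemma ratEval_div {a : Fin 2 → ℂ} {f g : RatXY} (hf : IsReg a f) (hg : IsReg a g)
    (h0 : ratEval a g ≠ 0) : ratEval a (f / g) = ratEval a f / ratEval a g := by
  rw [div_eq_mul_inv, ratEval_mul hf (hg.inv h0), ratEval_inv hg h0, div_eq_mul_inv]

lemma isReg_zpow_aux {a : Fin 2 → ℂ} {f : RatXY} (hf : IsReg a f)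
    (h0 : ratEval a f ≠ 0) (n : ℤ) :
    IsReg a (f ^ n) ∧ ratEval a (f ^ n) = ratEval a f ^ n := by
  cases n with
  | ofNat n => simpa using ⟨hf.pow n, ratEval_pow hf n⟩
  | negSucc n =>
    have h := isReg_inv_aux (hf.pow (n + 1)) (by rw [ratEval_pow hf]; exact pow_ne_zero _ h0)
    rw [zpow_negSucc, zpow_negSucc, ← ratEval_pow hf]
    exact h

lemma IsReg.zpow {a : Fin 2 → ℂ} {f : RatXY} (hf : IsReg a f)
    (h0 : ratEval a f ≠ 0) (n : ℤ) : IsReg a (f ^ n) := (isReg_zpow_aux hf h0 n).1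

lemma ratEval_zpow {a : Fin 2 → ℂ} {f : RatXY} (hf : IsReg a f)
    (h0 : ratEval a f ≠ 0) (n : ℤ) : ratEval a (f ^ n) = ratEval a f ^ n :=
  (isReg_zpow_aux hf h0 n).2

lemma isReg_varX (a : Fin 2 → ℂ) : IsReg a varX := isReg_toRat a _
lemma isReg_varY (a : Fin 2 → ℂ) : IsReg a varY := isReg_toRat a _
lemma isReg_const (a : Fin 2 → ℂ) (r : ℝ) : IsReg a (const r) := isReg_toRat a _

@[simp] lemma ratEval_varX (a : Fin 2 → ℂ) : ratEval a varX = a 0 := by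
  rw [varX, ratEval_toRat]; simp
@[simp] lemma ratEval_varY (a : Fin 2 → ℂ) : ratEval a varY = a 1 := by
  rw [varY, ratEval_toRat]; simp
@[simp] lemma ratEval_const (a : Fin 2 → ℂ) (r : ℝ) : ratEval a (const r) = r := by
  rw [const, ratEval_toRat]; simp

lemma varX_ne_zero : varX ≠ 0 := toRat_ne_zero (X_ne_zero 0)
lemma varY_ne_zero : varY ≠ 0 := toRat_ne_zero (X_ne_zero 1)

lemma const_eq (r : ℝ) : const r = algebraMap ℂ RatXY (r : ℂ) := rfl

end

section

open Algebra (smul_def)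
open Derivation (leibniz leibniz_inv mk')
open Ideal (mul_mem_left mul_mem_right span)
open MvPolynomial (C X eval eval_X induction_on pderiv pderiv_X smul_eq_C_mul)
/-! ### Derivations of the field of rational functions -/

lemma exists_eq_div (f : RatXY) : ∃ p d : PolyXY, d ≠ 0 ∧ f = toRat p / toRat d :=
  ⟨_, _, ratDen_ne_zero f, (ratNum_div_ratDen f).symm⟩

/-- The quotient rule. -/
def derivFun (δ : Derivation ℂ PolyXY RatXY) (f : RatXY) : RatXY :=
  (δ (ratNum f) * toRat (ratDen f) - toRat (ratNum f) * δ (ratDen f)) / toRat (ratDen f) ^ 2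

lemma derivation_mul_toRat (δ : Derivation ℂ PolyXY RatXY) (p q : PolyXY) :
    δ (p * q) = toRat p * δ q + toRat q * δ p := by
  rw [leibniz, smul_def, smul_def]

lemma derivFun_div (δ : Derivation ℂ PolyXY RatXY) (p d : PolyXY) (hd : d ≠ 0) :
    derivFun δ (toRat p / toRat d) =
      (δ p * toRat d - toRat p * δ d) / toRat d ^ 2 := by
  set f := toRat p / toRat d with hf
  have h3 := toRat_ne_zero (ratDen_ne_zero f)
  have h4 := toRat_ne_zero hd
  have h1 : ratNum f * d = p * ratDen f := by
    apply toRat_injective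
    rw [map_mul, map_mul, ← div_eq_div_iff h3 h4, ratNum_div_ratDen, hf]
  have h2 : toRat (ratNum f) * toRat d = toRat p * toRat (ratDen f) := by
    rw [← map_mul, h1, map_mul]
  have h5 := congrArg δ h1
  rw [derivation_mul_toRat, derivation_mul_toRat] at h5
  rw [derivFun, div_eq_div_iff (pow_ne_zero 2 h3) (pow_ne_zero 2 h4)]
  linear_combination toRat d * toRat (ratDen f) * h5 -
    (toRat (ratDen f) * δ d + toRat d * δ (ratDen f)) * h2

lemma derivFun_add (δ : Derivation ℂ PolyXY RatXY) (f g : RatXY) :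
    derivFun δ (f + g) = derivFun δ f + derivFun δ g := by
  obtain ⟨p, d, hd, rfl⟩ := exists_eq_div f
  obtain ⟨q, e, he, rfl⟩ := exists_eq_div g
  have h4 := toRat_ne_zero hd
  have h5 := toRat_ne_zero he
  have h : toRat p / toRat d + toRat q / toRat e = toRat (p * e + d * q) / toRat (d * e) := by
    rw [div_add_div _ _ h4 h5, map_add, map_mul, map_mul, map_mul]
  rw [h, derivFun_div _ _ _ (mul_ne_zero hd he), derivFun_div _ _ _ hd,
    derivFun_div _ _ _ he, map_add, derivation_mul_toRat, derivation_mul_toRat,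
    derivation_mul_toRat, map_add, map_mul, map_mul, map_mul,
    div_add_div _ _ (pow_ne_zero 2 h4) (pow_ne_zero 2 h5),
    div_eq_div_iff (pow_ne_zero 2 (mul_ne_zero h4 h5))
      (mul_ne_zero (pow_ne_zero 2 h4) (pow_ne_zero 2 h5))]
  ring

lemma derivFun_mul (δ : Derivation ℂ PolyXY RatXY) (f g : RatXY) :
    derivFun δ (f * g) = f * derivFun δ g + g * derivFun δ f := by
  obtain ⟨p, d, hd, rfl⟩ := exists_eq_div f
  obtain ⟨q, e, he, rfl⟩ := exists_eq_div g
  have h4 := toRat_ne_zero hd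
  have h5 := toRat_ne_zero he
  have h : toRat p / toRat d * (toRat q / toRat e) = toRat (p * q) / toRat (d * e) := by
    rw [div_mul_div_comm, map_mul, map_mul]
  rw [h, derivFun_div _ _ _ (mul_ne_zero hd he), derivFun_div _ _ _ hd,
    derivFun_div _ _ _ he, derivation_mul_toRat, derivation_mul_toRat, map_mul, map_mul,
    div_mul_div_comm, div_mul_div_comm,
    div_add_div _ _ (mul_ne_zero h4 (pow_ne_zero 2 h5)) (mul_ne_zero h5 (pow_ne_zero 2 h4)),
    div_eq_div_iff (pow_ne_zero 2 (mul_ne_zero h4 h5))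
      (mul_ne_zero (mul_ne_zero h4 (pow_ne_zero 2 h5)) (mul_ne_zero h5 (pow_ne_zero 2 h4)))]
  ring

lemma derivFun_smul (δ : Derivation ℂ PolyXY RatXY) (c : ℂ) (f : RatXY) :
    derivFun δ (c • f) = c • derivFun δ f := by
  obtain ⟨p, d, hd, rfl⟩ := exists_eq_div f
  have h : c • (toRat p / toRat d) = toRat (c • p) / toRat d := by
    rw [smul_def, smul_eq_C_mul, map_mul, algebraMap_complex, mul_div_assoc]
  rw [h, derivFun_div _ _ _ hd, derivFun_div _ _ _ hd, Derivation.map_smul, smul_def,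
    smul_eq_C_mul, map_mul, algebraMap_complex, smul_def, algebraMap_complex]
  ring

/-- The extension of a derivation to the field of fractions. -/
def extendDerivation (δ : Derivation ℂ PolyXY RatXY) : Derivation ℂ RatXY RatXY :=
  mk'
    { toFun := derivFun δ
      map_add' := derivFun_add δ
      map_smul' := derivFun_smul δ }
    (derivFun_mul δ)

lemma extendDerivation_div (δ : Derivation ℂ PolyXY RatXY) (p d : PolyXY) (hd : d ≠ 0) :
    extendDerivation δ (toRat p / toRat d) =
      (δ p * toRat d - toRat p * δ d) / toRat d ^ 2 := derivFun_div δ p d hd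

lemma extendDerivation_toRat (δ : Derivation ℂ PolyXY RatXY) (p : PolyXY) :
    extendDerivation δ (toRat p) = δ p := by
  have h := extendDerivation_div δ p 1 one_ne_zero
  simpa using h

lemma derivation_ext {δ δ' : Derivation ℂ RatXY RatXY} (hx : δ varX = δ' varX)
    (hy : δ varY = δ' varY) : δ = δ' := by
  have hp : ∀ p : PolyXY, δ (toRat p) = δ' (toRat p) := by
    intro p
    induction p using induction_on with
    | C c => rw [← algebraMap_complex]; simp
    | add p q hp hq => simp [hp, hq]
    | mul_X p i hp =>
      have hi : δ (toRat (X i)) = δ' (toRat (X i)) := by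
        fin_cases i
        · exact hx
        · exact hy
      rw [map_mul, leibniz, leibniz, hp, hi]
  ext f
  obtain ⟨p, d, hd, rfl⟩ := exists_eq_div f
  rw [div_eq_mul_inv, leibniz, leibniz, leibniz_inv,
    leibniz_inv, hp, hp]

/-- The derivation `xᵢ ∂/∂xᵢ`. -/
def euler (i : Fin 2) : Derivation ℂ RatXY RatXY :=
  extendDerivation (MvPolynomial.mkDerivation ℂ fun j => if j = i then toRat (X i) else 0)

lemma euler_X (i j : Fin 2) : euler i (toRat (X j)) =
    if j = i then toRat (X i) else 0 := by
  rw [euler, extendDerivation_toRat, MvPolynomial.mkDerivation_X]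

@[simp] lemma euler_zero_varX : euler 0 varX = varX := by
  rw [varX, euler_X]; simp
@[simp] lemma euler_zero_varY : euler 0 varY = 0 := by
  rw [varY, euler_X]; simp
@[simp] lemma euler_one_varX : euler 1 varX = 0 := by
  rw [varX, euler_X]; simp
@[simp] lemma euler_one_varY : euler 1 varY = varY := by
  rw [varY, euler_X]; simp

lemma euler_toRat (i : Fin 2) (p : PolyXY) :
    euler i (toRat p) = toRat (X i * pderiv i p) := by
  induction p using induction_on with
  | C c => rw [← algebraMap_complex]; simp
  | add p q hp hq => rw [map_add, map_add, hp, hq, map_add, mul_add, map_add]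
  | mul_X p j hp =>
    rw [map_mul, leibniz, hp, euler_X, leibniz, pderiv_X]
    rcases eq_or_ne j i with rfl | h
    · simp; ring
    · simp [h]; ring

/-- If the logarithmic derivative of each coordinate of a curve is `c j`, then a rational function
has derivative `∑ j, c j * xⱼ ∂/∂xⱼ f` along the curve. -/
lemma hasDerivAt_ratEval {a : ℝ → Fin 2 → ℂ} {c : Fin 2 → ℂ} {t : ℝ}
    (ha : ∀ j, HasDerivAt (fun t => a t j) (c j * a t j) t) {f : RatXY}
    (hf : IsReg (a t) f) :
    HasDerivAt (fun t => ratEval (a t) f)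
      (c 0 * ratEval (a t) (euler 0 f) + c 1 * ratEval (a t) (euler 1 f)) t := by
  have hpoly : ∀ p : PolyXY, HasDerivAt (fun t => eval (a t) p)
      (c 0 * ratEval (a t) (euler 0 (toRat p)) + c 1 * ratEval (a t) (euler 1 (toRat p))) t := by
    intro p
    simp only [euler_toRat, ratEval_toRat]
    induction p using induction_on with
    | C c => simpa using hasDerivAt_const t c
    | add p q hp hq =>
      simp only [map_add, mul_add]
      simp only [map_mul] at hp hq ⊢
      refine (hp.add hq).congr_deriv ?_
      ring
    | mul_X p j hp =>
      simp only [map_mul, eval_X]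
      refine (hp.mul (ha j)).congr_deriv ?_
      simp only [leibniz, pderiv_X, smul_eq_mul, map_add, map_mul,
        eval_X]
      fin_cases j <;> simp <;> ring
  have hd : eval (a t) (ratDen f) ≠ 0 := hf
  have hc := (hpoly (ratDen f)).continuousAt.eventually_ne hd
  have hq := (hpoly (ratNum f)).div (hpoly (ratDen f)) hd
  refine (hq.congr_deriv ?_)
  have he : ∀ i, ratEval (a t) (euler i f) =
      (ratEval (a t) (euler i (toRat (ratNum f))) * eval (a t) (ratDen f) -
        eval (a t) (ratNum f) * ratEval (a t) (euler i (toRat (ratDen f)))) /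
        eval (a t) (ratDen f) ^ 2 := by
    intro i
    have h1 : euler i f = toRat (X i * pderiv i (ratNum f) * ratDen f -
        ratNum f * (X i * pderiv i (ratDen f))) /
        toRat (ratDen f ^ 2) := by
      conv_lhs => rw [← ratNum_div_ratDen f]
      rw [euler, extendDerivation_div _ _ _ (ratDen_ne_zero f), ← extendDerivation_toRat,
        ← extendDerivation_toRat]
      change (euler i (toRat (ratNum f)) * _ - _ * euler i (toRat (ratDen f))) / _ = _
      rw [euler_toRat, euler_toRat]
      simp only [map_mul, map_sub, map_pow]
    rw [ratEval_of_eq_div (by simpa using hd) h1, euler_toRat, euler_toRat, ratEval_toRat,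
      ratEval_toRat]
    simp
  rw [he, he]
  field_simp
  ring

lemma isReg_euler {a : Fin 2 → ℂ} {f : RatXY} (hf : IsReg a f) (i : Fin 2) :
    IsReg a (euler i f) := by
  have h1 : euler i f = toRat (X i * pderiv i (ratNum f) * ratDen f -
      ratNum f * (X i * pderiv i (ratDen f))) /
      toRat (ratDen f ^ 2) := by
    conv_lhs => rw [← ratNum_div_ratDen f]
    rw [euler, extendDerivation_div _ _ _ (ratDen_ne_zero f), ← extendDerivation_toRat,
      ← extendDerivation_toRat]
    change (euler i (toRat (ratNum f)) * _ - _ * euler i (toRat (ratDen f))) / _ = _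
    rw [euler_toRat, euler_toRat]
    simp only [map_mul, map_sub, map_pow]
  exact isReg_of_eq_div (by rw [map_pow]; exact pow_ne_zero 2 hf) h1

/-! ### The filtration by the order of vanishing -/

/-- The ideal of polynomials that vanish at `b`. -/
def pointIdeal (b : Fin 2 → ℂ) : Ideal PolyXY :=
  span {X 0 - C (b 0)} ⊔
    span {X 1 - C (b 1)}

lemma mem_pointIdeal {b : Fin 2 → ℂ} {p : PolyXY} :
    p ∈ pointIdeal b ↔ eval b p = 0 := by
  constructor
  · intro h
    obtain ⟨q, hq, r, hr, rfl⟩ := Submodule.mem_sup.1 h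
    obtain ⟨q, rfl⟩ := Ideal.mem_span_singleton'.1 hq
    obtain ⟨r, rfl⟩ := Ideal.mem_span_singleton'.1 hr
    simp
  · have key : p - C (eval b p) ∈ pointIdeal b := by
      induction p using induction_on with
      | C c => simp
      | add p q hp hq =>
        have h := add_mem hp hq
        convert h using 1
        simp only [map_add]; ring
      | mul_X p j hp =>
        have h1 : (X j - C (b j) : PolyXY) ∈ pointIdeal b := by
          fin_cases j
          · exact Submodule.mem_sup_left (Ideal.mem_span_singleton_self _)
          · exact Submodule.mem_sup_right (Ideal.mem_span_singleton_self _)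
        have h2 := add_mem (mul_mem_left _ (X j) hp)
          (mul_mem_left _ (C (eval b p)) h1)
        convert h2 using 1
        simp only [map_mul, eval_X]; ring
    intro h
    simpa [h] using key

lemma pointIdeal_isCoprime {b : Fin 2 → ℂ} {d : PolyXY} (hd : eval b d ≠ 0) (n : ℕ) :
    IsCoprime (span {d}) (pointIdeal b ^ n) := by
  apply IsCoprime.pow_right
  rw [Ideal.isCoprime_iff_exists]
  refine ⟨C (eval b d)⁻¹ * d,
    mul_mem_left _ _ (Ideal.mem_span_singleton_self d),
    1 - C (eval b d)⁻¹ * d, ?_, by ring⟩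
  rw [mem_pointIdeal]
  simp [hd]

lemma iInf_pointIdeal_pow {b : Fin 2 → ℂ} {p : PolyXY} (h : ∀ n, p ∈ pointIdeal b ^ n) : p = 0 := by
  have h1 : pointIdeal b ≠ ⊤ := by
    intro h
    have : (1 : PolyXY) ∈ pointIdeal b := by rw [h]; trivial
    rw [mem_pointIdeal] at this
    simp at this
  have h2 := Ideal.iInf_pow_eq_bot_of_isDomain (pointIdeal b) h1
  have h3 : p ∈ ⨅ n : ℕ, pointIdeal b ^ n := by simpa [Ideal.mem_iInf] using h
  rw [h2] at h3
  exact h3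

/-- The rational functions that vanish to order at least `k` at `b`. -/
def vanish (b : Fin 2 → ℂ) (k : ℕ) : Submodule ℂ RatXY where
  carrier := {f | ∃ p d : PolyXY, p ∈ pointIdeal b ^ k ∧ eval b d ≠ 0 ∧
    f = toRat p / toRat d}
  zero_mem' := ⟨0, 1, zero_mem _, by simp, by simp⟩
  add_mem' := by
    rintro _ _ ⟨p, d, hp, hd, rfl⟩ ⟨q, e, hq, he, rfl⟩
    refine ⟨p * e + d * q, d * e, add_mem (mul_mem_right _ _ hp) (mul_mem_left _ _ hq),
      by simp [hd, he], ?_⟩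
    rw [div_add_div _ _ (toRat_ne_zero (ne_zero_of_eval_ne_zero hd))
      (toRat_ne_zero (ne_zero_of_eval_ne_zero he))]; simp
  smul_mem' := by
    rintro c _ ⟨p, d, hp, hd, rfl⟩
    refine ⟨C c * p, d, mul_mem_left _ _ hp, hd, ?_⟩
    rw [smul_def, algebraMap_complex, map_mul, mul_div_assoc]

lemma mem_vanish {b : Fin 2 → ℂ} {k : ℕ} {f : RatXY} : f ∈ vanish b k ↔
    ∃ p d : PolyXY, p ∈ pointIdeal b ^ k ∧ eval b d ≠ 0 ∧ f = toRat p / toRat d :=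
  Iff.rfl

lemma mem_vanish_zero {b : Fin 2 → ℂ} {f : RatXY} : f ∈ vanish b 0 ↔ IsReg b f := by
  rw [mem_vanish, isReg_iff]; simp

lemma vanish_le {b : Fin 2 → ℂ} {j k : ℕ} (h : j ≤ k) : vanish b k ≤ vanish b j := by
  rintro _ ⟨p, d, hp, hd, rfl⟩
  exact ⟨p, d, Ideal.pow_le_pow_right h hp, hd, rfl⟩

lemma isReg_of_mem_vanish {b : Fin 2 → ℂ} {k : ℕ} {f : RatXY} (h : f ∈ vanish b k) :
    IsReg b f := mem_vanish_zero.1 (vanish_le (Nat.zero_le k) h)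

lemma mul_mem_vanish {b : Fin 2 → ℂ} {j k : ℕ} {f g : RatXY} (hf : f ∈ vanish b j)
    (hg : g ∈ vanish b k) : f * g ∈ vanish b (j + k) := by
  obtain ⟨p, d, hp, hd, rfl⟩ := hf
  obtain ⟨q, e, hq, he, rfl⟩ := hg
  refine ⟨p * q, d * e, ?_, by simp [hd, he], by rw [div_mul_div_comm]; simp⟩
  rw [pow_add]
  exact Ideal.mul_mem_mul hp hq

lemma mul_mem_vanish_right {b : Fin 2 → ℂ} {k : ℕ} {f g : RatXY} (hf : IsReg b f)
    (hg : g ∈ vanish b k) : f * g ∈ vanish b k := by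
  simpa using mul_mem_vanish (mem_vanish_zero.2 hf) hg

lemma mul_mem_vanish_left {b : Fin 2 → ℂ} {k : ℕ} {f g : RatXY} (hf : f ∈ vanish b k)
    (hg : IsReg b g) : f * g ∈ vanish b k := by
  simpa using mul_mem_vanish hf (mem_vanish_zero.2 hg)

lemma pow_mem_vanish {b : Fin 2 → ℂ} {k : ℕ} {f : RatXY} (hf : f ∈ vanish b k) (n : ℕ) :
    f ^ n ∈ vanish b (n * k) := by
  induction n with
  | zero => simpa using mem_vanish_zero.2 (isReg_one b)
  | succ n ih => rw [pow_succ, add_mul, one_mul]; exact mul_mem_vanish ih hf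

lemma mem_vanish_one {b : Fin 2 → ℂ} {f : RatXY} (hf : IsReg b f) :
    f ∈ vanish b 1 ↔ ratEval b f = 0 := by
  constructor
  · rintro ⟨p, d, hp, hd, rfl⟩
    rw [pow_one, mem_pointIdeal] at hp
    rw [ratEval_of_eq_div hd rfl, hp, zero_div]
  · intro h
    obtain ⟨p, d, hd, rfl⟩ := isReg_iff.1 hf
    rw [ratEval_of_eq_div hd rfl, div_eq_zero_iff] at h
    exact ⟨p, d, by rw [pow_one, mem_pointIdeal]; exact h.resolve_right hd, hd, rfl⟩

/-- The coordinate functions centered at `b`. -/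
def centered (b : Fin 2 → ℂ) (i : Fin 2) : RatXY :=
  toRat (X i - C (b i))

lemma isReg_centered (a b : Fin 2 → ℂ) (i : Fin 2) : IsReg a (centered b i) :=
  isReg_toRat a _

lemma centered_mem (b : Fin 2 → ℂ) (i : Fin 2) : centered b i ∈ vanish b 1 := by
  rw [mem_vanish_one (isReg_centered b b i), centered, ratEval_toRat]
  simp

lemma exists_of_mem_vanish_succ {b : Fin 2 → ℂ} {k : ℕ} {f : RatXY} (h : f ∈ vanish b (k + 1)) :
    ∃ f₀ ∈ vanish b k, ∃ f₁ ∈ vanish b k, f = centered b 0 * f₀ + centered b 1 * f₁ := by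
  obtain ⟨p, d, hp, hd, rfl⟩ := h
  have hs : pointIdeal b ^ (k + 1) = span {X 0 - C (b 0)} *
      pointIdeal b ^ k ⊔ span {X 1 - C (b 1)} *
      pointIdeal b ^ k := by
    rw [pow_succ', ← Ideal.sup_mul]; rfl
  rw [hs] at hp
  obtain ⟨q, hq, r, hr, rfl⟩ := Submodule.mem_sup.1 hp
  obtain ⟨q', hq', rfl⟩ := Ideal.mem_span_singleton_mul.1 hq
  obtain ⟨r', hr', rfl⟩ := Ideal.mem_span_singleton_mul.1 hr
  refine ⟨toRat q' / toRat d, ⟨q', d, hq', hd, rfl⟩, toRat r' / toRat d, ⟨r', d, hr', hd, rfl⟩, ?_⟩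
  simp only [map_add, map_mul, centered]
  ring

lemma euler_mem_vanish {b : Fin 2 → ℂ} {k : ℕ} {f : RatXY} (h : f ∈ vanish b (k + 1))
    (i : Fin 2) : euler i f ∈ vanish b k := by
  induction k generalizing f with
  | zero => exact mem_vanish_zero.2 (isReg_euler (isReg_of_mem_vanish h) i)
  | succ k ih =>
    obtain ⟨f₀, sp, f₁, h₁, rfl⟩ := exists_of_mem_vanish_succ h
    have hz : ∀ j, ∀ g ∈ vanish b (k + 1), euler i (centered b j * g) ∈ vanish b (k + 1) := by
      intro j g hg
      rw [leibniz, smul_eq_mul, smul_eq_mul]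
      refine add_mem ?_ ?_
      · rw [add_comm k 1]; exact mul_mem_vanish (centered_mem b j) (ih hg)
      · exact mul_mem_vanish_left hg
          (isReg_euler (isReg_of_mem_vanish (centered_mem b j)) i)
    rw [map_add]
    exact add_mem (hz 0 _ sp) (hz 1 _ h₁)

lemma eq_zero_of_forall_mem_vanish {b : Fin 2 → ℂ} {f : RatXY} (h : ∀ k, f ∈ vanish b k) :
    f = 0 := by
  obtain ⟨p, d, hd, rfl⟩ := exists_eq_div f
  suffices p = 0 by simp [this]
  -- the numerator may be multiplied by any denominator of `f`
  have hp : ∀ k, ∃ q : PolyXY, ∃ e, eval b e ≠ 0 ∧ q ∈ pointIdeal b ^ k ∧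
      p * e = q * d := by
    intro k
    obtain ⟨q, e, hq, he, hqe⟩ := h k
    refine ⟨q, e, he, hq, toRat_injective ?_⟩
    rw [div_eq_div_iff (toRat_ne_zero hd) (toRat_ne_zero (ne_zero_of_eval_ne_zero he))] at hqe
    rw [map_mul, map_mul, hqe]
  apply iInf_pointIdeal_pow (b := b)
  intro k
  obtain ⟨q, e, he, hq, hqe⟩ := hp k
  obtain ⟨u, hu, v, hv, huv⟩ := Ideal.isCoprime_iff_exists.1 (pointIdeal_isCoprime he k)
  obtain ⟨u, rfl⟩ := Ideal.mem_span_singleton'.1 hu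
  have h1 : p = u * (q * d) + v * p := by
    rw [← hqe]; linear_combination -p * huv
  rw [h1]
  exact add_mem (mul_mem_left _ _ (mul_mem_right _ _ hq)) (mul_mem_right _ _ hv)

/-- The gradient of a rational function at `b`, with respect to logarithmic coordinates. -/
def grad (b : Fin 2 → ℂ) (f : RatXY) (i : Fin 2) : ℂ := ratEval b (euler i f)

lemma euler_centered (b : Fin 2 → ℂ) (i j : Fin 2) :
    euler i (centered b j) = if j = i then toRat (X i) else 0 := by
  rw [centered, map_sub, map_sub, ← algebraMap_complex, Derivation.map_algebraMap, sub_zero, euler_X]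

lemma grad_add {b : Fin 2 → ℂ} {f g : RatXY} (hf : IsReg b f) (hg : IsReg b g)
    (i : Fin 2) : grad b (f + g) i = grad b f i + grad b g i := by
  rw [grad, map_add, ratEval_add (isReg_euler hf i) (isReg_euler hg i), grad, grad]

lemma grad_mul {b : Fin 2 → ℂ} {f g : RatXY} (hf : IsReg b f) (hg : IsReg b g)
    (i : Fin 2) :
    grad b (f * g) i = ratEval b f * grad b g i + ratEval b g * grad b f i := by
  rw [grad, leibniz, smul_eq_mul, smul_eq_mul,
    ratEval_add (hf.mul (isReg_euler hg i)) (hg.mul (isReg_euler hf i)),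
    ratEval_mul hf (isReg_euler hg i), ratEval_mul hg (isReg_euler hf i), grad, grad]

lemma grad_smul {b : Fin 2 → ℂ} {f : RatXY} (hf : IsReg b f) (c : ℂ)
    (i : Fin 2) : grad b (c • f) i = c * grad b f i := by
  rw [grad, Derivation.map_smul, ratEval_smul (isReg_euler hf i), grad]

lemma grad_eq_zero_of_mem {b : Fin 2 → ℂ} {f : RatXY} (hf : f ∈ vanish b 2) (i : Fin 2) :
    grad b f i = 0 :=
  (mem_vanish_one (isReg_euler (isReg_of_mem_vanish hf) i)).1 (euler_mem_vanish hf i)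

lemma mem_vanish_two {b : Fin 2 → ℂ} (hb : ∀ i, b i ≠ 0) {f : RatXY} (hf : f ∈ vanish b 1) :
    f ∈ vanish b 2 ↔ ∀ i, grad b f i = 0 := by
  refine ⟨grad_eq_zero_of_mem, fun h => ?_⟩
  obtain ⟨f₀, sp, f₁, h₁, rfl⟩ := exists_of_mem_vanish_succ hf
  rw [mem_vanish_zero] at sp h₁
  have hz : ∀ j, IsReg b (centered b j) := fun j => isReg_of_mem_vanish (centered_mem b j)
  have hz0 : ∀ j, ratEval b (centered b j) = 0 := fun j =>
    (mem_vanish_one (hz j)).1 (centered_mem b j)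
  have hg : ∀ i j, grad b (centered b j) i = if j = i then b i else 0 := by
    intro i j
    rw [grad, euler_centered]
    split_ifs
    · rw [ratEval_toRat]; simp
    · simp
  have h2 : ∀ i, grad b (centered b 0 * f₀ + centered b 1 * f₁) i =
      ratEval b f₀ * (if (0 : Fin 2) = i then b i else 0) +
        ratEval b f₁ * (if (1 : Fin 2) = i then b i else 0) := by
    intro i
    rw [grad_add ((hz 0).mul sp) ((hz 1).mul h₁), grad_mul (hz 0) sp, grad_mul (hz 1) h₁,
      hz0, hz0, hg, hg]
    ring
  have e0 := h 0
  have e1 := h 1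
  rw [h2] at e0 e1
  simp [hb] at e0 e1
  exact add_mem (mul_mem_vanish (centered_mem b 0) ((mem_vanish_one sp).2 e0))
    (mul_mem_vanish (centered_mem b 1) ((mem_vanish_one h₁).2 e1))

end

section

open Finset (Icc mem_Icc sum_congr)
open Function (Injective)
open MvPolynomial (aeval aeval_C aeval_X eval eval_X induction_on map_C map_X)
/-! ### Substitutions -/

lemma eq_zero_of_eval_eq_zero {p d : PolyXY} (hd : d ≠ 0)
    (h : ∀ a, eval a d ≠ 0 → eval a p = 0) : p = 0 := by
  have h1 : p * d = 0 := by
    apply MvPolynomial.funext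
    intro a
    by_cases ha : eval a d = 0
    · simp [ha]
    · simp [h a ha]
  exact (mul_eq_zero.1 h1).resolve_right hd

/-- A polynomial at whose non-zeros `f` is regular and non-zero. -/
def badLocus (f : RatXY) : PolyXY := ratNum f * ratDen f

lemma badLocus_ne_zero {f : RatXY} (hf : f ≠ 0) : badLocus f ≠ 0 := by
  refine mul_ne_zero ?_ (ratDen_ne_zero f)
  intro h
  apply hf
  rw [← ratNum_div_ratDen f, h, map_zero, zero_div]

lemma isReg_of_badLocus {f : RatXY} {a : Fin 2 → ℂ}
    (h : eval a (badLocus f) ≠ 0) : IsReg a f ∧ ratEval a f ≠ 0 := by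
  rw [badLocus, map_mul] at h
  exact ⟨right_ne_zero_of_mul h, div_ne_zero (left_ne_zero_of_mul h) (right_ne_zero_of_mul h)⟩

lemma isReg_aeval {a : Fin 2 → ℂ} {X Y : RatXY} (hX : IsReg a X) (hY : IsReg a Y)
    (p : PolyXY) : IsReg a (aeval ![X, Y] p) ∧
      ratEval a (aeval ![X, Y] p) =
        eval ![ratEval a X, ratEval a Y] p := by
  induction p using induction_on with
  | C c =>
    have h : aeval ![X, Y] (MvPolynomial.C c) = algebraMap ℂ RatXY c :=
      aeval_C _ _
    rw [h]
    exact ⟨isReg_algebraMap a c, by simp⟩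
  | add p q hp hq =>
    rw [map_add, map_add, ratEval_add hp.1 hq.1, hp.2, hq.2]
    exact ⟨hp.1.add hq.1, rfl⟩
  | mul_X p j hp =>
    have hj : IsReg a (![X, Y] j) ∧ ratEval a (![X, Y] j) =
        ![ratEval a X, ratEval a Y] j := by
      fin_cases j
      · exact ⟨hX, rfl⟩
      · exact ⟨hY, rfl⟩
    rw [map_mul, map_mul, aeval_X, eval_X, ratEval_mul hp.1 hj.1, hp.2,
      hj.2]
    exact ⟨hp.1.mul hj.1, rfl⟩

/-- A substitution whose map of points is dominant is injective on polynomials. -/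
lemma aeval_injective_of_dominant {X Y : RatXY} {d : PolyXY} (hd : d ≠ 0)
    (h : ∀ a : Fin 2 → ℂ, eval a d ≠ 0 → ∃ a' : Fin 2 → ℂ,
      IsReg a' X ∧ IsReg a' Y ∧ ratEval a' X = a 0 ∧ ratEval a' Y = a 1) :
    Injective (aeval ![X, Y] : PolyXY →ₐ[ℂ] RatXY) := by
  rw [injective_iff_map_eq_zero]
  intro p hp
  refine eq_zero_of_eval_eq_zero hd fun a ha => ?_
  obtain ⟨a', hX, hY, h0, h1⟩ := h a ha
  have h2 := (isReg_aeval hX hY p).2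
  rw [hp, ratEval_zero, h0, h1] at h2
  have h3 : a = ![a 0, a 1] := by ext i; fin_cases i <;> rfl
  rw [h3, h2]

/-- The endomorphism of `ℂ(x, y)` with `x ↦ X` and `y ↦ Y`. -/
def substHom (X Y : RatXY)
    (h : Injective (aeval ![X, Y] : PolyXY →ₐ[ℂ] RatXY)) :
    RatXY →ₐ[ℂ] RatXY :=
  IsFractionRing.liftAlgHom (K := RatXY) h

lemma substHom_toRat {X Y : RatXY}
    (h : Injective (aeval ![X, Y] : PolyXY →ₐ[ℂ] RatXY)) (p : PolyXY) :
    substHom X Y h (toRat p) = aeval ![X, Y] p :=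
  IsFractionRing.lift_algebraMap (K := RatXY)
    (g := (aeval ![X, Y] : PolyXY →ₐ[ℂ] RatXY).toRingHom) h p

@[simp] lemma substHom_varX {X Y : RatXY}
    (h : Injective (aeval ![X, Y] : PolyXY →ₐ[ℂ] RatXY)) :
    substHom X Y h varX = X := by
  rw [varX, substHom_toRat, aeval_X]; rfl

@[simp] lemma substHom_varY {X Y : RatXY}
    (h : Injective (aeval ![X, Y] : PolyXY →ₐ[ℂ] RatXY)) :
    substHom X Y h varY = Y := by
  rw [varY, substHom_toRat, aeval_X]; rfl

lemma hom_toRat (σ : RatXY →ₐ[ℂ] RatXY) (p : PolyXY) :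
    σ (toRat p) = aeval ![σ varX, σ varY] p := by
  induction p using induction_on with
  | C c =>
    rw [← algebraMap_complex, AlgHom.commutes]
    exact (aeval_C _ _).symm
  | add p q hp hq => simp only [map_add, hp, hq]
  | mul_X p j hp =>
    rw [map_mul, map_mul, hp, map_mul, aeval_X]
    fin_cases j <;> rfl

lemma hom_ext {σ τ : RatXY →ₐ[ℂ] RatXY} (hx : σ varX = τ varX) (hy : σ varY = τ varY) : σ = τ := by
  refine AlgHom.ext fun f => ?_
  obtain ⟨p, d, hd, rfl⟩ := exists_eq_div f
  rw [map_div₀, map_div₀, hom_toRat, hom_toRat, hom_toRat, hom_toRat, hx, hy]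

lemma hom_const (σ : RatXY →ₐ[ℂ] RatXY) (r : ℝ) : σ (const r) = const r := by
  rw [const_eq, AlgHom.commutes]

lemma isReg_hom_aux (σ : RatXY →ₐ[ℂ] RatXY) {a a' : Fin 2 → ℂ}
    (hx : IsReg a (σ varX)) (hy : IsReg a (σ varY))
    (ha : a' = ![ratEval a (σ varX), ratEval a (σ varY)])
    {f : RatXY} (hf : IsReg a' f) :
    IsReg a (σ f) ∧ ratEval a (σ f) = ratEval a' f := by
  obtain ⟨p, d, hd, rfl⟩ := isReg_iff.1 hf
  rw [map_div₀, hom_toRat, hom_toRat]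
  have hp := isReg_aeval hx hy p
  have hq := isReg_aeval hx hy d
  rw [← ha] at hp hq
  refine ⟨hp.1.div hq.1 (by rwa [hq.2]), ?_⟩
  rw [ratEval_div hp.1 hq.1 (by rwa [hq.2]), hp.2, hq.2, ratEval_of_eq_div hd rfl]

lemma conj_injective :
    Injective (toRat.comp (MvPolynomial.map (σ := Fin 2) (starRingEnd ℂ))) :=
  toRat_injective.comp (MvPolynomial.map_injective _ (RingHom.injective _))

/-- Complex conjugation of the coefficients. -/
def conjHom : RatXY →+* RatXY := IsFractionRing.lift (K := RatXY) conj_injective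

lemma conjHom_toRat (p : PolyXY) :
    conjHom (toRat p) = toRat (MvPolynomial.map (starRingEnd ℂ) p) :=
  IsFractionRing.lift_algebraMap (K := RatXY) conj_injective p

@[simp] lemma conjHom_varX : conjHom varX = varX := by
  rw [varX, conjHom_toRat, map_X]
@[simp] lemma conjHom_varY : conjHom varY = varY := by
  rw [varY, conjHom_toRat, map_X]
@[simp] lemma conjHom_const (r : ℝ) : conjHom (const r) = const r := by
  rw [const, conjHom_toRat, map_C, Complex.conj_ofReal]

lemma eval_map_conj (a : Fin 2 → ℂ) (p : PolyXY) :
    eval (fun i => starRingEnd ℂ (a i)) (MvPolynomial.map (starRingEnd ℂ) p) =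
      starRingEnd ℂ (eval a p) := by
  induction p using induction_on with
  | C c => simp
  | add p q hp hq => simp [hp, hq]
  | mul_X p j hp => simp [hp]

lemma conjHom_regular {a : Fin 2 → ℂ} {f : RatXY} (hf : IsReg a f) :
    ratEval (fun i => starRingEnd ℂ (a i)) (conjHom f) = starRingEnd ℂ (ratEval a f) := by
  obtain ⟨p, d, hd, rfl⟩ := isReg_iff.1 hf
  rw [ratEval_of_eq_div hd rfl, map_div₀, map_div₀, ← eval_map_conj, ← eval_map_conj]
  refine ratEval_of_eq_div ?_ ?_
  · rw [eval_map_conj]; simpa using hd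
  · rw [conjHom_toRat, conjHom_toRat]

/-- The rational functions that are positive on the positive quadrant. -/
def IsPositive (f : RatXY) : Prop := ∀ x y : ℝ, 0 < x → 0 < y →
  IsReg ![(x : ℂ), (y : ℂ)] f ∧ ∃ r : ℝ, 0 < r ∧ ratEval ![(x : ℂ), (y : ℂ)] f = r

lemma IsPositive.ne_zero {f : RatXY} (hf : IsPositive f) : f ≠ 0 := by
  rintro rfl
  obtain ⟨-, r, hr, h⟩ := hf 1 1 one_pos one_pos
  rw [ratEval_zero] at h
  exact hr.ne (by exact_mod_cast h)

lemma isPositive_varX : IsPositive varX := fun x y hx _ =>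
  ⟨isReg_varX _, x, hx, by simp⟩

lemma isPositive_varY : IsPositive varY := fun x y _ hy =>
  ⟨isReg_varY _, y, hy, by simp⟩

lemma IsPositive.mul {f g : RatXY} (hf : IsPositive f) (hg : IsPositive g) :
    IsPositive (f * g) := by
  intro x y hx hy
  obtain ⟨h1, r, hr, h2⟩ := hf x y hx hy
  obtain ⟨h3, s, hs, h4⟩ := hg x y hx hy
  exact ⟨h1.mul h3, r * s, by positivity, by rw [ratEval_mul h1 h3, h2, h4]; simp⟩

lemma IsPositive.inv {f : RatXY} (hf : IsPositive f) : IsPositive f⁻¹ := by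
  intro x y hx hy
  obtain ⟨h1, r, hr, h2⟩ := hf x y hx hy
  have h0 : ratEval ![(x : ℂ), (y : ℂ)] f ≠ 0 := by rw [h2]; exact_mod_cast hr.ne'
  exact ⟨h1.inv h0, r⁻¹, by positivity, by rw [ratEval_inv h1 h0, h2]; simp⟩

lemma IsPositive.div {f g : RatXY} (hf : IsPositive f) (hg : IsPositive g) :
    IsPositive (f / g) := by
  rw [div_eq_mul_inv]; exact hf.mul hg.inv

lemma IsPositive.pow {f : RatXY} (hf : IsPositive f) (n : ℕ) : IsPositive (f ^ n) := by
  induction n with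
  | zero => rw [pow_zero]; exact fun _ _ _ _ => ⟨isReg_one _, 1, one_pos, by simp⟩
  | succ n ih => rw [pow_succ]; exact ih.mul hf

lemma IsPositive.zpow {f : RatXY} (hf : IsPositive f) (n : ℤ) : IsPositive (f ^ n) := by
  cases n with
  | ofNat n => simpa using hf.pow n
  | negSucc n => rw [zpow_negSucc]; exact (hf.pow _).inv

lemma isPositive_sum {ι : Type*} {s : Finset ι} {ω : ι → ℝ} {f : ι → RatXY}
    (hω : ∀ i ∈ s, 0 ≤ ω i) (hf : ∀ i ∈ s, IsPositive (f i)) (h : ∃ i ∈ s, ω i ≠ 0) :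
    IsPositive (∑ i ∈ s, const (ω i) * f i) := by
  intro x y hx hy
  choose! r hr using fun i (hi : i ∈ s) => (hf i hi x y hx hy).2
  have hreg : ∀ i ∈ s, IsReg ![(x : ℂ), (y : ℂ)] (const (ω i) * f i) := fun i hi =>
    (isReg_const _ _).mul (hf i hi x y hx hy).1
  refine ⟨isReg_sum hreg, ∑ i ∈ s, ω i * r i, ?_, ?_⟩
  · obtain ⟨i, hi, h0⟩ := h
    exact Finset.sum_pos' (fun j hj => mul_nonneg (hω j hj) (hr j hj).1.le)
      ⟨i, hi, mul_pos (lt_of_le_of_ne (hω i hi) (Ne.symm h0)) (hr i hi).1⟩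
  · rw [ratEval_sum hreg]
    push_cast
    refine sum_congr rfl fun i hi => ?_
    rw [ratEval_mul (isReg_const _ _) (hf i hi x y hx hy).1, ratEval_const, (hr i hi).2]

/-! ### The group of the model -/

lemma mem_stepBox {s : ℤ × ℤ} :
    s ∈ stepBox ↔ (-1 ≤ s.1 ∧ s.1 ≤ 1) ∧ (-1 ≤ s.2 ∧ s.2 ≤ 1) := by
  rw [stepBox, Finset.mem_product, mem_Icc, mem_Icc]

lemma exists_weight_row (M : Model) {j : ℤ} (hj : j = 1 ∨ j = -1) :
    ∃ i ∈ Icc (-1 : ℤ) 1, M.weight (i, j) ≠ 0 := by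
  obtain ⟨s, hs, h⟩ := M.nondegenerate 0 (-j) (by rcases hj with rfl | rfl <;> simp)
  have hb := mem_stepBox.1 (M.small s hs).1
  have h2 : 0 < (j : ℝ) * s.2 := by linarith
  have h3 : 0 < j * s.2 := by exact_mod_cast h2
  have h4 : s.2 = j := by rcases hj with rfl | rfl <;> omega
  exact ⟨s.1, mem_Icc.2 hb.1, by rw [← h4]; exact hs⟩

lemma exists_weight_col (M : Model) {i : ℤ} (hi : i = 1 ∨ i = -1) :
    ∃ j ∈ Icc (-1 : ℤ) 1, M.weight (i, j) ≠ 0 := by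
  obtain ⟨s, hs, h⟩ := M.nondegenerate (-i) 0 (by rcases hi with rfl | rfl <;> simp)
  have hb := mem_stepBox.1 (M.small s hs).1
  have h2 : 0 < (i : ℝ) * s.1 := by linarith
  have h3 : 0 < i * s.1 := by exact_mod_cast h2
  have h4 : s.1 = i := by rcases hi with rfl | rfl <;> omega
  exact ⟨s.2, mem_Icc.2 hb.2, by rw [← h4]; exact hs⟩

lemma isPositive_rowSum (M : Model) {j : ℤ} (hj : j = 1 ∨ j = -1) {X : RatXY} (hX : IsPositive X) :
    IsPositive (rowSum M j X) :=
  isPositive_sum (fun _ _ => M.weight_nonneg _) (fun _ _ => hX.zpow _) (exists_weight_row M hj)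

lemma isPositive_colSum (M : Model) {i : ℤ} (hi : i = 1 ∨ i = -1) {Y : RatXY} (hY : IsPositive Y) :
    IsPositive (colSum M i Y) :=
  isPositive_sum (fun _ _ => M.weight_nonneg _) (fun _ _ => hY.zpow _) (exists_weight_col M hi)

lemma rowSum_ratEval (M : Model) (j : ℤ) {a : Fin 2 → ℂ} {X : RatXY} (hX : IsReg a X)
    (h0 : ratEval a X ≠ 0) : IsReg a (rowSum M j X) ∧
      ratEval a (rowSum M j X) =
        ∑ i ∈ Icc (-1 : ℤ) 1, (M.weight (i, j) : ℂ) * ratEval a X ^ i := by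
  have h : ∀ i ∈ Icc (-1 : ℤ) 1, IsReg a (const (M.weight (i, j)) * X ^ i) :=
    fun i _ => (isReg_const _ _).mul (hX.zpow h0 i)
  refine ⟨isReg_sum h, ?_⟩
  rw [rowSum, ratEval_sum h]
  refine sum_congr rfl fun i _ => ?_
  rw [ratEval_mul (isReg_const _ _) (hX.zpow h0 i), ratEval_const, ratEval_zpow hX h0]

lemma colSum_ratEval (M : Model) (i : ℤ) {a : Fin 2 → ℂ} {Y : RatXY} (hY : IsReg a Y)
    (h0 : ratEval a Y ≠ 0) : IsReg a (colSum M i Y) ∧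
      ratEval a (colSum M i Y) =
        ∑ j ∈ Icc (-1 : ℤ) 1, (M.weight (i, j) : ℂ) * ratEval a Y ^ j := by
  have h : ∀ j ∈ Icc (-1 : ℤ) 1, IsReg a (const (M.weight (i, j)) * Y ^ j) :=
    fun j _ => (isReg_const _ _).mul (hY.zpow h0 j)
  refine ⟨isReg_sum h, ?_⟩
  rw [colSum, ratEval_sum h]
  refine sum_congr rfl fun j _ => ?_
  rw [ratEval_mul (isReg_const _ _) (hY.zpow h0 j), ratEval_const, ratEval_zpow hY h0]

lemma hom_rowSum (M : Model) (σ : RatXY →ₐ[ℂ] RatXY) (j : ℤ) (X : RatXY) :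
    σ (rowSum M j X) = rowSum M j (σ X) := by
  simp only [rowSum, map_sum, map_mul, hom_const, map_zpow₀]

lemma hom_colSum (M : Model) (σ : RatXY →ₐ[ℂ] RatXY) (i : ℤ) (Y : RatXY) :
    σ (colSum M i Y) = colSum M i (σ Y) := by
  simp only [colSum, map_sum, map_mul, hom_const, map_zpow₀]

/-- The quotient `c(x) / a(x)`. -/
def rowQuot (M : Model) : RatXY := rowSum M (-1) varX / rowSum M 1 varX

/-- The quotient `c̃(y) / ã(y)`. -/
def colQuot (M : Model) : RatXY := colSum M (-1) varY / colSum M 1 varY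

lemma isPositive_rowQuot (M : Model) : IsPositive (rowQuot M) :=
  (isPositive_rowSum M (Or.inr rfl) isPositive_varX).div
    (isPositive_rowSum M (Or.inl rfl) isPositive_varX)

lemma isPositive_colQuot (M : Model) : IsPositive (colQuot M) :=
  (isPositive_colSum M (Or.inr rfl) isPositive_varY).div
    (isPositive_colSum M (Or.inl rfl) isPositive_varY)

/-- The value of a function of `x` does not depend on `y`. -/
lemma rowQuot_ratEval_congr (M : Model) {a a' : Fin 2 → ℂ} (h : a 0 = a' 0)
    (h0 : a 0 ≠ 0) (h1 : ratEval a (rowSum M 1 varX) ≠ 0) :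
    (IsReg a' (rowQuot M)) ∧ ratEval a' (rowQuot M) = ratEval a (rowQuot M) := by
  have e : ∀ (j : ℤ), ratEval a' (rowSum M j varX) = ratEval a (rowSum M j varX) := by
    intro j
    rw [(rowSum_ratEval M j (isReg_varX a) (by simpa using h0)).2,
      (rowSum_ratEval M j (isReg_varX a') (by simpa [← h] using h0)).2, ratEval_varX,
      ratEval_varX, h]
  have r : ∀ j, IsReg a (rowSum M j varX) := fun j =>
    (rowSum_ratEval M j (isReg_varX a) (by simpa using h0)).1
  have r' : ∀ j, IsReg a' (rowSum M j varX) := fun j =>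
    (rowSum_ratEval M j (isReg_varX a') (by simpa [← h] using h0)).1
  refine ⟨(r' _).div (r' _) (by rwa [e]), ?_⟩
  rw [rowQuot, ratEval_div (r' _) (r' _) (by rwa [e]), ratEval_div (r _) (r _) h1, e, e]

lemma colQuot_ratEval_congr (M : Model) {a a' : Fin 2 → ℂ} (h : a 1 = a' 1)
    (h0 : a 1 ≠ 0) (h1 : ratEval a (colSum M 1 varY) ≠ 0) :
    (IsReg a' (colQuot M)) ∧ ratEval a' (colQuot M) = ratEval a (colQuot M) := by
  have e : ∀ (j : ℤ), ratEval a' (colSum M j varY) = ratEval a (colSum M j varY) := by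
    intro j
    rw [(colSum_ratEval M j (isReg_varY a) (by simpa using h0)).2,
      (colSum_ratEval M j (isReg_varY a') (by simpa [← h] using h0)).2, ratEval_varY,
      ratEval_varY, h]
  have r : ∀ j, IsReg a (colSum M j varY) := fun j =>
    (colSum_ratEval M j (isReg_varY a) (by simpa using h0)).1
  have r' : ∀ j, IsReg a' (colSum M j varY) := fun j =>
    (colSum_ratEval M j (isReg_varY a') (by simpa [← h] using h0)).1
  refine ⟨(r' _).div (r' _) (by rwa [e]), ?_⟩
  rw [colQuot, ratEval_div (r' _) (r' _) (by rwa [e]), ratEval_div (r _) (r _) h1, e, e]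

lemma phi_injective (M : Model) : Injective
    (aeval ![varX, varY⁻¹ * rowQuot M] : PolyXY →ₐ[ℂ] RatXY) := by
  have hq := isPositive_rowQuot M
  have hr := isPositive_rowSum M (Or.inl rfl) isPositive_varX
  refine aeval_injective_of_dominant (d := badLocus varX * badLocus varY * badLocus (rowQuot M) *
    badLocus (rowSum M 1 varX)) ?_ ?_
  · exact mul_ne_zero (mul_ne_zero (mul_ne_zero (badLocus_ne_zero varX_ne_zero)
      (badLocus_ne_zero varY_ne_zero)) (badLocus_ne_zero hq.ne_zero)) (badLocus_ne_zero hr.ne_zero)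
  · intro a ha
    simp only [map_mul, ne_eq, mul_eq_zero, not_or] at ha
    obtain ⟨⟨⟨h1, h2⟩, h3⟩, h4⟩ := ha
    have h1 := (isReg_of_badLocus h1).2
    have h2 := (isReg_of_badLocus h2).2
    have h3 := isReg_of_badLocus h3
    have h4 := isReg_of_badLocus h4
    rw [ratEval_varX] at h1
    rw [ratEval_varY] at h2
    set a' : Fin 2 → ℂ := ![a 0, ratEval a (rowQuot M) / a 1] with ha'
    have h5 : a' 1 ≠ 0 := div_ne_zero h3.2 h2
    have h6 := rowQuot_ratEval_congr M (a := a) (a' := a') rfl h1 h4.2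
    have h7 : IsReg a' varY⁻¹ := (isReg_varY a').inv (by simpa using h5)
    refine ⟨a', isReg_varX _, h7.mul h6.1, by simp [ha'], ?_⟩
    rw [ratEval_mul h7 h6.1, h6.2, ratEval_inv (isReg_varY a') (by simpa using h5),
      ratEval_varY]
    have h8 : a' 1 = ratEval a (rowQuot M) / a 1 := rfl
    rw [h8, inv_div, div_mul_cancel₀ _ h3.2]

lemma psi_injective (M : Model) : Injective
    (aeval ![varX⁻¹ * colQuot M, varY] : PolyXY →ₐ[ℂ] RatXY) := by
  have hq := isPositive_colQuot M
  have hr := isPositive_colSum M (Or.inl rfl) isPositive_varY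
  refine aeval_injective_of_dominant (d := badLocus varX * badLocus varY * badLocus (colQuot M) *
    badLocus (colSum M 1 varY)) ?_ ?_
  · exact mul_ne_zero (mul_ne_zero (mul_ne_zero (badLocus_ne_zero varX_ne_zero)
      (badLocus_ne_zero varY_ne_zero)) (badLocus_ne_zero hq.ne_zero)) (badLocus_ne_zero hr.ne_zero)
  · intro a ha
    simp only [map_mul, ne_eq, mul_eq_zero, not_or] at ha
    obtain ⟨⟨⟨h1, h2⟩, h3⟩, h4⟩ := ha
    have h1 := (isReg_of_badLocus h1).2
    have h2 := (isReg_of_badLocus h2).2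
    have h3 := isReg_of_badLocus h3
    have h4 := isReg_of_badLocus h4
    rw [ratEval_varX] at h1
    rw [ratEval_varY] at h2
    set a' : Fin 2 → ℂ := ![ratEval a (colQuot M) / a 0, a 1] with ha'
    have h5 : a' 0 ≠ 0 := div_ne_zero h3.2 h1
    have h6 := colQuot_ratEval_congr M (a := a) (a' := a') rfl h2 h4.2
    have h7 : IsReg a' varX⁻¹ := (isReg_varX a').inv (by simpa using h5)
    refine ⟨a', h7.mul h6.1, isReg_varY _, ?_, by simp [ha']⟩
    rw [ratEval_mul h7 h6.1, h6.2, ratEval_inv (isReg_varX a') (by simpa using h5),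
      ratEval_varX]
    have h8 : a' 0 = ratEval a (colQuot M) / a 0 := rfl
    rw [h8, inv_div, div_mul_cancel₀ _ h3.2]

/-- The substitution homomorphism of `Φ`. -/
def phiHom (M : Model) : RatXY →ₐ[ℂ] RatXY := substHom _ _ (phi_injective M)

/-- The substitution homomorphism of `Ψ`. -/
def psiHom (M : Model) : RatXY →ₐ[ℂ] RatXY := substHom _ _ (psi_injective M)

@[simp] lemma phiHom_varX (M : Model) : phiHom M varX = varX := substHom_varX _
@[simp] lemma phiHom_varY (M : Model) : phiHom M varY = varY⁻¹ * rowQuot M := substHom_varY _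
@[simp] lemma psiHom_varX (M : Model) : psiHom M varX = varX⁻¹ * colQuot M := substHom_varX _
@[simp] lemma psiHom_varY (M : Model) : psiHom M varY = varY := substHom_varY _

@[simp] lemma phiHom_rowQuot (M : Model) : phiHom M (rowQuot M) = rowQuot M := by
  rw [rowQuot, map_div₀, hom_rowSum, hom_rowSum, phiHom_varX]

@[simp] lemma psiHom_colQuot (M : Model) : psiHom M (colQuot M) = colQuot M := by
  rw [colQuot, map_div₀, hom_colSum, hom_colSum, psiHom_varY]

lemma phiHom_comp (M : Model) : (phiHom M).comp (phiHom M) = AlgHom.id ℂ RatXY := by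
  have h := (isPositive_rowQuot M).ne_zero
  have h' := varY_ne_zero
  apply hom_ext
  · simp
  · simp only [AlgHom.comp_apply, phiHom_varY, map_mul, map_inv₀, phiHom_rowQuot, AlgHom.id_apply]
    field_simp

lemma psiHom_comp (M : Model) : (psiHom M).comp (psiHom M) = AlgHom.id ℂ RatXY := by
  have h := (isPositive_colQuot M).ne_zero
  have h' := varX_ne_zero
  apply hom_ext
  · simp only [AlgHom.comp_apply, psiHom_varX, map_mul, map_inv₀, psiHom_colQuot, AlgHom.id_apply]
    field_simp
  · simp

/-- The involution of `ℂ(x, y)` induced by `Φ`. -/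
def phi (M : Model) : RatXY ≃ₐ[ℂ] RatXY :=
  AlgEquiv.ofAlgHom (phiHom M) (phiHom M) (phiHom_comp M) (phiHom_comp M)

/-- The involution of `ℂ(x, y)` induced by `Ψ`. -/
def psi (M : Model) : RatXY ≃ₐ[ℂ] RatXY :=
  AlgEquiv.ofAlgHom (psiHom M) (psiHom M) (psiHom_comp M) (psiHom_comp M)

lemma phi_apply (M : Model) (f : RatXY) : phi M f = phiHom M f := rfl
lemma psi_apply (M : Model) (f : RatXY) : psi M f = psiHom M f := rfl

@[simp] lemma phi_mul_phi (M : Model) : phi M * phi M = 1 := by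
  ext f; exact DFunLike.congr_fun (phiHom_comp M) f
@[simp] lemma psi_mul_psi (M : Model) : psi M * psi M = 1 := by
  ext f; exact DFunLike.congr_fun (psiHom_comp M) f

/-- The group of the model, as a group of automorphisms of `ℂ(x, y)`. -/
def modelGroup (M : Model) : Subgroup (RatXY ≃ₐ[ℂ] RatXY) := Subgroup.closure {phi M, psi M}

lemma phi_mem (M : Model) : phi M ∈ modelGroup M := Subgroup.subset_closure (by simp)
lemma psi_mem (M : Model) : psi M ∈ modelGroup M := Subgroup.subset_closure (by simp)

lemma equiv_ext {σ τ : RatXY ≃ₐ[ℂ] RatXY} (hx : σ varX = τ varX) (hy : σ varY = τ varY) :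
    σ = τ := by
  ext f
  exact DFunLike.congr_fun (hom_ext (σ := σ.toAlgHom) (τ := τ.toAlgHom) hx hy) f

lemma Phi_pair (M : Model) (σ : RatXY ≃ₐ[ℂ] RatXY) :
    Phi M (σ varX, σ varY) = ((σ * phi M) varX, (σ * phi M) varY) := by
  rw [Phi, AlgEquiv.mul_apply, AlgEquiv.mul_apply, phi_apply, phi_apply, phiHom_varX, phiHom_varY,
    rowQuot, map_mul, map_inv₀, map_div₀]
  have h := fun j => hom_rowSum M (σ : RatXY →ₐ[ℂ] RatXY) j varX
  change ∀ j, σ (rowSum M j varX) = rowSum M j (σ varX) at h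
  rw [h, h]

lemma Psi_pair (M : Model) (σ : RatXY ≃ₐ[ℂ] RatXY) :
    Psi M (σ varX, σ varY) = ((σ * psi M) varX, (σ * psi M) varY) := by
  rw [Psi, AlgEquiv.mul_apply, AlgEquiv.mul_apply, psi_apply, psi_apply, psiHom_varX, psiHom_varY,
    colQuot, map_mul, map_inv₀, map_div₀]
  have h := fun j => hom_colSum M (σ : RatXY →ₐ[ℂ] RatXY) j varY
  change ∀ i, σ (colSum M i varY) = colSum M i (σ varY) at h
  rw [h, h]

lemma memGroup_of_mem (M : Model) {σ : RatXY ≃ₐ[ℂ] RatXY} (h : σ ∈ modelGroup M) :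
    MemGroup M (σ varX, σ varY) := by
  have hphi : ∀ τ : RatXY ≃ₐ[ℂ] RatXY, MemGroup M (τ varX, τ varY) →
      MemGroup M ((τ * phi M) varX, (τ * phi M) varY) := fun τ hτ => by
    rw [← Phi_pair]; exact hτ.phi
  have hpsi : ∀ τ : RatXY ≃ₐ[ℂ] RatXY, MemGroup M (τ varX, τ varY) →
      MemGroup M ((τ * psi M) varX, (τ * psi M) varY) := fun τ hτ => by
    rw [← Psi_pair]; exact hτ.psi
  induction h using Subgroup.closure_induction_right with
  | one => exact MemGroup.one
  | mul_right x _ y hy ih =>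
    rcases hy with rfl | rfl
    · exact hphi x ih
    · exact hpsi x ih
  | mul_inv_cancel x _ y hy ih =>
    rcases hy with rfl | rfl
    · rw [inv_eq_of_mul_eq_one_left (phi_mul_phi M)]; exact hphi x ih
    · rw [inv_eq_of_mul_eq_one_left (psi_mul_psi M)]; exact hpsi x ih

lemma finite_modelGroup (M : Model) (h : {g | MemGroup M g}.Finite) :
    Finite (modelGroup M) := by
  have := h.to_subtype
  refine Finite.of_injective (β := {g | MemGroup M g})
    (fun σ => ⟨(σ.1 varX, σ.1 varY), memGroup_of_mem M σ.2⟩) ?_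
  intro σ τ h
  simp only [Subtype.mk.injEq, Prod.mk.injEq] at h
  exact Subtype.ext (equiv_ext h.1 h.2)

end

section

open Finset (Icc mul_sum range sum_congr sum_div sum_insert sum_mul sum_pos' sum_sub_distrib)
/-! ### The step polynomial and the alternating sum over the group -/

/-- The step polynomial as a rational function. -/
def stepRat (M : Model) : RatXY :=
  ∑ s ∈ stepBox, const (M.weight s) * varX ^ s.1 * varY ^ s.2

lemma stepRat_eq_rowSum (M : Model) :
    stepRat M = ∑ j ∈ Icc (-1 : ℤ) 1, rowSum M j varX * varY ^ j := by
  rw [stepRat, stepBox, Finset.sum_product_right]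
  refine sum_congr rfl fun j _ => ?_
  rw [rowSum, sum_mul]

lemma stepRat_eq_colSum (M : Model) :
    stepRat M = ∑ i ∈ Icc (-1 : ℤ) 1, colSum M i varY * varX ^ i := by
  rw [stepRat, stepBox, Finset.sum_product]
  refine sum_congr rfl fun i _ => ?_
  rw [colSum, sum_mul]
  exact sum_congr rfl fun j _ => by ring

lemma sum_Icc_neg_one_one {E : Type*} [AddCommMonoid E] (f : ℤ → E) :
    ∑ j ∈ Icc (-1 : ℤ) 1, f j = f (-1) + f 0 + f 1 := by
  have h : Icc (-1 : ℤ) 1 = {-1, 0, 1} := by decide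
  rw [h, sum_insert (by decide), sum_insert (by decide), Finset.sum_singleton, add_assoc]

@[simp] lemma phi_stepRat (M : Model) : phi M (stepRat M) = stepRat M := by
  have h1 := (isPositive_rowSum M (Or.inl rfl) isPositive_varX).ne_zero
  have h2 := (isPositive_rowSum M (Or.inr rfl) isPositive_varX).ne_zero
  have hy := varY_ne_zero
  rw [phi_apply, stepRat_eq_rowSum, sum_Icc_neg_one_one]
  simp only [map_add, map_mul, hom_rowSum, phiHom_varX, map_zpow₀, phiHom_varY, rowQuot]
  rw [zpow_neg_one, zpow_neg_one, zpow_zero, zpow_zero, zpow_one, zpow_one]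
  field_simp
  ring

@[simp] lemma psi_stepRat (M : Model) : psi M (stepRat M) = stepRat M := by
  have h1 := (isPositive_colSum M (Or.inl rfl) isPositive_varY).ne_zero
  have h2 := (isPositive_colSum M (Or.inr rfl) isPositive_varY).ne_zero
  have hy := varX_ne_zero
  rw [psi_apply, stepRat_eq_colSum, sum_Icc_neg_one_one]
  simp only [map_add, map_mul, hom_colSum, psiHom_varY, map_zpow₀, psiHom_varX, colQuot]
  rw [zpow_neg_one, zpow_neg_one, zpow_zero, zpow_zero, zpow_one, zpow_one]
  field_simp
  ring

/-- The rotation in the group of the model. -/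
def rot (M : Model) : RatXY ≃ₐ[ℂ] RatXY := phi M * psi M

/-- The order of the rotation, which is half the order of the group. -/
def rotOrder (M : Model) : ℕ := orderOf (rot M)

lemma rot_mem (M : Model) : rot M ∈ modelGroup M := mul_mem (phi_mem M) (psi_mem M)

lemma rotOrder_pos (M : Model) [Finite (modelGroup M)] : 0 < rotOrder M := by
  have h : IsOfFinOrder (⟨rot M, rot_mem M⟩ : modelGroup M) := isOfFinOrder_of_finite _
  exact ((Submonoid.isOfFinOrder_coe (H := (modelGroup M).toSubmonoid)).2 h).orderOf_pos

lemma rot_pow_rotOrder (M : Model) : rot M ^ rotOrder M = 1 := pow_orderOf_eq_one _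

lemma rot_inv (M : Model) : (rot M)⁻¹ = psi M * phi M := by
  apply inv_eq_of_mul_eq_one_right
  rw [rot, mul_assoc, ← mul_assoc (psi M), psi_mul_psi, one_mul, phi_mul_phi]

lemma rot_mul_psi (M : Model) : rot M * psi M = phi M := by
  rw [rot, mul_assoc, psi_mul_psi, mul_one]

lemma phi_mul_rot_pow (M : Model) (j : ℕ) : phi M * rot M ^ j = (rot M)⁻¹ ^ j * phi M := by
  induction j with
  | zero => simp
  | succ j ih =>
    have h : phi M * rot M = (rot M)⁻¹ * phi M := by
      rw [rot_inv, rot, ← mul_assoc, phi_mul_phi, one_mul, mul_assoc, phi_mul_phi, mul_one]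
    rw [pow_succ, ← mul_assoc, ih, pow_succ, mul_assoc, mul_assoc, h]

/-- The alternating sum over the group. -/
def altSum (M : Model) : RatXY →ₗ[ℂ] RatXY :=
  ∑ j ∈ range (rotOrder M),
    ((rot M ^ j).toLinearMap - (rot M ^ j * phi M).toLinearMap)

lemma altSum_apply (M : Model) (f : RatXY) : altSum M f =
    ∑ j ∈ range (rotOrder M), ((rot M ^ j) f - (rot M ^ j) (phi M f)) := by
  rw [altSum, LinearMap.sum_apply]
  rfl

lemma sum_range_succ_eq_of_periodic {E : Type*} [AddCommGroup E] {c : ℕ} {g : ℕ → E}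
    (h : g c = g 0) : ∑ j ∈ range c, g (j + 1) = ∑ j ∈ range c, g j := by
  have h1 := Finset.sum_range_succ g c
  rw [Finset.sum_range_succ', h] at h1
  exact add_right_cancel h1

lemma rot_altSum (M : Model) (f : RatXY) : rot M (altSum M f) = altSum M f := by
  rw [altSum_apply, map_sum]
  have h := sum_range_succ_eq_of_periodic (c := rotOrder M)
    (g := fun j => (rot M ^ j) f - (rot M ^ j) (phi M f)) (by rw [rot_pow_rotOrder, pow_zero])
  rw [← h]
  refine sum_congr rfl fun j _ => ?_
  rw [pow_succ', map_sub, AlgEquiv.mul_apply, AlgEquiv.mul_apply]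

lemma altSum_phi (M : Model) (f : RatXY) : altSum M (phi M f) = -altSum M f := by
  have h : phi M (phi M f) = f := DFunLike.congr_fun (phi_mul_phi M) f
  rw [altSum_apply, altSum_apply, h, ← Finset.sum_neg_distrib]
  exact sum_congr rfl fun j _ => by ring

lemma sum_rot_pow_shift (M : Model) (f : RatXY) :
    ∑ j ∈ range (rotOrder M), (rot M ^ j) (rot M f) =
      ∑ j ∈ range (rotOrder M), (rot M ^ j) f := by
  rw [← sum_range_succ_eq_of_periodic (c := rotOrder M) (g := fun j => (rot M ^ j) f)
    (by rw [rot_pow_rotOrder, pow_zero])]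
  refine sum_congr rfl fun j _ => ?_
  rw [pow_succ, AlgEquiv.mul_apply]

lemma altSum_rot (M : Model) (f : RatXY) : altSum M (rot M f) = altSum M f := by
  have h1 : rot M (phi M (rot M f)) = phi M f := by
    have h : rot M * (phi M * rot M) = phi M := by
      have h2 := phi_mul_rot_pow M 1
      rw [pow_one, pow_one] at h2
      rw [h2, mul_inv_cancel_left]
    have := DFunLike.congr_fun h f
    rwa [AlgEquiv.mul_apply, AlgEquiv.mul_apply] at this
  rw [altSum_apply, altSum_apply, sum_sub_distrib, sum_sub_distrib,
    sum_rot_pow_shift, ← sum_rot_pow_shift M (phi M (rot M f)), h1]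

lemma altSum_psi (M : Model) (f : RatXY) : altSum M (psi M f) = -altSum M f := by
  rw [← altSum_rot M (psi M f), ← altSum_phi]
  congr 1
  exact DFunLike.congr_fun (rot_mul_psi M) f

lemma phi_altSum (M : Model) (f : RatXY) : phi M (altSum M f) = -altSum M f := by
  have key : ∀ g : RatXY, ∑ j ∈ range (rotOrder M), ((rot M)⁻¹ ^ j) g =
      ∑ j ∈ range (rotOrder M), (rot M ^ j) g := by
    intro g
    rw [← sum_range_succ_eq_of_periodic (c := rotOrder M) (g := fun j => ((rot M)⁻¹ ^ j) g)
      (by rw [inv_pow, rot_pow_rotOrder]; simp), ← Finset.sum_range_reflect]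
    refine sum_congr rfl fun j hj => ?_
    have h : (rot M)⁻¹ ^ (rotOrder M - 1 - j + 1) = rot M ^ j := by
      rw [inv_pow, inv_eq_iff_mul_eq_one, ← pow_add, ← rot_pow_rotOrder M]
      congr 1
      have := Finset.mem_range.1 hj
      omega
    rw [h]
  have h1 : ∀ j g, phi M ((rot M ^ j) g) = ((rot M)⁻¹ ^ j) (phi M g) := fun j g =>
    DFunLike.congr_fun (phi_mul_rot_pow M j) g
  have h2 : phi M (phi M f) = f := DFunLike.congr_fun (phi_mul_phi M) f
  rw [altSum_apply, map_sum, ← Finset.sum_neg_distrib]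
  simp only [map_sub, h1, h2, neg_sub, sum_sub_distrib, key]

/-- Elements fixed by both involutions are constants for the alternating sum. -/
lemma altSum_mul_of_invariant (M : Model) {h : RatXY} (h1 : phi M h = h) (h2 : psi M h = h)
    (f : RatXY) : altSum M (h * f) = h * altSum M f := by
  have h3 : rot M h = h := by rw [rot, AlgEquiv.mul_apply, h2, h1]
  have h4 : ∀ j : ℕ, (rot M ^ j) h = h := by
    intro j
    induction j with
    | zero => rfl
    | succ j ih => rw [pow_succ, AlgEquiv.mul_apply, h3, ih]
  rw [altSum_apply, altSum_apply, mul_sum]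
  refine sum_congr rfl fun j _ => ?_
  rw [map_mul, map_mul, map_mul, h4, h1, h4, mul_sub]

lemma altSum_eq_zero_of_phi (M : Model) {f : RatXY} (h : phi M f = f) : altSum M f = 0 := by
  have h1 := altSum_phi M f
  rw [h] at h1
  have h2 : (2 : ℂ) • altSum M f = 0 := by rw [two_smul]; nth_rewrite 1 [h1]; simp
  exact (smul_eq_zero.1 h2).resolve_left two_ne_zero

lemma altSum_eq_zero_of_psi (M : Model) {f : RatXY} (h : psi M f = f) : altSum M f = 0 := by
  have h1 := altSum_psi M f
  rw [h] at h1
  have h2 : (2 : ℂ) • altSum M f = 0 := by rw [two_smul]; nth_rewrite 1 [h1]; simp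
  exact (smul_eq_zero.1 h2).resolve_left two_ne_zero

/-! ### The saddle point -/

/-- The saddle point. -/
def basePt (x0 y0 : ℝ) : Fin 2 → ℂ := ![(x0 : ℂ), (y0 : ℂ)]

/-- The weights of the tilted model, in which the steps form a centered probability measure. -/
def tilt (M : Model) (x0 y0 : ℝ) (s : ℤ × ℤ) : ℝ :=
  M.weight s * x0 ^ s.1 * y0 ^ s.2 / stepPoly M x0 y0

lemma stepPoly_real (M : Model) (x y : ℝ) :
    stepPoly M x y = ∑ s ∈ stepBox, M.weight s * x ^ s.1 * y ^ s.2 := rfl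

lemma exists_weight (M : Model) : ∃ s ∈ stepBox, M.weight s ≠ 0 := by
  obtain ⟨s, hs, -⟩ := M.nondegenerate 1 0 (by simp)
  exact ⟨s, (M.small s hs).1, hs⟩

lemma weight_pos (M : Model) {s : ℤ × ℤ} (h : M.weight s ≠ 0) : 0 < M.weight s :=
  lt_of_le_of_ne (M.weight_nonneg s) (Ne.symm h)

lemma stepPoly_pos (M : Model) {x y : ℝ} (hx : 0 < x) (hy : 0 < y) : 0 < stepPoly M x y := by
  rw [stepPoly_real]
  obtain ⟨s, hs, h⟩ := exists_weight M
  have := weight_pos M h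
  refine sum_pos' (fun t _ => ?_) ⟨s, hs, by positivity⟩
  have := M.weight_nonneg t
  positivity

variable {M : Model} {x0 y0 : ℝ}

lemma IsDominantSaddle.pos (sp : IsDominantSaddle M x0 y0) : 0 < stepPoly M x0 y0 :=
  stepPoly_pos M sp.1 sp.2.1

lemma tilt_nonneg (sp : IsDominantSaddle M x0 y0) (s : ℤ × ℤ) : 0 ≤ tilt M x0 y0 s := by
  have h1 := sp.1
  have h2 := sp.2.1
  have h3 := sp.pos
  have h4 := M.weight_nonneg s
  rw [tilt]; positivity

lemma tilt_pos (sp : IsDominantSaddle M x0 y0) {s : ℤ × ℤ} (hs : M.weight s ≠ 0) :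
    0 < tilt M x0 y0 s := by
  have h1 := sp.1
  have h2 := sp.2.1
  have h3 := sp.pos
  have h4 := weight_pos M hs
  rw [tilt]; positivity

lemma sum_tilt (sp : IsDominantSaddle M x0 y0) : ∑ s ∈ stepBox, tilt M x0 y0 s = 1 := by
  simp only [tilt]
  rw [← sum_div, ← stepPoly_real, div_self sp.pos.ne']

lemma sum_weight_fst (sp : IsDominantSaddle M x0 y0) :
    ∑ s ∈ stepBox, M.weight s * x0 ^ s.1 * y0 ^ s.2 * s.1 = 0 := by
  have hd : HasDerivAt (fun x : ℝ => stepPoly M x y0)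
      (∑ s ∈ stepBox, M.weight s * ((s.1 : ℝ) * x0 ^ (s.1 - 1)) * y0 ^ s.2) x0 := by
    simp only [stepPoly_real]
    refine HasDerivAt.fun_sum fun s _ => ?_
    exact ((hasDerivAt_zpow s.1 x0 (Or.inl sp.1.ne')).const_mul _).mul_const _
  have hm : IsLocalMin (fun x : ℝ => stepPoly M x y0) x0 := by
    filter_upwards [lt_mem_nhds sp.1] with x hx
    exact sp.2.2 x y0 hx sp.2.1
  have h := hm.hasDerivAt_eq_zero hd
  have h2 := congrArg (fun t => x0 * t) h
  simp only [mul_zero, mul_sum] at h2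
  rw [← h2]
  refine sum_congr rfl fun s _ => ?_
  rw [zpow_sub_one₀ sp.1.ne']
  field_simp [sp.1.ne']

lemma sum_weight_snd (sp : IsDominantSaddle M x0 y0) :
    ∑ s ∈ stepBox, M.weight s * x0 ^ s.1 * y0 ^ s.2 * s.2 = 0 := by
  have hd : HasDerivAt (fun y : ℝ => stepPoly M x0 y)
      (∑ s ∈ stepBox, M.weight s * x0 ^ s.1 * ((s.2 : ℝ) * y0 ^ (s.2 - 1))) y0 := by
    simp only [stepPoly_real]
    refine HasDerivAt.fun_sum fun s _ => ?_
    exact (hasDerivAt_zpow s.2 y0 (Or.inl sp.2.1.ne')).const_mul _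
  have hm : IsLocalMin (fun y : ℝ => stepPoly M x0 y) y0 := by
    filter_upwards [lt_mem_nhds sp.2.1] with y hy
    exact sp.2.2 x0 y sp.1 hy
  have h := hm.hasDerivAt_eq_zero hd
  have h2 := congrArg (fun t => y0 * t) h
  simp only [mul_zero, mul_sum] at h2
  rw [← h2]
  refine sum_congr rfl fun s _ => ?_
  rw [zpow_sub_one₀ sp.2.1.ne']
  field_simp [sp.2.1.ne']

lemma sum_tilt_fst (sp : IsDominantSaddle M x0 y0) :
    ∑ s ∈ stepBox, tilt M x0 y0 s * s.1 = 0 := by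
  simp only [tilt, div_mul_eq_mul_div]
  rw [← sum_div, sum_weight_fst sp, zero_div]

lemma sum_tilt_snd (sp : IsDominantSaddle M x0 y0) :
    ∑ s ∈ stepBox, tilt M x0 y0 s * s.2 = 0 := by
  simp only [tilt, div_mul_eq_mul_div]
  rw [← sum_div, sum_weight_snd sp, zero_div]

/-- The covariance matrix of the tilted model. -/
def covar (M : Model) (x0 y0 : ℝ) (i j : Fin 2) : ℝ :=
  ∑ s ∈ stepBox, tilt M x0 y0 s * (![(s.1 : ℝ), (s.2 : ℝ)] i * ![(s.1 : ℝ), (s.2 : ℝ)] j)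

lemma covar_symm (M : Model) (x0 y0 : ℝ) (i j : Fin 2) : covar M x0 y0 i j = covar M x0 y0 j i := by
  rw [covar, covar]
  exact sum_congr rfl fun s _ => by ring

lemma quadForm_eq (M : Model) (x0 y0 a b : ℝ) :
    ∑ s ∈ stepBox, tilt M x0 y0 s * (a * s.1 + b * s.2) ^ 2 =
      covar M x0 y0 0 0 * a ^ 2 + 2 * covar M x0 y0 0 1 * a * b + covar M x0 y0 1 1 * b ^ 2 := by
  simp only [covar, sum_mul, mul_sum, ← Finset.sum_add_distrib]
  refine sum_congr rfl fun s _ => ?_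
  simp
  ring

lemma quadForm_pos (sp : IsDominantSaddle M x0 y0) {a b : ℝ} (hab : (a, b) ≠ (0, 0)) :
    0 < covar M x0 y0 0 0 * a ^ 2 + 2 * covar M x0 y0 0 1 * a * b + covar M x0 y0 1 1 * b ^ 2 := by
  rw [← quadForm_eq]
  obtain ⟨s, hs, h⟩ := M.nondegenerate a b hab
  refine sum_pos' (fun t _ => mul_nonneg (tilt_nonneg sp t) (sq_nonneg _))
    ⟨s, (M.small s hs).1, mul_pos (tilt_pos sp hs) ?_⟩
  exact pow_pos_of_ne_zero h.ne
where
  pow_pos_of_ne_zero {t : ℝ} (h : t ≠ 0) : 0 < t ^ 2 := by positivity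

lemma covar_zero_pos (sp : IsDominantSaddle M x0 y0) : 0 < covar M x0 y0 0 0 := by
  simpa using quadForm_pos sp (a := 1) (b := 0) (by simp)

lemma covar_one_pos (sp : IsDominantSaddle M x0 y0) : 0 < covar M x0 y0 1 1 := by
  simpa using quadForm_pos sp (a := 0) (b := 1) (by simp)

lemma covar_det_pos (sp : IsDominantSaddle M x0 y0) :
    0 < covar M x0 y0 0 0 * covar M x0 y0 1 1 - covar M x0 y0 0 1 ^ 2 := by
  have h1 := covar_one_pos sp
  have h := quadForm_pos sp (a := covar M x0 y0 1 1) (b := -covar M x0 y0 0 1)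
    (by simp [h1.ne'])
  have h2 : 0 < covar M x0 y0 1 1 *
      (covar M x0 y0 0 0 * covar M x0 y0 1 1 - covar M x0 y0 0 1 ^ 2) := by nlinarith
  exact (mul_pos_iff_of_pos_left h1).1 h2

end

section

open Derivation (commutator_apply leibniz leibniz_inv leibniz_zpow map_algebraMap mk')
open Finset (Icc sum_congr sum_eq_zero)
variable {M : Model} {x0 y0 : ℝ}

lemma IsDominantSaddle.basePt_ne (sp : IsDominantSaddle M x0 y0) (i : Fin 2) :
    basePt x0 y0 i ≠ 0 := by
  fin_cases i
  · exact Complex.ofReal_ne_zero.2 sp.1.ne'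
  · exact Complex.ofReal_ne_zero.2 sp.2.1.ne'

@[simp] lemma basePt_zero (x0 y0 : ℝ) : basePt x0 y0 0 = x0 := rfl
@[simp] lemma basePt_one (x0 y0 : ℝ) : basePt x0 y0 1 = y0 := rfl

lemma IsPositive.regular_basePt (sp : IsDominantSaddle M x0 y0) {f : RatXY} (hf : IsPositive f) :
    IsReg (basePt x0 y0) f ∧ ratEval (basePt x0 y0) f ≠ 0 := by
  obtain ⟨h1, r, hr, h2⟩ := hf x0 y0 sp.1 sp.2.1
  exact ⟨h1, by rw [basePt, h2]; exact_mod_cast hr.ne'⟩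

/-! ### Monomials and the normalized step polynomial -/

lemma isReg_monomial {a : Fin 2 → ℂ} (h0 : a 0 ≠ 0) (h1 : a 1 ≠ 0) (m n : ℤ) :
    IsReg a (varX ^ m * varY ^ n) :=
  ((isReg_varX a).zpow (by simpa using h0) m).mul
    ((isReg_varY a).zpow (by simpa using h1) n)

lemma ratEval_monomial {a : Fin 2 → ℂ} (h0 : a 0 ≠ 0) (h1 : a 1 ≠ 0) (m n : ℤ) :
    ratEval a (varX ^ m * varY ^ n) = a 0 ^ m * a 1 ^ n := by
  rw [ratEval_mul ((isReg_varX a).zpow (by simpa using h0) m)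
    ((isReg_varY a).zpow (by simpa using h1) n),
    ratEval_zpow (isReg_varX a) (by simpa using h0),
    ratEval_zpow (isReg_varY a) (by simpa using h1), ratEval_varX, ratEval_varY]

lemma euler_monomial (i : Fin 2) (m n : ℤ) :
    euler i (varX ^ m * varY ^ n) = (![(m : ℂ), (n : ℂ)] i) • (varX ^ m * varY ^ n) := by
  have hx := varX_ne_zero
  have hy := varY_ne_zero
  rw [leibniz, leibniz_zpow, leibniz_zpow]
  have e : ∀ (n : ℤ) (z : RatXY), z ≠ 0 → n • (z ^ (n - 1) * z) = (n : ℂ) • z ^ n := by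
    intro n z hz
    rw [zpow_sub_one₀ hz, mul_assoc, inv_mul_cancel₀ hz, mul_one, ← Int.cast_smul_eq_zsmul ℂ]
  fin_cases i
  · simp only [Fin.zero_eta, euler_zero_varX, euler_zero_varY, smul_eq_mul, mul_zero, smul_zero,
      zero_add, Matrix.cons_val_zero, e _ _ hx]
    rw [mul_smul_comm, mul_comm]
  · simp only [Fin.mk_one, euler_one_varX, euler_one_varY, smul_eq_mul, mul_zero, smul_zero,
      add_zero, Matrix.cons_val_one, Matrix.cons_val_fin_one, e _ _ hy]
    rw [mul_smul_comm]

/-- A Laurent polynomial whose coefficients are functions of the weights. -/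
lemma stepRat_eq_smul (M : Model) :
    stepRat M = ∑ s ∈ stepBox, (M.weight s : ℂ) • (varX ^ s.1 * varY ^ s.2) := by
  rw [stepRat]
  refine sum_congr rfl fun s _ => ?_
  rw [const_eq, mul_assoc, Algebra.smul_def]

/-- The step polynomial divided by its value at the saddle point. -/
def normStep (M : Model) (x0 y0 : ℝ) : RatXY := ((stepPoly M x0 y0 : ℝ) : ℂ)⁻¹ • stepRat M

lemma isReg_stepRat {a : Fin 2 → ℂ} (h0 : a 0 ≠ 0) (h1 : a 1 ≠ 0) :
    IsReg a (stepRat M) := by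
  rw [stepRat_eq_smul]
  exact isReg_sum fun s _ => (isReg_monomial h0 h1 _ _).smul _

lemma ratEval_stepRat {a : Fin 2 → ℂ} (h0 : a 0 ≠ 0) (h1 : a 1 ≠ 0) :
    ratEval a (stepRat M) = stepPoly M (a 0) (a 1) := by
  rw [stepRat_eq_smul, ratEval_sum fun s _ => (isReg_monomial h0 h1 _ _).smul _]
  refine sum_congr rfl fun s _ => ?_
  rw [ratEval_smul (isReg_monomial h0 h1 _ _), ratEval_monomial h0 h1, mul_assoc]
  rfl

lemma isReg_normStep {a : Fin 2 → ℂ} (h0 : a 0 ≠ 0) (h1 : a 1 ≠ 0) :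
    IsReg a (normStep M x0 y0) := (isReg_stepRat h0 h1).smul _

lemma ratEval_normStep {a : Fin 2 → ℂ} (h0 : a 0 ≠ 0) (h1 : a 1 ≠ 0) :
    ratEval a (normStep M x0 y0) = stepPoly M (a 0) (a 1) / (stepPoly M x0 y0 : ℝ) := by
  rw [normStep, ratEval_smul (isReg_stepRat h0 h1), ratEval_stepRat h0 h1, inv_mul_eq_div]

lemma stepPoly_ofReal (M : Model) (x y : ℝ) : stepPoly M (x : ℂ) (y : ℂ) = (stepPoly M x y : ℝ) := by
  simp only [stepPoly]
  push_cast
  rfl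

lemma ratEval_normStep_basePt (sp : IsDominantSaddle M x0 y0) :
    ratEval (basePt x0 y0) (normStep M x0 y0) = 1 := by
  rw [ratEval_normStep (sp.basePt_ne 0) (sp.basePt_ne 1), basePt_zero, basePt_one,
    stepPoly_ofReal, div_self (Complex.ofReal_ne_zero.2 sp.pos.ne')]

lemma euler_normStep (M : Model) (x0 y0 : ℝ) (i : Fin 2) :
    euler i (normStep M x0 y0) = ∑ s ∈ stepBox, ((((stepPoly M x0 y0 : ℝ) : ℂ)⁻¹ * M.weight s) *
      ![(s.1 : ℂ), (s.2 : ℂ)] i) • (varX ^ s.1 * varY ^ s.2) := by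
  rw [normStep, Derivation.map_smul, stepRat_eq_smul, map_sum, Finset.smul_sum]
  refine sum_congr rfl fun s _ => ?_
  rw [Derivation.map_smul, euler_monomial, smul_smul, smul_smul]

lemma tilt_ofReal (M : Model) (x0 y0 : ℝ) (s : ℤ × ℤ) :
    (tilt M x0 y0 s : ℂ) =
      ((stepPoly M x0 y0 : ℝ) : ℂ)⁻¹ * M.weight s * ((x0 : ℂ) ^ s.1 * (y0 : ℂ) ^ s.2) := by
  rw [tilt]; push_cast; ring

lemma grad_normStep (sp : IsDominantSaddle M x0 y0) (i : Fin 2) :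
    grad (basePt x0 y0) (normStep M x0 y0) i = 0 := by
  have h0 := sp.basePt_ne 0
  have h1 := sp.basePt_ne 1
  rw [grad, euler_normStep, ratEval_sum fun s _ => (isReg_monomial h0 h1 _ _).smul _]
  have h : ∀ s ∈ stepBox, ratEval (basePt x0 y0) (((((stepPoly M x0 y0 : ℝ) : ℂ)⁻¹ * M.weight s) *
      ![(s.1 : ℂ), (s.2 : ℂ)] i) • (varX ^ s.1 * varY ^ s.2)) =
        tilt M x0 y0 s * ![(s.1 : ℂ), (s.2 : ℂ)] i := by
    intro s _
    rw [ratEval_smul (isReg_monomial h0 h1 _ _), ratEval_monomial h0 h1, tilt_ofReal,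
      basePt_zero, basePt_one]
    ring
  rw [sum_congr rfl h]
  fin_cases i
  · change ∑ s ∈ stepBox, (tilt M x0 y0 s : ℂ) * (s.1 : ℂ) = 0
    exact_mod_cast sum_tilt_fst sp
  · change ∑ s ∈ stepBox, (tilt M x0 y0 s : ℂ) * (s.2 : ℂ) = 0
    exact_mod_cast sum_tilt_snd sp

lemma grad_euler_normStep (sp : IsDominantSaddle M x0 y0) (i j : Fin 2) :
    grad (basePt x0 y0) (euler i (normStep M x0 y0)) j = covar M x0 y0 i j := by
  have h0 := sp.basePt_ne 0
  have h1 := sp.basePt_ne 1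
  rw [grad, euler_normStep, map_sum]
  have h : ∀ s ∈ stepBox, euler j (((((stepPoly M x0 y0 : ℝ) : ℂ)⁻¹ * M.weight s) *
      ![(s.1 : ℂ), (s.2 : ℂ)] i) • (varX ^ s.1 * varY ^ s.2)) =
      ((((stepPoly M x0 y0 : ℝ) : ℂ)⁻¹ * M.weight s) *
      ![(s.1 : ℂ), (s.2 : ℂ)] i * ![(s.1 : ℂ), (s.2 : ℂ)] j) • (varX ^ s.1 * varY ^ s.2) := by
    intro s _
    rw [Derivation.map_smul, euler_monomial, smul_smul]
  rw [sum_congr rfl h,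
    ratEval_sum fun s _ => (isReg_monomial h0 h1 _ _).smul _, covar, Complex.ofReal_sum]
  refine sum_congr rfl fun s _ => ?_
  rw [ratEval_smul (isReg_monomial h0 h1 _ _), ratEval_monomial h0 h1, Complex.ofReal_mul,
    tilt_ofReal, basePt_zero, basePt_one]
  fin_cases i <;> fin_cases j <;> simp <;> ring

lemma euler_normStep_mem (sp : IsDominantSaddle M x0 y0) (i : Fin 2) :
    euler i (normStep M x0 y0) ∈ vanish (basePt x0 y0) 1 :=
  (mem_vanish_one (isReg_euler
    (isReg_normStep (sp.basePt_ne 0) (sp.basePt_ne 1)) i)).2 (grad_normStep sp i)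

/-- The logarithmic derivatives of the step polynomial. -/
def logStep (M : Model) (x0 y0 : ℝ) (i : Fin 2) : RatXY :=
  (normStep M x0 y0)⁻¹ * euler i (normStep M x0 y0)

lemma isReg_inv_normStep (sp : IsDominantSaddle M x0 y0) :
    IsReg (basePt x0 y0) (normStep M x0 y0)⁻¹ :=
  (isReg_normStep (sp.basePt_ne 0) (sp.basePt_ne 1)).inv
    (by rw [ratEval_normStep_basePt sp]; exact one_ne_zero)

lemma logStep_mem (sp : IsDominantSaddle M x0 y0) (i : Fin 2) :
    logStep M x0 y0 i ∈ vanish (basePt x0 y0) 1 :=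
  mul_mem_vanish_right (isReg_inv_normStep sp) (euler_normStep_mem sp i)

lemma grad_logStep (sp : IsDominantSaddle M x0 y0) (i j : Fin 2) :
    grad (basePt x0 y0) (logStep M x0 y0 i) j = covar M x0 y0 i j := by
  have hs := isReg_normStep (M := M) (x0 := x0) (y0 := y0) (sp.basePt_ne 0) (sp.basePt_ne 1)
  have h1 := ratEval_normStep_basePt sp
  rw [logStep, grad_mul (isReg_inv_normStep sp) (isReg_euler hs i),
    grad_euler_normStep sp, ratEval_inv hs (by rw [h1]; exact one_ne_zero), h1]
  have h2 : ratEval (basePt x0 y0) (euler i (normStep M x0 y0)) = 0 := grad_normStep sp i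
  rw [h2]; simp

/-! ### Division by a pair of local parameters -/

lemma grad_centered (b : Fin 2 → ℂ) (i j : Fin 2) :
    grad b (centered b j) i = if j = i then b i else 0 := by
  rw [grad, euler_centered]
  split_ifs
  · rw [ratEval_toRat]; simp
  · simp

lemma grad_mul_of_mem {b : Fin 2 → ℂ} {f g : RatXY} (hf : f ∈ vanish b 1) (hg : IsReg b g)
    (i : Fin 2) : grad b (f * g) i = ratEval b g * grad b f i := by
  have hr := isReg_of_mem_vanish hf
  rw [grad_mul hr hg, (mem_vanish_one hr).1 hf, zero_mul, zero_add]

/-- Division by two functions that vanish at `b` with independent gradients. -/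
lemma exists_div_of_mem_vanish {b : Fin 2 → ℂ} {w₀ w₁ : RatXY}
    (sp : w₀ ∈ vanish b 1) (h₁ : w₁ ∈ vanish b 1)
    (hw : grad b w₀ 0 * grad b w₁ 1 - grad b w₀ 1 * grad b w₁ 0 ≠ 0) {k : ℕ} {f : RatXY}
    (hf : f ∈ vanish b (k + 1)) :
    ∃ f₀ ∈ vanish b k, ∃ f₁ ∈ vanish b k, f = f₀ * w₀ + f₁ * w₁ := by
  obtain ⟨u₀, hu₀, u₁, hu₁, rfl⟩ := exists_of_mem_vanish_succ sp
  obtain ⟨v₀, hv₀, v₁, hv₁, rfl⟩ := exists_of_mem_vanish_succ h₁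
  obtain ⟨f₀, hf₀, f₁, hf₁, rfl⟩ := exists_of_mem_vanish_succ hf
  rw [mem_vanish_zero] at hu₀ hu₁ hv₀ hv₁
  have hc := fun j => isReg_centered b b j
  simp only [grad_add ((hc 0).mul hu₀) ((hc 1).mul hu₁), grad_add ((hc 0).mul hv₀) ((hc 1).mul hv₁),
    grad_mul_of_mem (centered_mem b _) hu₀, grad_mul_of_mem (centered_mem b _) hu₁,
    grad_mul_of_mem (centered_mem b _) hv₀, grad_mul_of_mem (centered_mem b _) hv₁,
    grad_centered] at hw
  simp at hw
  set δ := u₀ * v₁ - u₁ * v₀ with hδ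
  have hδr : IsReg b δ := (hu₀.mul hv₁).sub (hu₁.mul hv₀)
  have hδe : ratEval b δ ≠ 0 := by
    rw [hδ, ratEval_sub (hu₀.mul hv₁) (hu₁.mul hv₀), ratEval_mul hu₀ hv₁, ratEval_mul hu₁ hv₀]
    intro h
    apply hw
    linear_combination b 0 * b 1 * h
  have hδ0 : δ ≠ 0 := by
    intro h
    rw [h] at hδe
    simp at hδe
  have hi := hδr.inv hδe
  refine ⟨δ⁻¹ * (v₁ * f₀ - v₀ * f₁), mul_mem_vanish_right hi
    (sub_mem (mul_mem_vanish_right hv₁ hf₀) (mul_mem_vanish_right hv₀ hf₁)),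
    δ⁻¹ * (u₀ * f₁ - u₁ * f₀), mul_mem_vanish_right hi
    (sub_mem (mul_mem_vanish_right hu₀ hf₁) (mul_mem_vanish_right hu₁ hf₀)), ?_⟩
  have h : centered b 0 * f₀ + centered b 1 * f₁ =
      δ⁻¹ * δ * (centered b 0 * f₀ + centered b 1 * f₁) := by
    rw [inv_mul_cancel₀ hδ0, one_mul]
  rw [h, hδ]
  ring

lemma exists_div_logStep (sp : IsDominantSaddle M x0 y0) {k : ℕ} {f : RatXY}
    (hf : f ∈ vanish (basePt x0 y0) (k + 1)) :
    ∃ f₀ ∈ vanish (basePt x0 y0) k, ∃ f₁ ∈ vanish (basePt x0 y0) k,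
      f = f₀ * logStep M x0 y0 0 + f₁ * logStep M x0 y0 1 := by
  refine exists_div_of_mem_vanish (logStep_mem sp 0) (logStep_mem sp 1) ?_ hf
  rw [grad_logStep sp, grad_logStep sp, grad_logStep sp, grad_logStep sp]
  have h := covar_det_pos sp
  rw [covar_symm M x0 y0 1 0, ← sq]
  exact_mod_cast h.ne'

lemma sub_ratEval_mem {b : Fin 2 → ℂ} {f : RatXY} (hf : IsReg b f) :
    f - algebraMap ℂ RatXY (ratEval b f) ∈ vanish b 1 := by
  rw [mem_vanish_one (hf.sub (isReg_algebraMap b _)),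
    ratEval_sub hf (isReg_algebraMap b _), ratEval_algebraMap, sub_self]

/-! ### The action of the group at the saddle point -/

lemma equiv_smul (σ : RatXY ≃ₐ[ℂ] RatXY) (c : ℂ) (f : RatXY) : σ (c • f) = c • σ f := by
  rw [Algebra.smul_def, map_mul, AlgEquiv.commutes, Algebra.smul_def]

/-- The substitution `σ` fixes the point `b`. -/
def FixesPt (b : Fin 2 → ℂ) (σ : RatXY ≃ₐ[ℂ] RatXY) : Prop :=
  ∀ f, IsReg b f → IsReg b (σ f) ∧ ratEval b (σ f) = ratEval b f

lemma FixesPt.mul {b : Fin 2 → ℂ} {σ τ : RatXY ≃ₐ[ℂ] RatXY} (hσ : FixesPt b σ)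
    (hτ : FixesPt b τ) : FixesPt b (σ * τ) := by
  intro f hf
  have h1 := hτ f hf
  have h2 := hσ _ h1.1
  exact ⟨h2.1, h2.2.trans h1.2⟩

lemma FixesPt.pow {b : Fin 2 → ℂ} {σ : RatXY ≃ₐ[ℂ] RatXY} (hσ : FixesPt b σ) (n : ℕ) :
    FixesPt b (σ ^ n) := by
  induction n with
  | zero => exact fun f hf => ⟨hf, rfl⟩
  | succ n ih => rw [pow_succ]; exact ih.mul hσ

lemma FixesPt.map_vanish {b : Fin 2 → ℂ} {σ : RatXY ≃ₐ[ℂ] RatXY} (hσ : FixesPt b σ) {k : ℕ}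
    {f : RatXY} (hf : f ∈ vanish b k) : σ f ∈ vanish b k := by
  induction k generalizing f with
  | zero => exact mem_vanish_zero.2 (hσ f (mem_vanish_zero.1 hf)).1
  | succ k ih =>
    obtain ⟨f₀, hf₀, f₁, hf₁, rfl⟩ := exists_of_mem_vanish_succ hf
    have hc : ∀ j, σ (centered b j) ∈ vanish b 1 := by
      intro j
      have h := hσ _ (isReg_centered b b j)
      rw [mem_vanish_one h.1, h.2]
      exact (mem_vanish_one (isReg_centered b b j)).1 (centered_mem b j)
    rw [map_add, map_mul, map_mul, add_comm k 1]
    exact add_mem (mul_mem_vanish (hc 0) (ih hf₀)) (mul_mem_vanish (hc 1) (ih hf₁))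

lemma fixesPt_of_coord {b : Fin 2 → ℂ} {σ : RatXY ≃ₐ[ℂ] RatXY}
    (hx : IsReg b (σ varX)) (hy : IsReg b (σ varY))
    (hx' : ratEval b (σ varX) = b 0) (hy' : ratEval b (σ varY) = b 1) : FixesPt b σ := by
  intro f hf
  exact isReg_hom_aux (σ : RatXY →ₐ[ℂ] RatXY) (a := b) (a' := b) hx hy (by
    ext i
    fin_cases i
    · exact hx'.symm
    · exact hy'.symm) hf

lemma fixesPt_phi (sp : IsDominantSaddle M x0 y0) : FixesPt (basePt x0 y0) (phi M) := by
  have hb0 := sp.basePt_ne 0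
  have hb1 := sp.basePt_ne 1
  have hq := (isPositive_rowQuot M).regular_basePt sp
  have hr := fun j => rowSum_ratEval M j (isReg_varX (basePt x0 y0))
    (by rw [ratEval_varX]; exact hb0)
  have hp := ((isPositive_rowSum M (Or.inl rfl) isPositive_varX).regular_basePt sp).2
  have hyi : IsReg (basePt x0 y0) varY⁻¹ :=
    (isReg_varY _).inv (by rw [ratEval_varY]; exact hb1)
  have hy : IsReg (basePt x0 y0) (phi M varY) := by
    rw [phi_apply, phiHom_varY]
    exact hyi.mul hq.1
  refine fixesPt_of_coord (by rw [phi_apply, phiHom_varX]; exact isReg_varX _) hy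
    (by rw [phi_apply, phiHom_varX, ratEval_varX]) ?_
  have hc := sum_weight_snd sp
  rw [stepBox, Finset.sum_product_right, sum_Icc_neg_one_one] at hc
  have hc' : (∑ i ∈ Icc (-1 : ℤ) 1, (M.weight (i, -1) : ℂ) * (x0 : ℂ) ^ i) =
      y0 ^ 2 * ∑ i ∈ Icc (-1 : ℤ) 1, (M.weight (i, 1) : ℂ) * (x0 : ℂ) ^ i := by
    have hy0 : y0 ≠ 0 := sp.2.1.ne'
    have h3 : (∑ i ∈ Icc (-1 : ℤ) 1, M.weight (i, -1) * x0 ^ i) =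
      y0 ^ 2 * ∑ i ∈ Icc (-1 : ℤ) 1, M.weight (i, 1) * x0 ^ i := by
      simp only [Int.cast_neg, Int.cast_one, Int.cast_zero, mul_zero, Finset.sum_const_zero,
        add_zero, mul_one, ← Finset.sum_mul] at hc
      rw [zpow_neg_one, zpow_one] at hc
      field_simp at hc
      linarith
    exact_mod_cast h3
  rw [phi_apply, phiHom_varY, ratEval_mul hyi hq.1,
    ratEval_inv (isReg_varY _) (by rw [ratEval_varY]; exact hb1), ratEval_varY, rowQuot,
    ratEval_div (hr _).1 (hr _).1 hp, basePt_one]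
  rw [(hr 1).2] at hp
  rw [(hr 1).2, (hr (-1)).2, ratEval_varX, basePt_zero, hc']
  rw [ratEval_varX, basePt_zero] at hp
  have hy1 : (y0 : ℂ) ≠ 0 := hb1
  field_simp

lemma fixesPt_psi (sp : IsDominantSaddle M x0 y0) : FixesPt (basePt x0 y0) (psi M) := by
  have hb0 := sp.basePt_ne 0
  have hb1 := sp.basePt_ne 1
  have hq := (isPositive_colQuot M).regular_basePt sp
  have hr := fun j => colSum_ratEval M j (isReg_varY (basePt x0 y0))
    (by rw [ratEval_varY]; exact hb1)
  have hp := ((isPositive_colSum M (Or.inl rfl) isPositive_varY).regular_basePt sp).2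
  have hxi : IsReg (basePt x0 y0) varX⁻¹ :=
    (isReg_varX _).inv (by rw [ratEval_varX]; exact hb0)
  have hx : IsReg (basePt x0 y0) (psi M varX) := by
    rw [psi_apply, psiHom_varX]
    exact hxi.mul hq.1
  refine fixesPt_of_coord hx (by rw [psi_apply, psiHom_varY]; exact isReg_varY _) ?_
    (by rw [psi_apply, psiHom_varY, ratEval_varY])
  have hc := sum_weight_fst sp
  rw [stepBox, Finset.sum_product, sum_Icc_neg_one_one] at hc
  have hc' : (∑ j ∈ Icc (-1 : ℤ) 1, (M.weight (-1, j) : ℂ) * (y0 : ℂ) ^ j) =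
      x0 ^ 2 * ∑ j ∈ Icc (-1 : ℤ) 1, (M.weight (1, j) : ℂ) * (y0 : ℂ) ^ j := by
    have hx0 : x0 ≠ 0 := sp.1.ne'
    have h3 : (∑ j ∈ Icc (-1 : ℤ) 1, M.weight (-1, j) * y0 ^ j) =
      x0 ^ 2 * ∑ j ∈ Icc (-1 : ℤ) 1, M.weight (1, j) * y0 ^ j := by
      have e : ∀ i : ℤ, ∑ j ∈ Icc (-1 : ℤ) 1, M.weight (i, j) * x0 ^ i * y0 ^ j * i =
          i * x0 ^ i * ∑ j ∈ Icc (-1 : ℤ) 1, M.weight (i, j) * y0 ^ j := by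
        intro i
        rw [Finset.mul_sum]
        exact sum_congr rfl fun j _ => by ring
      rw [e (-1), e 0, e 1] at hc
      simp only [Int.cast_neg, Int.cast_one, Int.cast_zero, zero_mul, add_zero, one_mul] at hc
      rw [zpow_neg_one, zpow_one] at hc
      field_simp at hc
      linarith
    exact_mod_cast h3
  rw [psi_apply, psiHom_varX, ratEval_mul hxi hq.1,
    ratEval_inv (isReg_varX _) (by rw [ratEval_varX]; exact hb0), ratEval_varX, colQuot,
    ratEval_div (hr _).1 (hr _).1 hp, basePt_zero]
  rw [(hr 1).2] at hp
  rw [(hr 1).2, (hr (-1)).2, ratEval_varY, basePt_one, hc']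
  rw [ratEval_varY, basePt_one] at hp
  have hx1 : (x0 : ℂ) ≠ 0 := hb0
  field_simp

lemma fixesPt_rot (sp : IsDominantSaddle M x0 y0) : FixesPt (basePt x0 y0) (rot M) :=
  (fixesPt_phi sp).mul (fixesPt_psi sp)

lemma altSum_mem_vanish (sp : IsDominantSaddle M x0 y0) {k : ℕ} {f : RatXY}
    (hf : f ∈ vanish (basePt x0 y0) k) : altSum M f ∈ vanish (basePt x0 y0) k := by
  rw [altSum_apply]
  refine sum_mem fun j _ => sub_mem ?_ ?_
  · exact ((fixesPt_rot sp).pow j).map_vanish hf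
  · exact ((fixesPt_rot sp).pow j).map_vanish ((fixesPt_phi sp).map_vanish hf)

/-- A reflection: an automorphism that, in logarithmic coordinates, fixes the coordinate `i` and
maps the coordinate `j` to its negative plus a function with logarithmic derivative `τ`. -/
structure IsReflection (M : Model) (x0 y0 : ℝ) (σ : RatXY ≃ₐ[ℂ] RatXY) (i j : Fin 2)
    (τ : RatXY) : Prop where
  ne : i ≠ j
  fixes : FixesPt (basePt x0 y0) σ
  map_step : σ (normStep M x0 y0) = normStep M x0 y0
  regular : IsReg (basePt x0 y0) τ
  euler_shift : euler j τ = 0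
  euler_fst : ∀ f, euler i (σ f) = σ (euler i f) + τ * σ (euler j f)
  euler_snd : ∀ f, euler j (σ f) = -σ (euler j f)

/-- The conjugate of a derivation by an automorphism. -/
def conjDerivation (σ : RatXY ≃ₐ[ℂ] RatXY) (δ : Derivation ℂ RatXY RatXY) :
    Derivation ℂ RatXY RatXY :=
  mk' (σ.symm.toLinearMap ∘ₗ (δ : RatXY →ₗ[ℂ] RatXY) ∘ₗ σ.toLinearMap) (by
    intro f g
    simp)

lemma conjDerivation_apply (σ : RatXY ≃ₐ[ℂ] RatXY) (δ : Derivation ℂ RatXY RatXY) (f : RatXY) :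
    conjDerivation σ δ f = σ.symm (δ (σ f)) := rfl

lemma euler_comm (i j : Fin 2) (f : RatXY) : euler i (euler j f) = euler j (euler i f) := by
  have h : ⁅euler i, euler j⁆ = 0 := by
    apply derivation_ext
    · rw [commutator_apply]
      fin_cases i <;> fin_cases j <;> simp
    · rw [commutator_apply]
      fin_cases i <;> fin_cases j <;> simp
  have h2 := DFunLike.congr_fun h f
  rw [commutator_apply] at h2
  exact sub_eq_zero.1 h2

lemma euler_logDeriv {i j : Fin 2} {f : RatXY} (h : euler j f = 0) :
    euler j (f⁻¹ * euler i f) = 0 := by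
  rw [leibniz, leibniz_inv, euler_comm, h]
  simp

lemma euler_one_rowQuot (M : Model) : euler 1 (rowQuot M) = 0 := by
  have h : ∀ j, euler 1 (rowSum M j varX) = 0 := by
    intro j
    rw [rowSum, map_sum]
    refine sum_eq_zero fun i _ => ?_
    rw [leibniz, const_eq, map_algebraMap, leibniz_zpow,
      euler_one_varX]
    simp
  rw [rowQuot, div_eq_mul_inv, leibniz, leibniz_inv, h, h]
  simp

lemma euler_zero_colQuot (M : Model) : euler 0 (colQuot M) = 0 := by
  have h : ∀ j, euler 0 (colSum M j varY) = 0 := by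
    intro j
    rw [colSum, map_sum]
    refine sum_eq_zero fun i _ => ?_
    rw [leibniz, const_eq, map_algebraMap, leibniz_zpow,
      euler_zero_varY]
    simp
  rw [colQuot, div_eq_mul_inv, leibniz, leibniz_inv, h, h]
  simp

lemma euler_of_generators {σ : RatXY ≃ₐ[ℂ] RatXY} {i j : Fin 2} {u v : RatXY}
    (hx : euler i (σ varX) = u * σ (euler i varX) + v * σ (euler j varX))
    (hy : euler i (σ varY) = u * σ (euler i varY) + v * σ (euler j varY)) (f : RatXY) :
    euler i (σ f) = u * σ (euler i f) + v * σ (euler j f) := by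
  have h : conjDerivation σ (euler i) = σ.symm u • euler i + σ.symm v • euler j := by
    apply derivation_ext
    · rw [conjDerivation_apply, hx]; simp
    · rw [conjDerivation_apply, hy]; simp
  have h2 := congrArg σ (DFunLike.congr_fun h f)
  rw [conjDerivation_apply, AlgEquiv.apply_symm_apply] at h2
  rw [h2]
  simp

lemma isReflection_phi (sp : IsDominantSaddle M x0 y0) :
    IsReflection M x0 y0 (phi M) 0 1 ((rowQuot M)⁻¹ * euler 0 (rowQuot M)) where
  ne := by decide
  fixes := fixesPt_phi sp
  map_step := by rw [normStep, equiv_smul, phi_stepRat]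
  regular := by
    have h := (isPositive_rowQuot M).regular_basePt sp
    exact (h.1.inv h.2).mul (isReg_euler h.1 0)
  euler_shift := euler_logDeriv (euler_one_rowQuot M)
  euler_fst := by
    have h := (isPositive_rowQuot M).ne_zero
    have hy := varY_ne_zero
    intro f
    rw [← one_mul (phi M (euler 0 f))]
    apply euler_of_generators
    · simp [phi_apply]
    · simp only [phi_apply, phiHom_varY, leibniz, leibniz_inv,
        euler_zero_varY, euler_one_varY, map_zero, smul_eq_mul]
      field_simp
      ring
  euler_snd := by
    have h := (isPositive_rowQuot M).ne_zero
    have hy := varY_ne_zero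
    intro f
    have := euler_of_generators (σ := phi M) (i := 1) (j := 0) (u := -1) (v := 0)
      (by simp [phi_apply]) (by
        simp only [phi_apply, phiHom_varY, leibniz, leibniz_inv,
          euler_zero_varY, euler_one_varY, euler_one_rowQuot, smul_eq_mul]
        field_simp
        ring) f
    simpa using this

lemma isReflection_psi (sp : IsDominantSaddle M x0 y0) :
    IsReflection M x0 y0 (psi M) 1 0 ((colQuot M)⁻¹ * euler 1 (colQuot M)) where
  ne := by decide
  fixes := fixesPt_psi sp
  map_step := by rw [normStep, equiv_smul, psi_stepRat]
  regular := by
    have h := (isPositive_colQuot M).regular_basePt sp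
    exact (h.1.inv h.2).mul (isReg_euler h.1 1)
  euler_shift := euler_logDeriv (euler_zero_colQuot M)
  euler_fst := by
    have h := (isPositive_colQuot M).ne_zero
    have hx := varX_ne_zero
    intro f
    rw [← one_mul (psi M (euler 1 f))]
    apply euler_of_generators
    · simp only [psi_apply, psiHom_varX, leibniz, leibniz_inv,
        euler_zero_varX, euler_one_varX, map_zero, smul_eq_mul]
      field_simp
      ring
    · simp [psi_apply]
  euler_snd := by
    have h := (isPositive_colQuot M).ne_zero
    have hx := varX_ne_zero
    intro f
    have := euler_of_generators (σ := psi M) (i := 0) (j := 1) (u := -1) (v := 0)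
      (by
        simp only [psi_apply, psiHom_varX, leibniz, leibniz_inv,
          euler_zero_varX, euler_one_varX, euler_zero_colQuot, smul_eq_mul]
        field_simp
        ring) (by simp [psi_apply]) f
    simpa using this

end

section

open Complex (I I_sq ofReal_ne_zero)
open Finset (card_range range sum_congr sum_const sum_smul)
open Real (sqrt)
open Submodule (smul_mem)
variable {M : Model} {x0 y0 : ℝ}

/-! ### Eigenvectors of the rotation -/

lemma IsReflection.map_logStep_snd {σ : RatXY ≃ₐ[ℂ] RatXY} {i j : Fin 2} {τ : RatXY}
    (h : IsReflection M x0 y0 σ i j τ) : σ (logStep M x0 y0 j) = -logStep M x0 y0 j := by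
  have h1 := h.euler_snd (normStep M x0 y0)
  rw [h.map_step] at h1
  have h2 : σ (euler j (normStep M x0 y0)) = -euler j (normStep M x0 y0) := by
    linear_combination h1
  rw [logStep, map_mul, map_inv₀, h.map_step, h2]
  ring

lemma IsReflection.map_logStep_fst {σ : RatXY ≃ₐ[ℂ] RatXY} {i j : Fin 2} {τ : RatXY}
    (h : IsReflection M x0 y0 σ i j τ) :
    σ (logStep M x0 y0 i) = logStep M x0 y0 i + τ * logStep M x0 y0 j := by
  have h1 := h.euler_snd (normStep M x0 y0)
  have h2 := h.euler_fst (normStep M x0 y0)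
  rw [h.map_step] at h1 h2
  have h3 : σ (euler i (normStep M x0 y0)) =
      euler i (normStep M x0 y0) + τ * euler j (normStep M x0 y0) := by
    linear_combination -h2 - τ * h1
  rw [logStep, logStep, map_mul, map_inv₀, h.map_step, h3]
  ring

lemma IsReflection.grad_snd {σ : RatXY ≃ₐ[ℂ] RatXY} {i j : Fin 2} {τ : RatXY}
    (h : IsReflection M x0 y0 σ i j τ) {f : RatXY} (hf : IsReg (basePt x0 y0) f) :
    grad (basePt x0 y0) (σ f) j = -grad (basePt x0 y0) f j := by
  have h1 := h.fixes _ (isReg_euler hf j)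
  rw [grad, h.euler_snd, ratEval_neg h1.1, h1.2, grad]

lemma IsReflection.grad_fst {σ : RatXY ≃ₐ[ℂ] RatXY} {i j : Fin 2} {τ : RatXY}
    (h : IsReflection M x0 y0 σ i j τ) {f : RatXY} (hf : IsReg (basePt x0 y0) f) :
    grad (basePt x0 y0) (σ f) i =
      grad (basePt x0 y0) f i + ratEval (basePt x0 y0) τ * grad (basePt x0 y0) f j := by
  have h1 := h.fixes _ (isReg_euler hf j)
  have h2 := h.fixes _ (isReg_euler hf i)
  rw [grad, h.euler_fst, ratEval_add h2.1 (h.regular.mul h1.1), ratEval_mul h.regular h1.1,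
    h1.2, h2.2, grad, grad]

lemma IsReflection.covar_eq {σ : RatXY ≃ₐ[ℂ] RatXY} {i j : Fin 2} {τ : RatXY}
    (h : IsReflection M x0 y0 σ i j τ) (sp : IsDominantSaddle M x0 y0) :
    ratEval (basePt x0 y0) τ * covar M x0 y0 j j = -2 * covar M x0 y0 i j := by
  have hr := isReg_of_mem_vanish (logStep_mem sp j)
  have h1 := h.grad_fst hr
  rw [h.map_logStep_snd, ← neg_one_smul ℂ, grad_smul hr, grad_logStep sp, grad_logStep sp,
    covar_symm M x0 y0 j i] at h1
  linear_combination -h1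

/-- A root of `D r² + 2 B r + A`, where `A`, `B`, `D` are the entries of the covariance matrix. -/
def root (M : Model) (x0 y0 : ℝ) : ℂ :=
  (-covar M x0 y0 0 1 + I *
    sqrt (covar M x0 y0 0 0 * covar M x0 y0 1 1 - covar M x0 y0 0 1 ^ 2)) /
      covar M x0 y0 1 1

/-- The other root. -/
def root' (M : Model) (x0 y0 : ℝ) : ℂ :=
  (-covar M x0 y0 0 1 - I *
    sqrt (covar M x0 y0 0 0 * covar M x0 y0 1 1 - covar M x0 y0 0 1 ^ 2)) /
      covar M x0 y0 1 1

lemma covar_one_ne (sp : IsDominantSaddle M x0 y0) : (covar M x0 y0 1 1 : ℂ) ≠ 0 :=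
  ofReal_ne_zero.2 (covar_one_pos sp).ne'

lemma covar_zero_ne (sp : IsDominantSaddle M x0 y0) : (covar M x0 y0 0 0 : ℂ) ≠ 0 :=
  ofReal_ne_zero.2 (covar_zero_pos sp).ne'

lemma root_add (sp : IsDominantSaddle M x0 y0) :
    covar M x0 y0 1 1 * (root M x0 y0 + root' M x0 y0) = -2 * covar M x0 y0 0 1 := by
  have h := covar_one_ne sp
  rw [root, root']
  field_simp
  ring

lemma root_mul (sp : IsDominantSaddle M x0 y0) :
    covar M x0 y0 1 1 * (root M x0 y0 * root' M x0 y0) = covar M x0 y0 0 0 := by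
  have h := covar_one_ne sp
  have hs := Real.sq_sqrt (covar_det_pos sp).le
  rw [root, root']
  set q := sqrt (covar M x0 y0 0 0 * covar M x0 y0 1 1 - covar M x0 y0 0 1 ^ 2)
  have hs' : (q : ℂ) ^ 2 = covar M x0 y0 0 0 * covar M x0 y0 1 1 - covar M x0 y0 0 1 ^ 2 := by
    exact_mod_cast hs
  field_simp
  linear_combination hs' - (q : ℂ) ^ 2 * I_sq

lemma root_ne_root' (sp : IsDominantSaddle M x0 y0) : root M x0 y0 ≠ root' M x0 y0 := by
  have h := covar_one_ne sp
  have hs := Real.sqrt_pos.2 (covar_det_pos sp)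
  rw [root, root']
  set q := sqrt (covar M x0 y0 0 0 * covar M x0 y0 1 1 - covar M x0 y0 0 1 ^ 2)
  intro he
  rw [div_left_inj' h] at he
  have h1 : I * (q : ℂ) = 0 := by linear_combination (1 / 2 : ℂ) * he
  rcases mul_eq_zero.1 h1 with h2 | h2
  · exact Complex.I_ne_zero h2
  · exact hs.ne' (Complex.ofReal_eq_zero.1 h2)

lemma root_ne_zero (sp : IsDominantSaddle M x0 y0) : root M x0 y0 ≠ 0 := by
  intro h
  have := root_mul sp
  rw [h] at this
  exact covar_zero_ne sp (by rw [← this]; ring)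

lemma root'_ne_zero (sp : IsDominantSaddle M x0 y0) : root' M x0 y0 ≠ 0 := by
  intro h
  have := root_mul sp
  rw [h] at this
  exact covar_zero_ne sp (by rw [← this]; ring)

/-- The eigenvalue of the rotation. -/
def rotEigen (M : Model) (x0 y0 : ℝ) : ℂ := root M x0 y0 / root' M x0 y0

lemma rotEigen_ne_zero (sp : IsDominantSaddle M x0 y0) : rotEigen M x0 y0 ≠ 0 :=
  div_ne_zero (root_ne_zero sp) (root'_ne_zero sp)

lemma grad_phi (sp : IsDominantSaddle M x0 y0) {f : RatXY} (hf : IsReg (basePt x0 y0) f) :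
    grad (basePt x0 y0) (phi M f) 0 = grad (basePt x0 y0) f 0 +
      (root M x0 y0 + root' M x0 y0) * grad (basePt x0 y0) f 1 := by
  have h := isReflection_phi sp
  have h1 : ratEval (basePt x0 y0) ((rowQuot M)⁻¹ * euler 0 (rowQuot M)) =
      root M x0 y0 + root' M x0 y0 := by
    apply mul_right_cancel₀ (covar_one_ne sp)
    rw [h.covar_eq sp, ← root_add sp, mul_comm]
  rw [h.grad_fst hf, h1]

lemma grad_psi (sp : IsDominantSaddle M x0 y0) {f : RatXY} (hf : IsReg (basePt x0 y0) f) :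
    root M x0 y0 * root' M x0 y0 * grad (basePt x0 y0) (psi M f) 1 =
      root M x0 y0 * root' M x0 y0 * grad (basePt x0 y0) f 1 +
      (root M x0 y0 + root' M x0 y0) * grad (basePt x0 y0) f 0 := by
  have h := isReflection_psi sp
  have h2 := h.covar_eq sp
  rw [covar_symm M x0 y0 1 0] at h2
  have h1 : root M x0 y0 * root' M x0 y0 * ratEval (basePt x0 y0) ((colQuot M)⁻¹ * euler 1 (colQuot M)) =
      root M x0 y0 + root' M x0 y0 := by
    apply mul_left_cancel₀ (covar_one_ne sp)
    rw [root_add sp, ← h2, ← root_mul sp]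
    ring
  rw [h.grad_fst hf, ← h1]
  ring

/-- The function `W` vanishes at the saddle point and is an eigenvector of the rotation; its
gradient is normalized. -/
structure IsEigenParam (M : Model) (x0 y0 : ℝ) (W : RatXY) : Prop where
  mem : W ∈ vanish (basePt x0 y0) 1
  grad_zero : grad (basePt x0 y0) W 0 = -root M x0 y0
  grad_one : grad (basePt x0 y0) W 1 = 1
  rot_eq : rot M W = rotEigen M x0 y0 • W

lemma grad_rot_pow (sp : IsDominantSaddle M x0 y0) {z : RatXY}
    (hz : z ∈ vanish (basePt x0 y0) 1) (hz0 : grad (basePt x0 y0) z 0 = -root M x0 y0)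
    (hz1 : grad (basePt x0 y0) z 1 = 1) (n : ℕ) :
    grad (basePt x0 y0) ((rot M ^ n) z) 0 = -root M x0 y0 * rotEigen M x0 y0 ^ n ∧
      grad (basePt x0 y0) ((rot M ^ n) z) 1 = rotEigen M x0 y0 ^ n := by
  have hr := root_ne_zero sp
  have hr' := root'_ne_zero sp
  induction n with
  | zero => simpa using ⟨hz0, hz1⟩
  | succ n ih =>
    have h0 : (rot M ^ n) z ∈ vanish (basePt x0 y0) 1 := ((fixesPt_rot sp).pow n).map_vanish hz
    rw [pow_succ', AlgEquiv.mul_apply, rot, AlgEquiv.mul_apply, ← rot]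
    set f := (rot M ^ n) z
    have h1 := isReg_of_mem_vanish h0
    have h2 : IsReg (basePt x0 y0) (psi M f) := ((fixesPt_psi sp) f h1).1
    have e1 : grad (basePt x0 y0) (psi M f) 1 = -rotEigen M x0 y0 ^ (n + 1) := by
      apply mul_left_cancel₀ (mul_ne_zero hr hr')
      rw [grad_psi sp h1, ih.1, ih.2, pow_succ, rotEigen]
      field_simp
      ring
    have e2 : grad (basePt x0 y0) (psi M f) 0 = root M x0 y0 * rotEigen M x0 y0 ^ n := by
      rw [(isReflection_psi sp).grad_snd h1, ih.1]; ring
    constructor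
    · rw [grad_phi sp h2, e1, e2, pow_succ, rotEigen]
      field_simp
      ring
    · rw [(isReflection_phi sp).grad_snd h2, e1, neg_neg]

lemma exists_grad_eq (sp : IsDominantSaddle M x0 y0) (a₀ a₁ : ℂ) :
    ∃ z ∈ vanish (basePt x0 y0) 1, grad (basePt x0 y0) z 0 = a₀ ∧ grad (basePt x0 y0) z 1 = a₁ := by
  have hb0 := sp.basePt_ne 0
  have hb1 := sp.basePt_ne 1
  have hc := fun j => isReg_centered (basePt x0 y0) (basePt x0 y0) j
  refine ⟨(a₀ / basePt x0 y0 0) • centered (basePt x0 y0) 0 +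
    (a₁ / basePt x0 y0 1) • centered (basePt x0 y0) 1,
    add_mem (smul_mem _ _ (centered_mem _ _)) (smul_mem _ _ (centered_mem _ _)), ?_, ?_⟩
  · rw [grad_add ((hc 0).smul _) ((hc 1).smul _), grad_smul (hc 0), grad_smul (hc 1), grad_centered,
      grad_centered]
    simp only [if_true, one_ne_zero, if_false, mul_zero, add_zero]
    exact div_mul_cancel₀ _ hb0
  · rw [grad_add ((hc 0).smul _) ((hc 1).smul _), grad_smul (hc 0), grad_smul (hc 1), grad_centered,
      grad_centered]
    simp only [if_true, zero_ne_one, if_false, mul_zero, zero_add]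
    exact div_mul_cancel₀ _ hb1

lemma grad_eq_of_rot_pow_eq_one (sp : IsDominantSaddle M x0 y0) {n : ℕ} (h : rot M ^ n = 1) :
    rotEigen M x0 y0 ^ n = 1 := by
  obtain ⟨z, hz, hz0, hz1⟩ := exists_grad_eq sp (-root M x0 y0) 1
  have h1 := (grad_rot_pow sp hz hz0 hz1 n).2
  rw [h] at h1
  rw [← h1]
  exact hz1

lemma exists_isEigenParam [Finite (modelGroup M)] (sp : IsDominantSaddle M x0 y0) :
    ∃ W, IsEigenParam M x0 y0 W := by
  obtain ⟨z, hz, hz0, hz1⟩ := exists_grad_eq sp (-root M x0 y0) 1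
  have hω := rotEigen_ne_zero sp
  have hωc := grad_eq_of_rot_pow_eq_one sp (rot_pow_rotOrder M)
  have hc : (rotOrder M : ℂ) ≠ 0 := Nat.cast_ne_zero.2 (rotOrder_pos M).ne'
  have hm : ∀ j : ℕ, (rot M ^ j) z ∈ vanish (basePt x0 y0) 1 := fun j =>
    ((fixesPt_rot sp).pow j).map_vanish hz
  set ω := rotEigen M x0 y0 with hωd
  have hsum : ∀ i, grad (basePt x0 y0)
      (∑ j ∈ range (rotOrder M), ((ω⁻¹) ^ j) • (rot M ^ j) z) i =
        ∑ j ∈ range (rotOrder M), (ω⁻¹) ^ j * grad (basePt x0 y0) ((rot M ^ j) z) i := by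
    intro i
    rw [grad, map_sum]
    simp only [Derivation.map_smul]
    rw [ratEval_sum fun j _ => (isReg_euler (isReg_of_mem_vanish (hm j)) i).smul _]
    refine sum_congr rfl fun j _ => ?_
    rw [ratEval_smul (isReg_euler (isReg_of_mem_vanish (hm j)) i), grad]
  have hmem : ∑ j ∈ range (rotOrder M), ((ω⁻¹) ^ j) • (rot M ^ j) z ∈
      vanish (basePt x0 y0) 1 := sum_mem fun j _ => smul_mem _ _ (hm j)
  have hcancel : ∀ j : ℕ, (ω⁻¹) ^ j * ω ^ j = 1 := fun j => by
    rw [← mul_pow, inv_mul_cancel₀ hω, one_pow]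
  refine ⟨(rotOrder M : ℂ)⁻¹ • ∑ j ∈ range (rotOrder M), ((ω⁻¹) ^ j) • (rot M ^ j) z,
    smul_mem _ _ hmem, ?_, ?_, ?_⟩
  · rw [grad_smul (isReg_of_mem_vanish hmem), hsum]
    have h : ∀ j ∈ range (rotOrder M), (ω⁻¹) ^ j * grad (basePt x0 y0) ((rot M ^ j) z) 0 =
        -root M x0 y0 := by
      intro j _
      rw [(grad_rot_pow sp hz hz0 hz1 j).1]
      linear_combination -root M x0 y0 * hcancel j
    rw [sum_congr rfl h, sum_const, card_range, nsmul_eq_mul,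
      inv_mul_cancel_left₀ hc]
  · rw [grad_smul (isReg_of_mem_vanish hmem), hsum]
    have h : ∀ j ∈ range (rotOrder M), (ω⁻¹) ^ j * grad (basePt x0 y0) ((rot M ^ j) z) 1 =
        1 := by
      intro j _
      rw [(grad_rot_pow sp hz hz0 hz1 j).2]
      exact hcancel j
    rw [sum_congr rfl h, sum_const, card_range, nsmul_eq_mul,
      inv_mul_cancel_left₀ hc]
  · rw [equiv_smul, map_sum, smul_comm]
    congr 1
    have h := sum_range_succ_eq_of_periodic (c := rotOrder M)
      (g := fun j => ((ω⁻¹) ^ j) • (rot M ^ j) z) (by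
        have : ω⁻¹ ^ rotOrder M = 1 := by rw [inv_pow, hωc, inv_one]
        rw [rot_pow_rotOrder, pow_zero, this, pow_zero])
    rw [← h, Finset.smul_sum]
    refine sum_congr rfl fun j _ => ?_
    rw [equiv_smul, smul_smul]
    rw [pow_succ' (rot M), AlgEquiv.mul_apply, pow_succ', mul_inv_cancel_left₀ hω]

namespace IsEigenParam

variable {W : RatXY}

lemma phi_mem (sp : IsDominantSaddle M x0 y0) (hW : IsEigenParam M x0 y0 W) :
    phi M W ∈ vanish (basePt x0 y0) 1 := (fixesPt_phi sp).map_vanish hW.mem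

lemma grad_phi_zero (sp : IsDominantSaddle M x0 y0) (hW : IsEigenParam M x0 y0 W) :
    grad (basePt x0 y0) (phi M W) 0 = root' M x0 y0 := by
  rw [grad_phi sp (isReg_of_mem_vanish hW.mem), hW.grad_zero, hW.grad_one]
  ring

lemma grad_phi_one (sp : IsDominantSaddle M x0 y0) (hW : IsEigenParam M x0 y0 W) :
    grad (basePt x0 y0) (phi M W) 1 = -1 := by
  rw [(isReflection_phi sp).grad_snd (isReg_of_mem_vanish hW.mem), hW.grad_one]

lemma rot_pow (hW : IsEigenParam M x0 y0 W) (n : ℕ) :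
    (rot M ^ n) W = rotEigen M x0 y0 ^ n • W := by
  induction n with
  | zero => simp
  | succ n ih => rw [pow_succ, AlgEquiv.mul_apply, hW.rot_eq, equiv_smul, ih, smul_smul, pow_succ']

lemma rot_phi (sp : IsDominantSaddle M x0 y0) (hW : IsEigenParam M x0 y0 W) :
    rot M (phi M W) = (rotEigen M x0 y0)⁻¹ • phi M W := by
  have hω := rotEigen_ne_zero sp
  have h : rot M * phi M * rot M = phi M := by
    have h1 := phi_mul_rot_pow M 1
    rw [pow_one, pow_one] at h1
    rw [mul_assoc, h1, mul_inv_cancel_left]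
  have h2 := DFunLike.congr_fun h W
  rw [AlgEquiv.mul_apply, AlgEquiv.mul_apply, hW.rot_eq, equiv_smul, equiv_smul] at h2
  rw [← h2, smul_smul, inv_mul_cancel₀ hω, one_smul, h2]

lemma rot_pow_phi (sp : IsDominantSaddle M x0 y0) (hW : IsEigenParam M x0 y0 W) (n : ℕ) :
    (rot M ^ n) (phi M W) = (rotEigen M x0 y0)⁻¹ ^ n • phi M W := by
  induction n with
  | zero => simp
  | succ n ih => rw [pow_succ, AlgEquiv.mul_apply, hW.rot_phi sp, equiv_smul, ih, smul_smul, pow_succ']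

lemma exists_div (sp : IsDominantSaddle M x0 y0) (hW : IsEigenParam M x0 y0 W) {k : ℕ} {f : RatXY}
    (hf : f ∈ vanish (basePt x0 y0) (k + 1)) :
    ∃ f₀ ∈ vanish (basePt x0 y0) k, ∃ f₁ ∈ vanish (basePt x0 y0) k,
      f = f₀ * W + f₁ * phi M W := by
  refine exists_div_of_mem_vanish hW.mem (hW.phi_mem sp) ?_ hf
  rw [hW.grad_zero, hW.grad_one, hW.grad_phi_zero sp, hW.grad_phi_one sp]
  intro h
  exact root_ne_root' sp (by linear_combination h)

/-- The eigenvalue of the rotation is a primitive root of unity. -/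
lemma isPrimitiveRoot [Finite (modelGroup M)] (sp : IsDominantSaddle M x0 y0)
    (hW : IsEigenParam M x0 y0 W) : IsPrimitiveRoot (rotEigen M x0 y0) (rotOrder M) := by
  refine ⟨grad_eq_of_rot_pow_eq_one sp (rot_pow_rotOrder M), fun d hd => ?_⟩
  apply orderOf_dvd_of_pow_eq_one
  set T := rot M ^ d with hT
  have hT1 : T W = W := by rw [hT, hW.rot_pow, hd, one_smul]
  have hT2 : T (phi M W) = phi M W := by rw [hT, hW.rot_pow_phi sp, inv_pow, hd, inv_one, one_smul]
  have hTf : FixesPt (basePt x0 y0) T := (fixesPt_rot sp).pow d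
  have hTc : T ^ rotOrder M = 1 := by
    rw [hT, ← pow_mul, mul_comm, pow_mul, rot_pow_rotOrder, one_pow]
  have h1 : ∀ k : ℕ, ∀ f ∈ vanish (basePt x0 y0) k, T f - f ∈ vanish (basePt x0 y0) (k + 1) := by
    intro k
    induction k with
    | zero =>
      intro f hf
      have hf' := mem_vanish_zero.1 hf
      have h2 := hTf f hf'
      rw [zero_add, mem_vanish_one (h2.1.sub hf'), ratEval_sub h2.1 hf', h2.2, sub_self]
    | succ k ih =>
      intro f hf
      obtain ⟨f₀, h3, f₁, h4, rfl⟩ := hW.exists_div sp hf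
      rw [map_add, map_mul, map_mul, hT1, hT2]
      have : T f₀ * W + T f₁ * phi M W - (f₀ * W + f₁ * phi M W) =
        (T f₀ - f₀) * W + (T f₁ - f₁) * phi M W := by ring
      rw [this]
      exact add_mem (mul_mem_vanish (ih _ h3) hW.mem) (mul_mem_vanish (ih _ h4) (hW.phi_mem sp))
  have h2 : ∀ f, IsReg (basePt x0 y0) f → T f = f := by
    intro f hf
    rw [← sub_eq_zero]
    refine eq_zero_of_forall_mem_vanish (b := basePt x0 y0) fun k => ?_
    induction k with
    | zero => exact mem_vanish_zero.2 ((hTf f hf).1.sub hf)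
    | succ k ih =>
      have h3 : ∀ n : ℕ, (T ^ n) f - f - (n : ℂ) • (T f - f) ∈ vanish (basePt x0 y0) (k + 1) := by
        intro n
        induction n with
        | zero => simp
        | succ n ihn =>
          have h4 : (T ^ (n + 1)) f - f - ((n + 1 : ℕ) : ℂ) • (T f - f) =
              T ((T ^ n) f - f - (n : ℂ) • (T f - f)) + (n : ℂ) • (T (T f - f) - (T f - f)) := by
            rw [pow_succ', AlgEquiv.mul_apply, map_sub, map_sub, equiv_smul]
            rw [map_sub T (T f) f]
            push_cast
            module
          rw [h4]
          exact add_mem (hTf.map_vanish ihn) (smul_mem _ _ (h1 _ _ ih))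
      have h5 := h3 (rotOrder M)
      rw [hTc, AlgEquiv.one_apply, sub_self, zero_sub] at h5
      have h6 := smul_mem _ (-(rotOrder M : ℂ)⁻¹) h5
      rwa [smul_neg, neg_smul, neg_neg, smul_smul,
        inv_mul_cancel₀ (Nat.cast_ne_zero.2 (rotOrder_pos M).ne'), one_smul] at h6
  exact equiv_ext (h2 _ (isReg_varX _)) (h2 _ (isReg_varY _))

lemma rot_pow_monomial (sp : IsDominantSaddle M x0 y0) (hW : IsEigenParam M x0 y0 W) (n a b : ℕ) :
    (rot M ^ n) (W ^ a * phi M W ^ b) =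
      (rotEigen M x0 y0 ^ a * (rotEigen M x0 y0)⁻¹ ^ b) ^ n • (W ^ a * phi M W ^ b) := by
  rw [map_mul, map_pow, map_pow, hW.rot_pow, hW.rot_pow_phi sp, smul_pow, smul_pow,
    smul_mul_smul_comm]
  congr 1
  ring

lemma geom_sum_eq_zero {θ : ℂ} {c : ℕ} (h : θ ^ c = 1) (h1 : θ ≠ 1) :
    ∑ j ∈ range c, θ ^ j = 0 := by
  rw [geom_sum_eq h1, h, sub_self, zero_div]

lemma phi_phi (M : Model) (f : RatXY) : phi M (phi M f) = f := DFunLike.congr_fun (phi_mul_phi M) f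

lemma altSum_monomial (sp : IsDominantSaddle M x0 y0) (hW : IsEigenParam M x0 y0 W) (a b : ℕ) :
    altSum M (W ^ a * phi M W ^ b) =
      (∑ j ∈ range (rotOrder M), (rotEigen M x0 y0 ^ a * (rotEigen M x0 y0)⁻¹ ^ b) ^ j) •
        (W ^ a * phi M W ^ b) -
      (∑ j ∈ range (rotOrder M), (rotEigen M x0 y0 ^ b * (rotEigen M x0 y0)⁻¹ ^ a) ^ j) •
        (W ^ b * phi M W ^ a) := by
  have h : phi M (W ^ a * phi M W ^ b) = W ^ b * phi M W ^ a := by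
    rw [map_mul, map_pow, map_pow, phi_phi, mul_comm]
  rw [altSum_apply, Finset.sum_sub_distrib, h, sum_smul, sum_smul]
  simp only [hW.rot_pow_monomial sp]

lemma altSum_monomial_eq_zero [Finite (modelGroup M)] (sp : IsDominantSaddle M x0 y0)
    (hW : IsEigenParam M x0 y0 W) {a b : ℕ} (hab : a + b < rotOrder M) :
    altSum M (W ^ a * phi M W ^ b) = 0 := by
  have hp := hW.isPrimitiveRoot sp
  have hω := rotEigen_ne_zero sp
  rcases eq_or_ne a b with rfl | hne
  · rw [hW.altSum_monomial sp, sub_self]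
  · have key : ∀ a b : ℕ, a + b < rotOrder M → a ≠ b →
        ∑ j ∈ range (rotOrder M),
          (rotEigen M x0 y0 ^ a * (rotEigen M x0 y0)⁻¹ ^ b) ^ j = 0 := by
      intro a b hab hne
      apply geom_sum_eq_zero
      · rw [mul_pow, ← pow_mul, ← pow_mul, mul_comm a, mul_comm b, pow_mul, pow_mul, inv_pow,
          hp.pow_eq_one, inv_one, one_pow, one_pow, one_mul]
      · rw [inv_pow, ← div_eq_mul_inv, Ne, div_eq_one_iff_eq (pow_ne_zero _ hω)]
        intro h
        exact hne (hp.pow_inj (by omega) (by omega) h)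
    rw [hW.altSum_monomial sp, key a b hab hne, key b a (by omega) hne.symm, zero_smul, zero_smul,
      sub_self]

lemma altSum_monomial_add [Finite (modelGroup M)] (sp : IsDominantSaddle M x0 y0)
    (hW : IsEigenParam M x0 y0 W) (b : ℕ) :
    altSum M (W ^ (rotOrder M + b) * phi M W ^ b) = (rotOrder M : ℂ) •
      (W ^ (rotOrder M + b) * phi M W ^ b - W ^ b * phi M W ^ (rotOrder M + b)) := by
  have hp := hW.isPrimitiveRoot sp
  have hω := rotEigen_ne_zero sp
  have h1 : rotEigen M x0 y0 ^ (rotOrder M + b) * (rotEigen M x0 y0)⁻¹ ^ b = 1 := by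
    rw [pow_add, hp.pow_eq_one, one_mul, ← mul_pow, mul_inv_cancel₀ hω, one_pow]
  have h2 : rotEigen M x0 y0 ^ b * (rotEigen M x0 y0)⁻¹ ^ (rotOrder M + b) = 1 := by
    rw [pow_add, inv_pow, hp.pow_eq_one, inv_one, one_mul, ← mul_pow, mul_inv_cancel₀ hω, one_pow]
  rw [hW.altSum_monomial sp, h1, h2]
  simp [smul_sub]

end IsEigenParam

/-- The alternating sum of a regular function vanishes at the saddle point to the order of the
rotation. -/
lemma altSum_mem_vanish_rotOrder [Finite (modelGroup M)] (sp : IsDominantSaddle M x0 y0) {f : RatXY}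
    (hf : IsReg (basePt x0 y0) f) : altSum M f ∈ vanish (basePt x0 y0) (rotOrder M) := by
  obtain ⟨W, hW⟩ := exists_isEigenParam sp
  have key : ∀ k a b : ℕ, a + b + k = rotOrder M → ∀ f, IsReg (basePt x0 y0) f →
      altSum M (W ^ a * phi M W ^ b * f) ∈ vanish (basePt x0 y0) (rotOrder M) := by
    intro k
    induction k with
    | zero =>
      intro a b hab f hf
      apply altSum_mem_vanish sp
      rw [← hab, add_zero]
      have h1 := pow_mem_vanish hW.mem a
      have h2 := pow_mem_vanish (hW.phi_mem sp) b
      rw [mul_one] at h1 h2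
      exact mul_mem_vanish_left (mul_mem_vanish h1 h2) hf
    | succ k ih =>
      intro a b hab f hf
      obtain ⟨f₀, h3, f₁, h4, h5⟩ := hW.exists_div (k := 0) sp (sub_ratEval_mem hf)
      have h6 : W ^ a * phi M W ^ b * f =
          ratEval (basePt x0 y0) f • (W ^ a * phi M W ^ b) +
          W ^ (a + 1) * phi M W ^ b * f₀ + W ^ a * phi M W ^ (b + 1) * f₁ := by
        rw [Algebra.smul_def]
        linear_combination (W ^ a * phi M W ^ b) * h5
      rw [h6, map_add, map_add, map_smul, hW.altSum_monomial_eq_zero sp (by omega), smul_zero,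
        zero_add]
      exact add_mem (ih _ _ (by omega) _ (mem_vanish_zero.1 h3))
        (ih _ _ (by omega) _ (mem_vanish_zero.1 h4))
  have := key (rotOrder M) 0 0 (by omega) f hf
  simpa using this

end

section

open Submodule (smul_mem)
variable {M : Model} {x0 y0 : ℝ}

/-! ### Functionals given by the coefficients of a Gaussian integral -/

/-- The linear functionals that satisfy the relations between the coefficients of the asymptotic
expansion, in powers of `1 / n`, of the integrals of `s ^ n f` near the saddle point. -/
structure GaussFunctional (M : Model) (x0 y0 : ℝ) where
  toFun : ℕ → RatXY →ₗ[ℂ] ℂ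
  zero : ∀ f, IsReg (basePt x0 y0) f → toFun 0 f = 0
  euler : ∀ p i f, IsReg (basePt x0 y0) f →
    toFun p (euler i f) = -toFun (p + 1) (f * logStep M x0 y0 i)
  one_ne_zero : toFun 1 1 ≠ 0
  real : ∀ p f, IsReg (basePt x0 y0) f → conjHom f = f → (toFun p f).im = 0

namespace GaussFunctional

variable (L : GaussFunctional M x0 y0)
include L

lemma apply_mul_logStep (p : ℕ) (i : Fin 2) {f : RatXY} (hf : IsReg (basePt x0 y0) f) :
    L.toFun (p + 1) (f * logStep M x0 y0 i) = -L.toFun p (QuadrantWalk.euler i f) := by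
  rw [L.euler p i f hf, neg_neg]

lemma eq_zero_of_mem (sp : IsDominantSaddle M x0 y0) (p : ℕ) {f : RatXY}
    (hf : f ∈ vanish (basePt x0 y0) (2 * p - 1)) : L.toFun p f = 0 := by
  induction p generalizing f with
  | zero => exact L.zero f (mem_vanish_zero.1 hf)
  | succ p ih =>
    obtain ⟨f₀, h1, f₁, h2, rfl⟩ := exists_div_logStep sp (k := 2 * p) hf
    have key : ∀ i, ∀ g ∈ vanish (basePt x0 y0) (2 * p),
        L.toFun (p + 1) (g * logStep M x0 y0 i) = 0 := by
      intro i g hg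
      rw [L.apply_mul_logStep p i (isReg_of_mem_vanish hg), ih, neg_zero]
      rcases p with _ | p
      · exact mem_vanish_zero.2 (isReg_euler (isReg_of_mem_vanish hg) i)
      · exact euler_mem_vanish hg i
    rw [map_add, key 0 _ h1, key 1 _ h2, add_zero]

lemma map_reflection (sp : IsDominantSaddle M x0 y0) {σ : RatXY ≃ₐ[ℂ] RatXY} {i j : Fin 2}
    {τ : RatXY} (h : IsReflection M x0 y0 σ i j τ) (p : ℕ) {f : RatXY}
    (hf : IsReg (basePt x0 y0) f) : L.toFun p (σ f) = L.toFun p f := by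
  induction p generalizing f with
  | zero => rw [L.zero _ hf, L.zero _ (h.fixes f hf).1]
  | succ p ih =>
    have hi : ∀ g, IsReg (basePt x0 y0) g →
        L.toFun (p + 1) (σ (g * logStep M x0 y0 i)) = L.toFun (p + 1) (g * logStep M x0 y0 i) := by
      intro g hg
      have hσ := (h.fixes g hg).1
      have e1 : QuadrantWalk.euler i (σ g) + QuadrantWalk.euler j (τ * σ g) =
          σ (QuadrantWalk.euler i g) := by
        rw [Derivation.leibniz, h.euler_shift, h.euler_snd, h.euler_fst, smul_eq_mul, smul_eq_mul]
        ring
      rw [map_mul, h.map_logStep_fst, mul_add, map_add,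
        show σ g * (τ * logStep M x0 y0 j) = (τ * σ g) * logStep M x0 y0 j by ring,
        L.apply_mul_logStep p i hσ, L.apply_mul_logStep p j (h.regular.mul hσ), ← neg_add, ← map_add,
        e1, ih (isReg_euler hg i), L.apply_mul_logStep p i hg]
    have hj : ∀ g, IsReg (basePt x0 y0) g →
        L.toFun (p + 1) (σ (g * logStep M x0 y0 j)) = L.toFun (p + 1) (g * logStep M x0 y0 j) := by
      intro g hg
      have hσ := (h.fixes g hg).1
      rw [map_mul, h.map_logStep_snd, mul_neg, map_neg, L.apply_mul_logStep p j hσ, h.euler_snd,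
        map_neg, neg_neg, ih (isReg_euler hg j), L.apply_mul_logStep p j hg]
    have hall : ∀ m g, IsReg (basePt x0 y0) g →
        L.toFun (p + 1) (σ (g * logStep M x0 y0 m)) = L.toFun (p + 1) (g * logStep M x0 y0 m) := by
      intro m g hg
      have hm : m = i ∨ m = j := by
        have := h.ne
        omega
      rcases hm with rfl | rfl
      · exact hi g hg
      · exact hj g hg
    obtain ⟨f₀, h3, f₁, h4, h5⟩ := exists_div_logStep sp (k := 0) (sub_ratEval_mem hf)
    have h6 : f = algebraMap ℂ RatXY (ratEval (basePt x0 y0) f) +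
        (f₀ * logStep M x0 y0 0 + f₁ * logStep M x0 y0 1) := by rw [← h5]; ring
    rw [h6, map_add, map_add, AlgEquiv.commutes, map_add, map_add, map_add, map_add,
      hall 0 _ (mem_vanish_zero.1 h3), hall 1 _ (mem_vanish_zero.1 h4)]

lemma map_phi (sp : IsDominantSaddle M x0 y0) (p : ℕ) {f : RatXY}
    (hf : IsReg (basePt x0 y0) f) : L.toFun p (phi M f) = L.toFun p f :=
  L.map_reflection sp (isReflection_phi sp) p hf

lemma map_rot (sp : IsDominantSaddle M x0 y0) (p : ℕ) {f : RatXY}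
    (hf : IsReg (basePt x0 y0) f) : L.toFun p (rot M f) = L.toFun p f := by
  rw [rot, AlgEquiv.mul_apply, L.map_phi sp p (fixesPt_psi sp f hf).1,
    L.map_reflection sp (isReflection_psi sp) p hf]

lemma map_rot_pow (sp : IsDominantSaddle M x0 y0) (p n : ℕ) {f : RatXY}
    (hf : IsReg (basePt x0 y0) f) : L.toFun p ((rot M ^ n) f) = L.toFun p f := by
  induction n with
  | zero => rfl
  | succ n ih =>
    rw [pow_succ', AlgEquiv.mul_apply, L.map_rot sp p (((fixesPt_rot sp).pow n) f hf).1, ih]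

omit L in
lemma rot_pow_altSum (n : ℕ) (f : RatXY) : (rot M ^ n) (altSum M f) = altSum M f := by
  induction n with
  | zero => rfl
  | succ n ih => rw [pow_succ', AlgEquiv.mul_apply, ih, rot_altSum]

/-- Antisymmetrization of the second factor next to an antisymmetric one. -/
lemma apply_altSum_mul_altSum (sp : IsDominantSaddle M x0 y0) (p : ℕ) {f g : RatXY}
    (hf : IsReg (basePt x0 y0) f) (hg : IsReg (basePt x0 y0) g) :
    L.toFun p (altSum M f * altSum M g) = 2 * rotOrder M * L.toFun p (altSum M f * g) := by
  have ha : IsReg (basePt x0 y0) (altSum M f) :=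
    mem_vanish_zero.1 (altSum_mem_vanish sp (mem_vanish_zero.2 hf))
  have hag := ha.mul hg
  have h1 : ∀ j : ℕ, altSum M f * ((rot M ^ j) g - (rot M ^ j) (phi M g)) =
      (rot M ^ j) (altSum M f * g) + (rot M ^ j) (phi M (altSum M f * g)) := by
    intro j
    rw [map_mul (phi M), phi_altSum, map_mul, map_mul, map_neg, rot_pow_altSum]
    ring
  rw [altSum_apply M g, Finset.mul_sum, map_sum]
  have h2 : ∀ j ∈ Finset.range (rotOrder M),
      L.toFun p (altSum M f * ((rot M ^ j) g - (rot M ^ j) (phi M g))) =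
        2 * L.toFun p (altSum M f * g) := by
    intro j _
    rw [h1, map_add, L.map_rot_pow sp p j hag,
      L.map_rot_pow sp p j (fixesPt_phi sp _ hag).1, L.map_phi sp p hag]
    ring
  rw [Finset.sum_congr rfl h2, Finset.sum_const, Finset.card_range, nsmul_eq_mul]
  ring

variable {W : RatXY}

lemma apply_mul_phi (sp : IsDominantSaddle M x0 y0) (hW : IsEigenParam M x0 y0 W) (p : ℕ)
    {f : RatXY} (hf : f ∈ vanish (basePt x0 y0) (2 * p - 1)) :
    covar M x0 y0 1 1 * L.toFun (p + 1) (f * phi M W) =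
      2 / (root' M x0 y0 - root M x0 y0) * (L.toFun p (QuadrantWalk.euler 0 f) +
        root' M x0 y0 * L.toFun p (QuadrantWalk.euler 1 f)) := by
  have hD := covar_one_ne sp
  have hne : root' M x0 y0 - root M x0 y0 ≠ 0 := sub_ne_zero.2 (root_ne_root' sp).symm
  have hfr := isReg_of_mem_vanish hf
  have hψ := fun i => logStep_mem sp i
  have hψr := fun i => isReg_of_mem_vanish (hψ i)
  have hPr := isReg_of_mem_vanish (hW.phi_mem sp)
  have hm : logStep M x0 y0 0 + root' M x0 y0 • logStep M x0 y0 1 -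
      (covar M x0 y0 1 1 * (root M x0 y0 - root' M x0 y0) / 2) • phi M W ∈
        vanish (basePt x0 y0) 2 := by
    have hmem : logStep M x0 y0 0 + root' M x0 y0 • logStep M x0 y0 1 -
      (covar M x0 y0 1 1 * (root M x0 y0 - root' M x0 y0) / 2) • phi M W ∈
        vanish (basePt x0 y0) 1 :=
      sub_mem (add_mem (hψ 0) (smul_mem _ _ (hψ 1)))
        (smul_mem _ _ (hW.phi_mem sp))
    rw [mem_vanish_two sp.basePt_ne hmem]
    intro i
    rw [sub_eq_add_neg, ← neg_smul, grad_add ((hψr 0).add ((hψr 1).smul _)) (hPr.smul _),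
      grad_add (hψr 0) ((hψr 1).smul _), grad_smul (hψr 1), grad_smul hPr, grad_logStep sp,
      grad_logStep sp]
    have ha := root_add sp
    have hb := root_mul sp
    fin_cases i
    · change (covar M x0 y0 0 0 : ℂ) + root' M x0 y0 * covar M x0 y0 1 0 +
        -_ * grad (basePt x0 y0) (phi M W) 0 = 0
      rw [hW.grad_phi_zero sp, covar_symm M x0 y0 1 0]
      linear_combination -hb + root' M x0 y0 / 2 * ha
    · change (covar M x0 y0 0 1 : ℂ) + root' M x0 y0 * covar M x0 y0 1 1 +
        -_ * grad (basePt x0 y0) (phi M W) 1 = 0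
      rw [hW.grad_phi_one sp]
      linear_combination (1 / 2 : ℂ) * ha
  have hz : L.toFun (p + 1) (f * (logStep M x0 y0 0 + root' M x0 y0 • logStep M x0 y0 1 -
      (covar M x0 y0 1 1 * (root M x0 y0 - root' M x0 y0) / 2) • phi M W)) = 0 :=
    L.eq_zero_of_mem sp (p + 1) (vanish_le (by omega) (mul_mem_vanish hf hm))
  rw [mul_sub, mul_add, mul_smul_comm, mul_smul_comm, map_sub, map_add, map_smul, map_smul,
    L.apply_mul_logStep p 0 hfr, L.apply_mul_logStep p 1 hfr, smul_eq_mul, smul_eq_mul] at hz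
  field_simp
  linear_combination (2 : ℂ) * hz

lemma apply_monomial_succ (sp : IsDominantSaddle M x0 y0) (hW : IsEigenParam M x0 y0 W)
    {p a b : ℕ} (hab : a + b + 1 = 2 * p) :
    covar M x0 y0 1 1 * L.toFun (p + 1) (W ^ a * phi M W ^ (b + 1)) =
      2 * a * L.toFun p (W ^ (a - 1) * phi M W ^ b) := by
  have hne : root' M x0 y0 - root M x0 y0 ≠ 0 := sub_ne_zero.2 (root_ne_root' sp).symm
  have hWr := isReg_of_mem_vanish hW.mem
  have hPr := isReg_of_mem_vanish (hW.phi_mem sp)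
  have hmon : ∀ a b : ℕ, W ^ a * phi M W ^ b ∈ vanish (basePt x0 y0) (a + b) := by
    intro a b
    have h1 := pow_mem_vanish hW.mem a
    have h2 := pow_mem_vanish (hW.phi_mem sp) b
    rw [mul_one] at h1 h2
    exact mul_mem_vanish h1 h2
  have h1 := L.apply_mul_phi sp hW p (f := W ^ a * phi M W ^ b)
    (vanish_le (by omega) (hmon a b))
  rw [pow_succ, ← mul_assoc, h1, ← smul_eq_mul (root' M x0 y0), ← map_smul, ← map_add]
  have hd : ∀ {V : RatXY} (_ : IsReg (basePt x0 y0) V) (v : ℂ),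
      grad (basePt x0 y0) V 0 + root' M x0 y0 * grad (basePt x0 y0) V 1 = v →
      QuadrantWalk.euler 0 V + root' M x0 y0 • QuadrantWalk.euler 1 V - algebraMap ℂ RatXY v ∈
        vanish (basePt x0 y0) 1 := by
    intro V hV v hv
    have h3 := isReg_euler hV 0
    have h4 := (isReg_euler hV 1).smul (root' M x0 y0)
    have h5 := isReg_algebraMap (basePt x0 y0) v
    rw [mem_vanish_one ((h3.add h4).sub h5), ratEval_sub (h3.add h4) h5, ratEval_add h3 h4,
      ratEval_smul (isReg_euler hV 1), ratEval_algebraMap, ← hv, grad, grad, sub_self]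
  have hd1 := hd hWr (root' M x0 y0 - root M x0 y0) (by rw [hW.grad_zero, hW.grad_one]; ring)
  have hd2 := hd hPr 0 (by rw [hW.grad_phi_zero sp, hW.grad_phi_one sp]; ring)
  have key : QuadrantWalk.euler 0 (W ^ a * phi M W ^ b) +
      root' M x0 y0 • QuadrantWalk.euler 1 (W ^ a * phi M W ^ b) -
      ((root' M x0 y0 - root M x0 y0) * a) • (W ^ (a - 1) * phi M W ^ b) ∈
        vanish (basePt x0 y0) (2 * p - 1) := by
    have e : QuadrantWalk.euler 0 (W ^ a * phi M W ^ b) +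
      root' M x0 y0 • QuadrantWalk.euler 1 (W ^ a * phi M W ^ b) -
      ((root' M x0 y0 - root M x0 y0) * a) • (W ^ (a - 1) * phi M W ^ b) =
      (a : ℂ) • ((W ^ (a - 1) * phi M W ^ b) * (QuadrantWalk.euler 0 W +
        root' M x0 y0 • QuadrantWalk.euler 1 W - algebraMap ℂ RatXY (root' M x0 y0 - root M x0 y0))) +
      (b : ℂ) • ((W ^ a * phi M W ^ (b - 1)) * (QuadrantWalk.euler 0 (phi M W) +
        root' M x0 y0 • QuadrantWalk.euler 1 (phi M W) - algebraMap ℂ RatXY 0)) := by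
      simp only [Derivation.leibniz, Derivation.leibniz_pow, smul_eq_mul, nsmul_eq_mul,
        Algebra.smul_def, map_mul, map_sub, map_natCast, map_zero]
      ring
    rw [e]
    refine add_mem ?_ ?_
    · rcases a with _ | a
      · simp
      · refine smul_mem _ _ (vanish_le ?_ (mul_mem_vanish (hmon _ _) hd1))
        omega
    · rcases b with _ | b
      · simp
      · refine smul_mem _ _ (vanish_le ?_ (mul_mem_vanish (hmon _ _) hd2))
        omega
  have h2 := L.eq_zero_of_mem sp p key
  rw [map_sub, map_smul, smul_eq_mul, sub_eq_zero] at h2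
  rw [h2]
  field_simp

lemma apply_monomial_eq_zero (sp : IsDominantSaddle M x0 y0) (hW : IsEigenParam M x0 y0 W)
    {p a b : ℕ} (hab : a + b = 2 * p) (hne : a ≠ b) :
    L.toFun (p + 1) (W ^ a * phi M W ^ b) = 0 := by
  have hD := covar_one_ne sp
  have key : ∀ p a b : ℕ, a + b = 2 * p → a < b → L.toFun (p + 1) (W ^ a * phi M W ^ b) = 0 := by
    intro p
    induction p with
    | zero => intro a b h1 h2; omega
    | succ p ih =>
      intro a b h1 h2
      obtain ⟨b, rfl⟩ : ∃ b', b = b' + 1 := ⟨b - 1, by omega⟩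
      apply (mul_eq_zero.1 ?_).resolve_left hD
      rw [L.apply_monomial_succ sp hW (by omega)]
      rcases a with _ | a
      · simp
      · rw [Nat.add_sub_cancel, ih a b (by omega) (by omega), mul_zero]
  rcases lt_or_gt_of_ne hne with h | h
  · exact key p a b hab h
  · have hr : IsReg (basePt x0 y0) (W ^ a * phi M W ^ b) :=
      ((isReg_of_mem_vanish hW.mem).pow a).mul
        ((isReg_of_mem_vanish (hW.phi_mem sp)).pow b)
    rw [← L.map_phi sp _ hr, map_mul, map_pow, map_pow, IsEigenParam.phi_phi, mul_comm]
    exact key p b a (by omega) h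

lemma apply_diagonal_ne_zero (sp : IsDominantSaddle M x0 y0) (hW : IsEigenParam M x0 y0 W)
    (p : ℕ) : L.toFun (p + 1) (W ^ p * phi M W ^ p) ≠ 0 := by
  induction p with
  | zero => simpa using L.one_ne_zero
  | succ p ih =>
    intro h
    have h1 := L.apply_monomial_succ sp hW (p := p + 1) (a := p + 1) (b := p) (by omega)
    rw [h, mul_zero, Nat.add_sub_cancel] at h1
    have h2 : (2 * ((p + 1 : ℕ) : ℂ)) ≠ 0 :=
      mul_ne_zero two_ne_zero (Nat.cast_ne_zero.2 p.succ_ne_zero)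
    exact mul_ne_zero h2 ih h1.symm

/-- The value of the functional that controls the degree of the coefficients of the expansion. -/
lemma apply_altSum_ne_zero [Finite (modelGroup M)] (sp : IsDominantSaddle M x0 y0)
    (hW : IsEigenParam M x0 y0 W) (b : ℕ) :
    L.toFun (rotOrder M + b + 1) (altSum M (W ^ rotOrder M) *
      altSum M (W ^ (rotOrder M + b) * phi M W ^ b)) ≠ 0 := by
  have hc := rotOrder_pos M
  have h1 := hW.altSum_monomial_add sp 0
  rw [add_zero, pow_zero, pow_zero, mul_one, one_mul] at h1
  have e : altSum M (W ^ rotOrder M) * altSum M (W ^ (rotOrder M + b) * phi M W ^ b) =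
      ((rotOrder M : ℂ) ^ 2) • (W ^ (2 * rotOrder M + b) * phi M W ^ b +
        W ^ b * phi M W ^ (2 * rotOrder M + b)) -
      (2 * (rotOrder M : ℂ) ^ 2) • (W ^ (rotOrder M + b) * phi M W ^ (rotOrder M + b)) := by
    rw [h1, hW.altSum_monomial_add sp b]
    simp only [Algebra.smul_def, map_mul, map_pow, map_ofNat]
    ring
  rw [e, map_sub, map_smul, map_smul, map_add,
    L.apply_monomial_eq_zero sp hW (p := rotOrder M + b) (by omega) (by omega),
    L.apply_monomial_eq_zero sp hW (p := rotOrder M + b) (by omega) (by omega), add_zero, smul_zero,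
    zero_sub, neg_ne_zero, smul_eq_mul]
  have hc' : (rotOrder M : ℂ) ≠ 0 := Nat.cast_ne_zero.2 hc.ne'
  exact mul_ne_zero (mul_ne_zero two_ne_zero (pow_ne_zero _ hc'))
    (L.apply_diagonal_ne_zero sp hW _)

end GaussFunctional

end

section

open Fin (init last)
open Finset (Icc mem_Icc mem_coe mem_product mem_range mul_sum range sum_congr sum_eq_zero
  sum_filter sum_subset)
open Fintype (mem_piFinset)
variable {M : Model} {x0 y0 : ℝ}

/-! ### Counting walks -/

lemma position_castSucc (A : ℤ × ℤ) {n : ℕ} (σ : Fin (n + 1) → ℤ × ℤ) {i : ℕ} (hi : i ≤ n) :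
    position A σ i = position A (init σ) i := by
  rw [position, position, sum_filter, sum_filter, Fin.sum_univ_castSucc]
  have h : ¬ (last n).val < i := by simp; omega
  rw [if_neg h, add_zero]
  rfl

lemma position_last (A : ℤ × ℤ) {n : ℕ} (σ : Fin (n + 1) → ℤ × ℤ) :
    position A σ (n + 1) = position A (init σ) n + σ (last n) := by
  rw [position, position, sum_filter, sum_filter, Fin.sum_univ_castSucc, add_assoc]
  have h : (last n).val < n + 1 := by simp
  rw [if_pos h]
  congr 2
  refine sum_congr rfl fun j _ => ?_
  have h1 : j.castSucc.val < n + 1 := by simp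
  rw [if_pos h1, if_pos j.2]
  rfl

lemma walks_of_not_inQuadrant (M : Model) (A : ℤ × ℤ) {B : ℤ × ℤ} (hB : ¬ InQuadrant B) (n : ℕ) :
    walks M A B n = 0 := by
  rw [walks]
  refine sum_eq_zero fun σ hσ => ?_
  rw [Finset.mem_filter] at hσ
  exact absurd (hσ.2.2 ▸ hσ.2.1 n le_rfl) hB

lemma walks_zero (M : Model) {A : ℤ × ℤ} (hA : InQuadrant A) (B : ℤ × ℤ) :
    walks M A B 0 = if A = B then 1 else 0 := by
  classical
  have hp : ∀ (σ : Fin 0 → ℤ × ℤ) (i : ℕ), position A σ i = A := by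
    intro σ i
    simp [position]
  rw [walks, sum_filter]
  simp only [hp, Finset.univ_eq_empty, Finset.prod_empty]
  simp [hA]

lemma walks_succ (M : Model) (A : ℤ × ℤ) {B : ℤ × ℤ} (hB : InQuadrant B) (n : ℕ) :
    walks M A B (n + 1) = ∑ s ∈ stepBox, M.weight s * walks M A (B - s) n := by
  classical
  simp only [walks, sum_filter, mul_sum]
  rw [← Finset.sum_product' stepBox]
  refine Finset.sum_nbij' (fun σ => (σ (last n), init σ)) (fun p => Fin.snoc p.2 p.1)
    ?_ ?_ ?_ ?_ ?_
  · intro σ hσ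
    rw [mem_piFinset] at hσ
    rw [mem_product, mem_piFinset]
    exact ⟨hσ _, fun j => hσ _⟩
  · intro p hp
    rw [mem_product, mem_piFinset] at hp
    rw [mem_piFinset]
    intro j
    refine Fin.lastCases ?_ (fun i => ?_) j
    · rw [Fin.snoc_last]; exact hp.1
    · rw [Fin.snoc_castSucc]; exact hp.2 i
  · intro σ _
    exact Fin.snoc_init_self σ
  · intro p _
    simp
  · intro σ _
    have h1 : ((∀ i ≤ n + 1, InQuadrant (position A σ i)) ∧ position A σ (n + 1) = B) ↔
        ((∀ i ≤ n, InQuadrant (position A (init σ) i)) ∧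
          position A (init σ) n = B - σ (last n)) := by
      rw [position_last, eq_sub_iff_add_eq]
      refine and_congr_left fun h2 => ⟨fun h3 i hi => ?_, fun h3 i hi => ?_⟩
      · rw [← position_castSucc A σ hi]
        exact h3 i (by omega)
      · rcases Nat.lt_or_ge n i with h4 | h4
        · obtain rfl : i = n + 1 := by omega
          rw [position_last, h2]
          exact hB
        · rw [position_castSucc A σ h4]
          exact h3 i h4
    by_cases h : ((∀ i ≤ n, InQuadrant (position A (init σ) i)) ∧
          position A (init σ) n = B - σ (last n))
    · rw [if_pos (h1.2 h), if_pos h, Fin.prod_univ_castSucc, mul_comm]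
      rfl
    · rw [if_neg (fun h2 => h (h1.1 h2)), if_neg h, mul_zero]

lemma walks_eq_zero (M : Model) {A : ℤ × ℤ} (hA : InQuadrant A) (n : ℕ) {B : ℤ × ℤ}
    (hB : A.1 + n < B.1 ∨ A.2 + n < B.2) : walks M A B n = 0 := by
  induction n generalizing B with
  | zero =>
    rw [walks_zero M hA, if_neg]
    rintro rfl
    simp at hB
  | succ n ih =>
    by_cases h : InQuadrant B
    · rw [walks_succ M A h]
      refine sum_eq_zero fun s hs => ?_
      rw [mem_stepBox] at hs
      rw [ih, mul_zero]
      rw [Prod.fst_sub, Prod.snd_sub]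
      push_cast at hB
      omega
    · exact walks_of_not_inQuadrant M A h _

/-- The Laurent monomial `x ^ (k + 1) y ^ (l + 1)`. -/
def shiftMono (B : ℤ × ℤ) : RatXY := varX ^ (B.1 + 1) * varY ^ (B.2 + 1)

lemma shiftMono_mul (B s : ℤ × ℤ) : varX ^ s.1 * varY ^ s.2 * shiftMono B = shiftMono (B + s) := by
  rw [shiftMono, shiftMono, Prod.fst_add, Prod.snd_add,
    show B.1 + s.1 + 1 = s.1 + (B.1 + 1) by ring, show B.2 + s.2 + 1 = s.2 + (B.2 + 1) by ring,
    zpow_add₀ varX_ne_zero s.1, zpow_add₀ varY_ne_zero s.2]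
  ring

/-- The end points of walks of length `n` from `(u, v)`. -/
def endBox (u v n : ℕ) : Finset (ℤ × ℤ) :=
  Icc 0 ((u : ℤ) + n) ×ˢ Icc 0 ((v : ℤ) + n)

lemma sum_range_eq_sum_Icc {E : Type*} [AddCommMonoid E] (n : ℕ) (f : ℤ → E) :
    ∑ k ∈ range (n + 1), f k = ∑ k ∈ Icc (0 : ℤ) n, f k := by
  refine Finset.sum_nbij (fun k => (k : ℤ)) ?_ ?_ ?_ fun _ _ => rfl
  · intro k hk
    rw [mem_range] at hk
    rw [mem_Icc]
    omega
  · intro a _ b _ h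
    exact Int.ofNat_inj.1 h
  · intro k hk
    rw [mem_coe, mem_Icc] at hk
    refine ⟨k.toNat, ?_, Int.toNat_of_nonneg hk.1⟩
    rw [mem_coe, mem_range]
    omega

lemma mul_walkGF (M : Model) (u v n : ℕ) : varX * varY * walkGF M u v n varX varY =
    ∑ B ∈ endBox u v n, (walks M (u, v) B n : ℂ) • shiftMono B := by
  have h1 : ∀ B : ℤ × ℤ, (walks M (u, v) B n : ℂ) • shiftMono B =
      varX * varY * (const (walks M (u, v) B n) * varX ^ B.1 * varY ^ B.2) := by
    intro B
    rw [shiftMono, zpow_add₀ varX_ne_zero, zpow_add₀ varY_ne_zero, Algebra.smul_def, const_eq,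
      zpow_one, zpow_one]
    ring
  rw [sum_congr rfl fun B _ => h1 B, ← mul_sum, endBox, Finset.sum_product, walkGF]
  congr 1
  have h2 := sum_range_eq_sum_Icc (u + n) (fun k : ℤ => ∑ l ∈ Icc (0 : ℤ) ((v : ℤ) + n),
    const (walks M (u, v) (k, l) n) * varX ^ k * varY ^ l)
  push_cast at h2
  rw [← h2]
  refine sum_congr rfl fun k _ => ?_
  have h3 := sum_range_eq_sum_Icc (v + n) (fun l : ℤ =>
    const (walks M (u, v) (k, l) n) * varX ^ (k : ℤ) * varY ^ l)
  push_cast at h3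
  rw [← h3]
  simp only [zpow_natCast]

lemma altSum_shiftMono_eq_zero (M : Model) {B : ℤ × ℤ} (h : B.1 = -1 ∨ B.2 = -1) :
    altSum M (shiftMono B) = 0 := by
  rcases h with h | h
  · apply altSum_eq_zero_of_psi
    rw [shiftMono, h, psi_apply, map_mul, map_zpow₀, map_zpow₀, psiHom_varY]
    norm_num
  · apply altSum_eq_zero_of_phi
    rw [shiftMono, h, phi_apply, map_mul, map_zpow₀, map_zpow₀, phiHom_varX]
    norm_num

/-- The kernel equation after summation over the group. -/
lemma altSum_walkGF_succ (M : Model) (u v n : ℕ) :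
    altSum M (varX * varY * walkGF M u v (n + 1) varX varY) =
      stepRat M * altSum M (varX * varY * walkGF M u v n varX varY) := by
  have hA : InQuadrant ((u : ℤ), (v : ℤ)) := ⟨by simp, by simp⟩
  set q : ℕ → ℤ × ℤ → ℝ := fun n B => walks M (u, v) B n with hq
  set box : Finset (ℤ × ℤ) :=
    Icc (-1) ((u : ℤ) + n + 1) ×ˢ Icc (-1) ((v : ℤ) + n + 1) with hbox
  have hsupp : ∀ B, B ∉ endBox u v n → q n B = 0 := by
    intro B hB
    by_cases h : InQuadrant B
    · apply walks_eq_zero M hA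
      obtain ⟨h1, h2⟩ := h
      rw [endBox, mem_product, mem_Icc, mem_Icc] at hB
      by_contra h3
      push Not at h3
      exact hB ⟨⟨h1, h3.1⟩, h2, h3.2⟩
    · exact walks_of_not_inQuadrant M _ h _
  have hshift : ∀ s ∈ stepBox, ∑ B ∈ endBox u v n, (q n B : ℂ) • shiftMono (B + s) =
      ∑ B ∈ box, (q n (B - s) : ℂ) • shiftMono B := by
    intro s hs
    rw [mem_stepBox] at hs
    rw [← sum_subset (s₁ := (endBox u v n).map (addRightEmbedding s)) (s₂ := box), Finset.sum_map]
    · refine sum_congr rfl fun B _ => ?_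
      simp
    · intro B hB
      rw [Finset.mem_map] at hB
      obtain ⟨B', hB', rfl⟩ := hB
      rw [endBox, mem_product, mem_Icc, mem_Icc] at hB'
      rw [hbox, mem_product, mem_Icc, mem_Icc]
      simp only [addRightEmbedding_apply, Prod.fst_add, Prod.snd_add]
      omega
    · intro B _ hB
      rw [hsupp, Complex.ofReal_zero, zero_smul]
      intro h
      apply hB
      rw [Finset.mem_map]
      exact ⟨B - s, h, by simp⟩
  have hS : stepRat M * (varX * varY * walkGF M u v n varX varY) =
      ∑ B ∈ box, (∑ s ∈ stepBox, (M.weight s : ℂ) * q n (B - s)) • shiftMono B := by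
    rw [mul_walkGF, stepRat_eq_smul, Finset.sum_mul]
    simp only [Finset.sum_smul]
    rw [Finset.sum_comm]
    refine sum_congr rfl fun s hs => ?_
    simp only [mul_smul]
    rw [← Finset.smul_sum, ← hshift s hs, smul_mul_assoc, mul_sum]
    congr 1
    refine sum_congr rfl fun B _ => ?_
    rw [mul_smul_comm, shiftMono_mul]
  rw [← altSum_mul_of_invariant M (phi_stepRat M) (psi_stepRat M), hS, mul_walkGF, map_sum, map_sum]
  have hsub : endBox u v (n + 1) ⊆ box := by
    intro B hB
    rw [endBox, mem_product, mem_Icc, mem_Icc] at hB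
    rw [hbox, mem_product, mem_Icc, mem_Icc]
    push_cast at hB
    omega
  rw [sum_subset hsub]
  · refine sum_congr rfl fun B hB => ?_
    rw [map_smul, map_smul]
    by_cases h : InQuadrant B
    · rw [walks_succ M _ h]
      push_cast
      rfl
    · rw [altSum_shiftMono_eq_zero M, smul_zero, smul_zero]
      rw [hbox, mem_product, mem_Icc, mem_Icc] at hB
      rw [InQuadrant] at h
      omega
  · intro B hB hB'
    by_cases h : InQuadrant B
    · rw [endBox, mem_product, mem_Icc, mem_Icc] at hB'
      rw [hbox, mem_product, mem_Icc, mem_Icc] at hB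
      exfalso
      apply hB'
      obtain ⟨h1, h2⟩ := h
      push_cast
      omega
    · rw [walks_of_not_inQuadrant M _ h, Complex.ofReal_zero, zero_smul, map_zero]

lemma altSum_walkGF (M : Model) (u v n : ℕ) :
    altSum M (varX * varY * walkGF M u v n varX varY) =
      stepRat M ^ n * altSum M (shiftMono (u, v)) := by
  induction n with
  | zero =>
    have hA : InQuadrant ((u : ℤ), (v : ℤ)) := ⟨by simp, by simp⟩
    rw [mul_walkGF, pow_zero, one_mul, Finset.sum_eq_single ((u : ℤ), (v : ℤ))]
    · rw [walks_zero M hA, if_pos rfl, Complex.ofReal_one, one_smul]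
    · intro B _ hB
      rw [walks_zero M hA, if_neg hB.symm, Complex.ofReal_zero, zero_smul]
    · intro h
      exfalso
      apply h
      simp [endBox]
  | succ n ih => rw [altSum_walkGF_succ, ih, pow_succ']; ring

end

section

open scoped Polynomial
open Finset (mem_range range sum_congr sum_ite_eq)
open Finsupp (cons single)
open MvPolynomial (C X X_ne_zero aeval_X algebraMap_eq coe_X eval renameEquiv_apply rename_id
  ringHom_ext)
open MvPowerSeries (c_eq_algebraMap coeff coeff_X_pow renameEquiv rename_coe)
open Polynomial (aeval aeval_C aeval_algHom_apply aeval_def coeff_add coeff_monomial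
  finsetSum_coeff monomial)
open PowerSeries (X_dvd_iff coeff_C coeff_C_mul constantCoeff constantCoeff_C)
open RingHom (coe_coe comp_apply)
/-! ### Power series of rational functions without positive part -/

/-- The inclusion of polynomials in power series. -/
abbrev toSer : PolyXY →+* MvPowerSeries (Fin 2) ℂ := MvPolynomial.coeToMvPowerSeries.ringHom

lemma toSer_injective : Function.Injective toSer := MvPolynomial.coe_injective _ _

/-- A polynomial in the variable with index `c`. -/
def inVar (c : Fin 2) : ℂ[X] →ₐ[ℂ] PolyXY := aeval (X c)

/-- A polynomial as a power series in one variable. -/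
def ser1 : ℂ[X] →ₐ[ℂ] MvPowerSeries (Fin 1) ℂ := aeval (MvPowerSeries.X 0)

/-- A power series in two variables as a power series in the first. -/
def columns : MvPowerSeries (Fin 2) ℂ ≃ₐ[ℂ] PowerSeries (MvPowerSeries (Fin 1) ℂ) :=
  MvPowerSeries.finSuccEquiv ℂ 1

/-- Restriction to the line where the first variable is `ρ`. -/
def lineEval (ρ : ℂ) : PolyXY →ₐ[ℂ] ℂ[X] :=
  MvPolynomial.aeval ![Polynomial.C ρ, Polynomial.X]

lemma coeff_ser1 (p : ℂ[X]) (x : Fin 1 →₀ ℕ) :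
    coeff x (ser1 p) = p.coeff (x 0) := by
  classical
  induction p using Polynomial.induction_on' with
  | add p q hp hq => rw [map_add, map_add, hp, hq, coeff_add]
  | monomial n a =>
    rw [ser1, Polynomial.aeval_monomial, ← Algebra.smul_def, map_smul, coeff_X_pow,
      coeff_monomial, smul_eq_mul]
    have h : x = single 0 n ↔ n = x 0 := by
      constructor
      · rintro rfl; simp
      · intro h
        refine Finsupp.ext fun i => ?_
        rw [Subsingleton.elim i 0, h]
        simp
    simp only [h]
    split_ifs <;> simp

lemma ser1_injective : Function.Injective ser1 := by
  intro p q h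
  ext n
  have := congrArg (coeff (single 0 n)) h
  simpa [coeff_ser1] using this

lemma columns_inVar_one (e : ℂ[X]) :
    columns (toSer (inVar 1 e)) = PowerSeries.C (ser1 e) := by
  have h : ((columns : MvPowerSeries (Fin 2) ℂ →+* _).comp toSer).comp
      (inVar 1 : ℂ[X] →+* PolyXY) =
      (PowerSeries.C).comp (ser1 : ℂ[X] →+* MvPowerSeries (Fin 1) ℂ) := by
    refine Polynomial.ringHom_ext (fun a => ?_) ?_
    · simp only [comp_apply, coe_coe, inVar, ser1, aeval_C]
      rw [algebraMap_eq]
      simp [columns, ← c_eq_algebraMap]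
    · simp only [comp_apply, coe_coe, inVar, ser1, Polynomial.aeval_X]
      rw [toSer, MvPolynomial.coeToMvPowerSeries.ringHom_apply, coe_X, columns]
      exact MvPowerSeries.finSuccEquiv_X_succ 0
  exact RingHom.congr_fun h e

lemma columns_X_zero : columns (toSer (X 0)) = PowerSeries.X := by
  rw [toSer, MvPolynomial.coeToMvPowerSeries.ringHom_apply, coe_X, columns,
    MvPowerSeries.finSuccEquiv_X_zero]

lemma constantCoeff_columns (p : PolyXY) :
    constantCoeff (columns (toSer p)) = ser1 (lineEval 0 p) := by
  have h : ((constantCoeff).comp (columns : MvPowerSeries (Fin 2) ℂ →+* _)).comp toSer =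
      (ser1 : ℂ[X] →+* MvPowerSeries (Fin 1) ℂ).comp
        (lineEval 0 : PolyXY →+* ℂ[X]) := by
    refine ringHom_ext (fun a => ?_) fun i => ?_
    · simp only [comp_apply, coe_coe, lineEval, ser1]
      simp [columns, ← c_eq_algebraMap]
    · simp only [comp_apply, coe_coe, lineEval, aeval_X]
      fin_cases i
      · change constantCoeff (columns (toSer (X 0))) = _
        rw [columns_X_zero]
        simp
      · have h1 := columns_inVar_one Polynomial.X
        rw [inVar, Polynomial.aeval_X] at h1
        change constantCoeff (columns (toSer (X 1))) = _
        rw [h1]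
        simp
  exact RingHom.congr_fun h p

lemma dvd_of_lineEval_eq_zero {ρ : ℂ} {p : PolyXY} (h : lineEval ρ p = 0) :
    X 0 - C ρ ∣ p := by
  have key : ∀ p : PolyXY, X 0 - C ρ ∣ p - inVar 1 (lineEval ρ p) := by
    intro p
    induction p using MvPolynomial.induction_on with
    | C a => simp [lineEval, inVar, algebraMap_eq]
    | add p q hp hq =>
      rw [map_add, map_add, add_sub_add_comm]
      exact dvd_add hp hq
    | mul_X p i hp =>
      have h1 : X 0 - C ρ ∣
          X i - inVar 1 (lineEval ρ (X i)) := by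
        fin_cases i
        · simp [lineEval, inVar, algebraMap_eq]
        · simp [lineEval, inVar]
      have h2 := dvd_add (hp.mul_right (X i))
        (h1.mul_left (inVar 1 (lineEval ρ p)))
      rw [map_mul, map_mul]
      convert h2 using 1
      ring
  simpa [h] using key p

lemma lineEval_X_sub (ρ : ℂ) : lineEval ρ (X 0 - C ρ) = 0 := by
  simp [lineEval]

lemma exists_isRelPrime {F : MvPowerSeries (Fin 2) ℂ} {d P : PolyXY} (hd : d ≠ 0)
    (h : toSer d * F = toSer P) {f : RatXY} (hf : f = toRat P / toRat d) :
    toSer (ratDen f) * F = toSer (ratNum f) := by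
  have h1 : P * ratDen f = ratNum f * d := by
    have h2 := ratNum_div_ratDen f
    nth_rewrite 3 [hf] at h2
    rw [div_eq_div_iff (toRat_ne_zero (ratDen_ne_zero f)) (toRat_ne_zero hd)] at h2
    apply toRat_injective
    rw [map_mul, map_mul, h2]
  have h3 : toSer d ≠ 0 := (map_ne_zero_iff _ toSer_injective).2 hd
  apply mul_left_cancel₀ h3
  rw [mul_left_comm, h, ← map_mul, ← map_mul, mul_comm d, ← h1, mul_comm]

/-- The columns of the power series of a rational function are rational. -/
lemma exists_column (k : ℕ) {F : MvPowerSeries (Fin 2) ℂ} {d P : PolyXY} (hd : d ≠ 0)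
    (h : toSer d * F = toSer P) : ∃ e r : ℂ[X], e ≠ 0 ∧
      ser1 e * PowerSeries.coeff k (columns F) = ser1 r := by
  induction k generalizing F d P with
  | zero =>
    have h1 := exists_isRelPrime hd h rfl
    set f : RatXY := toRat P / toRat d
    have h2 : ser1 (lineEval 0 (ratDen f)) * PowerSeries.coeff 0 (columns F) =
        ser1 (lineEval 0 (ratNum f)) := by
      rw [← constantCoeff_columns, ← constantCoeff_columns, ← h1,
        PowerSeries.coeff_zero_eq_constantCoeff, map_mul, map_mul]
    refine ⟨_, _, fun h3 => ?_, h2⟩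
    rw [h3, map_zero, zero_mul] at h2
    have h4 : lineEval 0 (ratNum f) = 0 := ser1_injective (by rw [← h2, map_zero])
    have h5 := isRelPrime_ratNum_ratDen f (dvd_of_lineEval_eq_zero h4) (dvd_of_lineEval_eq_zero h3)
    have h6 := h5.map (lineEval 0)
    rw [lineEval_X_sub] at h6
    exact not_isUnit_zero h6
  | succ k ih =>
    have h0 : ∃ e r : ℂ[X], e ≠ 0 ∧
        ser1 e * PowerSeries.coeff 0 (columns F) = ser1 r := by
      clear ih
      have h1 := exists_isRelPrime hd h rfl
      set f : RatXY := toRat P / toRat d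
      have h2 : ser1 (lineEval 0 (ratDen f)) * PowerSeries.coeff 0 (columns F) =
          ser1 (lineEval 0 (ratNum f)) := by
        rw [← constantCoeff_columns, ← constantCoeff_columns, ← h1,
          PowerSeries.coeff_zero_eq_constantCoeff, map_mul, map_mul]
      refine ⟨_, _, fun h3 => ?_, h2⟩
      rw [h3, map_zero, zero_mul] at h2
      have h4 : lineEval 0 (ratNum f) = 0 := ser1_injective (by rw [← h2, map_zero])
      have h5 := isRelPrime_ratNum_ratDen f (dvd_of_lineEval_eq_zero h4) (dvd_of_lineEval_eq_zero h3)
      have h6 := h5.map (lineEval 0)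
      rw [lineEval_X_sub] at h6
      exact not_isUnit_zero h6
    obtain ⟨e, r, he, her⟩ := h0
    have h1 : PowerSeries.X ∣ columns (toSer (inVar 1 e) * F - toSer (inVar 1 r)) := by
      rw [X_dvd_iff, map_sub, map_mul, columns_inVar_one, columns_inVar_one, map_sub,
        map_mul, ← PowerSeries.coeff_zero_eq_constantCoeff_apply (columns F),
        constantCoeff_C, constantCoeff_C, her, sub_self]
    obtain ⟨H, hH⟩ := h1
    have h2 : toSer (d * X 0) * columns.symm H =
        toSer (inVar 1 e * P - d * inVar 1 r) := by
      apply columns.injective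
      rw [map_mul toSer, mul_assoc, map_mul columns, map_mul columns, columns_X_zero,
        AlgEquiv.apply_symm_apply, ← hH, ← map_mul]
      congr 1
      rw [map_sub, map_mul, map_mul, ← h]
      ring
    obtain ⟨e', r', he', her'⟩ := ih (mul_ne_zero hd (X_ne_zero 0)) h2
    rw [AlgEquiv.apply_symm_apply] at her'
    refine ⟨e' * e, r', mul_ne_zero he' he, ?_⟩
    have h3 := congrArg (PowerSeries.coeff (k + 1)) hH
    rw [PowerSeries.coeff_succ_X_mul, map_sub, map_sub, map_mul, columns_inVar_one,
      columns_inVar_one, coeff_C_mul, coeff_C, if_neg k.succ_ne_zero,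
      sub_zero] at h3
    rw [map_mul, mul_assoc, h3, her']

/-- A common denominator for finitely many columns. -/
lemma exists_columns (N : ℕ) {F : MvPowerSeries (Fin 2) ℂ} {d P : PolyXY} (hd : d ≠ 0)
    (h : toSer d * F = toSer P) : ∃ (e : ℂ[X]) (r : ℕ → ℂ[X]), e ≠ 0 ∧
      ∀ k ≤ N, ser1 e * PowerSeries.coeff k (columns F) = ser1 (r k) := by
  choose e r he hr using fun k => exists_column k hd h
  refine ⟨∏ k ∈ range (N + 1), e k,
    fun k => (∏ j ∈ (range (N + 1)).erase k, e j) * r k,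
    Finset.prod_ne_zero_iff.2 fun k _ => he k, fun k hk => ?_⟩
  have hk' : k ∈ range (N + 1) := mem_range.2 (by omega)
  rw [← Finset.prod_erase_mul _ _ hk', map_mul, mul_assoc, hr, map_mul]

lemma eq_of_columns {N : ℕ} {e : ℂ[X]} {r : ℕ → ℂ[X]}
    {G : MvPowerSeries (Fin 2) ℂ}
    (h1 : ∀ k ≤ N, ser1 e * PowerSeries.coeff k (columns G) = ser1 (r k))
    (h2 : ∀ k, N < k → PowerSeries.coeff k (columns G) = 0) :
    toSer (inVar 1 e) * G =
      toSer (∑ k ∈ range (N + 1), X 0 ^ k * inVar 1 (r k)) := by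
  apply columns.injective
  rw [map_mul, columns_inVar_one, map_sum, map_sum]
  have h3 : ∀ k ∈ range (N + 1), columns (toSer (X 0 ^ k * inVar 1 (r k))) =
      PowerSeries.C (ser1 (r k)) * PowerSeries.X ^ k := by
    intro k _
    rw [map_mul, map_mul, map_pow, map_pow, columns_X_zero, columns_inVar_one, mul_comm]
  rw [sum_congr rfl h3]
  ext1 n
  rw [coeff_C_mul, map_sum]
  simp only [PowerSeries.coeff_C_mul_X_pow]
  rw [sum_ite_eq]
  split_ifs with h4
  · exact h1 n (by rw [mem_range] at h4; omega)
  · rw [h2 n (by rw [mem_range] at h4; omega), mul_zero]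

lemma coeff_columns (F : MvPowerSeries (Fin 2) ℂ) (k : ℕ) (x : Fin 1 →₀ ℕ) :
    coeff x (PowerSeries.coeff k (columns F)) =
      coeff (single 0 k + single 1 (x 0)) F := by
  have h : cons k x = single 0 k + single 1 (x 0) := by
    refine Finsupp.ext fun i => ?_
    fin_cases i
    · simp
    · change (cons k x) (Fin.succ 0) = _
      rw [Finsupp.cons_succ]
      simp
  rw [columns, MvPowerSeries.coeff_coeff_finSuccEquiv, h]

/-- Exchange of the variables. -/
def swapSer : MvPowerSeries (Fin 2) ℂ ≃ₐ[ℂ] MvPowerSeries (Fin 2) ℂ :=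
  renameEquiv ℂ (Equiv.swap 0 1)

/-- Exchange of the variables. -/
def swapPoly : PolyXY ≃ₐ[ℂ] PolyXY := MvPolynomial.renameEquiv ℂ (Equiv.swap 0 1)

lemma swapSer_toSer (p : PolyXY) : swapSer (toSer p) = toSer (swapPoly p) :=
  rename_coe _ p

lemma swapPoly_swapPoly (p : PolyXY) : swapPoly (swapPoly p) = p := by
  rw [swapPoly, renameEquiv_apply, renameEquiv_apply,
    MvPolynomial.rename_rename]
  have h : ⇑(Equiv.swap (0 : Fin 2) 1) ∘ ⇑(Equiv.swap (0 : Fin 2) 1) = id := by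
    funext i
    simp
  rw [h, rename_id]
  rfl

lemma swapPoly_inVar (c : Fin 2) (p : ℂ[X]) :
    swapPoly (inVar c p) = inVar (Equiv.swap 0 1 c) p := by
  have h := aeval_algHom_apply (swapPoly : PolyXY →ₐ[ℂ] PolyXY) (X c) p
  have h1 : (swapPoly : PolyXY →ₐ[ℂ] PolyXY) (X c) =
      X (Equiv.swap 0 1 c) := by simp [swapPoly]
  rw [h1] at h
  exact h.symm

@[simp] lemma swapPoly_X (c : Fin 2) :
    swapPoly (X c) = X (Equiv.swap 0 1 c) := by
  simp [swapPoly]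

lemma coeff_swapSer (F : MvPowerSeries (Fin 2) ℂ) (k l : ℕ) :
    coeff (single 0 k + single 1 l) (swapSer F) =
      coeff (single 0 l + single 1 k) F := by
  have h := MvPowerSeries.coeff_embDomain_rename (R := ℂ) (Equiv.swap (0 : Fin 2) 1).toEmbedding F
    (single 0 l + single 1 k)
  rw [← h]
  congr 1
  rw [Finsupp.embDomain_eq_mapDomain, Finsupp.mapDomain_add, Finsupp.mapDomain_single,
    Finsupp.mapDomain_single, add_comm]
  simp

/-- The rational function `p / d` is a sum of monomials in one variable times rational functions of
the other; the exponents are at most `N`, and `D`, `E` are common denominators. -/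
structure IsSplit (N : ℕ) (d p : PolyXY) (D E : ℂ[X]) (e g : ℕ → ℂ[X]) : Prop where
  fst_ne : D ≠ 0
  snd_ne : E ≠ 0
  eq : inVar 0 D * inVar 1 E * p = d * (
    inVar 0 D * ∑ k ∈ range (N + 1), X 0 ^ k * inVar 1 (e k) +
    inVar 1 E * ∑ k ∈ range (N + 1), X 1 ^ k * inVar 0 (g k))

lemma IsSplit.swap {N : ℕ} {d p : PolyXY} {D E : ℂ[X]} {e g : ℕ → ℂ[X]}
    (h : IsSplit N d p D E e g) : IsSplit N (swapPoly d) (swapPoly p) E D g e := by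
  refine ⟨h.snd_ne, h.fst_ne, ?_⟩
  have h1 := congrArg swapPoly h.eq
  simp only [map_mul, map_add, map_sum, map_pow, swapPoly_inVar, swapPoly_X, Equiv.swap_apply_left,
    Equiv.swap_apply_right] at h1
  rw [mul_comm (inVar 0 E), h1]
  ring

lemma exists_isSplit {N : ℕ} {d p : PolyXY} {F : MvPowerSeries (Fin 2) ℂ} (hd : d ≠ 0)
    (h : toSer d * F = toSer p) (hF : ∀ k l : ℕ, N < k → N < l →
      coeff (single 0 k + single 1 l) F = 0) :
    ∃ D E e g, IsSplit N d p D E e g := by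
  obtain ⟨E, e, hE, he⟩ := exists_columns N hd h
  have h' : toSer (swapPoly d) * swapSer F = toSer (swapPoly p) := by
    rw [← swapSer_toSer, ← swapSer_toSer, ← map_mul, h]
  have hd' : swapPoly d ≠ 0 := (map_ne_zero_iff _ swapPoly.injective).2 hd
  obtain ⟨D, r, hD, hr⟩ := exists_columns N hd' h'
  set FA : MvPowerSeries (Fin 2) ℂ := fun m => if m 0 ≤ N then coeff m F else 0 with hFA
  obtain ⟨FB, hFB⟩ : ∃ FB : MvPowerSeries (Fin 2) ℂ, FB = F - FA := ⟨_, rfl⟩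
  have cA : ∀ m, coeff m FA = if m 0 ≤ N then coeff m F else 0 :=
    fun m => rfl
  have hA := eq_of_columns (N := N) (e := E) (r := e) (G := FA) (by
    intro k hk
    rw [← he k hk]
    congr 1
    ext x
    rw [coeff_columns, coeff_columns, cA, if_pos]
    simpa using hk) (by
    intro k hk
    ext x
    rw [coeff_columns, cA, if_neg]
    · simp
    · simpa using hk)
  set tr : ℕ → ℂ[X] := fun l => ∑ k ∈ range (N + 1),
    monomial k (coeff (single 0 k + single 1 l) F) with htr
  have hB := eq_of_columns (N := N) (e := D) (r := fun l => r l - D * tr l) (G := swapSer FB) (by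
    intro l hl
    rw [map_sub ser1, map_mul ser1, ← hr l hl, ← mul_sub]
    congr 1
    ext x
    rw [map_sub (coeff x), coeff_columns, coeff_columns, coeff_swapSer, coeff_swapSer,
      hFB, map_sub, cA, coeff_ser1, htr, finsetSum_coeff]
    simp only [coeff_monomial]
    rw [Finset.sum_ite_eq']
    congr 1
    have h0 : (single 0 (x 0) + single 1 l : Fin 2 →₀ ℕ) 0 = x 0 := by simp
    rw [h0]
    simp only [mem_range, Nat.lt_succ_iff]) (by
    intro l hl
    ext x
    rw [coeff_columns, coeff_swapSer, hFB, map_sub, cA]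
    have h0 : (single 0 (x 0) + single 1 l : Fin 2 →₀ ℕ) 0 = x 0 := by simp
    rw [h0, LinearMap.map_zero]
    split_ifs with h1
    · rw [sub_self]
    · rw [sub_zero, hF _ _ (by omega) hl])
  have hB' : toSer (inVar 0 D) * FB = toSer (∑ k ∈ range (N + 1),
      X 1 ^ k * inVar 0 (r k - D * tr k)) := by
    apply swapSer.injective
    rw [map_mul, swapSer_toSer, swapPoly_inVar, Equiv.swap_apply_left, hB, swapSer_toSer]
    congr 1
    simp only [map_sum, map_mul, map_pow, swapPoly_inVar, swapPoly_X, Equiv.swap_apply_left,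
      Equiv.swap_apply_right]
  refine ⟨D, E, e, fun l => r l - D * tr l, hD, hE, ?_⟩
  apply toSer_injective
  have hF' : F = FA + FB := by rw [hFB]; ring
  rw [map_mul toSer, ← h, hF', map_mul toSer, map_mul toSer, map_add toSer, map_mul toSer,
    map_mul toSer, ← hA, ← hB']
  ring

lemma inVar_X_sub (c : Fin 2) (ρ : ℂ) : inVar c (Polynomial.X - Polynomial.C ρ) =
    X c - C ρ := by
  simp [inVar, algebraMap_eq]

lemma lineEval_inVar_zero (ρ : ℂ) (p : ℂ[X]) :
    lineEval ρ (inVar 0 p) = Polynomial.C (p.eval ρ) := by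
  rw [inVar, lineEval, ← aeval_algHom_apply, aeval_X]
  simp only [Matrix.cons_val_zero]
  rw [aeval_def, Polynomial.algebraMap_eq, Polynomial.eval₂_at_apply]

lemma lineEval_inVar_one (ρ : ℂ) (p : ℂ[X]) : lineEval ρ (inVar 1 p) = p := by
  rw [inVar, lineEval, ← aeval_algHom_apply, aeval_X]
  simp

/-- A denominator that is not forced by a pole can be removed. -/
lemma IsSplit.reduce {N : ℕ} {d p : PolyXY} {D E : ℂ[X]} {e g : ℕ → ℂ[X]}
    (h : IsSplit N d p D E e g) {ρ : ℂ} (hD : D.eval ρ = 0)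
    (hd : ¬ X 0 - C ρ ∣ d) :
    ∃ D' g', IsSplit N d p D' E e g' ∧ D'.natDegree < D.natDegree := by
  obtain ⟨D', rfl⟩ := Polynomial.dvd_iff_isRoot.2 hD
  have hD' : D' ≠ 0 := right_ne_zero_of_mul h.fst_ne
  have hg : ∀ k ∈ range (N + 1), (g k).eval ρ = 0 := by
    have h1 := congrArg (lineEval ρ) h.eq
    have hD0 : lineEval ρ (inVar 0 ((Polynomial.X - Polynomial.C ρ) * D')) = 0 := by
      rw [lineEval_inVar_zero, hD, map_zero]
    generalize inVar 0 ((Polynomial.X - Polynomial.C ρ) * D') = DD at h1 hD0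
    simp only [map_mul, map_add, map_sum, map_pow, lineEval_inVar_zero, lineEval_inVar_one, hD0,
      zero_mul, zero_add] at h1
    have hd' : lineEval ρ d ≠ 0 := fun h2 => hd (dvd_of_lineEval_eq_zero h2)
    have h2 : ∑ k ∈ range (N + 1),
        lineEval ρ (X 1) ^ k * Polynomial.C ((g k).eval ρ) = 0 := by
      rcases mul_eq_zero.1 h1.symm with h3 | h3
      · exact absurd h3 hd'
      · exact (mul_eq_zero.1 h3).resolve_left h.snd_ne
    have hX : lineEval ρ (X 1) = Polynomial.X := by simp [lineEval]
    rw [hX] at h2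
    intro k hk
    have h3 := congrArg (fun q => Polynomial.coeff q k) h2
    simp only [finsetSum_coeff, Polynomial.coeff_mul_C, Polynomial.coeff_X_pow, ite_mul,
      one_mul, zero_mul, Polynomial.coeff_zero] at h3
    rw [sum_ite_eq, if_pos hk] at h3
    exact h3
  choose g' hg' using fun k : range (N + 1) => Polynomial.dvd_iff_isRoot.2 (hg k k.2)
  refine ⟨D', fun k => if hk : k ∈ range (N + 1) then g' ⟨k, hk⟩ else 0,
    ⟨hD', h.snd_ne, ?_⟩, ?_⟩
  · have h1 : inVar 0 (Polynomial.X - Polynomial.C ρ) ≠ 0 := by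
      rw [inVar_X_sub]
      intro h2
      have := congrArg (eval (fun _ => ρ + 1)) h2
      simp at this
    apply mul_left_cancel₀ h1
    have h2 := h.eq
    have h3 : ∑ k ∈ range (N + 1), X 1 ^ k * inVar 0 (g k) =
        inVar 0 (Polynomial.X - Polynomial.C ρ) * ∑ k ∈ range (N + 1), X 1 ^ k *
          inVar 0 (if hk : k ∈ range (N + 1) then g' ⟨k, hk⟩ else 0) := by
      rw [Finset.mul_sum]
      refine sum_congr rfl fun k hk => ?_
      rw [dif_pos hk, hg' ⟨k, hk⟩, map_mul]
      ring
    rw [map_mul, h3] at h2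
    linear_combination h2
  · rw [Polynomial.natDegree_mul (Polynomial.X_sub_C_ne_zero ρ) hD', Polynomial.natDegree_X_sub_C]
    omega

lemma swapPoly_dvd {c : Fin 2} {ρ : ℂ} {d : PolyXY}
    (h : X c - C ρ ∣ swapPoly d) :
    X (Equiv.swap 0 1 c) - C ρ ∣ d := by
  have h1 := map_dvd swapPoly h
  rw [swapPoly_swapPoly, map_sub, swapPoly_X] at h1
  simpa [swapPoly] using h1

/-- A rational function without positive part is a sum of monomials in one variable times rational
functions of the other, whose poles come from linear factors of its denominator. -/
theorem exists_isSplit_of_noPositivePart {f : RatXY} (hf : NoPositivePart f) :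
    ∃ N D E e g, IsSplit N (ratDen f) (ratNum f * (X 0 * X 1) ^ N) D E e g ∧
      (∀ ρ, D.eval ρ = 0 → X 0 - C ρ ∣ ratDen f) ∧
      (∀ ρ, E.eval ρ = 0 → X 1 - C ρ ∣ ratDen f) := by
  classical
  obtain ⟨N, F, ⟨p, d, hd, hfd, hF⟩, hpos⟩ := hf
  have h1 : toSer (ratDen f) * F =
      toSer (ratNum f * (X 0 * X 1) ^ N) := by
    have h2 : p * ratDen f = ratNum f * d := by
      have h2 := ratNum_div_ratDen f
      nth_rewrite 3 [hfd] at h2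
      rw [div_eq_div_iff (toRat_ne_zero (ratDen_ne_zero f)) (toRat_ne_zero hd)] at h2
      apply toRat_injective
      rw [map_mul, map_mul, h2]
    have h3 : toSer d ≠ 0 := (map_ne_zero_iff _ toSer_injective).2 hd
    have hF' : toSer d * F = toSer (p * (X 0 * X 1) ^ N) := hF
    apply mul_left_cancel₀ h3
    rw [mul_left_comm, hF', ← map_mul, ← map_mul]
    congr 1
    linear_combination (X 0 * X 1) ^ N * h2
  have h4 : ∀ k l : ℕ, N < k → N < l →
      coeff (single 0 k + single 1 l) F = 0 := by
    intro k l hk hl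
    have := hpos (k - N) (l - N) (by omega) (by omega)
    rwa [Nat.sub_add_cancel hk.le, Nat.sub_add_cancel hl.le] at this
  obtain ⟨D₀, E₀, e₀, g₀, sp⟩ := exists_isSplit (ratDen_ne_zero f) h1 h4
  set P : ℕ → Prop := fun n => ∃ D E e g,
    IsSplit N (ratDen f) (ratNum f * (X 0 * X 1) ^ N) D E e g ∧
      D.natDegree + E.natDegree = n with hP
  have hex : ∃ n, P n := ⟨_, D₀, E₀, e₀, g₀, sp, rfl⟩
  obtain ⟨D, E, e, g, h, hdeg⟩ := Nat.find_spec hex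
  refine ⟨N, D, E, e, g, h, fun ρ hρ => ?_, fun ρ hρ => ?_⟩
  · by_contra hn
    obtain ⟨D', g', h', hlt⟩ := h.reduce hρ hn
    exact Nat.find_min hex (m := D'.natDegree + E.natDegree) (by omega) ⟨_, _, _, _, h', rfl⟩
  · by_contra hn
    obtain ⟨E', e', h', hlt⟩ := h.swap.reduce hρ (fun h5 => hn (by simpa using swapPoly_dvd h5))
    have h'' := h'.swap
    rw [swapPoly_swapPoly, swapPoly_swapPoly] at h''
    exact Nat.find_min hex (m := D.natDegree + E'.natDegree) (by omega) ⟨_, _, _, _, h'', rfl⟩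

end

section

open scoped Polynomial
open Finset (mul_sum range sum_ite_eq')
open Polynomial (C X X_dvd_iff X_pow_dvd_iff coeff_monomial coeff_sub eval_C eval_X eval_add
  eval_monomial eval_mul eval_pow eval_sub finsetSum_coeff monomial)
open Real (norm_of_nonneg)
open Topology

/-! ### Asymptotic expansions in powers of `1 / n` -/

/-- The comparison sequence `n ^ (-m)`. -/
def negPow (m n : ℕ) : ℝ := ((n : ℝ) ^ m)⁻¹

lemma negPow_zero : negPow 0 = fun _ => 1 := by
  funext n; simp [negPow]

lemma negPow_nonneg (m n : ℕ) : 0 ≤ negPow m n := by rw [negPow]; positivity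

lemma negPow_mul (a b n : ℕ) : negPow a n * negPow b n = negPow (a + b) n := by
  rw [negPow, negPow, negPow, pow_add, mul_inv]

lemma negPow_isBigO {a b : ℕ} (h : a ≤ b) : negPow b =O[atTop] negPow a := by
  refine IsBigO.of_bound 1 ?_
  filter_upwards [eventually_ge_atTop 1] with n hn
  have hn' : (1 : ℝ) ≤ n := by exact_mod_cast hn
  rw [norm_of_nonneg (negPow_nonneg _ _), norm_of_nonneg (negPow_nonneg _ _), one_mul,
    negPow, negPow]
  gcongr

lemma isBigO_mul_negPow {u v : ℕ → ℂ} {a b : ℕ} (hu : u =O[atTop] negPow a)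
    (hv : v =O[atTop] negPow b) : (fun n => u n * v n) =O[atTop] negPow (a + b) := by
  refine (hu.mul hv).congr_right fun n => negPow_mul a b n

lemma inv_pow_isBigO (m : ℕ) : (fun n : ℕ => ((n : ℂ)⁻¹) ^ m) =O[atTop] negPow m := by
  refine IsBigO.of_bound 1 (Eventually.of_forall fun n => ?_)
  rw [norm_of_nonneg (negPow_nonneg _ _), negPow, norm_pow, norm_inv, Complex.norm_natCast,
    one_mul, inv_pow]

lemma inv_isBigO : (fun n : ℕ => (n : ℂ)⁻¹) =O[atTop] negPow 1 := by
  simpa using inv_pow_isBigO 1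

lemma inv_succ_isBigO : (fun n : ℕ => ((n + 1 : ℕ) : ℂ)⁻¹) =O[atTop] negPow 1 := by
  refine IsBigO.of_bound 1 ?_
  filter_upwards [eventually_ge_atTop 1] with n hn
  have hn' : (1 : ℝ) ≤ n := by exact_mod_cast hn
  rw [norm_of_nonneg (negPow_nonneg _ _), norm_inv, Complex.norm_natCast, one_mul, negPow,
    pow_one]
  gcongr
  simp

lemma tendsto_natCast_inv : Tendsto (fun n : ℕ => (n : ℂ)⁻¹) atTop (𝓝 0) := by
  have h := tendsto_inv_atTop_nhds_zero_nat (𝕜 := ℂ)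
  simpa using h

lemma tendsto_eval_inv (p : ℂ[X]) :
    Tendsto (fun n : ℕ => p.eval (n : ℂ)⁻¹) atTop (𝓝 (p.eval 0)) :=
  (p.continuous.tendsto 0).comp tendsto_natCast_inv

lemma eval_inv_isBigO {p : ℂ[X]} {m : ℕ} (h : X ^ m ∣ p) :
    (fun n : ℕ => p.eval (n : ℂ)⁻¹) =O[atTop] negPow m := by
  obtain ⟨q, rfl⟩ := h
  have h1 : (fun n : ℕ => q.eval (n : ℂ)⁻¹) =O[atTop] negPow 0 := by
    rw [negPow_zero]
    exact (tendsto_eval_inv q).isBigO_one ℝ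
  have h2 := isBigO_mul_negPow (inv_pow_isBigO m) h1
  simpa using h2

lemma X_pow_dvd_of_isBigO {p : ℂ[X]} {m : ℕ}
    (h : (fun n : ℕ => p.eval (n : ℂ)⁻¹) =O[atTop] negPow m) : X ^ m ∣ p := by
  induction m with
  | zero => simp
  | succ m ih =>
    obtain ⟨q, rfl⟩ := ih (h.trans (negPow_isBigO m.le_succ))
    have h1 : (fun n : ℕ => q.eval (n : ℂ)⁻¹) =O[atTop] negPow 1 := by
      obtain ⟨C, hC⟩ := h.bound
      refine IsBigO.of_bound C ?_
      filter_upwards [hC, eventually_ge_atTop 1] with n hn hn1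
      have hn' : (0 : ℝ) < n := by exact_mod_cast hn1
      rw [norm_of_nonneg (negPow_nonneg _ _)] at hn ⊢
      rw [eval_mul, eval_pow, eval_X, norm_mul, norm_pow, norm_inv,
        Complex.norm_natCast, negPow, pow_succ, mul_inv, ← inv_pow] at hn
      rw [negPow, pow_one]
      have hp : 0 < ((n : ℝ)⁻¹) ^ m := by positivity
      refine le_of_mul_le_mul_left ?_ hp
      calc _ ≤ _ := hn
        _ = _ := by ring
    have h2 : Tendsto (fun n : ℕ => q.eval (n : ℂ)⁻¹) atTop (𝓝 0) := by
      refine h1.trans_tendsto ?_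
      have h3 := tendsto_inv_atTop_nhds_zero_nat (𝕜 := ℝ)
      refine h3.congr fun n => ?_
      rw [negPow, pow_one]
    have h3 := tendsto_nhds_unique h2 (tendsto_eval_inv q)
    rw [pow_succ]
    refine mul_dvd_mul_left _ (X_dvd_iff.2 ?_)
    rw [Polynomial.coeff_zero_eq_eval_zero, ← h3]

/-- The sequence is a polynomial in `1 / n` up to an error `O(n ^ (-m))`. -/
def PolyApprox (m : ℕ) (u : ℕ → ℂ) : Prop :=
  ∃ p : ℂ[X], (fun n => u n - p.eval (n : ℂ)⁻¹) =O[atTop] negPow m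

namespace PolyApprox

variable {m : ℕ} {u v : ℕ → ℂ}

lemma of_isBigO (h : u =O[atTop] negPow m) : PolyApprox m u := ⟨0, by simpa using h⟩

lemma eval (m : ℕ) (p : ℂ[X]) : PolyApprox m fun n => p.eval (n : ℂ)⁻¹ :=
  ⟨p, by simpa using isBigO_zero _ _⟩

lemma congr (hu : PolyApprox m u) (h : (fun n => u n - v n) =O[atTop] negPow m) :
    PolyApprox m v := by
  obtain ⟨p, hp⟩ := hu
  exact ⟨p, (hp.sub h).congr_left fun n => by ring⟩

lemma isBigO_one (hu : PolyApprox m u) : u =O[atTop] negPow 0 := by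
  obtain ⟨p, hp⟩ := hu
  have h := (hp.trans (negPow_isBigO m.zero_le)).add
    (eval_inv_isBigO (p := p) (m := 0) (by simp))
  exact h.congr_left fun n => by ring

lemma add (hu : PolyApprox m u) (hv : PolyApprox m v) : PolyApprox m fun n => u n + v n := by
  obtain ⟨p, hp⟩ := hu
  obtain ⟨q, hq⟩ := hv
  exact ⟨p + q, (hp.add hq).congr_left fun n => by rw [eval_add]; ring⟩

lemma mul (hu : PolyApprox m u) (hv : PolyApprox m v) : PolyApprox m fun n => u n * v n := by
  have hv1 := hv.isBigO_one
  obtain ⟨p, hp⟩ := hu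
  obtain ⟨q, hq⟩ := hv
  have h1 := isBigO_mul_negPow hp hv1
  have h2 := isBigO_mul_negPow (eval_inv_isBigO (p := p) (m := 0) (by simp)) hq
  rw [add_zero] at h1
  rw [zero_add] at h2
  exact ⟨p * q, (h1.add h2).congr_left fun n => by rw [eval_mul]; ring⟩

lemma sub (hu : PolyApprox m u) (hv : PolyApprox m v) : PolyApprox m fun n => u n - v n := by
  obtain ⟨p, hp⟩ := hu
  obtain ⟨q, hq⟩ := hv
  exact ⟨p - q, (hp.sub hq).congr_left fun n => by rw [eval_sub]; ring⟩

lemma inv_mul (hu : PolyApprox m u) : PolyApprox (m + 1) fun n => (n : ℂ)⁻¹ * u n := by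
  obtain ⟨p, hp⟩ := hu
  refine ⟨X * p, ?_⟩
  have h := isBigO_mul_negPow inv_isBigO hp
  rw [add_comm 1 m] at h
  exact h.congr_left fun n => by rw [eval_mul, eval_X]; ring

lemma inv_succ (m : ℕ) : PolyApprox m fun n => ((n + 1 : ℕ) : ℂ)⁻¹ := by
  induction m with
  | zero => exact of_isBigO (inv_succ_isBigO.trans (negPow_isBigO zero_le_one))
  | succ m ih =>
    have h1 := (eval (m + 1) X).sub ih.inv_mul
    refine h1.congr (IsBigO.of_bound 1 ?_)
    filter_upwards [eventually_ge_atTop 1] with n hn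
    have hn' : (n : ℂ) ≠ 0 := Nat.cast_ne_zero.2 (by omega)
    have hn2 : ((n : ℂ) + 1) ≠ 0 := by exact_mod_cast n.succ_ne_zero
    have : Polynomial.eval (n : ℂ)⁻¹ X - (n : ℂ)⁻¹ * ((n + 1 : ℕ) : ℂ)⁻¹ -
        ((n + 1 : ℕ) : ℂ)⁻¹ = 0 := by
      rw [eval_X]
      push_cast
      field_simp
      ring
    rw [this, norm_zero, one_mul]
    exact norm_nonneg _

lemma eval_succ (m : ℕ) (p : ℂ[X]) :
    PolyApprox m fun n => p.eval ((n + 1 : ℕ) : ℂ)⁻¹ := by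
  induction p using Polynomial.induction_on' with
  | add p q hp hq =>
    refine (hp.add hq).congr ((isBigO_zero _ _).congr_left fun n => ?_)
    rw [eval_add, sub_self]
  | monomial k a =>
    induction k with
    | zero =>
      refine (eval m (C a)).congr ((isBigO_zero _ _).congr_left fun n => ?_)
      simp
    | succ k ih =>
      refine (ih.mul (inv_succ m)).congr ((isBigO_zero _ _).congr_left fun n => ?_)
      simp only [eval_monomial, pow_succ]
      ring

end PolyApprox

lemma inv_succ_pow_sub (k : ℕ) : (fun n : ℕ => (((n + 1 : ℕ) : ℂ)⁻¹) ^ k - ((n : ℂ)⁻¹) ^ k +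
    k * ((n : ℂ)⁻¹) ^ (k + 1)) =O[atTop] negPow (k + 2) := by
  induction k with
  | zero => exact (isBigO_zero _ _).congr_left fun n => by simp
  | succ k ih =>
    have h1 := isBigO_mul_negPow ih inv_succ_isBigO
    have h2 := isBigO_mul_negPow (inv_pow_isBigO (k + 2)) inv_succ_isBigO
    refine (h1.add (h2.const_mul_left ((k + 1 : ℕ) : ℂ))).congr' ?_ (by rfl)
    filter_upwards [eventually_ge_atTop 1] with n hn
    have hn' : (n : ℂ) ≠ 0 := Nat.cast_ne_zero.2 (by omega)
    have hn2 : ((n : ℂ) + 1) ≠ 0 := by exact_mod_cast n.succ_ne_zero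
    have h3 : ((n + 1 : ℕ) : ℂ)⁻¹ = (n : ℂ)⁻¹ - (n : ℂ)⁻¹ * ((n + 1 : ℕ) : ℂ)⁻¹ := by
      push_cast
      field_simp
      ring
    set x := (n : ℂ)⁻¹
    set y := ((n + 1 : ℕ) : ℂ)⁻¹
    push_cast
    rw [pow_succ y]
    linear_combination ((-1 : ℂ) * x ^ k + k * x ^ (k + 1) + x ^ (k + 1)) * h3

/-- A sequence whose differences are given by a polynomial in `1 / n`. -/
lemma exists_difference (m : ℕ) {q : ℂ[X]} (hq : X ^ 2 ∣ q) :
    ∃ g : ℂ[X], (fun n : ℕ => g.eval ((n + 1 : ℕ) : ℂ)⁻¹ - g.eval (n : ℂ)⁻¹ -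
      q.eval (n : ℂ)⁻¹) =O[atTop] negPow (m + 2) := by
  induction m with
  | zero => exact ⟨0, (eval_inv_isBigO hq).neg_left.congr_left fun n => by simp⟩
  | succ m ih =>
    obtain ⟨g, hg⟩ := ih
    obtain ⟨t, ht⟩ := ((PolyApprox.eval_succ (m + 3) g).sub (PolyApprox.eval (m + 3) g)).sub
      (PolyApprox.eval (m + 3) q)
    have h1 : X ^ (m + 2) ∣ t := by
      apply X_pow_dvd_of_isBigO
      refine (hg.sub (ht.trans (negPow_isBigO (by omega)))).congr_left fun n => by ring
    obtain ⟨t, rfl⟩ := h1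
    obtain ⟨t', ht'⟩ : X ∣ t - C (t.eval 0) := by
      rw [X_dvd_iff, coeff_sub, Polynomial.coeff_C_zero,
        Polynomial.coeff_zero_eq_eval_zero, sub_self]
    refine ⟨g + C (t.eval 0 / (m + 1)) * X ^ (m + 1), ?_⟩
    have h2 := (inv_succ_pow_sub (m + 1)).const_mul_left (t.eval 0 / (m + 1))
    have h3 := isBigO_mul_negPow (inv_pow_isBigO (m + 3))
      (eval_inv_isBigO (p := t') (m := 0) (by simp))
    rw [add_zero] at h3
    have hm : ((m : ℂ) + 1) ≠ 0 := by exact_mod_cast m.succ_ne_zero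
    refine ((ht.add h3).add h2).congr_left fun n => ?_
    have h4 : t.eval (n : ℂ)⁻¹ = t.eval 0 + (n : ℂ)⁻¹ * t'.eval (n : ℂ)⁻¹ := by
      have := congrArg (Polynomial.eval (n : ℂ)⁻¹) ht'
      rw [eval_sub, eval_C, eval_mul, eval_X] at this
      linear_combination this
    simp only [eval_add, eval_mul, eval_C, eval_pow,
      eval_X, h4]
    push_cast
    field_simp
    ring

lemma sub_isBigO_of_tendsto {w : ℕ → ℂ} {ℓ : ℂ} {m : ℕ} (h : Tendsto w atTop (𝓝 ℓ))
    (hw : (fun n => w (n + 1) - w n) =O[atTop] negPow (m + 2)) :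
    (fun n => w n - ℓ) =O[atTop] negPow (m + 1) := by
  obtain ⟨C, hC0, hC⟩ := hw.exists_pos
  rw [IsBigOWith] at hC
  obtain ⟨N, hN⟩ := eventually_atTop.1 hC
  refine IsBigO.of_bound (2 * C) ?_
  filter_upwards [eventually_ge_atTop (max N 1)] with n hn
  have hnN : N ≤ n := le_trans (le_max_left _ _) hn
  have hn1 : 1 ≤ n := le_trans (le_max_right _ _) hn
  have hn0 : (0 : ℝ) < n := by exact_mod_cast hn1
  have key : ∀ k : ℕ, ‖w (n + k) - w n‖ ≤
      2 * C * negPow m n * ((n : ℝ)⁻¹ - ((n + k : ℕ) : ℝ)⁻¹) := by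
    intro k
    induction k with
    | zero => simp
    | succ k ih =>
      have h1 := hN (n + k) (by omega)
      rw [norm_of_nonneg (negPow_nonneg _ _)] at h1
      have hk0 : (0 : ℝ) < ((n + k : ℕ) : ℝ) := by exact_mod_cast (by omega : 0 < n + k)
      have h2 : negPow (m + 2) (n + k) ≤
          negPow m n * (2 * (((n + k : ℕ) : ℝ)⁻¹ - ((n + (k + 1) : ℕ) : ℝ)⁻¹)) := by
        rw [← negPow_mul]
        refine mul_le_mul ?_ ?_ (negPow_nonneg _ _) (negPow_nonneg _ _)
        · rw [negPow, negPow]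
          gcongr
          exact_mod_cast (by omega : n ≤ n + k)
        · rw [negPow]
          set x : ℝ := ((n + k : ℕ) : ℝ) with hx
          have hx1 : (1 : ℝ) ≤ x := by rw [hx]; exact_mod_cast (by omega : 1 ≤ n + k)
          have e : ((n + (k + 1) : ℕ) : ℝ) = x + 1 := by rw [hx]; push_cast; ring
          have e2 : 2 * (x⁻¹ - (x + 1)⁻¹) = 2 / (x * (x + 1)) := by
            field_simp
            ring
          rw [e, e2, inv_eq_one_div, div_le_div_iff₀ (by positivity) (by positivity)]
          nlinarith
      calc ‖w (n + (k + 1)) - w n‖ ≤ ‖w (n + k + 1) - w (n + k)‖ + ‖w (n + k) - w n‖ := by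
            refine le_trans (le_of_eq ?_) (norm_add_le _ _)
            congr 1
            rw [← add_assoc]
            ring
        _ ≤ C * (negPow m n * (2 * (((n + k : ℕ) : ℝ)⁻¹ - ((n + (k + 1) : ℕ) : ℝ)⁻¹))) +
            2 * C * negPow m n * ((n : ℝ)⁻¹ - ((n + k : ℕ) : ℝ)⁻¹) := by
            refine add_le_add (h1.trans ?_) ih
            gcongr
        _ = _ := by ring
  have h3 : ∀ k : ℕ, ‖w (n + k) - w n‖ ≤ 2 * C * negPow (m + 1) n := by
    intro k
    refine (key k).trans ?_
    rw [← negPow_mul, ← mul_assoc, negPow, negPow, pow_one]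
    refine mul_le_mul_of_nonneg_left ?_ (by positivity)
    have : (0 : ℝ) ≤ ((n + k : ℕ) : ℝ)⁻¹ := by positivity
    linarith
  have h4 : Tendsto (fun k => ‖w (n + k) - w n‖) atTop (𝓝 ‖ℓ - w n‖) := by
    refine ((h.comp (tendsto_add_atTop_nat n)).sub_const (w n)).norm.congr fun k => ?_
    simp [add_comm]
  rw [norm_of_nonneg (negPow_nonneg _ _), norm_sub_rev]
  exact le_of_tendsto h4 (Eventually.of_forall h3)

/-- A convergent solution of a linear recursion with coefficients that are polynomials in `1 / n`. -/
lemma polyApprox_of_recursion {β : ℕ → ℂ} {ℓ : ℂ} (hβ : Tendsto β atTop (𝓝 ℓ))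
    (h : ∀ m, ∃ e : ℂ[X], X ^ 2 ∣ e ∧
      (fun n : ℕ => β (n + 1) - β n - β n * e.eval (n : ℂ)⁻¹) =O[atTop] negPow m) (m : ℕ) :
    PolyApprox m β := by
  induction m with
  | zero =>
    apply PolyApprox.of_isBigO
    rw [negPow_zero]
    exact hβ.isBigO_one ℝ
  | succ m ih =>
    obtain ⟨p, hp⟩ := ih
    obtain ⟨e, he, hβe⟩ := h (m + 2)
    obtain ⟨g, hg⟩ := exists_difference m (q := p * e) (he.mul_left p)
    have h1 := isBigO_mul_negPow hp (eval_inv_isBigO he)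
    have h2 : (fun n : ℕ => (β (n + 1) - g.eval ((n + 1 : ℕ) : ℂ)⁻¹) - (β n - g.eval (n : ℂ)⁻¹))
        =O[atTop] negPow (m + 2) := by
      refine ((hβe.add h1).sub hg).congr_left fun n => ?_
      rw [eval_mul]
      ring
    have h3 := sub_isBigO_of_tendsto (w := fun n => β n - g.eval (n : ℂ)⁻¹)
      (hβ.sub (tendsto_eval_inv g)) h2
    refine ⟨g + C (ℓ - g.eval 0), h3.congr_left fun n => ?_⟩
    rw [eval_add, eval_C]
    ring

/-- The sequence has the full asymptotic expansion `∑ a p / n ^ p`. -/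
def HasExpansion (u a : ℕ → ℂ) : Prop :=
  ∀ m, (fun n => u n - ∑ p ∈ range m, a p * ((n : ℂ)⁻¹) ^ p) =O[atTop] negPow m

lemma eval_sum_monomial (a : ℕ → ℂ) (m : ℕ) (x : ℂ) :
    (∑ p ∈ range m, monomial p (a p)).eval x =
      ∑ p ∈ range m, a p * x ^ p := by
  rw [Polynomial.eval_finsetSum]
  simp only [eval_monomial]

lemma HasExpansion.unique {u a b : ℕ → ℂ} (ha : HasExpansion u a) (hb : HasExpansion u b) :
    a = b := by
  funext p
  have h := (hb (p + 1)).sub (ha (p + 1))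
  have h1 : X ^ (p + 1) ∣ (∑ i ∈ range (p + 1), monomial i (a i) -
      ∑ i ∈ range (p + 1), monomial i (b i)) := by
    apply X_pow_dvd_of_isBigO
    refine h.congr_left fun n => ?_
    rw [eval_sub, eval_sum_monomial, eval_sum_monomial]
    ring
  have h2 := X_pow_dvd_iff.1 h1 p p.lt_succ_self
  simp only [coeff_sub, finsetSum_coeff, coeff_monomial] at h2
  rw [sum_ite_eq', sum_ite_eq', if_pos (Finset.self_mem_range_succ p),
    if_pos (Finset.self_mem_range_succ p)] at h2
  exact sub_eq_zero.1 h2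

lemma exists_hasExpansion {u : ℕ → ℂ} (h : ∀ m, PolyApprox m u) : ∃ a, HasExpansion u a := by
  choose P hP using h
  refine ⟨fun p => (P (p + 1)).coeff p, fun m => ?_⟩
  have h1 : ∀ p < m, (P m).coeff p = (P (p + 1)).coeff p := by
    intro p hp
    have h2 : X ^ (p + 1) ∣ P m - P (p + 1) := by
      apply X_pow_dvd_of_isBigO
      refine ((hP (p + 1)).sub ((hP m).trans (negPow_isBigO hp))).congr_left fun n => ?_
      rw [eval_sub]
      ring
    have h3 := X_pow_dvd_iff.1 h2 p p.lt_succ_self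
    rw [coeff_sub] at h3
    exact sub_eq_zero.1 h3
  have h2 : X ^ m ∣ P m -
      ∑ p ∈ range m, monomial p ((P (p + 1)).coeff p) := by
    rw [X_pow_dvd_iff]
    intro d hd
    rw [coeff_sub, finsetSum_coeff]
    simp only [coeff_monomial]
    rw [sum_ite_eq', if_pos (Finset.mem_range.2 hd), h1 d hd, sub_self]
  refine ((hP m).add (eval_inv_isBigO h2)).congr_left fun n => ?_
  rw [eval_sub, eval_sum_monomial]
  ring

/-- The sequence decreases faster than every power of `n`. -/
def IsRapid (u : ℕ → ℂ) : Prop := ∀ m, u =O[atTop] negPow m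

lemma IsRapid.add {u v : ℕ → ℂ} (hu : IsRapid u) (hv : IsRapid v) :
    IsRapid fun n => u n + v n := fun m => (hu m).add (hv m)

lemma IsRapid.sub {u v : ℕ → ℂ} (hu : IsRapid u) (hv : IsRapid v) :
    IsRapid fun n => u n - v n := fun m => (hu m).sub (hv m)

lemma IsRapid.const_mul {u : ℕ → ℂ} (hu : IsRapid u) (c : ℂ) : IsRapid fun n => c * u n :=
  fun m => (hu m).const_mul_left c

lemma IsRapid.mul {u v : ℕ → ℂ} (hu : IsRapid u) (hv : v =O[atTop] negPow 0) :
    IsRapid fun n => v n * u n := by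
  intro m
  have h := isBigO_mul_negPow hv (hu m)
  rwa [zero_add] at h

lemma IsRapid.congr {u v : ℕ → ℂ} (hu : IsRapid u) (h : ∀ n, u n = v n) : IsRapid v :=
  (funext h : u = v) ▸ hu

lemma isRapid_of_le_pow {u : ℕ → ℂ} {C r : ℝ} (hr0 : 0 ≤ r) (hr : r < 1)
    (h : ∀ n, ‖u n‖ ≤ C * r ^ n) : IsRapid u := by
  intro m
  have h1 := tendsto_pow_const_mul_const_pow_of_abs_lt_one m (r := r) (by rwa [abs_of_nonneg hr0])
  obtain ⟨K, hK⟩ := (h1.isBigO_one ℝ).bound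
  refine IsBigO.of_bound (|C| * K) ?_
  filter_upwards [hK, eventually_ge_atTop 1] with n hn hn1
  have hn0 : (0 : ℝ) < n := by exact_mod_cast hn1
  rw [norm_of_nonneg (by positivity), norm_one, mul_one] at hn
  rw [norm_of_nonneg (negPow_nonneg _ _), negPow]
  have h2 : r ^ n ≤ K * ((n : ℝ) ^ m)⁻¹ := by
    rw [← div_eq_mul_inv, le_div_iff₀ (by positivity)]
    linarith
  calc ‖u n‖ ≤ C * r ^ n := h n
    _ ≤ |C| * r ^ n := by gcongr; exact le_abs_self C
    _ ≤ |C| * (K * ((n : ℝ) ^ m)⁻¹) := by gcongr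
    _ = _ := by ring

lemma HasExpansion.congr_rapid {u v a : ℕ → ℂ} (hu : HasExpansion u a)
    (h : IsRapid fun n => v n - u n) : HasExpansion v a :=
  fun m => ((hu m).add (h m)).congr_left fun n => by ring

lemma HasExpansion.add {u v a b : ℕ → ℂ} (hu : HasExpansion u a) (hv : HasExpansion v b) :
    HasExpansion (fun n => u n + v n) (fun p => a p + b p) :=
  fun m => ((hu m).add (hv m)).congr_left fun n => by
    simp only [add_mul, Finset.sum_add_distrib]
    ring

lemma HasExpansion.const_mul {u a : ℕ → ℂ} (hu : HasExpansion u a) (c : ℂ) :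
    HasExpansion (fun n => c * u n) (fun p => c * a p) :=
  fun m => ((hu m).const_mul_left c).congr_left fun n => by
    simp only [mul_assoc, ← mul_sum]
    ring

lemma HasExpansion.inv_mul {u a : ℕ → ℂ} (hu : HasExpansion u a) :
    HasExpansion (fun n => (n : ℂ)⁻¹ * u n) (fun p => if p = 0 then 0 else a (p - 1)) := by
  intro m
  rcases m with _ | m
  · have h1 := isBigO_mul_negPow inv_isBigO (hu 0)
    refine (h1.trans (negPow_isBigO (by omega))).congr_left fun n => by simp
  · have h1 := isBigO_mul_negPow inv_isBigO (hu m)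
    rw [add_comm 1 m] at h1
    refine h1.congr_left fun n => ?_
    rw [Finset.sum_range_succ', mul_sub, mul_sum]
    simp only [if_true, zero_mul, add_zero]
    congr 1
    refine Finset.sum_congr rfl fun p _ => ?_
    rw [if_neg p.succ_ne_zero, Nat.add_sub_cancel, pow_succ]
    ring

lemma HasExpansion.conj {u a : ℕ → ℂ} (hu : HasExpansion u a) :
    HasExpansion (fun n => starRingEnd ℂ (u n)) (fun p => starRingEnd ℂ (a p)) := by
  intro m
  refine (IsBigO.of_norm_left (g := negPow m) ?_)
  refine (hu m).norm_left.congr_left fun n => ?_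
  rw [← Complex.norm_conj]
  congr 1
  simp [map_sub, map_sum]

lemma HasExpansion.tendsto {u a : ℕ → ℂ} (hu : HasExpansion u a) :
    Tendsto u atTop (𝓝 (a 0)) := by
  have h1 := hu 1
  have h2 : Tendsto (negPow 1) atTop (𝓝 0) := by
    refine (tendsto_inv_atTop_nhds_zero_nat (𝕜 := ℝ)).congr fun n => ?_
    rw [negPow, pow_one]
  have h3 := (h1.trans_tendsto h2).add_const (a 0)
  rw [zero_add] at h3
  refine h3.congr fun n => by simp

end

section

open scoped Real
open Complex (I I_sq exp exp_int_mul exp_ne_zero im_sum norm_I ofReal_ne_zero re_sum)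
open Finset (mul_sum range sum_add_distrib sum_congr sum_div sum_le_sum sum_mul_sum
  sum_sub_distrib)
open Real (cos exp_pos sin sq_sqrt sqrt)
open Topology MeasureTheory

variable {M : Model} {x0 y0 : ℝ}

/-! ### The step polynomial near the saddle point -/

/-- The point of the torus with arguments `p`. -/
def torusPt (x0 y0 : ℝ) (p : ℝ × ℝ) : Fin 2 → ℂ :=
  ![(x0 : ℂ) * exp (I * p.1), (y0 : ℂ) * exp (I * p.2)]

lemma continuous_torusPt (x0 y0 : ℝ) : Continuous (torusPt x0 y0) := by
  refine continuous_pi fun i => ?_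
  fin_cases i
  · change Continuous fun p : ℝ × ℝ => (x0 : ℂ) * exp (I * p.1)
    fun_prop
  · change Continuous fun p : ℝ × ℝ => (y0 : ℂ) * exp (I * p.2)
    fun_prop

lemma torusPt_zero (x0 y0 : ℝ) : torusPt x0 y0 0 = basePt x0 y0 := by
  simp [torusPt, basePt]

lemma torusPt_ne (sp : IsDominantSaddle M x0 y0) (p : ℝ × ℝ) (i : Fin 2) :
    torusPt x0 y0 p i ≠ 0 := by
  fin_cases i
  · exact mul_ne_zero (ofReal_ne_zero.2 sp.1.ne') (exp_ne_zero _)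
  · exact mul_ne_zero (ofReal_ne_zero.2 sp.2.1.ne') (exp_ne_zero _)

/-- The scalar product of a point with a step. -/
def ang (s : ℤ × ℤ) (p : ℝ × ℝ) : ℝ := p.1 * s.1 + p.2 * s.2

/-- The characteristic function of the tilted step distribution. -/
def charFn (M : Model) (x0 y0 : ℝ) (p : ℝ × ℝ) : ℂ :=
  ∑ s ∈ stepBox, (tilt M x0 y0 s : ℂ) * exp (I * ang s p)

lemma continuous_charFn (M : Model) (x0 y0 : ℝ) : Continuous (charFn M x0 y0) := by
  unfold charFn ang
  fun_prop

lemma exp_ang (s : ℤ × ℤ) (p : ℝ × ℝ) : exp (I * ang s p) =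
    exp (I * p.1) ^ s.1 * exp (I * p.2) ^ s.2 := by
  rw [← exp_int_mul, ← exp_int_mul, ← Complex.exp_add, ang]
  congr 1
  push_cast
  ring

lemma ratEval_normStep_torusPt (sp : IsDominantSaddle M x0 y0) (p : ℝ × ℝ) :
    ratEval (torusPt x0 y0 p) (normStep M x0 y0) = charFn M x0 y0 p := by
  rw [ratEval_normStep (torusPt_ne sp p 0) (torusPt_ne sp p 1), stepPoly, sum_div, charFn]
  refine sum_congr rfl fun s _ => ?_
  rw [tilt_ofReal]
  change (M.weight s : ℂ) * ((x0 : ℂ) * exp (I * p.1)) ^ s.1 *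
    ((y0 : ℂ) * exp (I * p.2)) ^ s.2 / _ = _
  rw [exp_ang, mul_zpow, mul_zpow]
  ring

lemma charFn_sq (M : Model) (x0 y0 : ℝ) (p : ℝ × ℝ) : ‖charFn M x0 y0 p‖ ^ 2 =
    ∑ s ∈ stepBox, ∑ s' ∈ stepBox, tilt M x0 y0 s * tilt M x0 y0 s' *
      cos (ang s p - ang s' p) := by
  have hre : (charFn M x0 y0 p).re = ∑ s ∈ stepBox, tilt M x0 y0 s * cos (ang s p) := by
    rw [charFn, re_sum]
    refine sum_congr rfl fun s _ => ?_
    rw [Complex.re_ofReal_mul, mul_comm I, Complex.exp_ofReal_mul_I_re]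
  have him : (charFn M x0 y0 p).im = ∑ s ∈ stepBox, tilt M x0 y0 s * sin (ang s p) := by
    rw [charFn, im_sum]
    refine sum_congr rfl fun s _ => ?_
    rw [Complex.im_ofReal_mul, mul_comm I, Complex.exp_ofReal_mul_I_im]
  rw [Complex.sq_norm, Complex.normSq_apply, hre, him, sum_mul_sum, sum_mul_sum,
    ← sum_add_distrib]
  refine sum_congr rfl fun s _ => ?_
  rw [← sum_add_distrib]
  refine sum_congr rfl fun s' _ => ?_
  rw [Real.cos_sub]
  ring

/-- The quadratic form of the covariance matrix. -/
def quadForm (M : Model) (x0 y0 : ℝ) (p : ℝ × ℝ) : ℝ :=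
  ∑ s ∈ stepBox, tilt M x0 y0 s * ang s p ^ 2

lemma sum_tilt_ang (sp : IsDominantSaddle M x0 y0) (p : ℝ × ℝ) :
    ∑ s ∈ stepBox, tilt M x0 y0 s * ang s p = 0 := by
  have h : ∑ s ∈ stepBox, tilt M x0 y0 s * ang s p = p.1 * ∑ s ∈ stepBox, tilt M x0 y0 s * s.1 +
      p.2 * ∑ s ∈ stepBox, tilt M x0 y0 s * s.2 := by
    rw [mul_sum, mul_sum, ← sum_add_distrib]
    exact sum_congr rfl fun s _ => by rw [ang]; ring
  rw [h, sum_tilt_fst sp, sum_tilt_snd sp]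
  ring

lemma exists_quadForm_ge (sp : IsDominantSaddle M x0 y0) :
    ∃ c : ℝ, 0 < c ∧ ∀ p : ℝ × ℝ, c * (p.1 ^ 2 + p.2 ^ 2) ≤ quadForm M x0 y0 p := by
  have hA := covar_zero_pos sp
  have hD := covar_one_pos sp
  have hdet := covar_det_pos sp
  refine ⟨(covar M x0 y0 0 0 * covar M x0 y0 1 1 - covar M x0 y0 0 1 ^ 2) /
    (covar M x0 y0 0 0 + covar M x0 y0 1 1), by positivity, fun p => ?_⟩
  have h := quadForm_eq M x0 y0 p.1 p.2
  have h2 : quadForm M x0 y0 p = ∑ s ∈ stepBox, tilt M x0 y0 s * (p.1 * s.1 + p.2 * s.2) ^ 2 := rfl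
  rw [h2, h, div_mul_eq_mul_div, div_le_iff₀ (by positivity)]
  nlinarith [sq_nonneg (covar M x0 y0 0 0 * p.1 + covar M x0 y0 0 1 * p.2),
    sq_nonneg (covar M x0 y0 0 1 * p.1 + covar M x0 y0 1 1 * p.2)]

/-- The square with side length `2 δ`. -/
def box (δ : ℝ) : Set (ℝ × ℝ) := Set.Icc (-δ) δ ×ˢ Set.Icc (-δ) δ

lemma isCompact_box (δ : ℝ) : IsCompact (box δ) := isCompact_Icc.prod isCompact_Icc

lemma measurableSet_box (δ : ℝ) : MeasurableSet (box δ) := measurableSet_Icc.prod measurableSet_Icc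

lemma box_subset {δ δ' : ℝ} (h : δ ≤ δ') : box δ ⊆ box δ' :=
  Set.prod_mono (Set.Icc_subset_Icc (by linarith) h) (Set.Icc_subset_Icc (by linarith) h)

lemma mem_box {δ : ℝ} {p : ℝ × ℝ} : p ∈ box δ ↔ |p.1| ≤ δ ∧ |p.2| ≤ δ := by
  rw [box, Set.mem_prod, Set.mem_Icc, Set.mem_Icc, abs_le, abs_le]

lemma exists_charFn_le (sp : IsDominantSaddle M x0 y0) :
    ∃ c : ℝ, 0 < c ∧ ∀ p ∈ box (π / 4),
      ‖charFn M x0 y0 p‖ ≤ Real.exp (-c * (p.1 ^ 2 + p.2 ^ 2)) := by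
  obtain ⟨c, hc, hq⟩ := exists_quadForm_ge sp
  have hπ := Real.pi_pos
  refine ⟨2 / π ^ 2 * c, by positivity, fun p hp => ?_⟩
  have hp' := mem_box.1 hp
  have hang : ∀ s ∈ stepBox, |ang s p| ≤ π / 2 := by
    intro s hs
    rw [mem_stepBox] at hs
    have h1 : |(s.1 : ℝ)| ≤ 1 := by
      rw [abs_le]; exact ⟨by exact_mod_cast hs.1.1, by exact_mod_cast hs.1.2⟩
    have h2 : |(s.2 : ℝ)| ≤ 1 := by
      rw [abs_le]; exact ⟨by exact_mod_cast hs.2.1, by exact_mod_cast hs.2.2⟩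
    calc |ang s p| ≤ |p.1 * s.1| + |p.2 * s.2| := abs_add_le _ _
      _ ≤ π / 4 * 1 + π / 4 * 1 := by
        rw [abs_mul, abs_mul]
        gcongr
        · exact hp'.1
        · exact hp'.2
      _ = _ := by ring
  have h1 : ‖charFn M x0 y0 p‖ ^ 2 ≤ 1 - 4 / π ^ 2 * quadForm M x0 y0 p := by
    rw [charFn_sq]
    calc _ ≤ ∑ s ∈ stepBox, ∑ s' ∈ stepBox, tilt M x0 y0 s * tilt M x0 y0 s' *
          (1 - 2 / π ^ 2 * (ang s p - ang s' p) ^ 2) := by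
          refine sum_le_sum fun s hs => sum_le_sum fun s' hs' => ?_
          refine mul_le_mul_of_nonneg_left ?_ (mul_nonneg (tilt_nonneg sp s) (tilt_nonneg sp s'))
          refine Real.cos_le_one_sub_mul_cos_sq ?_
          have h3 : |ang s p - ang s' p| ≤ |ang s p| + |ang s' p| := by
            rw [sub_eq_add_neg, ← abs_neg (ang s' p)]
            exact abs_add_le _ _
          linarith [hang s hs, hang s' hs']
      _ = (∑ s ∈ stepBox, tilt M x0 y0 s) * (∑ s ∈ stepBox, tilt M x0 y0 s) - 2 / π ^ 2 *
          (quadForm M x0 y0 p * (∑ s ∈ stepBox, tilt M x0 y0 s) -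
            2 * ((∑ s ∈ stepBox, tilt M x0 y0 s * ang s p) *
              (∑ s ∈ stepBox, tilt M x0 y0 s * ang s p)) +
            (∑ s ∈ stepBox, tilt M x0 y0 s) * quadForm M x0 y0 p) := by
          rw [quadForm, sum_mul_sum, sum_mul_sum, sum_mul_sum,
            sum_mul_sum]
          simp only [mul_sum, ← sum_sub_distrib, ← sum_add_distrib]
          refine sum_congr rfl fun s _ => sum_congr rfl fun s' _ => ?_
          ring
      _ = _ := by rw [sum_tilt sp, sum_tilt_ang sp]; ring
  refine le_of_sq_le_sq ?_ (exp_pos _).le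
  rw [← Real.exp_nat_mul]
  refine h1.trans ?_
  have h2 := Real.add_one_le_exp (-(4 / π ^ 2 * quadForm M x0 y0 p))
  refine (by linarith : 1 - 4 / π ^ 2 * quadForm M x0 y0 p ≤ _).trans
    (h2.trans (Real.exp_le_exp.2 ?_))
  have h3 : 4 / π ^ 2 * (c * (p.1 ^ 2 + p.2 ^ 2)) ≤ 4 / π ^ 2 * quadForm M x0 y0 p := by
    gcongr
    exact hq p
  have h4 : ((2 : ℕ) : ℝ) * (-(2 / π ^ 2 * c) * (p.1 ^ 2 + p.2 ^ 2)) =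
      -(4 / π ^ 2 * (c * (p.1 ^ 2 + p.2 ^ 2))) := by
    push_cast
    ring
  rw [h4]
  exact neg_le_neg h3

lemma integrable_exp_neg_sq {c : ℝ} (hc : 0 < c) :
    Integrable fun p : ℝ × ℝ => Real.exp (-c * (p.1 ^ 2 + p.2 ^ 2)) := by
  have h := (integrable_exp_neg_mul_sq hc).mul_prod (integrable_exp_neg_mul_sq hc)
  refine h.congr (Eventually.of_forall fun p => ?_)
  simp only
  rw [← Real.exp_add]
  congr 1
  ring

lemma exp_sub_tendsto (a : ℝ) : Tendsto (fun n : ℕ => (n : ℂ) *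
    (exp (I * ((sqrt n)⁻¹ * a : ℝ)) - 1 -
      I * ((sqrt n)⁻¹ * a : ℝ))) atTop (𝓝 (-(a ^ 2 / 2 : ℝ))) := by
  have hs : Tendsto (fun n : ℕ => (sqrt n)⁻¹) atTop (𝓝 0) :=
    (Real.tendsto_sqrt_atTop.comp tendsto_natCast_atTop_atTop).inv_tendsto_atTop
  have h1 : Tendsto (fun n : ℕ => |a| ^ 3 * (sqrt n)⁻¹) atTop (𝓝 0) := by
    simpa using hs.const_mul (|a| ^ 3)
  rw [tendsto_iff_norm_sub_tendsto_zero]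
  refine squeeze_zero' (Eventually.of_forall fun n => norm_nonneg _) ?_ h1
  have h2 : Tendsto (fun n : ℕ => |(sqrt n)⁻¹ * a|) atTop (𝓝 0) := by
    simpa using (hs.mul_const a).abs
  filter_upwards [h2.eventually (ge_mem_nhds zero_lt_one), eventually_ge_atTop 1] with n hn hn1
  have hn0 : (0 : ℝ) < n := by exact_mod_cast hn1
  have hsq : sqrt n * sqrt n = n := Real.mul_self_sqrt hn0.le
  have hsp : 0 < sqrt n := Real.sqrt_pos.2 hn0
  set z : ℂ := I * ((sqrt n)⁻¹ * a : ℝ) with hz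
  have hzn : ‖z‖ = |(sqrt n)⁻¹ * a| := by
    rw [hz, norm_mul, norm_I, one_mul, Complex.norm_real, Real.norm_eq_abs]
  have h3 := Complex.exp_bound (x := z) (by rw [hzn]; exact hn) (n := 3) (by norm_num)
  have h4 : (n : ℂ) * (exp z - 1 - z) - (-(a ^ 2 / 2 : ℝ)) =
      n * (exp z - ∑ m ∈ range 3, z ^ m / m.factorial) := by
    have h5 : (n : ℂ) * z ^ 2 = -(a : ℂ) ^ 2 := by
      have h6 : (sqrt n : ℂ) * (sqrt n : ℂ) = n := by exact_mod_cast hsq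
      have h7 : (sqrt n : ℂ) ≠ 0 := ofReal_ne_zero.2 hsp.ne'
      rw [hz]
      push_cast
      rw [← h6]
      field_simp
      rw [I_sq]
      ring
    simp only [Finset.sum_range_succ, Finset.sum_range_zero, Nat.factorial]
    push_cast
    linear_combination (1 / 2 : ℂ) * h5
  rw [h4, norm_mul, Complex.norm_natCast]
  calc (n : ℝ) * ‖exp z - ∑ m ∈ range 3, z ^ m / m.factorial‖
      ≤ n * (‖z‖ ^ 3 * 1) := by
        gcongr
        refine h3.trans ?_
        gcongr
        norm_num [Nat.factorial]
    _ = |a| ^ 3 * (sqrt n)⁻¹ := by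
        rw [hzn, abs_mul, abs_of_pos (inv_pos.2 hsp)]
        nth_rewrite 1 [← hsq]
        field_simp

/-- The leading term of the Gaussian integral. -/
lemma exists_tendsto_integral_charFn (sp : IsDominantSaddle M x0 y0) :
    ∃ ℓ : ℂ, ℓ ≠ 0 ∧ Tendsto (fun n : ℕ => (n : ℂ) * ∫ p in box (π / 4), charFn M x0 y0 p ^ n)
      atTop (𝓝 ℓ) := by
  obtain ⟨c, hc, hq⟩ := exists_quadForm_ge sp
  obtain ⟨c', hc', hle⟩ := exists_charFn_le sp
  have hang : ∀ s (R : ℝ) (p : ℝ × ℝ), ang s (R • p) = R * ang s p := by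
    intro s R p
    simp only [ang, Prod.smul_fst, Prod.smul_snd, smul_eq_mul]
    ring
  have hqint : Integrable fun p : ℝ × ℝ => Real.exp (-(quadForm M x0 y0 p) / 2) := by
    refine (integrable_exp_neg_sq (half_pos hc)).mono' ?_ (Eventually.of_forall fun p => ?_)
    · refine Continuous.aestronglyMeasurable ?_
      unfold quadForm ang
      fun_prop
    · rw [Real.norm_of_nonneg (exp_pos _).le]
      refine Real.exp_le_exp.2 ?_
      linarith [hq p]
  refine ⟨((∫ p : ℝ × ℝ, Real.exp (-(quadForm M x0 y0 p) / 2) : ℝ) : ℂ),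
    ofReal_ne_zero.2 (integral_exp_pos hqint).ne', ?_⟩
  set F : ℕ → ℝ × ℝ → ℂ := fun n => (box (π / 4)).indicator fun p => charFn M x0 y0 p ^ n with hF
  have hscale : ∀ n : ℕ, 1 ≤ n → (n : ℂ) * ∫ p in box (π / 4), charFn M x0 y0 p ^ n =
      ∫ p : ℝ × ℝ, F n ((sqrt n)⁻¹ • p) := by
    intro n hn
    have hn0 : (0 : ℝ) < n := by exact_mod_cast hn
    rw [Measure.integral_comp_smul, hF]
    simp only
    rw [integral_indicator (measurableSet_box _), Module.finrank_prod, Module.finrank_self,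
      inv_pow, inv_inv, sq_sqrt hn0.le, abs_of_pos hn0, Complex.real_smul]
    simp
  have hdom : Tendsto (fun n : ℕ => ∫ p : ℝ × ℝ, F n ((sqrt n)⁻¹ • p)) atTop
      (𝓝 (∫ p : ℝ × ℝ, ((Real.exp (-(quadForm M x0 y0 p) / 2) : ℝ) : ℂ))) := by
    refine tendsto_integral_filter_of_dominated_convergence
      (fun p : ℝ × ℝ => Real.exp (-c' * (p.1 ^ 2 + p.2 ^ 2))) ?_ ?_ (integrable_exp_neg_sq hc') ?_
    · refine Eventually.of_forall fun n => ?_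
      have h1 : Measurable (F n) :=
        (((continuous_charFn M x0 y0).pow n).measurable).indicator (measurableSet_box _)
      exact (h1.comp (measurable_const_smul _)).aestronglyMeasurable
    · filter_upwards [eventually_ge_atTop 1] with n hn
      have hn0 : (0 : ℝ) < n := by exact_mod_cast hn
      refine Eventually.of_forall fun p => ?_
      simp only [hF]
      by_cases hp : (sqrt n)⁻¹ • p ∈ box (π / 4)
      · rw [Set.indicator_of_mem hp, norm_pow]
        refine (pow_le_pow_left₀ (norm_nonneg _) (hle _ hp) n).trans (le_of_eq ?_)
        rw [← Real.exp_nat_mul]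
        congr 1
        simp only [Prod.smul_fst, Prod.smul_snd, smul_eq_mul, mul_pow, inv_pow]
        rw [sq_sqrt hn0.le]
        field_simp
      · rw [Set.indicator_of_notMem hp, norm_zero]
        exact (exp_pos _).le
    · refine Eventually.of_forall fun p => ?_
      have hs : Tendsto (fun n : ℕ => (sqrt n)⁻¹) atTop (𝓝 0) :=
        (Real.tendsto_sqrt_atTop.comp tendsto_natCast_atTop_atTop).inv_tendsto_atTop
      have hin : ∀ᶠ n : ℕ in atTop, (sqrt n)⁻¹ • p ∈ box (π / 4) := by
        have hπ : (0 : ℝ) < π / 4 := by positivity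
        have h1 : Tendsto (fun n : ℕ => |(sqrt n)⁻¹ * p.1|) atTop (𝓝 0) := by
          simpa using (hs.mul_const p.1).abs
        have h2 : Tendsto (fun n : ℕ => |(sqrt n)⁻¹ * p.2|) atTop (𝓝 0) := by
          simpa using (hs.mul_const p.2).abs
        filter_upwards [h1.eventually (ge_mem_nhds hπ), h2.eventually (ge_mem_nhds hπ)] with n a b
        exact mem_box.2 ⟨a, b⟩
      have hlim : Tendsto (fun n : ℕ => (n : ℂ) * (charFn M x0 y0 ((sqrt n)⁻¹ • p) - 1)) atTop
          (𝓝 (-(quadForm M x0 y0 p) / 2 : ℝ)) := by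
        have h1 : ∀ n : ℕ, (n : ℂ) * (charFn M x0 y0 ((sqrt n)⁻¹ • p) - 1) =
            ∑ s ∈ stepBox, (tilt M x0 y0 s : ℂ) * ((n : ℂ) *
              (exp (I * ((sqrt n)⁻¹ * ang s p : ℝ)) - 1 -
                I * ((sqrt n)⁻¹ * ang s p : ℝ))) := by
          intro n
          have e1 : ∑ s ∈ stepBox, (tilt M x0 y0 s : ℂ) = 1 := by exact_mod_cast sum_tilt sp
          have e2 : ∑ s ∈ stepBox, (tilt M x0 y0 s : ℂ) * (ang s p : ℂ) = 0 := by
            exact_mod_cast sum_tilt_ang sp p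
          have e3 : ∀ s ∈ stepBox, (tilt M x0 y0 s : ℂ) * ((n : ℂ) *
              (exp (I * ((sqrt n)⁻¹ * ang s p : ℝ)) - 1 -
                I * ((sqrt n)⁻¹ * ang s p : ℝ))) =
              n * ((tilt M x0 y0 s : ℂ) * exp (I * ((sqrt n)⁻¹ * ang s p : ℝ))) -
              n * (tilt M x0 y0 s : ℂ) - n * (I * ((sqrt n)⁻¹ : ℝ)) *
                ((tilt M x0 y0 s : ℂ) * (ang s p : ℂ)) := by
            intro s _
            push_cast
            ring
          rw [sum_congr rfl e3, sum_sub_distrib, sum_sub_distrib,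
            ← mul_sum, ← mul_sum, ← mul_sum, e1, e2, charFn]
          simp only [hang]
          ring
        have h2 : ((-(quadForm M x0 y0 p) / 2 : ℝ) : ℂ) =
            ∑ s ∈ stepBox, (tilt M x0 y0 s : ℂ) * (-(ang s p ^ 2 / 2 : ℝ)) := by
          rw [quadForm]
          push_cast
          rw [← Finset.sum_neg_distrib, sum_div]
          exact sum_congr rfl fun s _ => by ring
        rw [h2]
        simp only [h1]
        exact tendsto_finsetSum _ fun s _ => (exp_sub_tendsto (ang s p)).const_mul _
      have h3 := Complex.tendsto_one_add_pow_exp_of_tendsto hlim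
      rw [← Complex.ofReal_exp] at h3
      refine h3.congr' ?_
      filter_upwards [hin] with n hn
      simp only [hF]
      rw [Set.indicator_of_mem hn]
      congr 1
      ring
  have hreal : ∫ p : ℝ × ℝ, ((Real.exp (-(quadForm M x0 y0 p) / 2) : ℝ) : ℂ) =
      ((∫ p : ℝ × ℝ, Real.exp (-(quadForm M x0 y0 p) / 2) : ℝ) : ℂ) := integral_ofReal
  rw [hreal] at hdom
  refine hdom.congr' ?_
  filter_upwards [eventually_ge_atTop 1] with n hn
  exact (hscale n hn).symm

end

section

open scoped Real
open Complex (I exp norm_I)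
open Set (Icc)
open Topology MeasureTheory

variable {M : Model} {x0 y0 : ℝ}

/-! ### Integrals over small squares around the saddle point -/

lemma isRapid_setIntegral {X : Type*} [MeasurableSpace X] {μ : Measure X} {K : Set X}
    (hμ : μ K < ⊤) {s g : X → ℂ} {r C : ℝ} (hr0 : 0 ≤ r) (hr : r < 1) (hs : ∀ p ∈ K, ‖s p‖ ≤ r)
    (hg : ∀ p ∈ K, ‖g p‖ ≤ C) : IsRapid fun n => ∫ p in K, s p ^ n * g p ∂μ := by
  refine isRapid_of_le_pow (C := C * μ.real K) hr0 hr fun n => ?_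
  refine (norm_setIntegral_le_of_norm_le_const (C := r ^ n * C) hμ fun p hp => ?_).trans
    (le_of_eq (by ring))
  rw [norm_mul, norm_pow]
  exact mul_le_mul (pow_le_pow_left₀ (norm_nonneg _) (hs p hp) n) (hg p hp) (norm_nonneg _)
    (pow_nonneg hr0 n)

/-- A square on which the integrals of the rational function `f` are considered. -/
structure IsGoodBox (x0 y0 : ℝ) (f : RatXY) (δ : ℝ) : Prop where
  pos : 0 < δ
  le : δ ≤ π / 4
  regular : ∀ p ∈ box δ, IsReg (torusPt x0 y0 p) f

lemma IsGoodBox.mono {f : RatXY} {δ δ' : ℝ} (h : IsGoodBox x0 y0 f δ) (hpos : 0 < δ')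
    (hle : δ' ≤ δ) : IsGoodBox x0 y0 f δ' :=
  ⟨hpos, hle.trans h.le, fun p hp => h.regular p (box_subset hle hp)⟩

lemma exists_box_subset {U : Set (ℝ × ℝ)} (hU : U ∈ 𝓝 (0 : ℝ × ℝ)) :
    ∃ δ : ℝ, 0 < δ ∧ δ ≤ π / 4 ∧ box δ ⊆ U := by
  obtain ⟨ε, hε, h⟩ := Metric.nhds_basis_closedBall.mem_iff.1 hU
  refine ⟨min ε (π / 4), lt_min hε (by positivity), min_le_right _ _, fun p hp => h ?_⟩
  have hp' := mem_box.1 hp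
  rw [mem_closedBall_zero_iff, Prod.norm_def]
  exact max_le (hp'.1.trans (min_le_left _ _)) (hp'.2.trans (min_le_left _ _))

lemma continuous_eval_torusPt (x0 y0 : ℝ) (d : PolyXY) :
    Continuous fun p => MvPolynomial.eval (torusPt x0 y0 p) d :=
  (MvPolynomial.continuous_eval d).comp (continuous_torusPt x0 y0)

lemma exists_isGoodBox {f : RatXY} (hf : IsReg (basePt x0 y0) f) :
    ∃ δ, IsGoodBox x0 y0 f δ := by
  have h1 : {p | MvPolynomial.eval (torusPt x0 y0 p) (ratDen f) ≠ 0} ∈ 𝓝 (0 : ℝ × ℝ) := by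
    refine (continuous_eval_torusPt x0 y0 (ratDen f)).continuousAt.eventually_ne ?_
    rw [torusPt_zero]
    exact hf
  obtain ⟨δ, h0, hle, h⟩ := exists_box_subset h1
  exact ⟨δ, h0, hle, fun p hp => h hp⟩

lemma IsGoodBox.continuousOn {f : RatXY} {δ : ℝ} (h : IsGoodBox x0 y0 f δ) :
    ContinuousOn (fun p => ratEval (torusPt x0 y0 p) f) (box δ) :=
  (continuous_eval_torusPt x0 y0 _).continuousOn.div (continuous_eval_torusPt x0 y0 _).continuousOn
    h.regular

/-- The integral of `s ^ n f` over a square around the saddle point. -/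
def boxInt (M : Model) (x0 y0 δ : ℝ) (f : RatXY) (n : ℕ) : ℂ :=
  ∫ p in box δ, charFn M x0 y0 p ^ n * ratEval (torusPt x0 y0 p) f

lemma IsGoodBox.integrableOn {f : RatXY} {δ : ℝ} (h : IsGoodBox x0 y0 f δ) (M : Model) (n : ℕ) :
    IntegrableOn (fun p => charFn M x0 y0 p ^ n * ratEval (torusPt x0 y0 p) f) (box δ) :=
  (((continuous_charFn M x0 y0).pow n).continuousOn.mul h.continuousOn).integrableOn_compact
    (isCompact_box δ)

lemma exists_charFn_le_of_notMem (sp : IsDominantSaddle M x0 y0) {δ : ℝ} (hδ : 0 < δ) :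
    ∃ r : ℝ, 0 ≤ r ∧ r < 1 ∧ ∀ p ∈ box (π / 4), δ ≤ |p.1| ∨ δ ≤ |p.2| →
      ‖charFn M x0 y0 p‖ ≤ r := by
  obtain ⟨c, hc, h⟩ := exists_charFn_le sp
  refine ⟨Real.exp (-c * δ ^ 2), (Real.exp_pos _).le, Real.exp_lt_one_iff.2 ?_, fun p hp hp' =>
    (h p hp).trans (Real.exp_le_exp.2 ?_)⟩
  · have : 0 < c * δ ^ 2 := by positivity
    linarith
  · have h1 : δ ^ 2 ≤ p.1 ^ 2 + p.2 ^ 2 := by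
      rcases hp' with h2 | h2
      · have h3 := pow_le_pow_left₀ hδ.le h2 2
        rw [sq_abs] at h3
        linarith [sq_nonneg p.2]
      · have h3 := pow_le_pow_left₀ hδ.le h2 2
        rw [sq_abs] at h3
        linarith [sq_nonneg p.1]
    have h4 := mul_le_mul_of_nonneg_left h1 hc.le
    linarith

lemma IsGoodBox.isRapid_sub {f : RatXY} {δ δ' : ℝ} (h : IsGoodBox x0 y0 f δ)
    (h' : IsGoodBox x0 y0 f δ') (sp : IsDominantSaddle M x0 y0) :
    IsRapid fun n => boxInt M x0 y0 δ f n - boxInt M x0 y0 δ' f n := by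
  have key : ∀ {δ δ' : ℝ}, IsGoodBox x0 y0 f δ → IsGoodBox x0 y0 f δ' → δ' ≤ δ →
      IsRapid fun n => boxInt M x0 y0 δ f n - boxInt M x0 y0 δ' f n := by
    intro δ δ' h h' hle
    obtain ⟨r, hr0, hr, hs⟩ := exists_charFn_le_of_notMem sp h'.pos
    obtain ⟨C, hC⟩ := (isCompact_box δ).exists_bound_of_continuousOn h.continuousOn
    refine (isRapid_setIntegral (K := box δ \ box δ') (μ := volume) (s := charFn M x0 y0)
      (g := fun p => ratEval (torusPt x0 y0 p) f) (r := r) (C := C)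
      ((measure_mono Set.sdiff_subset).trans_lt (isCompact_box δ).measure_lt_top) hr0 hr ?_
      (fun p hp => hC p hp.1)).congr fun n => ?_
    · intro p hp
      refine hs p (box_subset h.le hp.1) ?_
      by_contra hcon
      push Not at hcon
      exact hp.2 (mem_box.2 ⟨hcon.1.le, hcon.2.le⟩)
    · exact setIntegral_sdiff (measurableSet_box δ') (h.integrableOn M n) (box_subset hle)
  rcases le_total δ' δ with hle | hle
  · exact key h h' hle
  · refine ((key h' h hle).const_mul (-1)).congr fun n => ?_
    ring

/-- The size of a square around the saddle point for the function `f`. -/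
def goodSize (x0 y0 : ℝ) (f : RatXY) : ℝ := Classical.epsilon fun δ => IsGoodBox x0 y0 f δ

lemma isGoodBox_goodSize {f : RatXY} (hf : IsReg (basePt x0 y0) f) :
    IsGoodBox x0 y0 f (goodSize x0 y0 f) := Classical.epsilon_spec (exists_isGoodBox hf)

/-- The integral of `s ^ n f` near the saddle point, up to rapidly decreasing sequences. -/
def localInt (M : Model) (x0 y0 : ℝ) (f : RatXY) (n : ℕ) : ℂ :=
  boxInt M x0 y0 (goodSize x0 y0 f) f n

lemma IsGoodBox.isRapid_localInt {f : RatXY} {δ : ℝ} (h : IsGoodBox x0 y0 f δ)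
    (hf : IsReg (basePt x0 y0) f) (sp : IsDominantSaddle M x0 y0) :
    IsRapid fun n => localInt M x0 y0 f n - boxInt M x0 y0 δ f n :=
  (isGoodBox_goodSize hf).isRapid_sub h sp

lemma exists_common_isGoodBox {f g : RatXY} (hf : IsReg (basePt x0 y0) f)
    (hg : IsReg (basePt x0 y0) g) : ∃ δ, IsGoodBox x0 y0 f δ ∧ IsGoodBox x0 y0 g δ := by
  obtain ⟨δ, h⟩ := exists_isGoodBox hf
  obtain ⟨δ', h'⟩ := exists_isGoodBox hg
  have h1 : 0 < min δ δ' := lt_min h.pos h'.pos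
  exact ⟨min δ δ', h.mono h1 (min_le_left _ _), h'.mono h1 (min_le_right _ _)⟩

lemma isRapid_localInt_add (sp : IsDominantSaddle M x0 y0) {f g : RatXY}
    (hf : IsReg (basePt x0 y0) f) (hg : IsReg (basePt x0 y0) g) :
    IsRapid fun n => localInt M x0 y0 (f + g) n -
      (localInt M x0 y0 f n + localInt M x0 y0 g n) := by
  obtain ⟨δ, h1, h2⟩ := exists_common_isGoodBox hf hg
  have h3 : IsGoodBox x0 y0 (f + g) δ :=
    ⟨h1.pos, h1.le, fun p hp => (h1.regular p hp).add (h2.regular p hp)⟩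
  refine (((h3.isRapid_localInt (hf.add hg) sp).sub (h1.isRapid_localInt hf sp)).sub
    (h2.isRapid_localInt hg sp)).congr fun n => ?_
  have h4 : boxInt M x0 y0 δ (f + g) n = boxInt M x0 y0 δ f n + boxInt M x0 y0 δ g n := by
    rw [boxInt, boxInt, boxInt, ← integral_add (h1.integrableOn M n) (h2.integrableOn M n)]
    refine setIntegral_congr_fun (measurableSet_box δ) fun p hp => ?_
    rw [ratEval_add (h1.regular p hp) (h2.regular p hp), mul_add]
  rw [h4]
  ring

lemma isRapid_localInt_smul (sp : IsDominantSaddle M x0 y0) {f : RatXY}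
    (hf : IsReg (basePt x0 y0) f) (c : ℂ) :
    IsRapid fun n => localInt M x0 y0 (c • f) n - c * localInt M x0 y0 f n := by
  obtain ⟨δ, h1⟩ := exists_isGoodBox hf
  have h3 : IsGoodBox x0 y0 (c • f) δ := ⟨h1.pos, h1.le, fun p hp => (h1.regular p hp).smul c⟩
  refine ((h3.isRapid_localInt (hf.smul c) sp).sub
    ((h1.isRapid_localInt hf sp).const_mul c)).congr fun n => ?_
  have h4 : boxInt M x0 y0 δ (c • f) n = c * boxInt M x0 y0 δ f n := by
    rw [boxInt, boxInt, ← integral_const_mul]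
    refine setIntegral_congr_fun (measurableSet_box δ) fun p hp => ?_
    rw [ratEval_smul (h1.regular p hp)]
    ring
  rw [h4]
  ring

lemma localInt_isBigO (sp : IsDominantSaddle M x0 y0) {f : RatXY}
    (hf : IsReg (basePt x0 y0) f) : localInt M x0 y0 f =O[atTop] negPow 0 := by
  obtain ⟨c, hc, h⟩ := exists_charFn_le sp
  have hg := isGoodBox_goodSize hf
  obtain ⟨C, hC⟩ := (isCompact_box _).exists_bound_of_continuousOn hg.continuousOn
  rw [negPow_zero]
  refine IsBigO.of_bound (C * volume.real (box (goodSize x0 y0 f))) (Eventually.of_forall fun n => ?_)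
  rw [norm_one, mul_one]
  refine norm_setIntegral_le_of_norm_le_const (isCompact_box _).measure_lt_top fun p hp => ?_
  have h1 : ‖charFn M x0 y0 p‖ ≤ 1 := by
    refine (h p (box_subset hg.le hp)).trans (Real.exp_le_one_iff.2 ?_)
    have : 0 ≤ c * (p.1 ^ 2 + p.2 ^ 2) := by positivity
    linarith
  rw [norm_mul, norm_pow]
  calc _ ≤ 1 * C := mul_le_mul (pow_le_one₀ (norm_nonneg _) h1) (hC p hp) (norm_nonneg _) zero_le_one
    _ = C := one_mul C

/-! ### Integration by parts -/

lemma hasDerivAt_torusPt (i : Fin 2) (t u : ℝ) {f : RatXY}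
    (a : ℝ → ℝ × ℝ) (ha : a = if i = 0 then fun t => (t, u) else fun t => (u, t))
    (hf : IsReg (torusPt x0 y0 (a t)) f) :
    HasDerivAt (fun t => ratEval (torusPt x0 y0 (a t)) f)
      (I * ratEval (torusPt x0 y0 (a t)) (euler i f)) t := by
  have hexp : ∀ z : ℂ, HasDerivAt (fun t : ℝ => z * exp (I * t))
      (I * (z * exp (I * t))) t := by
    intro z
    have h1 : HasDerivAt (fun t : ℝ => I * (t : ℂ)) I t := by
      simpa using (Complex.ofRealCLM.hasDerivAt (x := t)).const_mul I
    refine ((h1.cexp).const_mul z).congr_deriv ?_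
    ring
  have key := hasDerivAt_ratEval (a := fun t => torusPt x0 y0 (a t))
    (c := fun j => if j = i then I else 0) (t := t) (f := f) ?_ hf
  · convert key using 1
    fin_cases i <;> simp
  · subst ha
    intro j
    fin_cases i <;> fin_cases j <;> simp only [torusPt]
    · simpa using hexp x0
    · simpa using hasDerivAt_const t ((y0 : ℂ) * exp (I * u))
    · simpa using hasDerivAt_const t ((x0 : ℂ) * exp (I * u))
    · simpa using hexp y0

lemma integral_euler_line (i : Fin 2) (u : ℝ) {f : RatXY} {δ : ℝ}
    (hδ : 0 < δ) (a : ℝ → ℝ × ℝ) (ha : a = if i = 0 then fun t => (t, u) else fun t => (u, t))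
    (hf : ∀ t ∈ Icc (-δ) δ, IsReg (torusPt x0 y0 (a t)) f) :
    I * ∫ t in Icc (-δ) δ, ratEval (torusPt x0 y0 (a t)) (euler i f) =
      ratEval (torusPt x0 y0 (a δ)) f - ratEval (torusPt x0 y0 (a (-δ))) f := by
  have hac : Continuous a := by
    subst ha
    split_ifs <;> fun_prop
  have hcont : ContinuousOn (fun t => ratEval (torusPt x0 y0 (a t)) (euler i f))
      (Icc (-δ) δ) :=
    (((continuous_eval_torusPt x0 y0 _).comp hac).continuousOn).div
      (((continuous_eval_torusPt x0 y0 _).comp hac).continuousOn)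
      fun t ht => isReg_euler (hf t ht) i
  have hle : -δ ≤ δ := by linarith
  rw [integral_Icc_eq_integral_Ioc, ← intervalIntegral.integral_of_le hle,
    ← intervalIntegral.integral_const_mul]
  refine intervalIntegral.integral_eq_sub_of_hasDerivAt (f := fun t => ratEval (torusPt x0 y0 (a t)) f)
    (fun t ht => ?_) ?_
  · rw [Set.uIcc_of_le hle] at ht
    exact hasDerivAt_torusPt i t u a ha (hf t ht)
  · refine ContinuousOn.intervalIntegrable ?_
    rw [Set.uIcc_of_le hle]
    exact continuousOn_const.mul hcont

lemma setIntegral_box {F : ℝ × ℝ → ℂ} {δ : ℝ} (hF : ContinuousOn F (box δ)) (i : Fin 2) :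
    ∫ p in box δ, F p = ∫ u in Icc (-δ) δ, ∫ t in Icc (-δ) δ,
      F ((if i = 0 then fun t => (t, u) else fun t => (u, t) : ℝ → ℝ × ℝ) t) := by
  have hint : IntegrableOn F (Icc (-δ) δ ×ˢ Icc (-δ) δ) (volume.prod volume) :=
    hF.integrableOn_compact (isCompact_box δ)
  have h1 : ∫ p in box δ, F p = ∫ p in Icc (-δ) δ ×ˢ Icc (-δ) δ, F p ∂(volume.prod volume) :=
    rfl
  fin_cases i
  · rw [h1, ← Measure.prod_restrict, integral_prod_symm]
    · rfl
    · rw [Measure.prod_restrict]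
      exact hint
  · rw [h1, setIntegral_prod _ hint]
    rfl

lemma isRapid_integral_euler (sp : IsDominantSaddle M x0 y0) (i : Fin 2) {f : RatXY} {δ : ℝ}
    (h : IsGoodBox x0 y0 f δ) : IsRapid fun n =>
      ∫ p in box δ, ratEval (torusPt x0 y0 p) (euler i (normStep M x0 y0 ^ n * f)) := by
  obtain ⟨r, hr0, hr, hs⟩ := exists_charFn_le_of_notMem sp h.pos
  obtain ⟨C, hC⟩ := (isCompact_box δ).exists_bound_of_continuousOn h.continuousOn
  have hreg : ∀ n, ∀ p ∈ box δ, IsReg (torusPt x0 y0 p) (normStep M x0 y0 ^ n * f) :=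
    fun n p hp => ((isReg_normStep (torusPt_ne sp p 0) (torusPt_ne sp p 1)).pow n).mul
      (h.regular p hp)
  have hval : ∀ n, ∀ p ∈ box δ, δ ≤ |p.1| ∨ δ ≤ |p.2| →
      ‖ratEval (torusPt x0 y0 p) (normStep M x0 y0 ^ n * f)‖ ≤ r ^ n * C := by
    intro n p hp hp'
    have hN := isReg_normStep (M := M) (x0 := x0) (y0 := y0) (torusPt_ne sp p 0)
      (torusPt_ne sp p 1)
    rw [ratEval_mul (hN.pow n) (h.regular p hp), ratEval_pow hN, ratEval_normStep_torusPt sp,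
      norm_mul, norm_pow]
    exact mul_le_mul (pow_le_pow_left₀ (norm_nonneg _) (hs p (box_subset h.le hp) hp') n) (hC p hp)
      (norm_nonneg _) (pow_nonneg hr0 n)
  refine isRapid_of_le_pow (C := 2 * C * volume.real (Icc (-δ) δ)) hr0 hr fun n => ?_
  have hg : IsGoodBox x0 y0 (euler i (normStep M x0 y0 ^ n * f)) δ :=
    ⟨h.pos, h.le, fun p hp => isReg_euler (hreg n p hp) i⟩
  rw [setIntegral_box hg.continuousOn i]
  refine (norm_setIntegral_le_of_norm_le_const (C := r ^ n * (2 * C)) isCompact_Icc.measure_lt_top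
    fun u hu => ?_).trans (le_of_eq (by ring))
  set a : ℝ → ℝ × ℝ := if i = 0 then fun t => (t, u) else fun t => (u, t) with ha
  have hmem : ∀ t ∈ Icc (-δ) δ, a t ∈ box δ := by
    intro t ht
    rw [ha]
    split_ifs
    exacts [⟨ht, hu⟩, ⟨hu, ht⟩]
  have hpos := h.pos
  have hend : ∀ t, |t| = δ → ‖ratEval (torusPt x0 y0 (a t)) (normStep M x0 y0 ^ n * f)‖ ≤ r ^ n * C := by
    intro t ht
    refine hval n _ (hmem t (abs_le.1 ht.le)) ?_
    rw [ha]
    split_ifs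
    exacts [Or.inl ht.ge, Or.inr ht.ge]
  have h1 := integral_euler_line i u hpos a ha fun t ht => hreg n _ (hmem t ht)
  have h2 : ‖∫ t in Icc (-δ) δ, ratEval (torusPt x0 y0 (a t))
      (euler i (normStep M x0 y0 ^ n * f))‖ = ‖I * ∫ t in Icc (-δ) δ,
        ratEval (torusPt x0 y0 (a t)) (euler i (normStep M x0 y0 ^ n * f))‖ := by
    rw [norm_mul, norm_I, one_mul]
  rw [h2, h1]
  refine (norm_sub_le _ _).trans ?_
  have h3 := hend δ (abs_of_pos hpos)
  have h4 := hend (-δ) (by rw [abs_neg, abs_of_pos hpos])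
  linarith

lemma normStep_ne_zero (sp : IsDominantSaddle M x0 y0) : normStep M x0 y0 ≠ 0 := by
  intro h
  have h1 := ratEval_normStep_basePt sp
  rw [h] at h1
  have h2 := ratEval_smul (isReg_one (basePt x0 y0)) 0
  rw [zero_smul, zero_mul] at h2
  rw [h2] at h1
  exact zero_ne_one h1

lemma euler_normStep_pow_mul (sp : IsDominantSaddle M x0 y0) (i : Fin 2) (f : RatXY) (n : ℕ) :
    euler i (normStep M x0 y0 ^ n * f) = normStep M x0 y0 ^ n * (euler i f) +
      (n : ℂ) • (normStep M x0 y0 ^ n * (f * logStep M x0 y0 i)) := by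
  have hs := normStep_ne_zero sp
  have h1 : (n : ℕ) • normStep M x0 y0 ^ (n - 1) * euler i (normStep M x0 y0) =
      (n : ℂ) • (normStep M x0 y0 ^ n * logStep M x0 y0 i) := by
    rw [Nat.cast_smul_eq_nsmul]
    rcases n with _ | n
    · simp
    · rw [smul_mul_assoc, Nat.add_sub_cancel, logStep, pow_succ, mul_assoc, mul_inv_cancel_left₀ hs]
  rw [Derivation.leibniz, Derivation.leibniz_pow, smul_eq_mul, smul_eq_mul, smul_eq_mul,
    ← smul_mul_assoc, h1, mul_smul_comm]
  congr 2
  ring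

lemma isRapid_localInt_euler (sp : IsDominantSaddle M x0 y0) (i : Fin 2) {f : RatXY}
    (hf : IsReg (basePt x0 y0) f) :
    IsRapid fun n => localInt M x0 y0 (f * logStep M x0 y0 i) n +
      (n : ℂ)⁻¹ * localInt M x0 y0 (euler i f) n := by
  have hψ : IsReg (basePt x0 y0) (logStep M x0 y0 i) :=
    isReg_of_mem_vanish (logStep_mem sp i)
  obtain ⟨δ₁, h1⟩ := exists_isGoodBox hf
  obtain ⟨δ₂, h2⟩ := exists_isGoodBox (hf.mul hψ)
  have hpos : 0 < min δ₁ δ₂ := lt_min h1.pos h2.pos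
  set δ := min δ₁ δ₂
  replace h1 : IsGoodBox x0 y0 f δ := h1.mono hpos (min_le_left _ _)
  replace h2 : IsGoodBox x0 y0 (f * logStep M x0 y0 i) δ := h2.mono hpos (min_le_right _ _)
  have h3 : IsGoodBox x0 y0 (euler i f) δ :=
    ⟨h1.pos, h1.le, fun p hp => isReg_euler (h1.regular p hp) i⟩
  have key : ∀ n : ℕ, ∫ p in box δ, ratEval (torusPt x0 y0 p) (euler i (normStep M x0 y0 ^ n * f)) =
      boxInt M x0 y0 δ (euler i f) n + n * boxInt M x0 y0 δ (f * logStep M x0 y0 i) n := by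
    intro n
    rw [boxInt, boxInt, ← integral_const_mul, ← integral_add (h3.integrableOn M n)
      ((h2.integrableOn M n).const_mul _)]
    refine setIntegral_congr_fun (measurableSet_box δ) fun p hp => ?_
    have hN := isReg_normStep (M := M) (x0 := x0) (y0 := y0) (torusPt_ne sp p 0)
      (torusPt_ne sp p 1)
    rw [euler_normStep_pow_mul sp, ratEval_add ((hN.pow n).mul (h3.regular p hp))
      (((hN.pow n).mul (h2.regular p hp)).smul _), ratEval_smul ((hN.pow n).mul (h2.regular p hp)),
      ratEval_mul (hN.pow n) (h3.regular p hp), ratEval_mul (hN.pow n) (h2.regular p hp),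
      ratEval_pow hN, ratEval_normStep_torusPt sp]
  have hinv : (fun n : ℕ => (n : ℂ)⁻¹) =O[atTop] negPow 0 :=
    inv_isBigO.trans (negPow_isBigO (Nat.zero_le 1))
  have h4 := (((isRapid_integral_euler sp i h1).mul hinv).add
    (h2.isRapid_localInt (hf.mul hψ) sp)).add
    ((h3.isRapid_localInt (isReg_euler hf i) sp).mul hinv)
  intro m
  refine (h4 m).congr' ?_ EventuallyEq.rfl
  filter_upwards [eventually_ge_atTop 1] with n hn
  have hn0 : (n : ℂ) ≠ 0 := Nat.cast_ne_zero.2 (by omega)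
  rw [key]
  field_simp
  ring

end

section

open scoped Real
open Complex (conj_I conj_conj conj_ofReal exp_conj)
open Polynomial (C X X_dvd_iff eval_C eval_X eval_add eval_mul eval_one eval_sub)
open Topology MeasureTheory

variable {M : Model} {x0 y0 : ℝ}

/-! ### The asymptotic expansion of the integrals near the saddle point -/

lemma isGoodBox_one (x0 y0 : ℝ) : IsGoodBox x0 y0 1 (π / 4) :=
  ⟨by positivity, le_rfl, fun p _ => isReg_one _⟩

/-- The integral of `s ^ n` over the largest square. -/
def leadInt (M : Model) (x0 y0 : ℝ) (n : ℕ) : ℂ := boxInt M x0 y0 (π / 4) 1 n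

lemma leadInt_eq (M : Model) (x0 y0 : ℝ) (n : ℕ) :
    leadInt M x0 y0 n = ∫ p in box (π / 4), charFn M x0 y0 p ^ n := by
  simp only [leadInt, boxInt, ratEval_one, mul_one]

lemma isRapid_localInt_of_mem_vanish_one (sp : IsDominantSaddle M x0 y0) {f : RatXY}
    (hf : f ∈ vanish (basePt x0 y0) 1) : ∃ g, IsReg (basePt x0 y0) g ∧
      IsRapid fun n => localInt M x0 y0 f n + (n : ℂ)⁻¹ * localInt M x0 y0 g n := by
  obtain ⟨f₀, hf₀, f₁, hf₁, rfl⟩ := exists_div_logStep sp (k := 0) hf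
  rw [mem_vanish_zero] at hf₀ hf₁
  have hψ := fun i => isReg_of_mem_vanish (logStep_mem sp i)
  have he₀ := isReg_euler hf₀ 0
  have he₁ := isReg_euler hf₁ 1
  refine ⟨euler 0 f₀ + euler 1 f₁, he₀.add he₁, ?_⟩
  have hinv : (fun n : ℕ => (n : ℂ)⁻¹) =O[atTop] negPow 0 :=
    inv_isBigO.trans (negPow_isBigO (Nat.zero_le 1))
  refine ((((isRapid_localInt_add sp (hf₀.mul (hψ 0)) (hf₁.mul (hψ 1))).add
    (isRapid_localInt_euler sp 0 hf₀)).add (isRapid_localInt_euler sp 1 hf₁)).add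
    ((isRapid_localInt_add sp he₀ he₁).mul hinv)).congr fun n => ?_
  ring

lemma isReg_sub_const {b : Fin 2 → ℂ} {f : RatXY} (hf : IsReg b f) (c : ℂ) :
    IsReg b (f - algebraMap ℂ RatXY c) := hf.sub (isReg_algebraMap b c)

lemma isRapid_localInt_decomp (sp : IsDominantSaddle M x0 y0) {f : RatXY}
    (hf : IsReg (basePt x0 y0) f) : ∃ g, IsReg (basePt x0 y0) g ∧
      IsRapid fun n => localInt M x0 y0 f n - ratEval (basePt x0 y0) f * leadInt M x0 y0 n +
        (n : ℂ)⁻¹ * localInt M x0 y0 g n := by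
  set c := ratEval (basePt x0 y0) f
  obtain ⟨g, hg, h⟩ := isRapid_localInt_of_mem_vanish_one sp (sub_ratEval_mem hf)
  refine ⟨g, hg, ?_⟩
  have h1 := isRapid_localInt_add sp (isReg_sub_const hf c)
    (isReg_algebraMap (basePt x0 y0) c)
  rw [sub_add_cancel] at h1
  have h2 := isRapid_localInt_smul sp (isReg_one (basePt x0 y0)) c
  rw [← Algebra.algebraMap_eq_smul_one] at h2
  have h3 := ((isGoodBox_one x0 y0).isRapid_localInt (isReg_one _) sp).const_mul c
  refine (((h1.add h2).add h3).add h).congr fun n => ?_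
  simp only [leadInt]
  ring

lemma exists_polynomial_localInt (sp : IsDominantSaddle M x0 y0) (m : ℕ) : ∀ f : RatXY,
    IsReg (basePt x0 y0) f → ∃ c : Polynomial ℂ,
      (1 ≤ m → c.eval 0 = ratEval (basePt x0 y0) f) ∧
      (fun n : ℕ => localInt M x0 y0 f n - leadInt M x0 y0 n * c.eval (n : ℂ)⁻¹)
        =O[atTop] negPow m := by
  induction m with
  | zero =>
    intro f hf
    refine ⟨0, fun h => absurd h (by norm_num), ?_⟩
    simpa using localInt_isBigO sp hf
  | succ m ih =>
    intro f hf
    obtain ⟨g, hg, h⟩ := isRapid_localInt_decomp sp hf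
    obtain ⟨c, -, hc⟩ := ih g hg
    refine ⟨C (ratEval (basePt x0 y0) f) - X * c, fun _ => by simp, ?_⟩
    have h1 := isBigO_mul_negPow inv_isBigO hc
    rw [add_comm 1 m] at h1
    refine ((h (m + 1)).sub h1).congr_left fun n => ?_
    simp only [eval_sub, eval_C, eval_mul, eval_X]
    ring

lemma normStep_sub_one_mem (sp : IsDominantSaddle M x0 y0) :
    normStep M x0 y0 - 1 ∈ vanish (basePt x0 y0) 2 := by
  have hN := isReg_normStep (M := M) (x0 := x0) (y0 := y0) (sp.basePt_ne 0) (sp.basePt_ne 1)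
  have h1 : normStep M x0 y0 - 1 ∈ vanish (basePt x0 y0) 1 := by
    have h := sub_ratEval_mem hN
    rwa [ratEval_normStep_basePt sp, map_one] at h
  rw [mem_vanish_two sp.basePt_ne h1]
  intro i
  have h2 : euler i (normStep M x0 y0 - 1) = euler i (normStep M x0 y0) := by
    rw [map_sub, Derivation.map_one_eq_zero, sub_zero]
  rw [grad, h2]
  exact grad_normStep sp i

lemma exists_normStep_decomp (sp : IsDominantSaddle M x0 y0) :
    ∃ a₀ ∈ vanish (basePt x0 y0) 1, ∃ a₁ ∈ vanish (basePt x0 y0) 1,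
      normStep M x0 y0 - 1 = a₀ * logStep M x0 y0 0 + a₁ * logStep M x0 y0 1 ∧
      grad (basePt x0 y0) a₀ 0 + grad (basePt x0 y0) a₁ 1 = 1 := by
  obtain ⟨a₀, ha₀, a₁, ha₁, h⟩ := exists_div_logStep sp (k := 1) (normStep_sub_one_mem sp)
  refine ⟨a₀, ha₀, a₁, ha₁, h, ?_⟩
  set b := basePt x0 y0 with hb
  have hψ := fun i => logStep_mem sp i
  have hψr := fun i => isReg_of_mem_vanish (hψ i)
  have hψ0 : ∀ i, ratEval b (logStep M x0 y0 i) = 0 := fun i => (mem_vanish_one (hψr i)).1 (hψ i)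
  have h1 : ∀ {a : RatXY}, a ∈ vanish b 1 → ∀ i j k, grad b (euler j (a * logStep M x0 y0 i)) k =
      grad b a j * covar M x0 y0 i k + grad b a k * covar M x0 y0 i j := by
    intro a ha i j k
    have har := isReg_of_mem_vanish ha
    have ha0 : ratEval b a = 0 := (mem_vanish_one har).1 ha
    have e1 : euler j (a * logStep M x0 y0 i) = a * euler j (logStep M x0 y0 i) +
        logStep M x0 y0 i * euler j a := by
      rw [Derivation.leibniz, smul_eq_mul, smul_eq_mul]
    rw [e1, grad_add (har.mul (isReg_euler (hψr i) j))
      ((hψr i).mul (isReg_euler har j)), grad_mul_of_mem ha (isReg_euler (hψr i) j),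
      grad_mul_of_mem (hψ i) (isReg_euler har j), grad_logStep sp]
    have e2 : ratEval b (euler j (logStep M x0 y0 i)) = covar M x0 y0 i j := grad_logStep sp i j
    have e3 : ratEval b (euler j a) = grad b a j := rfl
    rw [e2, e3]
    ring
  have h2 : ∀ j k, (covar M x0 y0 j k : ℂ) =
      grad b a₀ j * covar M x0 y0 0 k + grad b a₀ k * covar M x0 y0 0 j +
      (grad b a₁ j * covar M x0 y0 1 k + grad b a₁ k * covar M x0 y0 1 j) := by
    intro j k
    rw [← h1 ha₀ 0 j k, ← h1 ha₁ 1 j k, ← grad_euler_normStep sp j k]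
    have hr0 := isReg_euler ((isReg_of_mem_vanish ha₀).mul (hψr 0)) j
    have hr1 := isReg_euler ((isReg_of_mem_vanish ha₁).mul (hψr 1)) j
    rw [← grad_add hr0 hr1, ← map_add, ← h, map_sub, Derivation.map_one_eq_zero, sub_zero]
  have hdet : (covar M x0 y0 0 0 * covar M x0 y0 1 1 - covar M x0 y0 0 1 ^ 2 : ℂ) ≠ 0 := by
    exact_mod_cast (covar_det_pos sp).ne'
  have e00 := h2 0 0
  have e01 := h2 0 1
  have e11 := h2 1 1
  rw [covar_symm M x0 y0 1 0] at e00 e01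
  apply mul_left_cancel₀ hdet
  linear_combination -(covar M x0 y0 1 1 : ℂ) / 2 * e00 - (covar M x0 y0 0 0 : ℂ) / 2 * e11 +
    (covar M x0 y0 0 1 : ℂ) * e01

lemma exists_leadInt_recursion (sp : IsDominantSaddle M x0 y0) (m : ℕ) :
    ∃ c : Polynomial ℂ, c.eval 0 = 1 ∧
      (fun n : ℕ => leadInt M x0 y0 (n + 1) - leadInt M x0 y0 n +
        leadInt M x0 y0 n * ((n : ℂ)⁻¹ * c.eval (n : ℂ)⁻¹)) =O[atTop] negPow (m + 1) := by
  obtain ⟨a₀, ha₀, a₁, ha₁, h, htr⟩ := exists_normStep_decomp sp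
  have hN := isReg_normStep (M := M) (x0 := x0) (y0 := y0) (sp.basePt_ne 0) (sp.basePt_ne 1)
  have hNg : IsGoodBox x0 y0 (normStep M x0 y0) (π / 4) :=
    ⟨by positivity, le_rfl, fun p _ => isReg_normStep (torusPt_ne sp p 0) (torusPt_ne sp p 1)⟩
  have hψr := fun i => isReg_of_mem_vanish (logStep_mem sp i)
  have hr₀ := isReg_of_mem_vanish ha₀
  have hr₁ := isReg_of_mem_vanish ha₁
  have he₀ := isReg_euler hr₀ 0
  have he₁ := isReg_euler hr₁ 1
  have h1 : ∀ n, boxInt M x0 y0 (π / 4) (normStep M x0 y0) n = leadInt M x0 y0 (n + 1) := by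
    intro n
    rw [leadInt_eq, boxInt]
    refine setIntegral_congr_fun (measurableSet_box _) fun p _ => ?_
    rw [ratEval_normStep_torusPt sp, pow_succ]
  have hinv : (fun n : ℕ => (n : ℂ)⁻¹) =O[atTop] negPow 0 :=
    inv_isBigO.trans (negPow_isBigO (Nat.zero_le 1))
  have h2 := isRapid_localInt_add sp (isReg_one (basePt x0 y0))
    ((hr₀.mul (hψr 0)).add (hr₁.mul (hψr 1)))
  have hsum : 1 + (a₀ * logStep M x0 y0 0 + a₁ * logStep M x0 y0 1) = normStep M x0 y0 := by
    rw [← h, add_sub_cancel]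
  rw [hsum] at h2
  have h3 := isRapid_localInt_add sp (hr₀.mul (hψr 0)) (hr₁.mul (hψr 1))
  obtain ⟨c, hc0, hc⟩ := exists_polynomial_localInt sp (m + 1) _ (he₀.add he₁)
  refine ⟨c, ?_, ?_⟩
  · rw [hc0 (by omega), ratEval_add he₀ he₁]
    exact htr
  have h4 := isBigO_mul_negPow inv_isBigO hc
  have h5 : IsRapid fun n => leadInt M x0 y0 (n + 1) - leadInt M x0 y0 n +
      (n : ℂ)⁻¹ * localInt M x0 y0 (euler 0 a₀ + euler 1 a₁) n := by
    refine ((((((h2.add h3).add (isRapid_localInt_euler sp 0 hr₀)).add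
      (isRapid_localInt_euler sp 1 hr₁)).add ((isRapid_localInt_add sp he₀ he₁).mul hinv)).add
      ((isGoodBox_one x0 y0).isRapid_localInt (isReg_one _) sp)).sub
      (hNg.isRapid_localInt hN sp)).congr fun n => ?_
    rw [h1]
    simp only [leadInt]
    ring
  refine ((h5 (m + 1)).sub (h4.trans (negPow_isBigO (by omega)))).congr_left fun n => ?_
  ring

lemma exists_polyApprox_leadInt (sp : IsDominantSaddle M x0 y0) :
    ∃ ℓ : ℂ, ℓ ≠ 0 ∧ Tendsto (fun n : ℕ => (n : ℂ) * leadInt M x0 y0 n) atTop (𝓝 ℓ) ∧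
      ∀ m, PolyApprox m fun n => (n : ℂ) * leadInt M x0 y0 n := by
  obtain ⟨ℓ, hℓ, ht⟩ := exists_tendsto_integral_charFn sp
  have ht' : Tendsto (fun n : ℕ => (n : ℂ) * leadInt M x0 y0 n) atTop (𝓝 ℓ) := by
    simpa only [leadInt_eq] using ht
  refine ⟨ℓ, hℓ, ht', fun m => polyApprox_of_recursion ht' (fun m => ?_) m⟩
  obtain ⟨c, hc0, hc⟩ := exists_leadInt_recursion sp m
  refine ⟨(1 + X) * (1 - X * c) - 1, ?_, ?_⟩
  · rw [show (1 + X) * (1 - X * c) - 1 =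
      X * ((1 - c) - X * c) by ring, pow_two]
    refine mul_dvd_mul_left _ (dvd_sub ?_ (dvd_mul_right _ _))
    rw [X_dvd_iff, Polynomial.coeff_zero_eq_eval_zero]
    simp [hc0]
  · have h1 : (fun n : ℕ => ((n + 1 : ℕ) : ℂ) * (leadInt M x0 y0 (n + 1) - leadInt M x0 y0 n +
        leadInt M x0 y0 n * ((n : ℂ)⁻¹ * c.eval (n : ℂ)⁻¹))) =O[atTop] negPow m := by
      obtain ⟨C, hC⟩ := hc.bound
      refine IsBigO.of_bound (C * 2) ?_
      filter_upwards [hC, eventually_ge_atTop 1] with n hn hn1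
      have hn0 : (0 : ℝ) < n := by exact_mod_cast hn1
      rw [norm_mul, Complex.norm_natCast]
      rw [Real.norm_of_nonneg (negPow_nonneg _ _)] at hn ⊢
      have h2 : ((n + 1 : ℕ) : ℝ) * negPow (m + 1) n ≤ 2 * negPow m n := by
        rw [negPow, negPow, pow_succ, mul_inv, mul_left_comm, ← div_eq_mul_inv, mul_comm 2]
        refine mul_le_mul_of_nonneg_left ?_ (by positivity)
        rw [div_le_iff₀ hn0]
        push_cast
        have : (1 : ℝ) ≤ n := by exact_mod_cast hn1
        linarith
      have hC0 : 0 ≤ C ∨ C < 0 := le_or_gt 0 C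
      calc _ ≤ ((n + 1 : ℕ) : ℝ) * (C * negPow (m + 1) n) :=
            mul_le_mul_of_nonneg_left hn (Nat.cast_nonneg _)
        _ = C * (((n + 1 : ℕ) : ℝ) * negPow (m + 1) n) := by ring
        _ ≤ C * (2 * negPow m n) := by
            rcases hC0 with h | h
            · exact mul_le_mul_of_nonneg_left h2 h
            · exfalso
              have h5 := (norm_nonneg _).trans hn
              have h6 : 0 < negPow (m + 1) n := by rw [negPow]; positivity
              nlinarith
        _ = _ := by ring
    refine h1.congr' ?_ EventuallyEq.rfl
    filter_upwards [eventually_ge_atTop 1] with n hn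
    have hn0 : (n : ℂ) ≠ 0 := Nat.cast_ne_zero.2 (by omega)
    simp only [eval_sub, eval_mul, eval_add, eval_one,
      eval_X]
    push_cast
    field_simp
    ring

lemma exists_hasExpansion_localInt (sp : IsDominantSaddle M x0 y0) {f : RatXY}
    (hf : IsReg (basePt x0 y0) f) :
    ∃ a : ℕ → ℂ, HasExpansion (localInt M x0 y0 f) a := by
  obtain ⟨ℓ, -, -, h⟩ := exists_polyApprox_leadInt sp
  refine exists_hasExpansion fun m => ?_
  obtain ⟨c, -, hc⟩ := exists_polynomial_localInt sp (m + 1) f hf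
  have h1 : PolyApprox (m + 1) fun n => (n : ℂ)⁻¹ * ((n : ℂ) * leadInt M x0 y0 n) := (h m).inv_mul
  have h2 : PolyApprox (m + 1) (localInt M x0 y0 f) := by
    refine (h1.mul (PolyApprox.eval (m + 1) c)).congr ?_
    refine hc.neg_left.congr' ?_ EventuallyEq.rfl
    filter_upwards [eventually_ge_atTop 1] with n hn
    have hn0 : (n : ℂ) ≠ 0 := Nat.cast_ne_zero.2 (by omega)
    rw [inv_mul_cancel_left₀ hn0]
    ring
  obtain ⟨p, hp⟩ := h2
  exact ⟨p, hp.trans (negPow_isBigO (Nat.le_succ m))⟩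

/-- The coefficients of the expansion of the integral of `s ^ n f`. -/
def localCoeff (M : Model) (x0 y0 : ℝ) (f : RatXY) : ℕ → ℂ :=
  Classical.epsilon fun a => HasExpansion (localInt M x0 y0 f) a

lemma hasExpansion_localInt (sp : IsDominantSaddle M x0 y0) {f : RatXY}
    (hf : IsReg (basePt x0 y0) f) :
    HasExpansion (localInt M x0 y0 f) (localCoeff M x0 y0 f) :=
  Classical.epsilon_spec (exists_hasExpansion_localInt sp hf)

lemma IsGoodBox.hasExpansion (sp : IsDominantSaddle M x0 y0) {f : RatXY} {δ : ℝ}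
    (hf : IsReg (basePt x0 y0) f) (h : IsGoodBox x0 y0 f δ) :
    HasExpansion (boxInt M x0 y0 δ f) (localCoeff M x0 y0 f) :=
  (hasExpansion_localInt sp hf).congr_rapid
    (((h.isRapid_localInt hf sp).const_mul (-1)).congr fun n => by ring)

/-- The coefficients as linear functionals on the local ring. -/
def coeffMap (sp : IsDominantSaddle M x0 y0) (p : ℕ) : vanish (basePt x0 y0) 0 →ₗ[ℂ] ℂ where
  toFun f := localCoeff M x0 y0 f p
  map_add' f g := by
    have hf := mem_vanish_zero.1 f.2
    have hg := mem_vanish_zero.1 g.2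
    have h1 := ((hasExpansion_localInt sp hf).add (hasExpansion_localInt sp hg)).congr_rapid
      (isRapid_localInt_add sp hf hg)
    exact congrFun ((hasExpansion_localInt sp (hf.add hg)).unique h1) p
  map_smul' c f := by
    have hf := mem_vanish_zero.1 f.2
    have h1 := ((hasExpansion_localInt sp hf).const_mul c).congr_rapid
      (isRapid_localInt_smul sp hf c)
    exact congrFun ((hasExpansion_localInt sp (hf.smul c)).unique h1) p

lemma localCoeff_euler (sp : IsDominantSaddle M x0 y0) {f : RatXY}
    (hf : IsReg (basePt x0 y0) f) (p : ℕ) (i : Fin 2) :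
    localCoeff M x0 y0 (euler i f) p = -localCoeff M x0 y0 (f * logStep M x0 y0 i) (p + 1) := by
  have hfψ := hf.mul (isReg_of_mem_vanish (logStep_mem sp i))
  have h1 := ((hasExpansion_localInt sp (isReg_euler hf i)).inv_mul.const_mul
    (-1)).congr_rapid ((isRapid_localInt_euler sp i hf).congr fun n => by ring)
  have h2 := congrFun ((hasExpansion_localInt sp hfψ).unique h1) (p + 1)
  rw [h2]
  simp

lemma tendsto_leadInt (sp : IsDominantSaddle M x0 y0) :
    Tendsto (leadInt M x0 y0) atTop (𝓝 0) := by
  obtain ⟨ℓ, -, ht, -⟩ := exists_polyApprox_leadInt sp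
  have h1 := tendsto_natCast_inv.mul ht
  rw [zero_mul] at h1
  refine h1.congr' ?_
  filter_upwards [eventually_ge_atTop 1] with n hn
  exact inv_mul_cancel_left₀ (Nat.cast_ne_zero.2 (by omega)) _

lemma localCoeff_zero (sp : IsDominantSaddle M x0 y0) {f : RatXY}
    (hf : IsReg (basePt x0 y0) f) : localCoeff M x0 y0 f 0 = 0 := by
  obtain ⟨c, -, hc⟩ := exists_polynomial_localInt sp 1 f hf
  refine tendsto_nhds_unique (hasExpansion_localInt sp hf).tendsto ?_
  have h1 : Tendsto (negPow 1) atTop (𝓝 0) := by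
    have h : negPow 1 = fun n : ℕ => ((n : ℝ))⁻¹ := by
      funext n
      rw [negPow, pow_one]
    rw [h]
    exact tendsto_inv_atTop_nhds_zero_nat
  have h2 := (hc.trans_tendsto h1).add ((tendsto_leadInt sp).mul (tendsto_eval_inv c))
  rw [zero_mul, add_zero] at h2
  refine h2.congr fun n => ?_
  ring

lemma localCoeff_one_ne_zero (sp : IsDominantSaddle M x0 y0) : localCoeff M x0 y0 1 1 ≠ 0 := by
  obtain ⟨ℓ, hℓ, ht, h⟩ := exists_polyApprox_leadInt sp
  obtain ⟨a, ha⟩ := exists_hasExpansion h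
  have h1 : HasExpansion (leadInt M x0 y0) (fun p => if p = 0 then 0 else a (p - 1)) := by
    intro m
    refine (ha.inv_mul m).congr' ?_ EventuallyEq.rfl
    filter_upwards [eventually_ge_atTop 1] with n hn
    rw [inv_mul_cancel_left₀ (Nat.cast_ne_zero.2 (by omega))]
  have h2 := ((isGoodBox_one x0 y0).hasExpansion sp (isReg_one _)).unique h1
  have h3 : localCoeff M x0 y0 1 1 = a 0 := by rw [h2]; simp
  rw [h3, tendsto_nhds_unique ha.tendsto ht]
  exact hℓ

lemma torusPt_neg (x0 y0 : ℝ) (p : ℝ × ℝ) :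
    torusPt x0 y0 (-p) = fun i => starRingEnd ℂ (torusPt x0 y0 p i) := by
  funext i
  fin_cases i <;> simp [torusPt, ← exp_conj]

lemma charFn_neg (M : Model) (x0 y0 : ℝ) (p : ℝ × ℝ) :
    charFn M x0 y0 (-p) = starRingEnd ℂ (charFn M x0 y0 p) := by
  rw [charFn, charFn, map_sum]
  refine Finset.sum_congr rfl fun s _ => ?_
  rw [map_mul, conj_ofReal, ← exp_conj, map_mul, conj_I,
    conj_ofReal]
  congr 2
  simp only [ang, Prod.fst_neg, Prod.snd_neg]
  push_cast
  ring

lemma conj_boxInt {f : RatXY} {δ : ℝ} (h : IsGoodBox x0 y0 f δ) (hf : conjHom f = f) (n : ℕ) :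
    starRingEnd ℂ (boxInt M x0 y0 δ f n) = boxInt M x0 y0 δ f n := by
  have h1 : Set.indicator (box δ) (fun p => charFn M x0 y0 p ^ n * ratEval (torusPt x0 y0 p) f) =
      fun p => starRingEnd ℂ (Set.indicator (box δ)
        (fun p => charFn M x0 y0 p ^ n * ratEval (torusPt x0 y0 p) f) (-p)) := by
    funext p
    have hneg : -p ∈ box δ ↔ p ∈ box δ := by
      rw [mem_box, mem_box, Prod.fst_neg, Prod.snd_neg, abs_neg, abs_neg]
    by_cases hp : p ∈ box δ
    · rw [Set.indicator_of_mem hp, Set.indicator_of_mem (hneg.2 hp), map_mul, map_pow, charFn_neg,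
        conj_conj, torusPt_neg]
      congr 1
      have h2 := conjHom_regular (h.regular p hp)
      rw [hf] at h2
      rw [h2, conj_conj]
    · rw [Set.indicator_of_notMem hp, Set.indicator_of_notMem (fun h => hp (hneg.1 h)), map_zero]
  rw [boxInt, ← integral_indicator (measurableSet_box δ), ← integral_conj]
  conv_rhs => rw [h1]
  rw [← integral_neg_eq_self]

lemma localCoeff_im (sp : IsDominantSaddle M x0 y0) {f : RatXY}
    (hf : IsReg (basePt x0 y0) f) (hconj : conjHom f = f) (p : ℕ) :
    (localCoeff M x0 y0 f p).im = 0 := by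
  have h1 := hasExpansion_localInt sp hf
  have h2 := h1.conj
  have h3 : (fun n => starRingEnd ℂ (localInt M x0 y0 f n)) = localInt M x0 y0 f :=
    funext fun n => conj_boxInt (isGoodBox_goodSize hf) hconj n
  rw [h3] at h2
  exact Complex.conj_eq_iff_im.1 (congrFun (h2.unique h1) p)

/-- The integrals over small squares around the saddle point have asymptotic expansions in
powers of `1 / n`. -/
theorem exists_gaussFunctional (sp : IsDominantSaddle M x0 y0) :
    ∃ L : GaussFunctional M x0 y0, ∀ f δ, IsGoodBox x0 y0 f δ →
      HasExpansion (boxInt M x0 y0 δ f) (fun p => L.toFun p f) := by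
  choose T hT using fun p => LinearMap.exists_extend (coeffMap sp p)
  have hT' : ∀ p f, IsReg (basePt x0 y0) f → T p f = localCoeff M x0 y0 f p := by
    intro p f hf
    exact DFunLike.congr_fun (hT p) (⟨f, mem_vanish_zero.2 hf⟩ : vanish (basePt x0 y0) 0)
  refine ⟨⟨T, fun f hf => ?_, fun p i f hf => ?_, ?_, fun p f hf hc => ?_⟩, fun f δ h => ?_⟩
  · rw [hT' _ _ hf, localCoeff_zero sp hf]
  · rw [hT' _ _ (isReg_euler hf i), hT' _ _ (hf.mul (isReg_of_mem_vanish
      (logStep_mem sp i))), localCoeff_euler sp hf]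
  · rw [hT' _ _ (isReg_one _)]
    exact localCoeff_one_ne_zero sp
  · rw [hT' _ _ hf]
    exact localCoeff_im sp hf hc p
  · have hf : IsReg (basePt x0 y0) f := by
      rw [← torusPt_zero]
      exact h.regular 0 (mem_box.2 (by simp [h.pos.le]))
    have h1 : (fun p => T p f) = localCoeff M x0 y0 f := funext fun p => hT' p f hf
    simp only [h1]
    exact h.hasExpansion sp hf

end

section

open AlgHom (comp_apply)
open Algebra (smul_def)
open Complex (I exp exp_ne_zero norm_real)
open Finset (smul_sum sum_congr)
open Real (cos norm_of_nonneg)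
open Topology

variable {M : Model} {x0 y0 : ℝ}

/-! ### The other saddle points -/

/-- The step polynomial is multiplied by `ζ` under the substitution `x ↦ α x`, `y ↦ β y`. -/
structure IsTwist (M : Model) (α β ζ : ℂ) : Prop where
  fst_ne : α ≠ 0
  snd_ne : β ≠ 0
  eq : ∀ s, M.weight s ≠ 0 → α ^ s.1 * β ^ s.2 = ζ

lemma IsTwist.inv {α β ζ : ℂ} (h : IsTwist M α β ζ) : IsTwist M α⁻¹ β⁻¹ ζ⁻¹ where
  fst_ne := inv_ne_zero h.fst_ne
  snd_ne := inv_ne_zero h.snd_ne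
  eq s hs := by rw [← h.eq s hs, mul_inv, inv_zpow, inv_zpow]

lemma IsTwist.ne_zero {α β ζ : ℂ} (h : IsTwist M α β ζ) : ζ ≠ 0 := by
  obtain ⟨s, -, hs⟩ := exists_weight M
  rw [← h.eq s hs]
  exact mul_ne_zero (zpow_ne_zero _ h.fst_ne) (zpow_ne_zero _ h.snd_ne)

lemma IsTwist.stepPoly {α β ζ : ℂ} (h : IsTwist M α β ζ) (x y : ℂ) :
    stepPoly M (α * x) (β * y) = ζ * stepPoly M x y := by
  rw [QuadrantWalk.stepPoly, QuadrantWalk.stepPoly, Finset.mul_sum]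
  refine sum_congr rfl fun s _ => ?_
  by_cases hs : M.weight s = 0
  · simp [hs]
  · rw [mul_zpow, mul_zpow, ← h.eq s hs]
    ring

lemma exists_twistHom {α β : ℂ} (hα : α ≠ 0) (hβ : β ≠ 0) :
    ∃ τ : RatXY →ₐ[ℂ] RatXY, τ varX = α • varX ∧ τ varY = β • varY := by
  refine ⟨substHom (α • varX) (β • varY) (aeval_injective_of_dominant one_ne_zero fun a _ =>
    ⟨![α⁻¹ * a 0, β⁻¹ * a 1], (isReg_varX _).smul _, (isReg_varY _).smul _, ?_, ?_⟩),
    substHom_varX _, substHom_varY _⟩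
  · rw [ratEval_smul (isReg_varX _), ratEval_varX]
    exact mul_inv_cancel_left₀ hα _
  · rw [ratEval_smul (isReg_varY _), ratEval_varY]
    exact mul_inv_cancel_left₀ hβ _

section

variable {α β ζ : ℂ} {τ : RatXY →ₐ[ℂ] RatXY}

lemma smul_zpow_rat (c : ℂ) (f : RatXY) (m : ℤ) : (c • f) ^ m = c ^ m • f ^ m := by
  rw [smul_def, mul_zpow, ← map_zpow₀, ← smul_def]

lemma IsTwist.rowSum (h : IsTwist M α β ζ) (j : ℤ) :
    rowSum M j (α • varX) = (ζ * β ^ (-j)) • rowSum M j varX := by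
  rw [QuadrantWalk.rowSum, QuadrantWalk.rowSum, smul_sum]
  refine sum_congr rfl fun i _ => ?_
  by_cases hs : M.weight (i, j) = 0
  · simp [hs, const]
  · have h1 := h.eq _ hs
    simp only at h1
    rw [smul_zpow_rat, ← h1, mul_assoc, ← zpow_add₀ h.snd_ne, add_neg_cancel, zpow_zero, mul_one,
      mul_smul_comm]

lemma IsTwist.colSum (h : IsTwist M α β ζ) (i : ℤ) :
    colSum M i (β • varY) = (ζ * α ^ (-i)) • colSum M i varY := by
  rw [QuadrantWalk.colSum, QuadrantWalk.colSum, smul_sum]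
  refine sum_congr rfl fun j _ => ?_
  by_cases hs : M.weight (i, j) = 0
  · simp [hs, const]
  · have h1 := h.eq _ hs
    simp only at h1
    rw [smul_zpow_rat, ← h1, mul_comm (α ^ i), mul_assoc, ← zpow_add₀ h.fst_ne, add_neg_cancel,
      zpow_zero, mul_one, mul_smul_comm]

lemma smul_div_smul_rat {c d : ℂ} (f g : RatXY) : (c • f) / (d • g) = (c / d) • (f / g) := by
  rw [smul_def, smul_def, smul_def, mul_div_mul_comm, map_div₀]

lemma smul_inv_rat (c : ℂ) (f : RatXY) : (c • f)⁻¹ = c⁻¹ • f⁻¹ := by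
  simpa using smul_zpow_rat c f (-1)

lemma hom_smul (σ : RatXY →ₐ[ℂ] RatXY) (c : ℂ) (f : RatXY) : σ (c • f) = c • σ f := by
  rw [smul_def, map_mul, AlgHom.commutes, ← smul_def]

lemma IsTwist.map_phi (h : IsTwist M α β ζ) (hx : τ varX = α • varX) (hy : τ varY = β • varY)
    (f : RatXY) : τ (phi M f) = phi M (τ f) := by
  have h1 : τ (rowQuot M) = (β ^ 2) • rowQuot M := by
    rw [rowQuot, map_div₀, hom_rowSum, hom_rowSum, hx, h.rowSum, h.rowSum, smul_div_smul_rat]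
    congr 1
    have := h.ne_zero
    have := h.snd_ne
    field_simp
    simp
  have key : τ.comp (phiHom M) = (phiHom M).comp τ := by
    refine hom_ext ?_ ?_
    · rw [comp_apply, comp_apply, phiHom_varX, hx, hom_smul, phiHom_varX]
    · rw [comp_apply, comp_apply, phiHom_varY, hy, hom_smul, phiHom_varY, map_mul,
        map_inv₀, hy, h1, smul_inv_rat, smul_mul_smul_comm]
      congr 1
      have := h.snd_ne
      field_simp
  exact DFunLike.congr_fun key f

lemma IsTwist.map_psi (h : IsTwist M α β ζ) (hx : τ varX = α • varX) (hy : τ varY = β • varY)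
    (f : RatXY) : τ (psi M f) = psi M (τ f) := by
  have h1 : τ (colQuot M) = (α ^ 2) • colQuot M := by
    rw [colQuot, map_div₀, hom_colSum, hom_colSum, hy, h.colSum, h.colSum, smul_div_smul_rat]
    congr 1
    have := h.ne_zero
    have := h.fst_ne
    field_simp
    simp
  have key : τ.comp (psiHom M) = (psiHom M).comp τ := by
    refine hom_ext ?_ ?_
    · rw [comp_apply, comp_apply, psiHom_varX, hx, hom_smul, psiHom_varX, map_mul,
        map_inv₀, hx, h1, smul_inv_rat, smul_mul_smul_comm]
      congr 1
      have := h.fst_ne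
      field_simp
    · rw [comp_apply, comp_apply, psiHom_varY, hy, hom_smul, psiHom_varY]
  exact DFunLike.congr_fun key f

lemma IsTwist.map_rot_pow (h : IsTwist M α β ζ) (hx : τ varX = α • varX) (hy : τ varY = β • varY)
    (n : ℕ) (f : RatXY) : τ ((rot M ^ n) f) = (rot M ^ n) (τ f) := by
  induction n generalizing f with
  | zero => rfl
  | succ n ih =>
    rw [pow_succ, AlgEquiv.mul_apply, ih, AlgEquiv.mul_apply, rot, AlgEquiv.mul_apply,
      AlgEquiv.mul_apply, h.map_phi hx hy, h.map_psi hx hy]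

lemma IsTwist.map_altSum (h : IsTwist M α β ζ) (hx : τ varX = α • varX) (hy : τ varY = β • varY)
    (f : RatXY) : τ (altSum M f) = altSum M (τ f) := by
  rw [altSum_apply, altSum_apply, map_sum]
  refine sum_congr rfl fun j _ => ?_
  rw [map_sub, h.map_rot_pow hx hy, h.map_rot_pow hx hy, h.map_phi hx hy]

lemma map_shiftMono (hx : τ varX = α • varX) (hy : τ varY = β • varY) (B : ℤ × ℤ) :
    τ (shiftMono B) = (α ^ (B.1 + 1) * β ^ (B.2 + 1)) • shiftMono B := by
  rw [shiftMono, map_mul, map_zpow₀, map_zpow₀, hx, hy, smul_zpow_rat, smul_zpow_rat,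
    smul_mul_smul_comm]

lemma regular_twistHom (hα : α ≠ 0) (hβ : β ≠ 0) (hx : τ varX = α • varX) (hy : τ varY = β • varY)
    {a : Fin 2 → ℂ} {f : RatXY} (hf : IsReg a f) :
    IsReg ![α⁻¹ * a 0, β⁻¹ * a 1] (τ f) ∧
      ratEval ![α⁻¹ * a 0, β⁻¹ * a 1] (τ f) = ratEval a f := by
  refine isReg_hom_aux τ ?_ ?_ ?_ hf
  · rw [hx]
    exact (isReg_varX _).smul _
  · rw [hy]
    exact (isReg_varY _).smul _
  · rw [hx, hy, ratEval_smul (isReg_varX _), ratEval_smul (isReg_varY _), ratEval_varX,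
      ratEval_varY]
    funext i
    fin_cases i
    · exact (mul_inv_cancel_left₀ hα (a 0)).symm
    · exact (mul_inv_cancel_left₀ hβ (a 1)).symm

end

lemma IsTwist.regular_of_eigen {α β ζ : ℂ} (h : IsTwist M α β ζ) {f : RatXY} {c : ℂ} (hc : c ≠ 0)
    (hf : ∀ τ : RatXY →ₐ[ℂ] RatXY, τ varX = α⁻¹ • varX → τ varY = β⁻¹ • varY → τ f = c⁻¹ • f)
    {a : Fin 2 → ℂ} (ha : IsReg a f) :
    IsReg ![α * a 0, β * a 1] f ∧ ratEval ![α * a 0, β * a 1] f = c * ratEval a f := by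
  obtain ⟨τ, hx, hy⟩ := exists_twistHom h.inv.fst_ne h.inv.snd_ne
  have h1 := regular_twistHom h.inv.fst_ne h.inv.snd_ne hx hy ha
  rw [inv_inv, inv_inv, hf τ hx hy] at h1
  have h2 : c • (c⁻¹ • f) = f := by rw [smul_smul, mul_inv_cancel₀ hc, one_smul]
  have h3 := h1.1.smul c
  have h4 := ratEval_smul h1.1 c
  rw [h2] at h3 h4
  rw [h1.2] at h4
  exact ⟨h3, h4⟩

lemma IsTwist.regular_altSum {α β ζ : ℂ} (h : IsTwist M α β ζ) (A : ℤ × ℤ)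
    {a : Fin 2 → ℂ} (ha : IsReg a (altSum M (shiftMono A))) :
    IsReg ![α * a 0, β * a 1] (altSum M (shiftMono A)) ∧
      ratEval ![α * a 0, β * a 1] (altSum M (shiftMono A)) =
        α ^ (A.1 + 1) * β ^ (A.2 + 1) * ratEval a (altSum M (shiftMono A)) := by
  refine h.regular_of_eigen (mul_ne_zero (zpow_ne_zero _ h.fst_ne) (zpow_ne_zero _ h.snd_ne))
    (fun τ hx hy => ?_) ha
  rw [h.inv.map_altSum hx hy, map_shiftMono hx hy, map_smul, mul_inv, inv_zpow, inv_zpow]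

lemma one_sub_cos_nonneg (x : ℝ) : 0 ≤ 1 - cos x := sub_nonneg.2 (Real.cos_le_one x)

lemma exp_ang_eq (sp : IsDominantSaddle M x0 y0) {p : ℝ × ℝ} (hp : ‖charFn M x0 y0 p‖ = 1)
    {s : ℤ × ℤ} (hs : M.weight s ≠ 0) : exp (I * ang s p) = charFn M x0 y0 p := by
  have hmem : ∀ {s}, M.weight s ≠ 0 → s ∈ stepBox := fun h => (M.small _ h).1
  have h1 : ∑ s ∈ stepBox, ∑ s' ∈ stepBox, tilt M x0 y0 s * tilt M x0 y0 s' *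
      (1 - cos (ang s p - ang s' p)) = 0 := by
    have h2 := charFn_sq M x0 y0 p
    rw [hp] at h2
    have h3 : ∑ s ∈ stepBox, ∑ s' ∈ stepBox, tilt M x0 y0 s * tilt M x0 y0 s' = 1 := by
      rw [← Finset.sum_mul_sum, sum_tilt sp, one_mul]
    simp only [mul_sub, mul_one, Finset.sum_sub_distrib]
    rw [h3, ← h2]
    norm_num
  have hnn : ∀ s s', 0 ≤ tilt M x0 y0 s * tilt M x0 y0 s' * (1 - cos (ang s p - ang s' p)) :=
    fun s s' => mul_nonneg (mul_nonneg (tilt_nonneg sp s) (tilt_nonneg sp s'))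
      (one_sub_cos_nonneg _)
  have heq : ∀ s', M.weight s' ≠ 0 → exp (I * ang s' p) =
      exp (I * ang s p) := by
    intro s' hs'
    have h2 := (Finset.sum_eq_zero_iff_of_nonneg fun s _ =>
      Finset.sum_nonneg fun s' _ => hnn s s').1 h1 s' (hmem hs')
    have h3 := (Finset.sum_eq_zero_iff_of_nonneg fun s _ => hnn s' s).1 h2 s (hmem hs)
    have h4 : cos (ang s' p - ang s p) = 1 := by
      rcases mul_eq_zero.1 h3 with h5 | h5
      · exact absurd h5 (mul_pos (tilt_pos sp hs') (tilt_pos sp hs)).ne'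
      · linarith
    obtain ⟨k, hk⟩ := (Real.cos_eq_one_iff _).1 h4
    rw [Complex.exp_eq_exp_iff_exists_int]
    refine ⟨k, ?_⟩
    have h5 : (ang s' p : ℂ) - ang s p = k * (2 * Real.pi) := by exact_mod_cast hk.symm
    linear_combination I * h5
  have h2 : charFn M x0 y0 p = ∑ s' ∈ stepBox, (tilt M x0 y0 s' : ℂ) *
      exp (I * ang s p) := by
    refine sum_congr rfl fun s' _ => ?_
    by_cases hs' : M.weight s' = 0
    · simp [tilt_ofReal, hs']
    · rw [heq s' hs']
  have h3 : ∑ s ∈ stepBox, (tilt M x0 y0 s : ℂ) = 1 := by exact_mod_cast sum_tilt sp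
  rw [h2, ← Finset.sum_mul, h3, one_mul]

lemma charFn_eq (sp : IsDominantSaddle M x0 y0) (p : ℝ × ℝ) : charFn M x0 y0 p =
    stepPoly M (torusPt x0 y0 p 0) (torusPt x0 y0 p 1) / (stepPoly M x0 y0 : ℝ) := by
  rw [← ratEval_normStep_torusPt sp, ratEval_normStep (torusPt_ne sp p 0) (torusPt_ne sp p 1)]

lemma isTwist_of_norm_charFn (sp : IsDominantSaddle M x0 y0) {p : ℝ × ℝ}
    (hp : ‖charFn M x0 y0 p‖ = 1) : IsTwist M (exp (I * p.1))
      (exp (I * p.2)) (charFn M x0 y0 p) :=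
  ⟨exp_ne_zero _, exp_ne_zero _, fun s hs => by rw [← exp_ang, exp_ang_eq sp hp hs]⟩

lemma norm_charFn_eq_one_iff (sp : IsDominantSaddle M x0 y0) (p : ℝ × ℝ) :
    ‖charFn M x0 y0 p‖ = 1 ↔
      (torusPt x0 y0 p 0, torusPt x0 y0 p 1) ∈ saddlePoints M x0 y0 := by
  have h1 : ∀ θ : ℝ, ‖exp (I * θ)‖ = 1 := fun θ => by
    rw [mul_comm, Complex.norm_exp_ofReal_mul_I]
  rw [charFn_eq sp, norm_div, norm_real, norm_of_nonneg sp.pos.le,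
    div_eq_one_iff_eq sp.pos.ne']
  refine ⟨fun h => ⟨?_, ?_, h⟩, fun h => h.2.2⟩
  · change ‖(x0 : ℂ) * exp (I * p.1)‖ = x0
    rw [norm_mul, h1, mul_one, norm_real, norm_of_nonneg sp.1.le]
  · change ‖(y0 : ℂ) * exp (I * p.2)‖ = y0
    rw [norm_mul, h1, mul_one, norm_real, norm_of_nonneg sp.2.1.le]

lemma norm_charFn_le_one (sp : IsDominantSaddle M x0 y0) (p : ℝ × ℝ) : ‖charFn M x0 y0 p‖ ≤ 1 := by
  rw [← sum_tilt sp]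
  refine (norm_sum_le _ _).trans (Finset.sum_le_sum fun s _ => ?_)
  rw [norm_mul, mul_comm I, Complex.norm_exp_ofReal_mul_I, mul_one, norm_real,
    norm_of_nonneg (tilt_nonneg sp s)]

lemma exists_torusPt {z : ℂ × ℂ} (hz : z ∈ saddlePoints M x0 y0) :
    ∃ p : ℝ × ℝ, z = (torusPt x0 y0 p 0, torusPt x0 y0 p 1) := by
  refine ⟨(z.1.arg, z.2.arg), Prod.ext ?_ ?_⟩
  · change z.1 = (x0 : ℂ) * exp (I * z.1.arg)
    rw [← hz.1, mul_comm I, Complex.norm_mul_exp_arg_mul_I]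
  · change z.2 = (y0 : ℂ) * exp (I * z.2.arg)
    rw [← hz.2.1, mul_comm I, Complex.norm_mul_exp_arg_mul_I]

lemma exists_independent_steps (M : Model) : ∃ s₀ s₁ s₂ s₃ : ℤ × ℤ, M.weight s₀ ≠ 0 ∧
    M.weight s₁ ≠ 0 ∧ M.weight s₂ ≠ 0 ∧ M.weight s₃ ≠ 0 ∧
    (s₁.1 - s₀.1) * (s₃.2 - s₂.2) - (s₁.2 - s₀.2) * (s₃.1 - s₂.1) ≠ 0 := by
  obtain ⟨s₀, h0, hs0⟩ := M.nondegenerate 1 0 (by simp)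
  obtain ⟨s₁, h1, hs1⟩ := M.nondegenerate (-1) 0 (by simp)
  have hne : ((s₁.1 - s₀.1 : ℤ) : ℝ) ≠ 0 := by
    push_cast
    intro h
    linarith
  obtain ⟨s₂, h2, hs2⟩ := M.nondegenerate (-((s₁.2 - s₀.2 : ℤ) : ℝ)) ((s₁.1 - s₀.1 : ℤ) : ℝ)
    (fun h => hne (congrArg Prod.snd h))
  obtain ⟨s₃, h3, hs3⟩ := M.nondegenerate ((s₁.2 - s₀.2 : ℤ) : ℝ) (-((s₁.1 - s₀.1 : ℤ) : ℝ))
    (fun h => hne (neg_eq_zero.1 (congrArg Prod.snd h)))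
  refine ⟨s₀, s₁, s₂, s₃, h0, h1, h2, h3, fun h => ?_⟩
  have h' : ((s₁.1 - s₀.1 : ℤ) : ℝ) * (s₃.2 - s₂.2) - ((s₁.2 - s₀.2 : ℤ) : ℝ) * (s₃.1 - s₂.1) = 0 := by
    exact_mod_cast h
  linarith

lemma zpow_eq_one_of_minor {α β : ℂ} (hα : α ≠ 0) (hβ : β ≠ 0) {a b c d : ℤ}
    (h1 : α ^ a * β ^ b = 1) (h2 : α ^ c * β ^ d = 1) : α ^ (a * d - b * c) = 1 := by
  have e : α ^ (a * d - b * c) = (α ^ a * β ^ b) ^ d * ((α ^ c * β ^ d) ^ b)⁻¹ := by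
    rw [mul_zpow, mul_zpow, ← zpow_mul, ← zpow_mul, ← zpow_mul, ← zpow_mul, zpow_sub₀ hα,
      mul_comm d b, mul_comm c b]
    have := zpow_ne_zero (b * d) hβ
    have := zpow_ne_zero (b * c) hα
    field_simp
  rw [e, h1, h2]
  simp

lemma finite_zpow_eq_one {N : ℤ} (hN : N ≠ 0) : {z : ℂ | z ^ N = 1}.Finite := by
  refine (Multiset.finite_toSet (Polynomial.nthRoots N.natAbs (1 : ℂ))).subset fun z hz => ?_
  have hpos : 0 < N.natAbs := Int.natAbs_pos.2 hN
  refine (Polynomial.mem_nthRoots hpos).2 ?_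
  have hz' : z ^ N = 1 := hz
  rcases Int.natAbs_eq N with h | h
  · rw [h, zpow_natCast] at hz'
    exact hz'
  · rw [h, zpow_neg, zpow_natCast, inv_eq_one] at hz'
    exact hz'

lemma finite_saddlePoints (sp : IsDominantSaddle M x0 y0) : (saddlePoints M x0 y0).Finite := by
  obtain ⟨s₀, s₁, s₂, s₃, h0, h1, h2, h3, hdet⟩ := exists_independent_steps M
  have hfin := finite_zpow_eq_one hdet
  refine (((hfin.image fun z => (x0 : ℂ) * z)).prod (hfin.image fun z => (y0 : ℂ) * z)).subset
    fun z hz => ?_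
  obtain ⟨p, rfl⟩ := exists_torusPt hz
  have ht := isTwist_of_norm_charFn sp ((norm_charFn_eq_one_iff sp p).2 hz)
  have key : ∀ {s s' : ℤ × ℤ}, M.weight s ≠ 0 → M.weight s' ≠ 0 →
      exp (I * p.1) ^ (s'.1 - s.1) * exp (I * p.2) ^ (s'.2 - s.2) =
        1 := by
    intro s s' hs hs'
    rw [zpow_sub₀ ht.fst_ne, zpow_sub₀ ht.snd_ne, div_mul_div_comm, ht.eq s hs, ht.eq s' hs',
      div_self ht.ne_zero]
  have e1 := key h0 h1
  have e2 := key h2 h3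
  refine ⟨⟨_, zpow_eq_one_of_minor ht.fst_ne ht.snd_ne e1 e2, rfl⟩, ⟨_, ?_, rfl⟩⟩
  rw [mul_comm] at e1 e2
  have e3 := zpow_eq_one_of_minor ht.snd_ne ht.fst_ne e2 e1
  rw [Set.mem_ofPred_eq, ← e3]
  congr 1
  ring

end

section

open scoped Real
open scoped Polynomial
open Complex (I)
open Finset (mem_range range sum_congr sum_div sum_eq_zero sum_mul univ)
open MvPolynomial (aeval aeval_X aeval_def continuous_eval eval eval_C eval_X hom_eval₂
  ringHom_ext)
open Topology MeasureTheory

/-! ### Contours -/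

/-- The arc `pt` is a closed contour around the origin with logarithmic derivative `w`. -/
structure IsContour (a : ℝ) (pt w : ℝ → ℂ) : Prop where
  ne : ∀ t, pt t ≠ 0
  deriv : ∀ t, HasDerivAt pt (w t * pt t) t
  cont : Continuous w
  periodic : pt (a + 2 * π) = pt a
  total : ∫ t in Set.Icc a (a + 2 * π), w t = 2 * π * I

/-- An interval of length `2 π`. -/
abbrev period (a : ℝ) : Set ℝ := Set.Icc a (a + 2 * π)

lemma setIntegral_period_of_hasDerivAt {a : ℝ} {f f' : ℝ → ℂ} (hf : ∀ t, HasDerivAt f (f' t) t)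
    (hc : Continuous f') : ∫ t in period a, f' t = f (a + 2 * π) - f a := by
  rw [integral_Icc_eq_integral_Ioc, ← intervalIntegral.integral_of_le (by linarith [Real.pi_pos])]
  exact intervalIntegral.integral_eq_sub_of_hasDerivAt (fun t _ => hf t)
    (hc.intervalIntegrable _ _)

namespace IsContour

variable {a : ℝ} {pt w : ℝ → ℂ}

lemma continuous (h : IsContour a pt w) : Continuous pt :=
  continuous_iff_continuousAt.2 fun t => (h.deriv t).continuousAt

lemma continuous_zpow (h : IsContour a pt w) (m : ℤ) : Continuous fun t => pt t ^ m :=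
  h.continuous.zpow₀ m fun t => Or.inl (h.ne t)

lemma integral_zpow (h : IsContour a pt w) (m : ℤ) :
    ∫ t in period a, pt t ^ m * w t = if m = 0 then 2 * π * I else 0 := by
  split_ifs with hm
  · simp only [hm, zpow_zero, one_mul]
    exact h.total
  · have hm' : (m : ℂ) ≠ 0 := Int.cast_ne_zero.2 hm
    rw [setIntegral_period_of_hasDerivAt (f := fun t => (m : ℂ)⁻¹ * pt t ^ m)
      (f' := fun t => pt t ^ m * w t) (fun t => ?_) ((h.continuous_zpow m).mul h.cont), h.periodic,
      sub_self]
    refine (((hasDerivAt_zpow m (pt t) (Or.inl (h.ne t))).comp t (h.deriv t)).const_mul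
      (m : ℂ)⁻¹).congr_deriv ?_
    have h1 : pt t ^ (m - 1) * pt t = pt t ^ m := by
      rw [← zpow_add_one₀ (h.ne t), sub_add_cancel]
    rw [← h1]
    field_simp

end IsContour

lemma setIntegral_sum_prod {ι : Type*} (s : Finset ι) {A B : ι → ℝ → ℂ} (a : ℝ)
    (hA : ∀ i, Continuous (A i)) (hB : ∀ i, Continuous (B i)) :
    ∫ p in period a ×ˢ period a, ∑ i ∈ s, A i p.1 * B i p.2 =
      ∑ i ∈ s, (∫ t in period a, A i t) * ∫ t in period a, B i t := by
  rw [integral_finsetSum]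
  · exact sum_congr rfl fun i _ => setIntegral_prod_mul (A i) (B i) _ _
  · intro i _
    exact (((hA i).comp continuous_fst).mul ((hB i).comp continuous_snd)).continuousOn
      |>.integrableOn_compact (isCompact_Icc.prod isCompact_Icc)

/-- A point of a product of two contours. -/
def contourPair (X Y : ℝ → ℂ) (p : ℝ × ℝ) : Fin 2 → ℂ := ![X p.1, Y p.2]

/-- The double contour integral of a rational function. -/
def contourInt (a : ℝ) (X Y wX wY : ℝ → ℂ) (k l : ℕ) (f : RatXY) : ℂ :=
  ∫ p in period a ×ˢ period a, ratEval (contourPair X Y p) f *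
    (X p.1 ^ (-(k : ℤ) - 1) * Y p.2 ^ (-(l : ℤ) - 1)) * (wX p.1 * wY p.2)

section

variable {a : ℝ} {X Y wX wY : ℝ → ℂ}

lemma continuous_contourPair (hX : Continuous X) (hY : Continuous Y) :
    Continuous (contourPair X Y) := by
  refine continuous_pi fun i => ?_
  fin_cases i
  · exact hX.comp continuous_fst
  · exact hY.comp continuous_snd

lemma continuous_ratEval_contourPair (hX : Continuous X) (hY : Continuous Y) {f : RatXY}
    (hf : ∀ p, IsReg (contourPair X Y p) f) :
    Continuous fun p => ratEval (contourPair X Y p) f :=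
  ((continuous_eval _).comp (continuous_contourPair hX hY)).div
    ((continuous_eval _).comp (continuous_contourPair hX hY)) hf

lemma continuous_contourInt (hX : IsContour a X wX) (hY : IsContour a Y wY) (k l : ℕ) {f : RatXY}
    (hf : ∀ p, IsReg (contourPair X Y p) f) :
    Continuous fun p : ℝ × ℝ => ratEval (contourPair X Y p) f *
      (X p.1 ^ (-(k : ℤ) - 1) * Y p.2 ^ (-(l : ℤ) - 1)) * (wX p.1 * wY p.2) :=
  ((continuous_ratEval_contourPair hX.continuous hY.continuous hf).mul
    (((hX.continuous_zpow _).comp continuous_fst).mul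
      ((hY.continuous_zpow _).comp continuous_snd))).mul
    ((hX.cont.comp continuous_fst).mul (hY.cont.comp continuous_snd))

lemma contourInt_sub (hX : IsContour a X wX) (hY : IsContour a Y wY) (k l : ℕ) {f g : RatXY}
    (hf : ∀ p, IsReg (contourPair X Y p) f) (hg : ∀ p, IsReg (contourPair X Y p) g) :
    contourInt a X Y wX wY k l (f - g) =
      contourInt a X Y wX wY k l f - contourInt a X Y wX wY k l g := by
  have hK : IsCompact (period a ×ˢ period a) := isCompact_Icc.prod isCompact_Icc
  rw [contourInt, contourInt, contourInt, ← integral_sub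
    ((continuous_contourInt hX hY k l hf).continuousOn.integrableOn_compact hK)
    ((continuous_contourInt hX hY k l hg).continuousOn.integrableOn_compact hK)]
  refine integral_congr_ae (Eventually.of_forall fun p => ?_)
  simp only
  rw [ratEval_sub (hf p) (hg p)]
  ring

lemma contourInt_sum (hX : IsContour a X wX) (hY : IsContour a Y wY) (k l : ℕ) {ι : Type*}
    (s : Finset ι) {f : ι → RatXY} (hf : ∀ i ∈ s, ∀ p, IsReg (contourPair X Y p) (f i)) :
    contourInt a X Y wX wY k l (∑ i ∈ s, f i) = ∑ i ∈ s, contourInt a X Y wX wY k l (f i) := by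
  have hK : IsCompact (period a ×ˢ period a) := isCompact_Icc.prod isCompact_Icc
  simp only [contourInt]
  rw [← integral_finsetSum s fun i hi =>
    (continuous_contourInt hX hY k l (hf i hi)).continuousOn.integrableOn_compact hK]
  refine integral_congr_ae (Eventually.of_forall fun p => ?_)
  simp only
  rw [ratEval_sum fun i hi => hf i hi p, sum_mul, sum_mul]

lemma contourInt_monomials (hX : IsContour a X wX) (hY : IsContour a Y wY) (k l : ℕ)
    (s : Finset (ℤ × ℤ)) (q : ℤ × ℤ → ℂ) :
    contourInt a X Y wX wY k l (∑ B ∈ s, q B • shiftMono B) =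
      (2 * π * I) ^ 2 * if ((k : ℤ), (l : ℤ)) ∈ s then q (k, l) else 0 := by
  have h1 : contourInt a X Y wX wY k l (∑ B ∈ s, q B • shiftMono B) =
      ∫ p in period a ×ˢ period a, ∑ B ∈ s, (q B * (X p.1 ^ (B.1 - k) * wX p.1)) *
        (Y p.2 ^ (B.2 - l) * wY p.2) := by
    refine integral_congr_ae (Eventually.of_forall fun p => ?_)
    have hx : X p.1 ≠ 0 := hX.ne _
    have hy : Y p.2 ≠ 0 := hY.ne _
    have hreg : ∀ B : ℤ × ℤ, IsReg (contourPair X Y p) (shiftMono B) := fun B =>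
      isReg_monomial (a := contourPair X Y p) hx hy (B.1 + 1) (B.2 + 1)
    simp only
    rw [ratEval_sum fun B _ => (hreg B).smul _, sum_mul, sum_mul]
    refine sum_congr rfl fun B _ => ?_
    have h2 : ratEval (contourPair X Y p) (shiftMono B) = X p.1 ^ (B.1 + 1) * Y p.2 ^ (B.2 + 1) :=
      ratEval_monomial (a := contourPair X Y p) hx hy _ _
    rw [ratEval_smul (hreg B), h2, show B.1 - (k : ℤ) = (B.1 + 1) + (-(k : ℤ) - 1) by ring,
      show B.2 - (l : ℤ) = (B.2 + 1) + (-(l : ℤ) - 1) by ring, zpow_add₀ hx (B.1 + 1),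
      zpow_add₀ hy (B.2 + 1)]
    generalize X p.1 ^ (B.1 + 1) = A₁, Y p.2 ^ (B.2 + 1) = A₂
    ring
  rw [h1, setIntegral_sum_prod s a
    (A := fun (B : ℤ × ℤ) t => q B * (X t ^ (B.1 - k) * wX t))
    (B := fun (B : ℤ × ℤ) t => Y t ^ (B.2 - l) * wY t)
    (fun B => continuous_const.mul ((hX.continuous_zpow _).mul hX.cont))
    (fun B => (hY.continuous_zpow _).mul hY.cont)]
  simp only [integral_const_mul, hX.integral_zpow, hY.integral_zpow]
  have h3 : ∀ B : ℤ × ℤ, q B * (if B.1 - (k : ℤ) = 0 then 2 * π * I else 0) *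
      (if B.2 - (l : ℤ) = 0 then 2 * π * I else 0) =
      if ((k : ℤ), (l : ℤ)) = B then (2 * π * I) ^ 2 * q (k, l) else 0 := by
    intro B
    by_cases h : ((k : ℤ), (l : ℤ)) = B
    · subst h
      simp
      ring
    · rw [if_neg h]
      by_cases h4 : B.1 - (k : ℤ) = 0
      · have h5 : B.2 - (l : ℤ) ≠ 0 := fun h5 => h (Prod.ext (by simp; omega) (by simp; omega))
        rw [if_neg h5, mul_zero]
      · rw [if_neg h4, mul_zero, zero_mul]
  rw [sum_congr rfl fun B _ => h3 B, Finset.sum_ite_eq, mul_ite, mul_zero]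

lemma eval_inVar (c : Fin 2) (b : Fin 2 → ℂ) (e : ℂ[X]) :
    eval b (inVar c e) = e.eval (b c) := by
  rw [inVar, ← MvPolynomial.coe_aeval_eq_eval, RingHom.coe_coe, ← Polynomial.aeval_algHom_apply,
    aeval_X, Polynomial.coe_aeval_eq_eval]

lemma IsSplit.regular {N : ℕ} {f : RatXY} {D E : ℂ[X]} {e g : ℕ → ℂ[X]}
    (h : IsSplit N (ratDen f) (ratNum f * (MvPolynomial.X 0 * MvPolynomial.X 1) ^ N) D E e g)
    {b : Fin 2 → ℂ} (h0 : b 0 ≠ 0) (h1 : b 1 ≠ 0) (hD : D.eval (b 0) ≠ 0) (hE : E.eval (b 1) ≠ 0) :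
    IsReg b f ∧ ratEval b f = (∑ i ∈ range (N + 1), b 0 ^ i * (e i).eval (b 1) /
      E.eval (b 1) + ∑ i ∈ range (N + 1), b 1 ^ i * (g i).eval (b 0) / D.eval (b 0)) /
        (b 0 * b 1) ^ N := by
  set num : PolyXY := inVar 0 D * ∑ k ∈ range (N + 1), MvPolynomial.X 0 ^ k * inVar 1 (e k) +
    inVar 1 E * ∑ k ∈ range (N + 1), MvPolynomial.X 1 ^ k * inVar 0 (g k) with hnum
  set den : PolyXY := inVar 0 D * inVar 1 E * (MvPolynomial.X 0 * MvPolynomial.X 1) ^ N with hden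
  have hdb : eval b den ≠ 0 := by
    rw [hden]
    simp only [map_mul, map_pow, eval_inVar, eval_X]
    exact mul_ne_zero (mul_ne_zero hD hE) (pow_ne_zero _ (mul_ne_zero h0 h1))
  have hden0 : den ≠ 0 := ne_zero_of_eval_ne_zero hdb
  have hf : f = toRat num / toRat den := by
    rw [eq_div_iff (toRat_ne_zero hden0)]
    nth_rewrite 1 [← ratNum_div_ratDen f]
    rw [div_mul_eq_mul_div, div_eq_iff (toRat_ne_zero (ratDen_ne_zero f)), ← map_mul, ← map_mul]
    congr 1
    rw [mul_comm num, ← h.eq, hden]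
    ring
  refine ⟨isReg_of_eq_div hdb hf, ?_⟩
  rw [ratEval_of_eq_div hdb hf, hnum, hden]
  simp only [map_mul, map_add, map_pow, map_sum, eval_inVar, eval_X,
    ← sum_div]
  field_simp

lemma IsSplit.contourInt_eq_zero {N : ℕ} {f : RatXY} {D E : ℂ[X]} {e g : ℕ → ℂ[X]}
    (h : IsSplit N (ratDen f) (ratNum f * (MvPolynomial.X 0 * MvPolynomial.X 1) ^ N) D E e g)
    (hX : IsContour a X wX) (hY : IsContour a Y wY) (hD : ∀ t, D.eval (X t) ≠ 0)
    (hE : ∀ t, E.eval (Y t) ≠ 0) (k l : ℕ) : contourInt a X Y wX wY k l f = 0 := by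
  have h1 : contourInt a X Y wX wY k l f = ∫ p in period a ×ˢ period a,
      ∑ i ∈ range (N + 1), ((X p.1 ^ ((i : ℤ) - N - k - 1) * wX p.1) *
        ((e i).eval (Y p.2) / E.eval (Y p.2) * Y p.2 ^ (-(N : ℤ) - l - 1) * wY p.2)) +
      ∑ i ∈ range (N + 1), (((g i).eval (X p.1) / D.eval (X p.1) *
        X p.1 ^ (-(N : ℤ) - k - 1) * wX p.1) * (Y p.2 ^ ((i : ℤ) - N - l - 1) * wY p.2)) := by
    refine integral_congr_ae (Eventually.of_forall fun p => ?_)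
    have hx : X p.1 ≠ 0 := hX.ne _
    have hy : Y p.2 ≠ 0 := hY.ne _
    have h2 := (h.regular (b := contourPair X Y p) hx hy (hD _) (hE _)).2
    simp only
    rw [h2]
    simp only [contourPair, Matrix.cons_val_zero, Matrix.cons_val_one]
    rw [add_div, add_mul, add_mul, sum_div, sum_mul, sum_mul, sum_div,
      sum_mul, sum_mul]
    congr 1
    · refine sum_congr rfl fun i _ => ?_
      rw [show (i : ℤ) - N - k - 1 = i + (-(N : ℤ)) + (-(k : ℤ) - 1) by ring,
        show -(N : ℤ) - l - 1 = -(N : ℤ) + (-(l : ℤ) - 1) by ring, zpow_add₀ hx, zpow_add₀ hx,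
        zpow_add₀ hy, zpow_neg, zpow_neg, zpow_natCast, zpow_natCast, zpow_natCast,
        mul_pow]
      field_simp
    · refine sum_congr rfl fun i _ => ?_
      rw [show (i : ℤ) - N - l - 1 = i + (-(N : ℤ)) + (-(l : ℤ) - 1) by ring,
        show -(N : ℤ) - k - 1 = -(N : ℤ) + (-(k : ℤ) - 1) by ring, zpow_add₀ hy, zpow_add₀ hy,
        zpow_add₀ hx, zpow_neg, zpow_neg, zpow_natCast, zpow_natCast, zpow_natCast,
        mul_pow]
      field_simp
  have hcX : ∀ (F G : ℂ[X]) (m : ℤ), (∀ t, G.eval (X t) ≠ 0) →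
      Continuous fun t => F.eval (X t) / G.eval (X t) * X t ^ m * wX t := fun F G m hG =>
    (((F.continuous.comp hX.continuous).div (G.continuous.comp hX.continuous) hG).mul
      (hX.continuous_zpow m)).mul hX.cont
  have hcY : ∀ (F G : ℂ[X]) (m : ℤ), (∀ t, G.eval (Y t) ≠ 0) →
      Continuous fun t => F.eval (Y t) / G.eval (Y t) * Y t ^ m * wY t := fun F G m hG =>
    (((F.continuous.comp hY.continuous).div (G.continuous.comp hY.continuous) hG).mul
      (hY.continuous_zpow m)).mul hY.cont
  have hK : IsCompact (period a ×ˢ period a) := isCompact_Icc.prod isCompact_Icc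
  rw [h1, integral_add]
  · rw [setIntegral_sum_prod _ a (A := fun (i : ℕ) t => X t ^ ((i : ℤ) - N - k - 1) * wX t)
      (B := fun (i : ℕ) t => (e i).eval (Y t) / E.eval (Y t) * Y t ^ (-(N : ℤ) - l - 1) * wY t)
      (fun i => (hX.continuous_zpow _).mul hX.cont) (fun i => hcY _ _ _ hE),
      setIntegral_sum_prod _ a (B := fun (i : ℕ) t => Y t ^ ((i : ℤ) - N - l - 1) * wY t)
      (A := fun (i : ℕ) t => (g i).eval (X t) / D.eval (X t) * X t ^ (-(N : ℤ) - k - 1) * wX t)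
      (fun i => hcX _ _ _ hD) (fun i => (hY.continuous_zpow _).mul hY.cont)]
    rw [sum_eq_zero, sum_eq_zero, add_zero]
    · intro i hi
      rw [hY.integral_zpow, if_neg, mul_zero]
      have := mem_range.1 hi
      omega
    · intro i hi
      rw [hX.integral_zpow, if_neg, zero_mul]
      have := mem_range.1 hi
      omega
  · refine (continuous_finsetSum _ fun i _ => ?_).continuousOn.integrableOn_compact hK
    exact (((hX.continuous_zpow ((i : ℤ) - N - k - 1)).mul hX.cont).comp continuous_fst).mul
      ((hcY (e i) E (-(N : ℤ) - l - 1) hE).comp continuous_snd)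
  · refine (continuous_finsetSum _ fun i _ => ?_).continuousOn.integrableOn_compact hK
    exact ((hcX (g i) D (-(N : ℤ) - k - 1) hD).comp continuous_fst).mul
      (((hY.continuous_zpow ((i : ℤ) - N - l - 1)).mul hY.cont).comp continuous_snd)

end

/-! ### The orbit sum on a contour -/

lemma hom_walkGF (M : Model) (σ : RatXY →ₐ[ℂ] RatXY) (u v n : ℕ) (X Y : RatXY) :
    σ (walkGF M u v n X Y) = walkGF M u v n (σ X) (σ Y) := by
  simp only [walkGF, map_sum, map_mul, map_pow, hom_const]

lemma isReg_walkGF (M : Model) (u v n : ℕ) (b : Fin 2 → ℂ) :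
    IsReg b (varX * varY * walkGF M u v n varX varY) :=
  ((isReg_varX b).mul (isReg_varY b)).mul (isReg_sum fun _ _ =>
    isReg_sum fun _ _ => ((isReg_const b _).mul ((isReg_varX b).pow _)).mul
      ((isReg_varY b).pow _))

/-- The automorphisms that occur in the alternating sum. -/
def orbitElem (M : Model) (ij : ℕ × Bool) : RatXY ≃ₐ[ℂ] RatXY :=
  if ij.2 then rot M ^ ij.1 * phi M else rot M ^ ij.1

/-- A common denominator of the coordinates of the orbit of the generic point. -/
def orbitDen (M : Model) : PolyXY :=
  ∏ ij ∈ range (rotOrder M) ×ˢ univ,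
    ratDen (orbitElem M ij varX) * ratDen (orbitElem M ij varY)

lemma orbitDen_ne_zero (M : Model) : orbitDen M ≠ 0 :=
  Finset.prod_ne_zero_iff.2 fun _ _ => mul_ne_zero (ratDen_ne_zero _) (ratDen_ne_zero _)

lemma eval_orbitDen_ne_zero_iff (M : Model) (b : Fin 2 → ℂ) :
    eval b (orbitDen M) ≠ 0 ↔ ∀ j < rotOrder M, ∀ i,
      IsReg b (orbitElem M (j, i) varX) ∧ IsReg b (orbitElem M (j, i) varY) := by
  rw [orbitDen, map_prod, Finset.prod_ne_zero_iff]
  constructor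
  · intro h j hj i
    have h1 := h (j, i) (by simp [hj])
    rw [map_mul] at h1
    exact ⟨left_ne_zero_of_mul h1, right_ne_zero_of_mul h1⟩
  · rintro h ⟨j, i⟩ hji
    have h1 := h j (by simpa using hji) i
    rw [map_mul]
    exact mul_ne_zero h1.1 h1.2

lemma orbitElem_mem (M : Model) (ij : ℕ × Bool) : orbitElem M ij ∈ modelGroup M := by
  rw [orbitElem]
  split_ifs
  · exact mul_mem (pow_mem (rot_mem M) _) (phi_mem M)
  · exact pow_mem (rot_mem M) _

lemma altSum_eq_sum (M : Model) (f : RatXY) : altSum M f =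
    ∑ j ∈ range (rotOrder M), (orbitElem M (j, false) f - orbitElem M (j, true) f) := by
  rw [altSum_apply]
  rfl

lemma exists_altSum_ne_zero {M : Model} {x0 y0 : ℝ} [Finite (modelGroup M)]
    (sp : IsDominantSaddle M x0 y0) : ∃ f, altSum M f ≠ 0 := by
  obtain ⟨W, hW⟩ := exists_isEigenParam sp
  obtain ⟨L, -⟩ := exists_gaussFunctional sp
  refine ⟨W ^ rotOrder M, fun h => ?_⟩
  have h1 := L.apply_altSum_ne_zero sp hW 0
  rw [h, zero_mul, map_zero] at h1
  exact h1 rfl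

lemma orbitElem_true_ne_one {M : Model} {x0 y0 : ℝ} [Finite (modelGroup M)]
    (sp : IsDominantSaddle M x0 y0) (j : ℕ) : orbitElem M (j, true) ≠ 1 := by
  intro h
  obtain ⟨f, hf⟩ := exists_altSum_ne_zero sp
  have h1 : rot M ^ j * phi M = 1 := h
  have h2 : ∀ (j : ℕ) (f : RatXY), altSum M ((rot M ^ j) f) = altSum M f := by
    intro j
    induction j with
    | zero => intro f; rfl
    | succ j ih =>
      intro f
      rw [pow_succ, AlgEquiv.mul_apply, ih, altSum_rot]
  have h3 := h2 j (phi M f)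
  rw [← AlgEquiv.mul_apply, h1, altSum_phi, AlgEquiv.one_apply] at h3
  exact hf (self_eq_neg.1 h3)

lemma orbitElem_false_ne_one (M : Model) {j : ℕ} (hj : j ≠ 0) (hj' : j < rotOrder M) :
    orbitElem M (j, false) ≠ 1 := pow_ne_one_of_lt_orderOf hj hj'

/-- The first (`c = 0`) or second coordinates of the lines on which the common denominator
vanishes. -/
def badCoords (M : Model) (c : Fin 2) : Set ℂ :=
  {ρ | ∀ b : Fin 2 → ℂ, b c = ρ → eval b (orbitDen M) = 0}

lemma finite_badCoords (M : Model) (c : Fin 2) : (badCoords M c).Finite := by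
  have h1 : ∃ b, eval b (orbitDen M) ≠ 0 := by
    by_contra hcon
    push Not at hcon
    exact orbitDen_ne_zero M (eq_zero_of_eval_eq_zero one_ne_zero fun a _ => hcon a)
  obtain ⟨b, hb⟩ := h1
  set q : ℂ[X] := aeval
    (Function.update (fun i => Polynomial.C (b i)) c Polynomial.X) (orbitDen M) with hq
  have hqe : ∀ z, q.eval z = eval (Function.update b c z) (orbitDen M) := by
    intro z
    rw [hq, ← Polynomial.coe_evalRingHom, aeval_def, hom_eval₂,
      ← MvPolynomial.coe_eval₂Hom]
    congr 1
    refine ringHom_ext (fun r => by simp) fun i => ?_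
    by_cases hi : i = c
    · subst hi
      simp
    · simp [Function.update_of_ne hi]
  have hq0 : q ≠ 0 := by
    intro h
    have h2 := hqe (b c)
    rw [h, Polynomial.eval_zero, Function.update_eq_self] at h2
    exact hb h2.symm
  refine (q.roots.toFinset.finite_toSet).subset fun ρ hρ => ?_
  rw [Finset.mem_coe, Multiset.mem_toFinset, Polynomial.mem_roots hq0, Polynomial.IsRoot, hqe]
  exact hρ _ (Function.update_self _ _ _)

lemma mem_badCoords_of_dvd {M : Model} {c : Fin 2} {ρ : ℂ} {j : ℕ} {i : Bool}
    (hj : j < rotOrder M) {u v n : ℕ} (h : MvPolynomial.X c - MvPolynomial.C ρ ∣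
      ratDen (orbitElem M (j, i) (varX * varY * walkGF M u v n varX varY))) :
    ρ ∈ badCoords M c := by
  intro b hb
  by_contra hcon
  have h1 := (eval_orbitDen_ne_zero_iff M b).1 hcon j hj i
  have h2 := (isReg_hom_aux (orbitElem M (j, i) : RatXY →ₐ[ℂ] RatXY) h1.1 h1.2 rfl
    (isReg_walkGF M u v n _)).1
  refine h2 ?_
  obtain ⟨q, hq⟩ := h
  have hq' : ratDen ((orbitElem M (j, i) : RatXY →ₐ[ℂ] RatXY)
    (varX * varY * walkGF M u v n varX varY)) = (MvPolynomial.X c - MvPolynomial.C ρ) * q := hq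
  rw [hq', map_mul, map_sub, eval_X, eval_C, hb, sub_self, zero_mul]

section

variable {M : Model} {x0 y0 a : ℝ} {X Y wX wY : ℝ → ℂ}

lemma orbitElem_contour (hM : OrbitSummable M) (hX : IsContour a X wX) (hY : IsContour a Y wY)
    (hbX : ∀ t, X t ∉ badCoords M 0) (hbY : ∀ t, Y t ∉ badCoords M 1) {j : ℕ} {i : Bool}
    (hj : j < rotOrder M) (h1 : orbitElem M (j, i) ≠ 1) (u v n k l : ℕ) :
    (∀ p, IsReg (contourPair X Y p)
      (orbitElem M (j, i) (varX * varY * walkGF M u v n varX varY))) ∧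
    contourInt a X Y wX wY k l
      (orbitElem M (j, i) (varX * varY * walkGF M u v n varX varY)) = 0 := by
  set σ := orbitElem M (j, i) with hσ
  have hne : (σ varX, σ varY) ≠ (varX, varY) := by
    intro h
    exact h1 (equiv_ext (congrArg Prod.fst h) (congrArg Prod.snd h))
  have h2 := hM.2 _ (memGroup_of_mem M (orbitElem_mem M (j, i))) hne u v n
  have h3 : σ varX * σ varY * walkGF M u v n (σ varX) (σ varY) =
      σ (varX * varY * walkGF M u v n varX varY) := by
    rw [map_mul, map_mul]
    congr 1
    exact (hom_walkGF M (σ : RatXY →ₐ[ℂ] RatXY) u v n varX varY).symm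
  rw [← hσ] at h2
  simp only [h3] at h2
  obtain ⟨N, D, E, e, g, hs, hD, hE⟩ := exists_isSplit_of_noPositivePart h2
  have hD' : ∀ t, D.eval (X t) ≠ 0 := fun t h => hbX t (mem_badCoords_of_dvd hj (hD _ h))
  have hE' : ∀ t, E.eval (Y t) ≠ 0 := fun t h => hbY t (mem_badCoords_of_dvd hj (hE _ h))
  exact ⟨fun p => (hs.regular (b := contourPair X Y p) (hX.ne _) (hY.ne _) (hD' _) (hE' _)).1,
    hs.contourInt_eq_zero hX hY hD' hE' k l⟩

theorem contourInt_altSum (hM : OrbitSummable M) [Finite (modelGroup M)]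
    (sp : IsDominantSaddle M x0 y0) (hX : IsContour a X wX)
    (hY : IsContour a Y wY) (hbX : ∀ t, X t ∉ badCoords M 0) (hbY : ∀ t, Y t ∉ badCoords M 1)
    (u v n k l : ℕ) :
    (∀ p, IsReg (contourPair X Y p) (altSum M (varX * varY * walkGF M u v n varX varY))) ∧
    contourInt a X Y wX wY k l (altSum M (varX * varY * walkGF M u v n varX varY)) =
      (2 * π * I) ^ 2 * walks M (u, v) (k, l) n := by
  set T := varX * varY * walkGF M u v n varX varY with hT
  have hpos := rotOrder_pos M
  have h1 : ∀ j < rotOrder M, ∀ i, ∀ p, IsReg (contourPair X Y p) (orbitElem M (j, i) T) := by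
    intro j hj i
    by_cases hne : orbitElem M (j, i) = 1
    · intro p
      rw [hne]
      exact isReg_walkGF M u v n _
    · exact (orbitElem_contour hM hX hY hbX hbY hj hne u v n k l).1
  have h2 : ∀ j < rotOrder M, ∀ p, IsReg (contourPair X Y p)
      (orbitElem M (j, false) T - orbitElem M (j, true) T) := fun j hj p =>
    (h1 j hj false p).sub (h1 j hj true p)
  rw [altSum_eq_sum]
  refine ⟨fun p => isReg_sum fun j hj => h2 j (mem_range.1 hj) p, ?_⟩
  rw [contourInt_sum hX hY k l _ fun j hj => h2 j (mem_range.1 hj),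
    Finset.sum_eq_single_of_mem 0 (mem_range.2 hpos)]
  · rw [contourInt_sub hX hY k l (h1 0 hpos false) (h1 0 hpos true),
      (orbitElem_contour hM hX hY hbX hbY hpos (orbitElem_true_ne_one sp 0) u v n k l).2, sub_zero]
    have h3 : orbitElem M (0, false) T = T := rfl
    rw [h3, hT, mul_walkGF, contourInt_monomials hX hY k l _
      fun B => (walks M (u, v) B n : ℂ)]
    congr 1
    split_ifs with hmem
    · rfl
    · rw [walks_eq_zero M ⟨Int.natCast_nonneg u, Int.natCast_nonneg v⟩, Complex.ofReal_zero]
      simp only [endBox, Finset.mem_product, Finset.mem_Icc] at hmem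
      simp only
      omega
  · intro j hj hj0
    have hj' := mem_range.1 hj
    rw [contourInt_sub hX hY k l (h1 j hj' false) (h1 j hj' true),
      (orbitElem_contour hM hX hY hbX hbY hj' (orbitElem_true_ne_one sp j) u v n k l).2,
      (orbitElem_contour hM hX hY hbX hbY hj' (orbitElem_false_ne_one M hj0 hj') u v n k l).2,
      sub_zero]

end

end

section

open scoped Real
open Complex (I exp exp_eq_exp_iff_exists_int ofReal_ne_zero)
open Real (smoothTransition two_pi_pos)
open Topology MeasureTheory

/-! ### Dented circles -/

/-- A circle whose radius is diminished by the factor `exp (-ε h)`. -/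
def dentedCircle (r : ℝ) (h : ℝ → ℝ) (ε t : ℝ) : ℂ := r * exp (I * t - (ε * h t : ℝ))

lemma isContour_dentedCircle {r : ℝ} (hr : 0 < r) {h : ℝ → ℝ} (hh : ContDiff ℝ 1 h)
    (hper : ∀ t, h (t + 2 * π) = h t) (a ε : ℝ) :
    IsContour a (dentedCircle r h ε) (fun t => I - (ε * deriv h t : ℝ)) := by
  have hd : ∀ t, HasDerivAt (fun t : ℝ => I * t - (ε * h t : ℝ))
      (I - (ε * deriv h t : ℝ)) t := by
    intro t
    have h1 : HasDerivAt (fun t : ℝ => I * (t : ℂ)) I t := by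
      simpa using (Complex.ofRealCLM.hasDerivAt (x := t)).const_mul I
    have h2 : HasDerivAt h (deriv h t) t := (hh.differentiable one_ne_zero t).hasDerivAt
    exact h1.sub (h2.const_mul ε).ofReal_comp
  have hc : Continuous fun t : ℝ => I - ((ε * deriv h t : ℝ) : ℂ) :=
    continuous_const.sub (Complex.continuous_ofReal.comp
      (continuous_const.mul (hh.continuous_deriv le_rfl)))
  refine ⟨fun t => mul_ne_zero (ofReal_ne_zero.2 hr.ne') (Complex.exp_ne_zero _),
    fun t => ?_, hc, ?_, ?_⟩
  · refine (((hd t).cexp).const_mul (r : ℂ)).congr_deriv ?_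
    rw [dentedCircle]
    ring
  · rw [dentedCircle, dentedCircle, hper]
    congr 1
    rw [exp_eq_exp_iff_exists_int]
    exact ⟨1, by push_cast; ring⟩
  · have h1 := setIntegral_period_of_hasDerivAt (a := a) hd hc
    rw [period] at h1
    rw [h1, hper]
    push_cast
    ring

lemma dentedCircle_of_eq_zero {r : ℝ} {h : ℝ → ℝ} {t : ℝ} (ht : h t = 0) (ε : ℝ) :
    dentedCircle r h ε t = r * exp (I * t) := by
  simp [dentedCircle, ht]

lemma norm_dentedCircle {r : ℝ} (hr : 0 < r) (h : ℝ → ℝ) (ε t : ℝ) :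
    ‖dentedCircle r h ε t‖ = r * Real.exp (-(ε * h t)) := by
  rw [dentedCircle, norm_mul, Complex.norm_real, Real.norm_of_nonneg hr.le, Complex.norm_exp]
  simp

/-- A circle can be dented so that it avoids the finite set `B` and is unchanged near the
finite set `S`. -/
lemma exists_dent {r : ℝ} (hr : 0 < r) (S B : Finset ℂ) (hSB : ∀ ρ ∈ B, ρ ∉ S) :
    ∃ h : ℝ → ℝ, ContDiff ℝ 1 h ∧ (∀ t, h (t + 2 * π) = h t) ∧
      (∀ t : ℝ, r * exp (I * t) ∈ S → ∀ᶠ s in 𝓝 t, h s = 0) ∧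
      ∀ᶠ ε in 𝓝[>] (0 : ℝ), ∀ t, dentedCircle r h ε t ∉ B := by
  have hK : ∀ᶠ K : ℝ in atTop, ∀ ρ ∈ B, 2 ≤ K * ∏ σ ∈ S, ‖ρ - σ‖ ^ 2 := by
    refine (eventually_all_finset B).2 fun ρ hρ => ?_
    have hpos : 0 < ∏ σ ∈ S, ‖ρ - σ‖ ^ 2 := Finset.prod_pos fun σ hσ =>
      pow_pos (norm_pos_iff.2 (sub_ne_zero.2 (ne_of_mem_of_not_mem hσ (hSB ρ hρ)).symm)) 2
    exact (tendsto_id.atTop_mul_const hpos).eventually_ge_atTop 2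
  obtain ⟨K, hK⟩ := hK.exists
  set g : ℝ → ℝ := fun t => K * ∏ σ ∈ S, ‖(r : ℂ) * exp (I * t) - σ‖ ^ 2 - 1 with hg
  have hgc : ContDiff ℝ 1 g := by
    refine (contDiff_const.mul (contDiff_prod fun σ _ => ContDiff.norm_sq ℝ ?_)).sub contDiff_const
    exact (contDiff_const.mul (contDiff_const.mul Complex.ofRealCLM.contDiff).cexp).sub
      contDiff_const
  set h : ℝ → ℝ := fun t => smoothTransition (g t) with hh
  have h_nonneg : ∀ t, 0 ≤ h t := fun t => smoothTransition.nonneg _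
  have h_le : ∀ t, h t ≤ 1 := fun t => smoothTransition.le_one _
  refine ⟨h, smoothTransition.contDiff.comp hgc, fun t => ?_, fun t ht => ?_, ?_⟩
  · have h1 : exp (I * ((t + 2 * π : ℝ) : ℂ)) =
        exp (I * t) := by
      rw [exp_eq_exp_iff_exists_int]
      exact ⟨1, by push_cast; ring⟩
    simp only [hh, hg, h1]
  · have h1 : g t < 0 := by
      have h2 : ∏ σ ∈ S, ‖(r : ℂ) * exp (I * t) - σ‖ ^ 2 = 0 :=
        Finset.prod_eq_zero ht (by simp)
      simp only [hg, h2]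
      norm_num
    filter_upwards [hgc.continuous.continuousAt.eventually_lt continuousAt_const h1] with s hs
    exact smoothTransition.zero_of_nonpos hs.le
  · have key : ∀ ρ ∈ B, ∀ᶠ ε in 𝓝[>] (0 : ℝ), ∀ t, dentedCircle r h ε t ≠ ρ := by
      intro ρ hρ
      rcases lt_or_ge ‖ρ‖ r with hlt | hge
      · have h1 : ∀ᶠ ε in 𝓝 (0 : ℝ), ‖ρ‖ < r * Real.exp (-ε) := by
          refine continuousAt_const.eventually_lt (by fun_prop) ?_
          simpa using hlt
        filter_upwards [self_mem_nhdsWithin, nhdsWithin_le_nhds h1] with ε hε h2 t h3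
        have hε' : 0 < ε := hε
        rw [← h3, norm_dentedCircle hr] at h2
        have h4 : Real.exp (-ε) ≤ Real.exp (-(ε * h t)) := by
          refine Real.exp_le_exp.2 (neg_le_neg ?_)
          nlinarith [h_le t]
        nlinarith
      · filter_upwards [self_mem_nhdsWithin] with ε hε t h3
        have hε' : 0 < ε := hε
        rw [← h3, norm_dentedCircle hr] at hge
        have h4 : h t = 0 := by
          by_contra hne
          have h5 : 0 < ε * h t := mul_pos hε' (lt_of_le_of_ne (h_nonneg t) (Ne.symm hne))
          have h6 : Real.exp (-(ε * h t)) < 1 := Real.exp_lt_one_iff.2 (by linarith)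
          nlinarith
        have h5 : 1 ≤ g t := by
          rw [dentedCircle_of_eq_zero h4] at h3
          simp only [hg]
          rw [h3]
          linarith [hK ρ hρ]
        have h6 : h t = 1 := smoothTransition.one_of_one_le h5
        rw [h4] at h6
        exact zero_ne_one h6
    filter_upwards [(eventually_all_finset B).2 key] with ε hε t hmem
    exact hε _ hmem t rfl

lemma continuous_dentedCircle (r : ℝ) {h : ℝ → ℝ} (hh : Continuous h) :
    Continuous fun q : ℝ × ℝ => dentedCircle r h q.1 q.2 := by
  unfold dentedCircle
  fun_prop

variable {M : Model} {x0 y0 : ℝ}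

/-! ### The saddle points and the dented torus -/

lemma fixesPt_orbitElem (sp : IsDominantSaddle M x0 y0) (ij : ℕ × Bool) :
    FixesPt (basePt x0 y0) (orbitElem M ij) := by
  rw [orbitElem]
  split_ifs
  · exact ((fixesPt_rot sp).pow _).mul (fixesPt_phi sp)
  · exact (fixesPt_rot sp).pow _

lemma IsTwist.map_orbitElem {α β ζ : ℂ} {τ : RatXY →ₐ[ℂ] RatXY} (h : IsTwist M α β ζ)
    (hx : τ varX = α • varX) (hy : τ varY = β • varY) (ij : ℕ × Bool) (f : RatXY) :
    τ (orbitElem M ij f) = orbitElem M ij (τ f) := by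
  rw [orbitElem]
  split_ifs
  · rw [AlgEquiv.mul_apply, AlgEquiv.mul_apply, h.map_rot_pow hx hy, h.map_phi hx hy]
  · rw [h.map_rot_pow hx hy]

lemma eval_orbitDen_ne_zero_of_mem (sp : IsDominantSaddle M x0 y0) {p : ℝ × ℝ}
    (hp : ‖charFn M x0 y0 p‖ = 1) : MvPolynomial.eval (torusPt x0 y0 p) (orbitDen M) ≠ 0 := by
  have ht := isTwist_of_norm_charFn sp hp
  have hpt : torusPt x0 y0 p = ![exp (I * p.1) * basePt x0 y0 0,
      exp (I * p.2) * basePt x0 y0 1] := by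
    funext i
    fin_cases i <;> simp [torusPt, basePt, mul_comm]
  rw [hpt, eval_orbitDen_ne_zero_iff]
  intro j _ i
  have hreg := fixesPt_orbitElem sp (j, i)
  constructor
  · refine (ht.regular_of_eigen ht.fst_ne (fun τ hx hy => ?_)
      (hreg _ (isReg_varX _)).1).1
    rw [ht.inv.map_orbitElem hx hy, hx, equiv_smul]
  · refine (ht.regular_of_eigen ht.snd_ne (fun τ hx hy => ?_)
      (hreg _ (isReg_varY _)).1).1
    rw [ht.inv.map_orbitElem hx hy, hy, equiv_smul]

lemma exists_mem_Ioo_exp_eq {a r : ℝ} {z : ℂ} (hz : ‖z‖ = r)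
    (ha : r * exp (I * a) ≠ z) :
    ∃ θ ∈ Set.Ioo a (a + 2 * π), (r : ℂ) * exp (I * θ) = z := by
  have hper : ∀ (θ : ℝ) (m : ℤ), exp (I * ((θ - m • (2 * π) : ℝ) : ℂ)) =
      exp (I * θ) := by
    intro θ m
    rw [exp_eq_exp_iff_exists_int]
    exact ⟨-m, by push_cast [zsmul_eq_mul]; ring⟩
  set θ := toIocMod two_pi_pos a z.arg with hθ
  have h1 : (r : ℂ) * exp (I * θ) = z := by
    rw [hθ, toIocMod, hper, ← hz, mul_comm I, Complex.norm_mul_exp_arg_mul_I]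
  have h2 := toIocMod_mem_Ioc two_pi_pos a z.arg
  refine ⟨θ, ⟨h2.1, lt_of_le_of_ne h2.2 fun h3 => ha ?_⟩, h1⟩
  rw [← h1]
  change θ = _ at h3
  rw [h3, ← hper (a + 2 * π) 1, one_smul, add_sub_cancel_right]

lemma eq_of_exp_eq {a r θ t : ℝ} (hr : 0 < r) (hθ : θ ∈ Set.Ioo a (a + 2 * π))
    (ht : t ∈ period a) (h : (r : ℂ) * exp (I * t) = r * exp (I * θ)) :
    t = θ := by
  have h1 := mul_left_cancel₀ (ofReal_ne_zero.2 hr.ne') h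
  obtain ⟨m, hm⟩ := exp_eq_exp_iff_exists_int.1 h1
  have h2 : t = θ + m * (2 * π) := by
    have h3 : I * (t : ℂ) = I * ((θ + m * (2 * π) : ℝ) : ℂ) := by
      rw [hm]
      push_cast
      ring
    exact_mod_cast mul_left_cancel₀ Complex.I_ne_zero h3
  have hπ := two_pi_pos
  have h3 : (m : ℝ) < 1 := by
    by_contra hcon
    push Not at hcon
    nlinarith [ht.2, hθ.1]
  have h4 : (-1 : ℝ) < m := by
    by_contra hcon
    push Not at hcon
    nlinarith [ht.1, hθ.2]
  have h5 : m = 0 := by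
    have h6 : m < 1 := by exact_mod_cast h3
    have h7 : -1 < m := by exact_mod_cast h4
    omega
  rw [h2, h5]
  simp

lemma exists_base_angle {x0 y0 : ℝ} (S : Finset (ℂ × ℂ)) (hx : 0 < x0) (hy : 0 < y0) :
    ∃ a : ℝ, ∀ z ∈ S, (x0 : ℂ) * exp (I * a) ≠ z.1 ∧
      (y0 : ℂ) * exp (I * a) ≠ z.2 := by
  have h1 : (Set.Ioo (-π) π).Infinite :=
    Set.Ioo_infinite (by linarith [Real.pi_pos])
  obtain ⟨a, ha, hna⟩ := h1.exists_notMem_finset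
    (S.image (fun z => z.1.arg) ∪ S.image (fun z => z.2.arg))
  have harg : ∀ r : ℝ, 0 < r → ((r : ℂ) * exp (I * a)).arg = a := by
    intro r hr
    rw [Complex.arg_real_mul _ hr, mul_comm, Complex.arg_exp_mul_I, toIocMod_eq_self]
    exact ⟨ha.1, by linarith [ha.2]⟩
  refine ⟨a, fun z hz => ⟨fun h => hna ?_, fun h => hna ?_⟩⟩
  · refine Finset.mem_union_left _ (Finset.mem_image.2 ⟨z, hz, ?_⟩)
    rw [← h, harg _ hx]
  · refine Finset.mem_union_right _ (Finset.mem_image.2 ⟨z, hz, ?_⟩)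
    rw [← h, harg _ hy]

end

section

open Complex (I exp)
open Finset (mem_image_of_mem mem_univ univ)
open Function (onFun)
open Metric (ball closedBall isOpen_ball)
open Topology MeasureTheory

variable {M : Model} {x0 y0 : ℝ}

/-! ### Localization at the saddle points -/

lemma box_eq_closedBall (δ : ℝ) : box δ = closedBall 0 δ := by
  ext p
  rw [mem_box, mem_closedBall_zero_iff, Prod.norm_def, max_le_iff, Real.norm_eq_abs,
    Real.norm_eq_abs]

lemma setIntegral_closedBall (F : ℝ × ℝ → ℂ) (P : ℝ × ℝ) (δ : ℝ) :
    ∫ p in closedBall P δ, F p = ∫ q in box δ, F (P + q) := by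
  rw [← integral_indicator Metric.isClosed_closedBall.measurableSet,
    ← integral_indicator (measurableSet_box δ), ← integral_add_left_eq_self _ P]
  congr 1
  funext q
  have h : P + q ∈ closedBall P δ ↔ q ∈ box δ := by
    rw [box_eq_closedBall, mem_closedBall_iff_norm, mem_closedBall_zero_iff, add_sub_cancel_left]
  by_cases hq : q ∈ box δ
  · rw [Set.indicator_of_mem hq, Set.indicator_of_mem (h.2 hq)]
  · rw [Set.indicator_of_notMem hq, Set.indicator_of_notMem fun h' => hq (h.1 h')]

lemma exists_lt_one_of_isCompact {K : Set (ℝ × ℝ)} (hK : IsCompact K) {s : ℝ × ℝ → ℂ}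
    (hs : Continuous s) (h : ∀ p ∈ K, ‖s p‖ < 1) : ∃ r : ℝ, 0 ≤ r ∧ r < 1 ∧ ∀ p ∈ K, ‖s p‖ ≤ r := by
  rcases K.eq_empty_or_nonempty with rfl | hne
  · exact ⟨0, le_rfl, zero_lt_one, fun p hp => absurd hp (Set.notMem_empty p)⟩
  · obtain ⟨p, hp, hmax⟩ := hK.exists_isMaxOn hne hs.norm.continuousOn
    exact ⟨‖s p‖, norm_nonneg _, h p hp, fun q hq => hmax hq⟩

lemma isRapid_integral_sub_sum {r : ℕ} {Q : Set (ℝ × ℝ)} (hQ : IsCompact Q) {s G : ℝ × ℝ → ℂ}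
    (hs : Continuous s) (hG : Continuous G) {P : Fin r → ℝ × ℝ} {δ : ℝ}
    (hsub : ∀ i, closedBall (P i) δ ⊆ Q)
    (hdisj : Pairwise (onFun Disjoint fun i => closedBall (P i) δ))
    (hlt : ∀ p ∈ Q \ ⋃ i, ball (P i) δ, ‖s p‖ < 1) :
    IsRapid fun n => (∫ p in Q, s p ^ n * G p) -
      ∑ i, ∫ q in box δ, s (P i + q) ^ n * G (P i + q) := by
  obtain ⟨r, hr0, hr, hle⟩ := exists_lt_one_of_isCompact
    (hQ.diff (isOpen_iUnion fun i => isOpen_ball)) hs hlt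
  obtain ⟨C, hC⟩ := hQ.exists_bound_of_continuousOn hG.continuousOn
  have hF : ∀ n, Continuous fun p => s p ^ n * G p := fun n => (hs.pow n).mul hG
  have hm : ∀ i, MeasurableSet (closedBall (P i) δ) := fun i =>
    Metric.isClosed_closedBall.measurableSet
  refine (isRapid_setIntegral (K := Q \ ⋃ i, closedBall (P i) δ) (μ := volume) (s := s)
    (g := G) ((measure_mono Set.sdiff_subset).trans_lt hQ.measure_lt_top) hr0 hr
    (fun p hp => hle p ⟨hp.1, fun h => hp.2 ?_⟩) (fun p hp => hC p hp.1)).congr fun n => ?_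
  · exact Set.iUnion_mono (fun i => Metric.ball_subset_closedBall) h
  · have hint : IntegrableOn (fun p => s p ^ n * G p) Q :=
      (hF n).continuousOn.integrableOn_compact hQ
    rw [setIntegral_sdiff (MeasurableSet.iUnion hm) hint (Set.iUnion_subset hsub),
      integral_iUnion_fintype hm hdisj fun i => hint.mono_set (hsub i)]
    simp only [setIntegral_closedBall]

lemma continuous_stepPoly {T : Type*} [TopologicalSpace T] (M : Model) {X Y : T → ℂ}
    (hX : Continuous X) (hY : Continuous Y) (hX0 : ∀ t, X t ≠ 0) (hY0 : ∀ t, Y t ≠ 0) :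
    Continuous fun t => stepPoly M (X t) (Y t) :=
  continuous_finsetSum _ fun s _ => (continuous_const.mul
    (hX.zpow₀ s.1 fun t => Or.inl (hX0 t))).mul (hY.zpow₀ s.2 fun t => Or.inl (hY0 t))

/-- A product of contours that agrees with the torus near the saddle points and on which the step
polynomial is small elsewhere. -/
structure IsSaddleContour (M : Model) (x0 y0 a δ : ℝ) (X Y wX wY : ℝ → ℂ) {r : ℕ}
    (P : Fin r → ℝ × ℝ) : Prop where
  fst : IsContour a X wX
  snd : IsContour a Y wY
  fst_notMem : ∀ t, X t ∉ badCoords M 0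
  snd_notMem : ∀ t, Y t ∉ badCoords M 1
  norm_charFn : ∀ i, ‖charFn M x0 y0 (P i)‖ = 1
  pair_eq : ∀ i, ∀ q ∈ box δ, contourPair X Y (P i + q) = torusPt x0 y0 (P i + q)
  weight_eq : ∀ i, ∀ q ∈ box δ, wX (P i + q).1 = I ∧ wY (P i + q).2 = I
  subset : ∀ i, closedBall (P i) δ ⊆ period a ×ˢ period a
  disjoint : Pairwise (onFun Disjoint fun i => closedBall (P i) δ)
  lt_one : ∀ p ∈ (period a ×ˢ period a) \ ⋃ i, ball (P i) δ,
    ‖stepPoly M (X p.1) (Y p.2) / (stepPoly M x0 y0 : ℝ)‖ < 1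

lemma exists_isSaddleContour (sp : IsDominantSaddle M x0 y0) {r : ℕ} {z : Fin r → ℂ × ℂ}
    (hinj : Function.Injective z) (hz : Set.range z = saddlePoints M x0 y0) {δ₀ : ℝ}
    (hδ₀ : 0 < δ₀) : ∃ (a δ : ℝ) (X Y wX wY : ℝ → ℂ) (P : Fin r → ℝ × ℝ), 0 < δ ∧ δ ≤ δ₀ ∧
      (∀ i, z i = (torusPt x0 y0 (P i) 0, torusPt x0 y0 (P i) 1)) ∧
      IsSaddleContour M x0 y0 a δ X Y wX wY P := by
  classical
  have hzmem : ∀ i, z i ∈ saddlePoints M x0 y0 := fun i => hz ▸ Set.mem_range_self i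
  obtain ⟨a, ha⟩ := exists_base_angle (univ.image z) sp.1 sp.2.1
  have ha' := fun i => ha (z i) (mem_image_of_mem z (mem_univ i))
  choose θ hθ hθz using fun i => exists_mem_Ioo_exp_eq (hzmem i).1 (ha' i).1
  choose φ hφ hφz using fun i => exists_mem_Ioo_exp_eq (hzmem i).2.1 (ha' i).2
  set P : Fin r → ℝ × ℝ := fun i => (θ i, φ i) with hP
  have hPz : ∀ i, z i = (torusPt x0 y0 (P i) 0, torusPt x0 y0 (P i) 1) := fun i =>
    Prod.ext (hθz i).symm (hφz i).symm
  have hPn : ∀ i, ‖charFn M x0 y0 (P i)‖ = 1 := fun i => by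
    rw [norm_charFn_eq_one_iff sp, ← hPz i]
    exact hzmem i
  have hPbad : ∀ i c, torusPt x0 y0 (P i) c ∉ badCoords M c := fun i c hmem =>
    eval_orbitDen_ne_zero_of_mem sp (hPn i) (hmem _ rfl)
  have hdis : ∀ c : Fin 2, ∀ ρ ∈ (finite_badCoords M c).toFinset,
      ρ ∉ univ.image fun i => torusPt x0 y0 (P i) c := by
    intro c ρ hρ hmem
    obtain ⟨i, -, rfl⟩ := Finset.mem_image.1 hmem
    exact hPbad i c ((Set.Finite.mem_toFinset _).1 hρ)
  obtain ⟨f, hf, hfper, hf0, hfbad⟩ := exists_dent sp.1 _ _ (hdis 0)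
  obtain ⟨g, hg, hgper, hg0, hgbad⟩ := exists_dent sp.2.1 _ _ (hdis 1)
  have hf0' : ∀ i, ∀ᶠ s in 𝓝 (P i).1, f s = 0 := fun i =>
    hf0 _ (mem_image_of_mem _ (mem_univ i))
  have hg0' : ∀ i, ∀ᶠ s in 𝓝 (P i).2, g s = 0 := fun i =>
    hg0 _ (mem_image_of_mem _ (mem_univ i))
  have ht : ∀ i, Tendsto (fun q : ℝ × ℝ => P i + q) (𝓝 0) (𝓝 (P i)) := fun i => by
    have h : ContinuousAt (fun q : ℝ × ℝ => P i + q) 0 := by fun_prop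
    simpa [ContinuousAt] using h
  have hU : ∀ᶠ q in 𝓝 (0 : ℝ × ℝ), ‖q‖ < δ₀ ∧ ∀ i, ((∀ᶠ s in 𝓝 (P i + q).1, f s = 0) ∧
      (∀ᶠ s in 𝓝 (P i + q).2, g s = 0)) ∧ ((P i + q) ∈ period a ×ˢ period a ∧
      ∀ j, P i ≠ P j → ‖q‖ < dist (P i) (P j) / 2) := by
    have hn : Tendsto (fun q : ℝ × ℝ => ‖q‖) (𝓝 0) (𝓝 0) := by
      simpa using (continuous_norm (E := ℝ × ℝ)).tendsto 0
    refine (hn.eventually (gt_mem_nhds hδ₀)).and (eventually_all.2 fun i => ((((continuous_fst.tendsto _).comp (ht i)).eventually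
      (eventually_eventually_nhds.2 (hf0' i))).and (((continuous_snd.tendsto _).comp
        (ht i)).eventually (eventually_eventually_nhds.2 (hg0' i)))).and (((ht i).eventually
          (prod_mem_nhds (Icc_mem_nhds (hθ i).1 (hθ i).2) (Icc_mem_nhds (hφ i).1 (hφ i).2))).and
          (eventually_all.2 fun j => ?_)))
    by_cases hij : P i = P j
    · exact Eventually.of_forall fun _ h => absurd hij h
    · filter_upwards [hn.eventually (gt_mem_nhds (half_pos (dist_pos.2 hij)))] with q hq _
      exact hq
  obtain ⟨δ, hδ, -, hbox⟩ := exists_box_subset hU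
  have hδmem : ((δ, 0) : ℝ × ℝ) ∈ box δ := mem_box.2 ⟨(abs_of_pos hδ).le, by simpa using hδ.le⟩
  have hδn : ‖((δ, 0) : ℝ × ℝ)‖ = δ := by simp [Prod.norm_def, hδ.le]
  have hδδ₀ : δ ≤ δ₀ := by
    have h := (hbox hδmem).1
    rw [hδn] at h
    exact h.le
  have hsub : ∀ i, closedBall (P i) δ ⊆ period a ×ˢ period a := by
    intro i p hp
    have h1 : p - P i ∈ box δ := by
      rwa [box_eq_closedBall, mem_closedBall_zero_iff, ← mem_closedBall_iff_norm]
    have h2 := ((hbox h1).2 i).2.1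
    rwa [add_sub_cancel] at h2
  have hdisj : Pairwise (onFun Disjoint fun i => closedBall (P i) δ) := by
    intro i j hij
    have hne : P i ≠ P j := fun h => hij (hinj (by rw [hPz i, hPz j, h]))
    refine Metric.closedBall_disjoint_closedBall ?_
    have h := ((hbox hδmem).2 i).2.2 j hne
    rw [hδn] at h
    linarith
  set K := (period a ×ˢ period a) \ ⋃ i, ball (P i) δ with hK
  have hKc : IsCompact K :=
    (isCompact_Icc.prod isCompact_Icc).diff (isOpen_iUnion fun i => isOpen_ball)
  have hγ := sp.pos
  have hKlt : ∀ p ∈ K, ‖charFn M x0 y0 p‖ < 1 := by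
    intro p hp
    refine lt_of_le_of_ne (norm_charFn_le_one sp p) fun h => hp.2 ?_
    rw [norm_charFn_eq_one_iff sp, ← hz] at h
    obtain ⟨i, hi⟩ := h
    rw [hPz i] at hi
    have h1 : p = P i := Prod.ext
      (eq_of_exp_eq sp.1 (hθ i) hp.1.1 (congrArg Prod.fst hi).symm)
      (eq_of_exp_eq sp.2.1 (hφ i) hp.1.2 (congrArg Prod.snd hi).symm)
    rw [h1]
    exact Set.mem_iUnion.2 ⟨i, Metric.mem_ball_self hδ⟩
  have hne : ∀ {r : ℝ} (_ : 0 < r) (h : ℝ → ℝ) (ε t : ℝ), dentedCircle r h ε t ≠ 0 :=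
    fun hr h ε t => mul_ne_zero (Complex.ofReal_ne_zero.2 hr.ne') (Complex.exp_ne_zero _)
  have hcont : Continuous fun e : ℝ × (ℝ × ℝ) => ‖stepPoly M (dentedCircle x0 f e.1 e.2.1)
      (dentedCircle y0 g e.1 e.2.2) / (stepPoly M x0 y0 : ℝ)‖ := by
    refine ((continuous_stepPoly M ?_ ?_ (fun _ => hne sp.1 _ _ _)
      (fun _ => hne sp.2.1 _ _ _)).div_const _).norm
    · exact (continuous_dentedCircle x0 hf.continuous).comp
        (continuous_fst.prodMk (continuous_fst.comp continuous_snd))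
    · exact (continuous_dentedCircle y0 hg.continuous).comp
        (continuous_fst.prodMk (continuous_snd.comp continuous_snd))
  have hev : ∀ᶠ ε in 𝓝 (0 : ℝ), ∀ p ∈ K, ‖stepPoly M (dentedCircle x0 f ε p.1)
      (dentedCircle y0 g ε p.2) / (stepPoly M x0 y0 : ℝ)‖ < 1 := by
    refine hKc.eventually_forall_of_forall_eventually (P := fun ε p => ‖stepPoly M
      (dentedCircle x0 f ε p.1) (dentedCircle y0 g ε p.2) / (stepPoly M x0 y0 : ℝ)‖ < 1)
      fun p hp => (hcont.continuousAt.eventually_lt continuousAt_const ?_)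
    have h1 := hKlt p hp
    rw [charFn_eq sp] at h1
    have h2 : ∀ (r : ℝ) (h : ℝ → ℝ) (t : ℝ), dentedCircle r h 0 t = r * exp (I * t) :=
      fun r h t => by simp [dentedCircle]
    simp only [h2]
    exact h1
  obtain ⟨ε, ⟨hε1, hε2⟩, hε3⟩ := ((hfbad.and hgbad).and (nhdsWithin_le_nhds hev)).exists
  refine ⟨a, δ, dentedCircle x0 f ε, dentedCircle y0 g ε, _, _, P, hδ, hδδ₀, hPz,
    isContour_dentedCircle sp.1 hf hfper a ε, isContour_dentedCircle sp.2.1 hg hgper a ε,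
    fun t hmem => hε1 t ((Set.Finite.mem_toFinset _).2 hmem),
    fun t hmem => hε2 t ((Set.Finite.mem_toFinset _).2 hmem), hPn, fun i q hq => ?_,
    fun i q hq => ?_, hsub, hdisj, hε3⟩
  · have h1 := ((hbox hq).2 i).1
    funext c
    fin_cases c
    · exact dentedCircle_of_eq_zero h1.1.self_of_nhds ε
    · exact dentedCircle_of_eq_zero h1.2.self_of_nhds ε
  · have h1 := ((hbox hq).2 i).1
    have hd : ∀ {h : ℝ → ℝ} {t : ℝ}, (∀ᶠ s in 𝓝 t, h s = 0) →
        I - ((ε * deriv h t : ℝ) : ℂ) = I := by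
      intro h t hev
      have h2 : deriv h t = 0 := by
        have h3 : h =ᶠ[𝓝 t] fun _ => 0 := hev
        rw [h3.deriv_eq, deriv_const]
      rw [h2]
      simp
    exact ⟨hd h1.1, hd h1.2⟩

end

section

open scoped Real
open Complex (I I_sq exp ofReal_ne_zero)
open Topology MeasureTheory

variable {M : Model} {x0 y0 : ℝ}

/-! ### The asymptotic expansion of the number of walks -/

/-- The function whose integrals against powers of the step polynomial count walks. -/
def walkSymbol (M : Model) (u v k l : ℕ) : RatXY :=
  altSum M (shiftMono (u, v)) * (varX ^ (-(k : ℤ) - 1) * varY ^ (-(l : ℤ) - 1))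

lemma isReg_shiftMono (sp : IsDominantSaddle M x0 y0) (B : ℤ × ℤ) :
    IsReg (basePt x0 y0) (shiftMono B) :=
  isReg_monomial (sp.basePt_ne 0) (sp.basePt_ne 1) (B.1 + 1) (B.2 + 1)

lemma isReg_altSum (sp : IsDominantSaddle M x0 y0) {f : RatXY}
    (hf : IsReg (basePt x0 y0) f) : IsReg (basePt x0 y0) (altSum M f) :=
  mem_vanish_zero.1 (altSum_mem_vanish sp (mem_vanish_zero.2 hf))

lemma stepRat_eq_normStep (sp : IsDominantSaddle M x0 y0) :
    stepRat M = ((stepPoly M x0 y0 : ℝ) : ℂ) • normStep M x0 y0 := by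
  rw [normStep, smul_smul, mul_inv_cancel₀ (ofReal_ne_zero.2 sp.pos.ne'), one_smul]

lemma torusPt_add (x0 y0 : ℝ) (P q : ℝ × ℝ) : torusPt x0 y0 (P + q) =
    ![exp (I * P.1) * torusPt x0 y0 q 0,
      exp (I * P.2) * torusPt x0 y0 q 1] := by
  funext i
  fin_cases i <;> simp [torusPt, mul_add, Complex.exp_add] <;> ring

theorem exists_isRapid_walks (hM : OrbitSummable M) [Finite (modelGroup M)]
    (sp : IsDominantSaddle M x0 y0) {r : ℕ} {z : Fin r → ℂ × ℂ}
    (hinj : Function.Injective z) (hz : Set.range z = saddlePoints M x0 y0) (u v k l : ℕ) :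
    ∃ δ, IsGoodBox x0 y0 (walkSymbol M u v k l) δ ∧ IsRapid fun n =>
      (walks M (u, v) (k, l) n : ℂ) / ((stepPoly M x0 y0 : ℝ) : ℂ) ^ n -
        (4 * (π : ℂ) ^ 2)⁻¹ * ∑ i, (((z i).1 / x0) ^ ((u : ℤ) - k) *
          ((z i).2 / y0) ^ ((v : ℤ) - l) * (stepPoly M (z i).1 (z i).2 / (stepPoly M x0 y0 : ℝ)) ^ n) *
            boxInt M x0 y0 δ (walkSymbol M u v k l) n := by
  obtain ⟨δ₀, hgood₀⟩ := exists_isGoodBox (isReg_altSum sp (isReg_shiftMono sp (u, v)))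
  obtain ⟨a, δ, X, Y, wX, wY, P, hδ, hδδ₀, hPz, hC⟩ :=
    exists_isSaddleContour sp hinj hz hgood₀.pos
  have hgood := hgood₀.mono hδ hδδ₀
  set f := altSum M (shiftMono (u, v)) with hf
  set γ : ℂ := ((stepPoly M x0 y0 : ℝ) : ℂ) with hγ
  have hγ0 : γ ≠ 0 := ofReal_ne_zero.2 sp.pos.ne'
  have hregT : ∀ q, IsReg (torusPt x0 y0 q) (varX ^ (-(k : ℤ) - 1) * varY ^ (-(l : ℤ) - 1)) :=
    fun q => isReg_monomial (torusPt_ne sp q 0) (torusPt_ne sp q 1) _ _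
  have hgood' : IsGoodBox x0 y0 (walkSymbol M u v k l) δ :=
    ⟨hδ, hgood.le, fun p hp => (hgood.regular p hp).mul (hregT p)⟩
  refine ⟨δ, hgood', ?_⟩
  have hint := fun n => contourInt_altSum hM sp hC.fst hC.snd hC.fst_notMem hC.snd_notMem u v n k l
  simp only [altSum_walkGF] at hint
  have hfreg : ∀ p, IsReg (contourPair X Y p) f := by
    have h := (hint 0).1
    rwa [pow_zero, one_mul] at h
  set s : ℝ × ℝ → ℂ := fun p => stepPoly M (X p.1) (Y p.2) / γ with hs
  set G : ℝ × ℝ → ℂ := fun p => ratEval (contourPair X Y p) f *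
    (X p.1 ^ (-(k : ℤ) - 1) * Y p.2 ^ (-(l : ℤ) - 1)) * (wX p.1 * wY p.2) with hG
  have hGc : Continuous G := continuous_contourInt hC.fst hC.snd k l hfreg
  have hsc : Continuous s := (continuous_stepPoly M (hC.fst.continuous.comp continuous_fst)
    (hC.snd.continuous.comp continuous_snd) (fun _ => hC.fst.ne _) (fun _ => hC.snd.ne _)).div_const _
  have h1 : ∀ n, ∫ p in period a ×ˢ period a, s p ^ n * G p =
      (2 * π * I) ^ 2 * (walks M (u, v) (k, l) n : ℂ) / γ ^ n := by
    intro n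
    rw [← (hint n).2, contourInt, eq_div_iff (pow_ne_zero n hγ0), ← integral_mul_const]
    refine integral_congr_ae (Eventually.of_forall fun p => ?_)
    have hN := isReg_stepRat (M := M) (a := contourPair X Y p) (hC.fst.ne _) (hC.snd.ne _)
    have hNe : ratEval (contourPair X Y p) (stepRat M) = stepPoly M (X p.1) (Y p.2) :=
      ratEval_stepRat (a := contourPair X Y p) (hC.fst.ne _) (hC.snd.ne _)
    simp only [hs, hG]
    rw [ratEval_mul (hN.pow n) (hfreg p), ratEval_pow hN, hNe, div_pow]
    field_simp
  have h2 : ∀ i, ∀ q ∈ box δ, ∀ n, s (P i + q) ^ n * G (P i + q) =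
      -(((z i).1 / x0) ^ ((u : ℤ) - k) * ((z i).2 / y0) ^ ((v : ℤ) - l) *
        (stepPoly M (z i).1 (z i).2 / γ) ^ n) *
        (charFn M x0 y0 q ^ n * ratEval (torusPt x0 y0 q) (walkSymbol M u v k l)) := by
    intro i q hq n
    have htw := isTwist_of_norm_charFn sp (hC.norm_charFn i)
    set α := exp (I * (P i).1) with hα
    set β := exp (I * (P i).2) with hβ
    have hzα : (z i).1 / x0 = α := by
      rw [hPz i]
      exact mul_div_cancel_left₀ α (ofReal_ne_zero.2 sp.1.ne')
    have hzβ : (z i).2 / y0 = β := by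
      rw [hPz i]
      exact mul_div_cancel_left₀ β (ofReal_ne_zero.2 sp.2.1.ne')
    have hζ : stepPoly M (z i).1 (z i).2 / γ = charFn M x0 y0 (P i) := by
      rw [hPz i, charFn_eq sp]
    have hpair : contourPair X Y (P i + q) = ![α * torusPt x0 y0 q 0, β * torusPt x0 y0 q 1] := by
      rw [hC.pair_eq i q hq, torusPt_add]
    have hXq : X (P i + q).1 = α * torusPt x0 y0 q 0 := congrFun hpair 0
    have hYq : Y (P i + q).2 = β * torusPt x0 y0 q 1 := congrFun hpair 1
    have hw := hC.weight_eq i q hq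
    have hfq := (htw.regular_altSum (u, v) (hgood.regular q hq)).2
    have hx := torusPt_ne sp q 0
    have hy := torusPt_ne sp q 1
    have hsq : s (P i + q) = charFn M x0 y0 (P i) * charFn M x0 y0 q := by
      simp only [hs]
      rw [hXq, hYq, htw.stepPoly, charFn_eq sp q, mul_div_assoc]
    have hGq : G (P i + q) = -(α ^ ((u : ℤ) - k) * β ^ ((v : ℤ) - l)) *
        ratEval (torusPt x0 y0 q) (walkSymbol M u v k l) := by
      simp only [hG]
      rw [hpair, hXq, hYq, hw.1, hw.2, hfq, walkSymbol, ratEval_mul (hgood.regular q hq) (hregT q),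
        ratEval_monomial hx hy, mul_zpow, mul_zpow,
        show (u : ℤ) - k = (u + 1) + (-(k : ℤ) - 1) by ring,
        show (v : ℤ) - l = (v + 1) + (-(l : ℤ) - 1) by ring, zpow_add₀ htw.fst_ne (u + 1),
        zpow_add₀ htw.snd_ne (v + 1), Complex.I_mul_I]
      ring
    rw [hsq, hGq, hzα, hzβ, hζ, mul_pow]
    ring
  have h3 : ∀ n i, ∫ q in box δ, s (P i + q) ^ n * G (P i + q) =
      -(((z i).1 / x0) ^ ((u : ℤ) - k) * ((z i).2 / y0) ^ ((v : ℤ) - l) *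
        (stepPoly M (z i).1 (z i).2 / γ) ^ n) * boxInt M x0 y0 δ (walkSymbol M u v k l) n := by
    intro n i
    rw [boxInt, ← integral_const_mul]
    exact setIntegral_congr_fun (measurableSet_box δ) fun q hq => h2 i q hq n
  have h4 := (isRapid_integral_sub_sum (isCompact_Icc.prod isCompact_Icc) hsc hGc hC.subset
    hC.disjoint hC.lt_one).const_mul (-(4 * (π : ℂ) ^ 2)⁻¹)
  refine h4.congr fun n => ?_
  rw [h1]
  simp only [h3, neg_mul, Finset.sum_neg_distrib]
  have hπ : (π : ℂ) ≠ 0 := ofReal_ne_zero.2 Real.pi_ne_zero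
  have h5 : (4 * (π : ℂ) ^ 2)⁻¹ * (4 * (π : ℂ) ^ 2) = 1 :=
    inv_mul_cancel₀ (by simp [hπ])
  rw [mul_pow, mul_pow, I_sq]
  linear_combination ((walks M (u, v) (k, l) n : ℂ) / γ ^ n) * h5

end

section

open Complex (re_ofReal_mul re_sum sub_re zero_re)
open Finset (sum_congr sum_mul)
variable {M : Model} {x0 y0 : ℝ}

/-! ### The coefficients of the expansion -/

lemma ringHom_ext_rat {σ τ : RatXY →+* RatXY} (hc : ∀ c : ℂ, σ (algebraMap ℂ RatXY c) =
    τ (algebraMap ℂ RatXY c)) (hx : σ varX = τ varX) (hy : σ varY = τ varY) : σ = τ := by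
  refine IsLocalization.ringHom_ext (nonZeroDivisors PolyXY) (MvPolynomial.ringHom_ext hc fun i => ?_)
  fin_cases i
  exacts [hx, hy]

lemma conjHom_algebraMap (c : ℂ) :
    conjHom (algebraMap ℂ RatXY c) = algebraMap ℂ RatXY (starRingEnd ℂ c) := by
  rw [algebraMap_complex, conjHom_toRat, MvPolynomial.map_C, ← algebraMap_complex]

lemma conjHom_rowQuot (M : Model) : conjHom (rowQuot M) = rowQuot M := by
  simp only [rowQuot, rowSum, map_div₀, map_sum, map_mul, map_zpow₀, conjHom_const, conjHom_varX]

lemma conjHom_colQuot (M : Model) : conjHom (colQuot M) = colQuot M := by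
  simp only [colQuot, colSum, map_div₀, map_sum, map_mul, map_zpow₀, conjHom_const, conjHom_varY]

lemma conjHom_phi (M : Model) (f : RatXY) : conjHom (phi M f) = phi M (conjHom f) := by
  have key : conjHom.comp (phiHom M : RatXY →+* RatXY) =
      (phiHom M : RatXY →+* RatXY).comp conjHom := by
    refine ringHom_ext_rat (fun c => ?_) ?_ ?_
    · simp only [RingHom.comp_apply, RingHom.coe_coe, AlgHom.commutes, conjHom_algebraMap]
    · simp
    · simp [conjHom_rowQuot]
  exact DFunLike.congr_fun key f

lemma conjHom_psi (M : Model) (f : RatXY) : conjHom (psi M f) = psi M (conjHom f) := by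
  have key : conjHom.comp (psiHom M : RatXY →+* RatXY) =
      (psiHom M : RatXY →+* RatXY).comp conjHom := by
    refine ringHom_ext_rat (fun c => ?_) ?_ ?_
    · simp only [RingHom.comp_apply, RingHom.coe_coe, AlgHom.commutes, conjHom_algebraMap]
    · simp [conjHom_colQuot]
    · simp
  exact DFunLike.congr_fun key f

lemma conjHom_rot_pow (M : Model) (n : ℕ) (f : RatXY) :
    conjHom ((rot M ^ n) f) = (rot M ^ n) (conjHom f) := by
  induction n generalizing f with
  | zero => rfl
  | succ n ih =>
    rw [pow_succ, AlgEquiv.mul_apply, ih, AlgEquiv.mul_apply, rot, AlgEquiv.mul_apply,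
      AlgEquiv.mul_apply, conjHom_phi, conjHom_psi]

lemma conjHom_altSum (M : Model) (f : RatXY) : conjHom (altSum M f) = altSum M (conjHom f) := by
  rw [altSum_apply, altSum_apply, map_sum]
  refine sum_congr rfl fun j _ => ?_
  rw [map_sub, conjHom_rot_pow, conjHom_rot_pow, conjHom_phi]

/-- The monomial with exponents inverse to those of the generating function at `B`. -/
def dualMono (B : ℤ × ℤ) : RatXY := shiftMono (-B.1 - 2, -B.2 - 2)

lemma isReg_dualMono (sp : IsDominantSaddle M x0 y0) (B : ℤ × ℤ) :
    IsReg (basePt x0 y0) (dualMono B) := isReg_shiftMono sp _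

lemma dualMono_sub (B s : ℤ × ℤ) : dualMono (B - s) = varX ^ s.1 * varY ^ s.2 * dualMono B := by
  rw [dualMono, dualMono, shiftMono_mul]
  congr 1
  refine Prod.ext ?_ ?_
  · simp only [Prod.fst_sub, Prod.fst_add]
    ring
  · simp only [Prod.snd_sub, Prod.snd_add]
    ring

lemma walkSymbol_eq (M : Model) (u v k l : ℕ) :
    walkSymbol M u v k l = altSum M (shiftMono (u, v)) * dualMono (k, l) := by
  rw [walkSymbol, dualMono, shiftMono, shiftMono,
    show -(k : ℤ) - 2 + 1 = -(k : ℤ) - 1 by ring, show -(l : ℤ) - 2 + 1 = -(l : ℤ) - 1 by ring]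

/-- The eigenvalue equation of the step polynomial. -/
def stepDefect (M : Model) (x0 y0 : ℝ) : RatXY :=
  stepRat M - algebraMap ℂ RatXY ((stepPoly M x0 y0 : ℝ) : ℂ)

lemma stepDefect_mem (sp : IsDominantSaddle M x0 y0) :
    stepDefect M x0 y0 ∈ vanish (basePt x0 y0) 2 := by
  have h : stepDefect M x0 y0 = ((stepPoly M x0 y0 : ℝ) : ℂ) • (normStep M x0 y0 - 1) := by
    rw [stepDefect, stepRat_eq_normStep sp, Algebra.smul_def, Algebra.smul_def]
    ring
  rw [h]
  exact Submodule.smul_mem _ _ (normStep_sub_one_mem sp)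

lemma phi_stepDefect (M : Model) (x0 y0 : ℝ) :
    phi M (stepDefect M x0 y0) = stepDefect M x0 y0 := by
  rw [stepDefect, map_sub, phi_stepRat, AlgEquiv.commutes]

lemma psi_stepDefect (M : Model) (x0 y0 : ℝ) :
    psi M (stepDefect M x0 y0) = stepDefect M x0 y0 := by
  rw [stepDefect, map_sub, psi_stepRat, AlgEquiv.commutes]

namespace GaussFunctional

variable (L : GaussFunctional M x0 y0)

/-- The symmetric bilinear form given by alternating sums. -/
def pairing (q : ℕ) (f g : RatXY) : ℂ := L.toFun q (altSum M f * altSum M g)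

lemma pairing_comm (q : ℕ) (f g : RatXY) : L.pairing q f g = L.pairing q g f := by
  rw [pairing, pairing, mul_comm]

lemma pairing_sum_left {ι : Type*} (q : ℕ) (s : Finset ι) (a : ι → ℂ) (f : ι → RatXY) (g : RatXY) :
    L.pairing q (∑ i ∈ s, a i • f i) g = ∑ i ∈ s, a i * L.pairing q (f i) g := by
  rw [pairing, map_sum, sum_mul, map_sum]
  refine sum_congr rfl fun i _ => ?_
  rw [map_smul, smul_mul_assoc, map_smul, smul_eq_mul, pairing]

lemma pairing_add_left (q : ℕ) (f f' g : RatXY) :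
    L.pairing q (f + f') g = L.pairing q f g + L.pairing q f' g := by
  rw [pairing, map_add, add_mul, map_add, pairing, pairing]

lemma pairing_smul_left (q : ℕ) (a : ℂ) (f g : RatXY) :
    L.pairing q (a • f) g = a * L.pairing q f g := by
  rw [pairing, map_smul, smul_mul_assoc, map_smul, smul_eq_mul, pairing]

lemma pairing_eq_zero (sp : IsDominantSaddle M x0 y0) {q i j : ℕ} (hij : 2 * q - 1 ≤ i + j)
    {f g : RatXY} (hf : f ∈ vanish (basePt x0 y0) i) (hg : g ∈ vanish (basePt x0 y0) j) :
    L.pairing q f g = 0 :=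
  L.eq_zero_of_mem sp q (vanish_le hij (mul_mem_vanish (altSum_mem_vanish sp hf)
    (altSum_mem_vanish sp hg)))

lemma pairing_eq_zero_left [Finite (modelGroup M)] (sp : IsDominantSaddle M x0 y0) {q i : ℕ}
    (hi : 2 * q - 1 ≤ i + rotOrder M) {f g : RatXY} (hf : f ∈ vanish (basePt x0 y0) i)
    (hg : IsReg (basePt x0 y0) g) : L.pairing q f g = 0 :=
  L.eq_zero_of_mem sp q (vanish_le hi (mul_mem_vanish (altSum_mem_vanish sp hf)
    (altSum_mem_vanish_rotOrder sp hg)))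

lemma pairing_im (sp : IsDominantSaddle M x0 y0) (q : ℕ) {f g : RatXY}
    (hf : IsReg (basePt x0 y0) f) (hg : IsReg (basePt x0 y0) g) (hf' : conjHom f = f)
    (hg' : conjHom g = g) : (L.pairing q f g).im = 0 := by
  refine L.real q _ ((isReg_altSum sp hf).mul (isReg_altSum sp hg)) ?_
  rw [map_mul, conjHom_altSum, conjHom_altSum, hf', hg']

lemma apply_altSum_mul [Finite (modelGroup M)] (sp : IsDominantSaddle M x0 y0) (q : ℕ) {f g : RatXY}
    (hf : IsReg (basePt x0 y0) f) (hg : IsReg (basePt x0 y0) g) :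
    L.toFun q (altSum M f * g) = (2 * rotOrder M : ℂ)⁻¹ * L.pairing q f g := by
  have hc : (2 * rotOrder M : ℂ) ≠ 0 :=
    mul_ne_zero two_ne_zero (Nat.cast_ne_zero.2 (rotOrder_pos M).ne')
  rw [pairing, L.apply_altSum_mul_altSum sp q hf hg, inv_mul_cancel_left₀ hc]

/-- The functional at a power of the step polynomial times the symbol of the walks from `A`
to `B`. -/
def symbolCoeff (q j : ℕ) (B A : ℤ × ℤ) : ℂ :=
  L.toFun q (stepDefect M x0 y0 ^ j * altSum M (shiftMono A) * dualMono B)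

lemma symbolCoeff_eq [Finite (modelGroup M)] (sp : IsDominantSaddle M x0 y0) (q j : ℕ)
    (B A : ℤ × ℤ) : L.symbolCoeff q j B A = (2 * rotOrder M : ℂ)⁻¹ *
      L.pairing q (stepDefect M x0 y0 ^ j * shiftMono A) (dualMono B) := by
  have h := altSum_mul_of_invariant M (h := stepDefect M x0 y0 ^ j)
    (by rw [map_pow, phi_stepDefect]) (by rw [map_pow, psi_stepDefect]) (shiftMono A)
  rw [symbolCoeff, ← h, L.apply_altSum_mul sp q
    (((isReg_of_mem_vanish (stepDefect_mem sp)).pow j).mul (isReg_shiftMono sp A))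
    (isReg_dualMono sp B)]

lemma symbolCoeff_boundary_fst [Finite (modelGroup M)] (sp : IsDominantSaddle M x0 y0) (q j : ℕ)
    {B : ℤ × ℤ} (A : ℤ × ℤ) (hB : B.1 = -1 ∨ B.2 = -1) : L.symbolCoeff q j B A = 0 := by
  rw [L.symbolCoeff_eq sp, pairing, dualMono, altSum_shiftMono_eq_zero M (B := (-B.1 - 2, -B.2 - 2))
    (hB.imp (fun h => by rw [h]; norm_num) (fun h => by rw [h]; norm_num)), mul_zero, map_zero,
    mul_zero]

lemma symbolCoeff_boundary_snd (q j : ℕ) (B : ℤ × ℤ) {A : ℤ × ℤ} (hA : A.1 = -1 ∨ A.2 = -1) :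
    L.symbolCoeff q j B A = 0 := by
  rw [symbolCoeff, altSum_shiftMono_eq_zero M hA, mul_zero, zero_mul, map_zero]

lemma apply_sum_steps (q : ℕ) (h : RatXY) : ∑ s ∈ stepBox, (M.weight s : ℂ) *
    L.toFun q (varX ^ s.1 * varY ^ s.2 * h) = L.toFun q (stepRat M * h) := by
  rw [stepRat_eq_smul, sum_mul, map_sum]
  refine sum_congr rfl fun s _ => ?_
  rw [smul_mul_assoc, map_smul, smul_eq_mul]

lemma apply_stepDefect_mul (q : ℕ) (h : RatXY) : L.toFun q (stepDefect M x0 y0 * h) =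
    L.toFun q (stepRat M * h) - ((stepPoly M x0 y0 : ℝ) : ℂ) * L.toFun q h := by
  rw [stepDefect, sub_mul, map_sub, ← Algebra.smul_def, map_smul, smul_eq_mul]

lemma symbolCoeff_laplacian_fst (q j : ℕ) (B A : ℤ × ℤ) :
    ∑ s ∈ stepBox, (M.weight s : ℂ) * L.symbolCoeff q j (B - s) A -
      ((stepPoly M x0 y0 : ℝ) : ℂ) * L.symbolCoeff q j B A = L.symbolCoeff q (j + 1) B A := by
  have h1 : ∀ s : ℤ × ℤ, L.symbolCoeff q j (B - s) A = L.toFun q (varX ^ s.1 * varY ^ s.2 *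
      (stepDefect M x0 y0 ^ j * altSum M (shiftMono A) * dualMono B)) := by
    intro s
    rw [symbolCoeff, dualMono_sub]
    congr 1
    ring
  simp only [h1]
  rw [apply_sum_steps, symbolCoeff, symbolCoeff, ← apply_stepDefect_mul]
  congr 1
  ring

lemma symbolCoeff_laplacian_snd (q j : ℕ) (B A : ℤ × ℤ) :
    ∑ s ∈ stepBox, (M.weight s : ℂ) * L.symbolCoeff q j B (A + s) -
      ((stepPoly M x0 y0 : ℝ) : ℂ) * L.symbolCoeff q j B A = L.symbolCoeff q (j + 1) B A := by
  have h1 : ∑ s ∈ stepBox, (M.weight s : ℂ) * L.symbolCoeff q j B (A + s) = L.toFun q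
      (stepRat M * (stepDefect M x0 y0 ^ j * altSum M (shiftMono A) * dualMono B)) := by
    have h2 : stepRat M * altSum M (shiftMono A) =
        ∑ s ∈ stepBox, (M.weight s : ℂ) • altSum M (shiftMono (A + s)) := by
      rw [← altSum_mul_of_invariant M (phi_stepRat M) (psi_stepRat M), stepRat_eq_smul,
        sum_mul, map_sum]
      refine sum_congr rfl fun s _ => ?_
      rw [smul_mul_assoc, shiftMono_mul, map_smul]
    rw [show stepRat M * (stepDefect M x0 y0 ^ j * altSum M (shiftMono A) * dualMono B) =
      (stepRat M * altSum M (shiftMono A)) * (stepDefect M x0 y0 ^ j * dualMono B) by ring, h2,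
      sum_mul, map_sum]
    refine sum_congr rfl fun s _ => ?_
    rw [smul_mul_assoc, map_smul, smul_eq_mul, symbolCoeff]
    congr 2
    ring
  rw [h1, symbolCoeff, symbolCoeff, ← apply_stepDefect_mul]
  congr 1
  ring

/-- The coefficients of the expansion, extended by zero. -/
def greenCoeff (K : ℂ) (q j : ℕ) (B A : ℤ × ℤ) : ℝ :=
  if InQuadrant B ∧ InQuadrant A then (K * L.symbolCoeff q j B A).re else 0

lemma inQuadrant_or {B s : ℤ × ℤ} (hB : InQuadrant B) (hs : s ∈ stepBox) :
    InQuadrant (B + s) ∨ ((B + s).1 = -1 ∨ (B + s).2 = -1) := by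
  rw [mem_stepBox] at hs
  have h1 := hB.1
  have h2 := hB.2
  have h3 : (B + s).1 = B.1 + s.1 := rfl
  have h4 : (B + s).2 = B.2 + s.2 := rfl
  unfold InQuadrant
  omega

lemma neg_mem_stepBox {s : ℤ × ℤ} : -s ∈ stepBox ↔ s ∈ stepBox := by
  simp only [mem_stepBox, Prod.fst_neg, Prod.snd_neg]
  omega

lemma re_mul_sum (K : ℂ) (w : ℤ × ℤ → ℝ) (c : ℝ) (f : ℤ × ℤ → ℂ) (z : ℂ) :
    ∑ s ∈ stepBox, w s * (K * f s).re - c * (K * z).re =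
      (K * (∑ s ∈ stepBox, (w s : ℂ) * f s - (c : ℂ) * z)).re := by
  rw [mul_sub, Finset.mul_sum, sub_re, re_sum]
  congr 1
  · refine sum_congr rfl fun s _ => ?_
    rw [mul_left_comm, re_ofReal_mul]
  · rw [mul_left_comm, re_ofReal_mul]

lemma laplacianFst_greenCoeff [Finite (modelGroup M)] (sp : IsDominantSaddle M x0 y0) (K : ℂ)
    (q j : ℕ) : laplacianFst M.weight (stepPoly M x0 y0) (L.greenCoeff K q j) =
      L.greenCoeff K q (j + 1) := by
  funext B A
  rw [laplacianFst, laplacian]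
  by_cases hB : InQuadrant B
  · by_cases hA : InQuadrant A
    · have h1 : ∀ s ∈ stepBox, M.weight s * L.greenCoeff K q j (B - s) A =
          M.weight s * (K * L.symbolCoeff q j (B - s) A).re := by
        intro s hs
        congr 1
        rw [sub_eq_add_neg]
        rcases inQuadrant_or hB (neg_mem_stepBox.2 hs) with h | h
        · exact if_pos ⟨h, hA⟩
        · rw [L.symbolCoeff_boundary_fst sp q j A h, mul_zero, zero_re, greenCoeff, if_neg]
          rintro ⟨⟨h2, h3⟩, -⟩
          omega
      rw [if_pos hB, sum_congr rfl h1, greenCoeff, if_pos ⟨hB, hA⟩, re_mul_sum,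
        symbolCoeff_laplacian_fst, greenCoeff, if_pos ⟨hB, hA⟩]
    · have h1 : ∀ q j B', L.greenCoeff K q j B' A = 0 := fun q j B' => if_neg fun h => hA h.2
      simp [h1]
  · rw [if_neg hB, greenCoeff, if_neg fun h => hB h.1]

lemma adjointLaplacianSnd_greenCoeff (K : ℂ) (q j : ℕ) :
    adjointLaplacianSnd M.weight (stepPoly M x0 y0) (L.greenCoeff K q j) =
      L.greenCoeff K q (j + 1) := by
  funext B A
  rw [adjointLaplacianSnd, laplacian]
  by_cases hA : InQuadrant A
  · by_cases hB : InQuadrant B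
    · have h1 : ∑ s ∈ stepBox, reverse M.weight s * L.greenCoeff K q j B (A - s) =
          ∑ s ∈ stepBox, M.weight s * (K * L.symbolCoeff q j B (A + s)).re := by
        refine Finset.sum_equiv (Equiv.neg (ℤ × ℤ)) (fun s => neg_mem_stepBox.symm) fun s hs => ?_
        rw [Equiv.neg_apply, reverse, sub_eq_add_neg]
        congr 1
        rcases inQuadrant_or hA (neg_mem_stepBox.2 hs) with h | h
        · exact if_pos ⟨hB, h⟩
        · rw [L.symbolCoeff_boundary_snd q j B h, mul_zero, zero_re, greenCoeff, if_neg]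
          rintro ⟨-, ⟨h2, h3⟩⟩
          omega
      rw [if_pos hA, h1, greenCoeff, if_pos ⟨hB, hA⟩, re_mul_sum,
        symbolCoeff_laplacian_snd, greenCoeff, if_pos ⟨hB, hA⟩]
    · have h1 : ∀ q j A', L.greenCoeff K q j B A' = 0 := fun q j A' => if_neg fun h => hB h.1
      simp [h1]
  · rw [if_neg hA, greenCoeff, if_neg fun h => hA h.2]

theorem isMultivariatePolyharmonic [Finite (modelGroup M)] (sp : IsDominantSaddle M x0 y0) (K : ℂ)
    (p : ℕ) : IsMultivariatePolyharmonic M.weight (stepPoly M x0 y0) p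
      (L.greenCoeff K (rotOrder M + p) 0) := by
  refine ⟨fun x y h => if_neg fun h' => h.elim (fun h => h h'.1) (fun h => h h'.2),
    fun k hk x y => ?_⟩
  set q := rotOrder M + p with hq
  have h1 : ∀ n j, (adjointLaplacianSnd M.weight (stepPoly M x0 y0))^[n] (L.greenCoeff K q j) =
      L.greenCoeff K q (j + n) := by
    intro n
    induction n with
    | zero => intro j; rfl
    | succ n ih =>
      intro j
      rw [Function.iterate_succ_apply, adjointLaplacianSnd_greenCoeff, ih, add_assoc, add_comm 1 n]
  have h2 : ∀ n j, (laplacianFst M.weight (stepPoly M x0 y0))^[n] (L.greenCoeff K q j) =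
      L.greenCoeff K q (j + n) := by
    intro n
    induction n with
    | zero => intro j; rfl
    | succ n ih =>
      intro j
      rw [Function.iterate_succ_apply, L.laplacianFst_greenCoeff sp, ih, add_assoc, add_comm 1 n]
  have h3 : ∀ B A, L.symbolCoeff q p B A = 0 := by
    intro B A
    rw [L.symbolCoeff_eq sp, pairing, altSum_mul_of_invariant M
      (by rw [map_pow, phi_stepDefect]) (by rw [map_pow, psi_stepDefect]),
      L.eq_zero_of_mem sp q, mul_zero]
    refine vanish_le (j := 2 * q - 1) (k := p * 2 + rotOrder M + rotOrder M) (by omega)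
      (mul_mem_vanish (mul_mem_vanish (pow_mem_vanish (stepDefect_mem sp) p)
        (altSum_mem_vanish_rotOrder sp (isReg_shiftMono sp A)))
        (altSum_mem_vanish_rotOrder sp (isReg_shiftMono sp _)))
  rw [h1, h2, greenCoeff, show 0 + (p - k) + k = p by omega, h3, mul_zero, zero_re, ite_self]

end GaussFunctional

end

section

open Finset (mem_univ range sum_le_sum)
open MvPolynomial (coeff coeff_C_mul coeff_sum mem_support_iff monomial monomial_eq)
open Polynomial (aeval eval_C eval_mul eval_zero)
open Polynomial in
/-- The polynomial with the values `Ring.choose m i`. -/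
def choosePoly (i : ℕ) : ℝ[X] := C ((i.factorial : ℝ)⁻¹) * descPochhammer ℝ i

lemma eval_choosePoly (i : ℕ) (m : ℤ) :
    (choosePoly i).eval (m : ℝ) = ((Ring.choose m i : ℤ) : ℝ) := by
  have h := Ring.descPochhammer_eq_factorial_smul_choose m i
  rw [← Polynomial.eval_eq_smeval] at h
  have h1 : (i.factorial : ℝ) ≠ 0 := Nat.cast_ne_zero.2 i.factorial_ne_zero
  rw [choosePoly, eval_mul, eval_C, ← descPochhammer_eval_cast, h, nsmul_eq_mul]
  push_cast
  rw [inv_mul_cancel_left₀ h1]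

lemma natDegree_choosePoly (i : ℕ) : (choosePoly i).natDegree = i := by
  rw [choosePoly, Polynomial.natDegree_C_mul (inv_ne_zero (Nat.cast_ne_zero.2 i.factorial_ne_zero)),
    descPochhammer_natDegree]

/-! ### Degrees of sums of products of univariate polynomials -/

lemma coeff_prod_aeval {σ R : Type*} [Fintype σ] [CommRing R]
    (q : σ → Polynomial R) (m : σ →₀ ℕ) :
    coeff m (∏ v, aeval (MvPolynomial.X v : MvPolynomial σ R) (q v)) =
      ∏ v, (q v).coeff (m v) := by
  classical
  have h1 : ∀ p : σ → ℕ, ∏ v, (q v).coeff (p v) • (MvPolynomial.X v : MvPolynomial σ R) ^ p v =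
      monomial (Finsupp.equivFunOnFinite.symm p) (∏ v, (q v).coeff (p v)) := by
    intro p
    simp only [MvPolynomial.smul_eq_C_mul]
    rw [Finset.prod_mul_distrib, ← map_prod, monomial_eq]
    congr 1
    rw [Finsupp.prod_fintype _ _ fun _ => pow_zero _]
    rfl
  simp only [Polynomial.aeval_eq_sum_range]
  rw [Finset.prod_univ_sum, Finset.sum_congr rfl fun p _ => h1 p, coeff_sum]
  simp only [MvPolynomial.coeff_monomial]
  have h2 : ∀ p : σ → ℕ, Finsupp.equivFunOnFinite.symm p = m ↔ p = m := fun p => by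
    rw [← DFunLike.coe_fn_eq]
    rfl
  simp only [h2]
  rw [Finset.sum_ite_eq']
  split_ifs with h
  · rfl
  · rw [Fintype.mem_piFinset, not_forall] at h
    obtain ⟨v, hv⟩ := h
    rw [Finset.mem_range] at hv
    exact (Finset.prod_eq_zero (mem_univ v)
      (Polynomial.coeff_eq_zero_of_natDegree_lt (by omega))).symm

lemma weightedTotalDegree_sum_prod {σ ι R : Type*} [Fintype σ] [CommRing R] [IsDomain R]
    {s : Finset ι} {e : ι → σ → ℕ} (he : Function.Injective e) {a : ι → R}
    {b : σ → ℕ → Polynomial R} (hb : ∀ v i, b v i ≠ 0) (hd : ∀ v i, (b v i).natDegree = i)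
    (w : σ → ℕ) {d T : ℕ} (hT : ∀ I ∈ s, a I ≠ 0 → ∑ v, e I v ≤ T)
    (hw : ∀ I ∈ s, a I ≠ 0 → ∑ v, e I v * w v ≤ d) {J : ι} (hJ : J ∈ s) (hJa : a J ≠ 0)
    (hJT : ∑ v, e J v = T) (hJd : ∑ v, e J v * w v = d) :
    (∑ I ∈ s, MvPolynomial.C (a I) * ∏ v, aeval (MvPolynomial.X v : MvPolynomial σ R)
      (b v (e I v))).weightedTotalDegree w = d := by
  set P := ∑ I ∈ s, MvPolynomial.C (a I) * ∏ v, aeval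
    (MvPolynomial.X v : MvPolynomial σ R) (b v (e I v)) with hP
  have hc : ∀ m, P.coeff m = ∑ I ∈ s, a I * ∏ v, (b v (e I v)).coeff (m v) := fun m => by
    simp only [hP, coeff_sum, coeff_C_mul, coeff_prod_aeval]
  have hle : ∀ (I : ι) (m : σ →₀ ℕ), ∏ v, (b v (e I v)).coeff (m v) ≠ 0 → ∀ v, m v ≤ e I v := by
    intro I m h v
    have := Finset.prod_ne_zero_iff.1 h v (mem_univ v)
    by_contra hlt
    exact this (Polynomial.coeff_eq_zero_of_natDegree_lt (by rw [hd]; omega))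
  have hwt : ∀ m : σ →₀ ℕ, Finsupp.weight w m = ∑ v, m v * w v := fun m => by
    rw [Finsupp.weight_apply, Finsupp.sum_fintype _ _ (by simp)]
    rfl
  refine le_antisymm (Finset.sup_le fun m hm => ?_) ?_
  · rw [mem_support_iff, hc] at hm
    obtain ⟨I, hI, h⟩ := Finset.exists_ne_zero_of_sum_ne_zero hm
    rw [hwt]
    exact (sum_le_sum fun v _ => Nat.mul_le_mul_right _
      (hle I m (right_ne_zero_of_mul h) v)).trans (hw I hI (left_ne_zero_of_mul h))
  · have hm : P.coeff (Finsupp.equivFunOnFinite.symm (e J)) ≠ 0 := by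
      rw [hc, Finset.sum_eq_single_of_mem J hJ]
      · refine mul_ne_zero hJa (Finset.prod_ne_zero_iff.2 fun v _ => ?_)
        have h := Polynomial.leadingCoeff_ne_zero.2 (hb v (e J v))
        rwa [Polynomial.leadingCoeff, hd] at h
      · intro I hI hIJ
        by_contra h
        refine hIJ (he (funext fun v => ?_))
        have h1 := hle I _ (right_ne_zero_of_mul h)
        have h2 : ∑ v, e J v = ∑ v, e I v := le_antisymm (sum_le_sum fun v _ => h1 v)
          (hJT ▸ hT I hI (left_ne_zero_of_mul h))
        exact ((Finset.sum_eq_sum_iff_of_le fun v _ => h1 v).1 h2 v (mem_univ v)).symm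
    rw [← hJd]
    have h := MvPolynomial.le_weightedTotalDegree w (mem_support_iff.2 hm)
    rw [hwt] at h
    exact h

/-! ### Exponential polynomials -/

lemma polynomial_eq_zero_of_tendsto {r : Polynomial ℝ}
    (h : Tendsto (fun n : ℕ => r.eval (n : ℝ)) atTop (nhds 0)) : r = 0 := by
  by_cases hd : 0 < r.degree
  · have h1 := (r.abs_tendsto_atTop hd).comp tendsto_natCast_atTop_atTop
    exact absurd h.abs (not_tendsto_nhds_of_tendsto_atTop h1 _)
  · rw [Polynomial.eq_C_of_degree_le_zero (not_lt.1 hd)] at h ⊢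
    simp only [eval_C] at h
    rw [tendsto_nhds_unique tendsto_const_nhds h, map_zero]

lemma tendsto_pow_mul_eval {x : ℝ} (h0 : 0 < x) (h1 : x < 1) (p : Polynomial ℝ) :
    Tendsto (fun n : ℕ => x ^ n * p.eval (n : ℝ)) atTop (nhds 0) := by
  simp only [Polynomial.eval_eq_sum_range, Finset.mul_sum]
  rw [← Finset.sum_const_zero (s := range (p.natDegree + 1))]
  refine tendsto_finsetSum _ fun i _ => ?_
  have h := (tendsto_pow_const_mul_const_pow_of_abs_lt_one i
    (by rwa [abs_of_pos h0] : |x| < 1)).const_mul (p.coeff i)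
  rw [mul_zero] at h
  refine h.congr fun n => ?_
  ring

lemma eq_one_of_pow_mul_eval_eq {x : ℝ} (h0 : 0 < x) {p r : Polynomial ℝ} (hp : p ≠ 0)
    (h : ∀ n : ℕ, x ^ n * p.eval (n : ℝ) = r.eval (n : ℝ)) : x = 1 := by
  rcases lt_trichotomy x 1 with h1 | h1 | h1
  · have hr := polynomial_eq_zero_of_tendsto
      ((tendsto_pow_mul_eval h0 h1 p).congr h)
    refine absurd (polynomial_eq_zero_of_tendsto (r := p) ?_) hp
    refine tendsto_const_nhds.congr fun n => ?_
    have h2 := h n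
    rw [hr, eval_zero, mul_eq_zero] at h2
    exact (h2.resolve_left (pow_pos h0 n).ne').symm
  · exact h1
  · refine absurd (polynomial_eq_zero_of_tendsto
      ((tendsto_pow_mul_eval (inv_pos.2 h0) (inv_lt_one_of_one_lt₀ h1) r).congr fun n => ?_)) hp
    rw [← h n, inv_pow, inv_mul_cancel_left₀ (pow_pos h0 n).ne']

/-! ### Binomial expansion of monomials -/

variable {M : Model} {x0 y0 : ℝ}

lemma one_add_mul_choose_sum {A : Type*} [CommRing A] (z : A) (m : ℤ) (R : ℕ) :
    (1 + z) * ∑ i ∈ range (R + 1), ((Ring.choose m i : ℤ) : A) * z ^ i =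
      ∑ i ∈ range (R + 1), ((Ring.choose (m + 1) i : ℤ) : A) * z ^ i +
        ((Ring.choose m R : ℤ) : A) * z ^ (R + 1) := by
  induction R with
  | zero => simp [add_comm]
  | succ R ih =>
    rw [Finset.sum_range_succ, mul_add, ih, Finset.sum_range_succ _ (R + 1), Ring.choose_succ_succ]
    push_cast
    ring

lemma zpow_sub_choose_sum_mem {b : Fin 2 → ℂ} {z : RatXY} (hz : z ∈ vanish b 1)
    (h0 : 1 + z ≠ 0) (hi : IsReg b (1 + z)⁻¹) (R : ℕ) (m : ℤ) :
    (1 + z) ^ m - ∑ i ∈ range (R + 1), ((Ring.choose m i : ℤ) : RatXY) * z ^ i ∈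
      vanish b (R + 1) := by
  have hreg : IsReg b (1 + z) := (isReg_one b).add (isReg_of_mem_vanish hz)
  have hpow : ∀ c : ℤ, (c : RatXY) * z ^ (R + 1) ∈ vanish b (R + 1) := fun c => by
    rw [← zsmul_eq_mul]
    refine AddSubgroup.zsmul_mem (vanish b (R + 1)).toAddSubgroup ?_ c
    simpa using pow_mem_vanish hz (R + 1)
  have key : ∀ m : ℤ, (1 + z) ^ (m + 1) - ∑ i ∈ range (R + 1),
      ((Ring.choose (m + 1) i : ℤ) : RatXY) * z ^ i = (1 + z) * ((1 + z) ^ m -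
        ∑ i ∈ range (R + 1), ((Ring.choose m i : ℤ) : RatXY) * z ^ i) +
          ((Ring.choose m R : ℤ) : RatXY) * z ^ (R + 1) := by
    intro m
    rw [mul_sub, one_add_mul_choose_sum, zpow_add_one₀ h0]
    ring
  have up : ∀ m : ℤ, (1 + z) ^ m - ∑ i ∈ range (R + 1),
      ((Ring.choose m i : ℤ) : RatXY) * z ^ i ∈ vanish b (R + 1) → (1 + z) ^ (m + 1) -
        ∑ i ∈ range (R + 1), ((Ring.choose (m + 1) i : ℤ) : RatXY) * z ^ i ∈
          vanish b (R + 1) := by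
    intro m h
    rw [key]
    exact Submodule.add_mem _ (mul_mem_vanish_right hreg h) (hpow _)
  have down : ∀ m : ℤ, (1 + z) ^ (m + 1) - ∑ i ∈ range (R + 1),
      ((Ring.choose (m + 1) i : ℤ) : RatXY) * z ^ i ∈ vanish b (R + 1) → (1 + z) ^ m -
        ∑ i ∈ range (R + 1), ((Ring.choose m i : ℤ) : RatXY) * z ^ i ∈
          vanish b (R + 1) := by
    intro m h
    have h2 := mul_mem_vanish_right hi (Submodule.sub_mem _ h (hpow (Ring.choose m R)))
    rwa [key, add_sub_cancel_right, inv_mul_cancel_left₀ h0] at h2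
  induction m using Int.induction_on with
  | zero =>
    rw [Finset.sum_range_succ', Finset.sum_eq_zero fun i _ => by
      rw [Ring.choose_zero_succ, Int.cast_zero, zero_mul]]
    simp
  | succ n ih => exact up _ ih
  | pred n ih => exact down _ (by rwa [sub_add_cancel])

end

section

open Algebra (smul_def)
open Finset (range sum_congr)
variable {M : Model} {x0 y0 : ℝ}

/-! ### Polynomial form of the coefficients -/

/-- The coordinates `x / x0 - 1` and `y / y0 - 1`. -/
def localCoord (x0 y0 : ℝ) (i : Fin 2) : RatXY :=
  (basePt x0 y0 i)⁻¹ • centered (basePt x0 y0) i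

/-- The monomials in the local coordinates. -/
def localMono (x0 y0 : ℝ) (i : ℕ × ℕ) : RatXY :=
  localCoord x0 y0 0 ^ i.1 * localCoord x0 y0 1 ^ i.2

lemma localCoord_mem (x0 y0 : ℝ) (i : Fin 2) :
    localCoord x0 y0 i ∈ vanish (basePt x0 y0) 1 := Submodule.smul_mem _ _ (centered_mem _ i)

lemma localMono_mem (x0 y0 : ℝ) (i : ℕ × ℕ) :
    localMono x0 y0 i ∈ vanish (basePt x0 y0) (i.1 + i.2) := by
  simpa [localMono] using mul_mem_vanish (pow_mem_vanish (localCoord_mem x0 y0 0) i.1)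
    (pow_mem_vanish (localCoord_mem x0 y0 1) i.2)

lemma isReg_localMono (x0 y0 : ℝ) (i : ℕ × ℕ) :
    IsReg (basePt x0 y0) (localMono x0 y0 i) := isReg_of_mem_vanish (localMono_mem x0 y0 i)

lemma conjHom_localCoord (x0 y0 : ℝ) (i : Fin 2) :
    conjHom (localCoord x0 y0 i) = localCoord x0 y0 i := by
  have h : starRingEnd ℂ (basePt x0 y0 i) = basePt x0 y0 i := by
    fin_cases i <;> simp [basePt]
  rw [localCoord, smul_def, map_mul, conjHom_algebraMap, map_inv₀, h, centered,
    conjHom_toRat, map_sub, MvPolynomial.map_X, MvPolynomial.map_C, h]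

lemma conjHom_localMono (x0 y0 : ℝ) (i : ℕ × ℕ) :
    conjHom (localMono x0 y0 i) = localMono x0 y0 i := by
  rw [localMono, map_mul, map_pow, map_pow, conjHom_localCoord, conjHom_localCoord]

lemma one_add_localCoord (sp : IsDominantSaddle M x0 y0) (i : Fin 2) :
    1 + localCoord x0 y0 i = (basePt x0 y0 i)⁻¹ • toRat (MvPolynomial.X i) := by
  have h : algebraMap ℂ RatXY (basePt x0 y0 i) ≠ 0 := by
    simpa using sp.basePt_ne i
  rw [localCoord, centered, map_sub, smul_sub, ← algebraMap_complex, smul_def _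
    (algebraMap ℂ RatXY (basePt x0 y0 i)), map_inv₀, inv_mul_cancel₀ h, add_sub_cancel]

lemma vanish_le_of_localMono (sp : IsDominantSaddle M x0 y0) {k : ℕ} {S : Submodule ℂ RatXY}
    (hm : ∀ i : ℕ × ℕ, i.1 + i.2 = k → localMono x0 y0 i ∈ S)
    (hs : vanish (basePt x0 y0) (k + 1) ≤ S) : vanish (basePt x0 y0) k ≤ S := by
  induction k generalizing S with
  | zero =>
    intro f hf
    have hr := mem_vanish_zero.1 hf
    have h1 := hm (0, 0) rfl
    rw [localMono, pow_zero, pow_zero, mul_one] at h1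
    rw [← sub_add_cancel f (algebraMap ℂ RatXY (ratEval (basePt x0 y0) f))]
    refine S.add_mem (hs ((mem_vanish_one (isReg_sub_const hr _)).2 ?_)) ?_
    · rw [ratEval_sub hr (isReg_algebraMap _ _), ratEval_algebraMap, sub_self]
    · rw [← mul_one (algebraMap ℂ RatXY _), ← smul_def]
      exact S.smul_mem _ h1
  | succ k ih =>
    intro f hf
    obtain ⟨f₀, hf0, f₁, hf1, rfl⟩ := exists_of_mem_vanish_succ hf
    have hc : ∀ i g, centered (basePt x0 y0) i * g =
        basePt x0 y0 i • (localCoord x0 y0 i * g) := by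
      intro i g
      rw [localCoord, smul_mul_assoc, smul_smul, mul_inv_cancel₀ (sp.basePt_ne i), one_smul]
    have h : ∀ i g, g ∈ vanish (basePt x0 y0) k → centered (basePt x0 y0) i * g ∈ S := by
      intro i g hg
      rw [hc]
      refine S.smul_mem _ (ih (S := S.comap (LinearMap.mulLeft ℂ (localCoord x0 y0 i)))
        (fun j hj => ?_) (fun g hg => ?_) hg)
      · rw [Submodule.mem_comap, LinearMap.mulLeft_apply]
        fin_cases i
        · have := hm (j.1 + 1, j.2) (by simp; omega)
          rw [localMono, pow_succ', mul_assoc] at this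
          exact this
        · have := hm (j.1, j.2 + 1) (by simp; omega)
          rw [localMono, pow_succ', mul_left_comm] at this
          exact this
      · rw [Submodule.mem_comap, LinearMap.mulLeft_apply]
        refine hs ?_
        rw [add_comm (k + 1) 1]
        exact mul_mem_vanish (localCoord_mem x0 y0 i) hg
    exact S.add_mem (h 0 f₀ hf0) (h 1 f₁ hf1)

/-- The indices of the truncated expansion. -/
def indexBox (R : ℕ) : Finset (ℕ × ℕ) := range (R + 1) ×ˢ range (R + 1)

/-- The coefficients of a shifted monomial in the local coordinates. -/
def monoCoeff (A : ℤ × ℤ) (i : ℕ × ℕ) : ℤ := Ring.choose (A.1 + 1) i.1 * Ring.choose (A.2 + 1) i.2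

lemma exists_shiftMono_eq (sp : IsDominantSaddle M x0 y0) (R : ℕ) (A : ℤ × ℤ) :
    ∃ r ∈ vanish (basePt x0 y0) (R + 1), shiftMono A = ((x0 : ℂ) ^ (A.1 + 1) * (y0 : ℂ) ^ (A.2 + 1)) •
      (∑ i ∈ indexBox R, (monoCoeff A i : ℂ) • localMono x0 y0 i + r) := by
  have hne : ∀ i, 1 + localCoord x0 y0 i ≠ 0 := fun i => by
    rw [one_add_localCoord sp]
    exact smul_ne_zero (inv_ne_zero (sp.basePt_ne i)) (toRat_ne_zero (MvPolynomial.X_ne_zero i))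
  have hreg : ∀ i, IsReg (basePt x0 y0) (1 + localCoord x0 y0 i) := fun i =>
    (isReg_one _).add (isReg_of_mem_vanish (localCoord_mem x0 y0 i))
  have hev : ∀ i, ratEval (basePt x0 y0) (1 + localCoord x0 y0 i) ≠ 0 := fun i => by
    have h := isReg_of_mem_vanish (localCoord_mem x0 y0 i)
    rw [ratEval_add (isReg_one _) h, (mem_vanish_one h).1 (localCoord_mem x0 y0 i), add_zero,
      ratEval_one]
    exact one_ne_zero
  have hx : shiftMono A = ((x0 : ℂ) ^ (A.1 + 1) * (y0 : ℂ) ^ (A.2 + 1)) •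
      ((1 + localCoord x0 y0 0) ^ (A.1 + 1) * (1 + localCoord x0 y0 1) ^ (A.2 + 1)) := by
    have hx0 : (x0 : ℂ) ≠ 0 := sp.basePt_ne 0
    have hy0 : (y0 : ℂ) ≠ 0 := sp.basePt_ne 1
    rw [one_add_localCoord sp, one_add_localCoord sp, smul_zpow_rat, smul_zpow_rat, smul_mul_smul_comm,
      smul_smul]
    have : (x0 : ℂ) ^ (A.1 + 1) * (y0 : ℂ) ^ (A.2 + 1) * ((basePt x0 y0 0)⁻¹ ^ (A.1 + 1) *
        (basePt x0 y0 1)⁻¹ ^ (A.2 + 1)) = 1 := by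
      rw [show basePt x0 y0 0 = x0 from rfl, show basePt x0 y0 1 = y0 from rfl, inv_zpow, inv_zpow]
      have h1 := zpow_ne_zero (A.1 + 1) hx0
      have h2 := zpow_ne_zero (A.2 + 1) hy0
      rw [mul_mul_mul_comm, mul_inv_cancel₀ h1, mul_inv_cancel₀ h2, one_mul]
    rw [this, one_smul]
    rfl
  have e := fun i => zpow_sub_choose_sum_mem (localCoord_mem x0 y0 i) (hne i)
    ((hreg i).inv (hev i)) R
  refine ⟨(1 + localCoord x0 y0 0) ^ (A.1 + 1) * (1 + localCoord x0 y0 1) ^ (A.2 + 1) -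
    ∑ i ∈ indexBox R, (monoCoeff A i : ℂ) • localMono x0 y0 i, ?_, by rw [hx, add_sub_cancel]⟩
  have hs : ∑ i ∈ indexBox R, (monoCoeff A i : ℂ) • localMono x0 y0 i =
      (∑ i ∈ range (R + 1), ((Ring.choose (A.1 + 1) i : ℤ) : RatXY) *
        localCoord x0 y0 0 ^ i) *
      ∑ i ∈ range (R + 1), ((Ring.choose (A.2 + 1) i : ℤ) : RatXY) *
        localCoord x0 y0 1 ^ i := by
    rw [Finset.sum_mul_sum, indexBox, Finset.sum_product]
    refine sum_congr rfl fun i _ => sum_congr rfl fun j _ => ?_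
    rw [smul_def, map_intCast, monoCoeff, localMono]
    push_cast
    ring
  rw [hs]
  have h1 := mul_mem_vanish_left (e 0 (A.1 + 1)) ((hreg 1).zpow (hev 1) (A.2 + 1))
  have h2 := mul_mem_vanish_right (isReg_sum (s := range (R + 1)) fun i _ =>
    (isReg_algebraMap (basePt x0 y0) ((Ring.choose (A.1 + 1) i : ℤ) : ℂ)).mul
      ((isReg_of_mem_vanish (localCoord_mem x0 y0 0)).pow i)) (e 1 (A.2 + 1))
  simp only [map_intCast] at h2
  convert Submodule.add_mem _ h1 h2 using 1
  ring

namespace GaussFunctional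

variable (L : GaussFunctional M x0 y0)

lemma pairing_shiftMono_left [Finite (modelGroup M)] (sp : IsDominantSaddle M x0 y0) {q R : ℕ}
    (hR : 2 * q - 1 ≤ R + 1 + rotOrder M) (A : ℤ × ℤ) {g : RatXY}
    (hg : IsReg (basePt x0 y0) g) : L.pairing q (shiftMono A) g =
      (x0 : ℂ) ^ (A.1 + 1) * (y0 : ℂ) ^ (A.2 + 1) * ∑ i ∈ indexBox R, (monoCoeff A i : ℂ) *
        L.pairing q (localMono x0 y0 i) g := by
  obtain ⟨r, hr, h⟩ := exists_shiftMono_eq sp R A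
  rw [h, pairing_smul_left, pairing_add_left, pairing_sum_left,
    L.pairing_eq_zero_left sp hR hr hg, add_zero]

lemma pairing_eq_zero_of_forall (sp : IsDominantSaddle M x0 y0) {q a d : ℕ}
    (hq : 2 * q - 1 ≤ a + d + 1) (h : ∀ i j : ℕ × ℕ, i.1 + i.2 = a → j.1 + j.2 = d →
      L.pairing q (localMono x0 y0 i) (localMono x0 y0 j) = 0) {f g : RatXY}
    (hf : f ∈ vanish (basePt x0 y0) a) (hg : g ∈ vanish (basePt x0 y0) d) :
    L.pairing q f g = 0 := by
  have hS : ∀ g f : RatXY, f ∈ LinearMap.ker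
      (L.toFun q ∘ₗ LinearMap.mulRight ℂ (altSum M g) ∘ₗ altSum M) ↔ L.pairing q f g = 0 :=
    fun g f => Iff.rfl
  have h1 : ∀ f ∈ vanish (basePt x0 y0) a, ∀ j : ℕ × ℕ, j.1 + j.2 = d →
      L.pairing q f (localMono x0 y0 j) = 0 := by
    intro f hf j hj
    rw [← hS]
    refine vanish_le_of_localMono sp (fun i hi => (hS _ _).2 (h i j hi hj)) (fun f hf => ?_) hf
    exact (hS _ _).2 (L.pairing_eq_zero sp (i := a + 1) (j := d) (by omega) hf
      (hj ▸ localMono_mem x0 y0 j))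
  rw [pairing_comm, ← hS]
  refine vanish_le_of_localMono sp (fun j hj => (hS _ _).2 ?_) (fun g hg => ?_) hg
  · rw [pairing_comm]
    exact h1 f hf j hj
  · exact (hS _ _).2 (L.pairing_eq_zero sp (i := d + 1) (j := a) (by omega) hg hf)

lemma exists_pairing_ne_zero [Finite (modelGroup M)] (sp : IsDominantSaddle M x0 y0) {p : ℕ}
    (hp : 1 ≤ p) : ∃ i j : ℕ × ℕ, i.1 + i.2 = rotOrder M ∧ j.1 + j.2 = rotOrder M + 2 * p - 2 ∧
      L.pairing (rotOrder M + p) (localMono x0 y0 i) (localMono x0 y0 j) ≠ 0 := by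
  obtain ⟨W, hW⟩ := exists_isEigenParam sp
  obtain ⟨b, rfl⟩ := Nat.exists_eq_add_of_le' hp
  by_contra! hcon
  refine L.apply_altSum_ne_zero sp hW b (L.pairing_eq_zero_of_forall sp
    (a := rotOrder M) (d := rotOrder M + 2 * (b + 1) - 2) (by omega) hcon ?_ ?_)
  · simpa using pow_mem_vanish hW.mem (rotOrder M)
  · have := mul_mem_vanish (pow_mem_vanish hW.mem (rotOrder M + b))
      (pow_mem_vanish (hW.phi_mem sp) b)
    exact vanish_le (by omega) this

end GaussFunctional

end

section

open Fin (sum_univ_four)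
open Finset (sum_congr)
variable {M : Model} {x0 y0 : ℝ}

/-- The univariate factors of the coefficient polynomials: binomial coefficients in the coordinates
of the end point and of the starting point. -/
def factorPoly (v : Fin 4) (i : ℕ) : Polynomial ℝ :=
  (choosePoly i).comp (![-Polynomial.X - 1, -Polynomial.X - 1, Polynomial.X + 1, Polynomial.X + 1] v)

lemma natDegree_factorPoly (v : Fin 4) (i : ℕ) : (factorPoly v i).natDegree = i := by
  have h1 : (Polynomial.X + 1 : Polynomial ℝ).natDegree = 1 := Polynomial.natDegree_X_add_C 1
  have h2 : (-Polynomial.X - 1 : Polynomial ℝ).natDegree = 1 := by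
    rw [← neg_add', Polynomial.natDegree_neg, h1]
  rw [factorPoly, Polynomial.natDegree_comp, natDegree_choosePoly]
  fin_cases v <;> simp [h1, h2]

lemma factorPoly_ne_zero (v : Fin 4) (i : ℕ) : factorPoly v i ≠ 0 := by
  rcases Nat.eq_zero_or_pos i with rfl | hi
  · simp [factorPoly, choosePoly]
  · intro h
    have := natDegree_factorPoly v i
    rw [h, Polynomial.natDegree_zero] at this
    omega

/-- The exponents of a pair of monomials in the local coordinates. -/
def exponents (I : (ℕ × ℕ) × (ℕ × ℕ)) : Fin 4 → ℕ := ![I.1.1, I.1.2, I.2.1, I.2.2]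

lemma exponents_injective : Function.Injective exponents := by
  intro I J h
  have h0 := congrFun h 0
  have h1 := congrFun h 1
  have h2 := congrFun h 2
  have h3 := congrFun h 3
  exact Prod.ext (Prod.ext h0 h1) (Prod.ext h2 h3)

namespace GaussFunctional

variable (L : GaussFunctional M x0 y0)

/-- The coefficients with respect to products of binomial coefficients. -/
def binomCoeff (K : ℝ) (q : ℕ) (I : (ℕ × ℕ) × (ℕ × ℕ)) : ℝ :=
  K * (2 * rotOrder M : ℝ)⁻¹ * (L.pairing q (localMono x0 y0 I.2) (localMono x0 y0 I.1)).re

/-- The polynomial part of the coefficients of the expansion. -/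
def coeffPoly (K : ℝ) (q R : ℕ) : MvPolynomial (Fin 4) ℝ :=
  ∑ I ∈ indexBox R ×ˢ indexBox R, MvPolynomial.C (L.binomCoeff K q I) *
    ∏ v, Polynomial.aeval (MvPolynomial.X v : MvPolynomial (Fin 4) ℝ) (factorPoly v (exponents I v))

lemma ofReal_pairing_re (sp : IsDominantSaddle M x0 y0) (q : ℕ) (i j : ℕ × ℕ) :
    ((L.pairing q (localMono x0 y0 i) (localMono x0 y0 j)).re : ℂ) =
      L.pairing q (localMono x0 y0 i) (localMono x0 y0 j) :=
  Complex.ext rfl (L.pairing_im sp q (isReg_localMono x0 y0 i) (isReg_localMono x0 y0 j)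
    (conjHom_localMono x0 y0 i) (conjHom_localMono x0 y0 j)).symm

lemma evalAt_coeffPoly (K : ℝ) (q R k l u w : ℕ) : evalAt (L.coeffPoly K q R) k l u w =
    ∑ I ∈ indexBox R ×ˢ indexBox R, L.binomCoeff K q I *
      ((monoCoeff (-(k : ℤ) - 2, -(l : ℤ) - 2) I.1 : ℝ) *
        (monoCoeff ((u : ℤ), (w : ℤ)) I.2 : ℝ)) := by
  have h : ∀ (a : Fin 4 → ℝ) (v : Fin 4) (p : Polynomial ℝ),
      MvPolynomial.eval a (Polynomial.aeval (MvPolynomial.X v : MvPolynomial (Fin 4) ℝ) p) =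
        p.eval (a v) := by
    intro a v p
    have := Polynomial.aeval_algHom_apply (MvPolynomial.aeval a) (MvPolynomial.X v) p
    rw [MvPolynomial.aeval_X] at this
    rw [Polynomial.aeval_def, Polynomial.eval₂_eq_eval_map] at this
    simpa using this.symm
  have hneg : ∀ (n i : ℕ), (choosePoly i).eval (-(n : ℝ) - 1) =
      ((Ring.choose (-(n : ℤ) - 2 + 1) i : ℤ) : ℝ) := fun n i => by
    rw [← eval_choosePoly]
    push_cast
    congr 1
    ring
  have hpos : ∀ (n i : ℕ), (choosePoly i).eval ((n : ℝ) + 1) =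
      ((Ring.choose ((n : ℤ) + 1) i : ℤ) : ℝ) := fun n i => by
    rw [← eval_choosePoly]
    push_cast
    rfl
  rw [evalAt, coeffPoly, map_sum]
  refine sum_congr rfl fun I _ => ?_
  rw [map_mul, MvPolynomial.eval_C, map_prod]
  simp only [h]
  congr 1
  simp [Fin.prod_univ_four, factorPoly, exponents, monoCoeff, hneg, hpos]
  ring

lemma mul_symbolCoeff_eq [Finite (modelGroup M)] (sp : IsDominantSaddle M x0 y0) (K : ℝ) {q R : ℕ}
    (hR : 2 * q - 1 ≤ R + 1 + rotOrder M) (k l u w : ℕ) :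
    K * L.symbolCoeff q 0 ((k : ℤ), (l : ℤ)) ((u : ℤ), (w : ℤ)) =
      ((x0 ^ ((u : ℤ) - k) * y0 ^ ((w : ℤ) - l) * evalAt (L.coeffPoly K q R) k l u w : ℝ) : ℂ) := by
  have hx : x0 ≠ 0 := sp.1.ne'
  have hy : y0 ≠ 0 := sp.2.1.ne'
  rw [L.symbolCoeff_eq sp, pow_zero, one_mul,
    L.pairing_shiftMono_left sp hR _ (isReg_dualMono sp _)]
  have h1 : ∀ i, L.pairing q (localMono x0 y0 i) (dualMono ((k : ℤ), (l : ℤ))) =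
      (x0 : ℂ) ^ (-(k : ℤ) - 1) * (y0 : ℂ) ^ (-(l : ℤ) - 1) * ∑ j ∈ indexBox R,
        (monoCoeff (-(k : ℤ) - 2, -(l : ℤ) - 2) j : ℂ) *
          ((L.pairing q (localMono x0 y0 i) (localMono x0 y0 j)).re : ℂ) := by
    intro i
    rw [pairing_comm, dualMono, L.pairing_shiftMono_left sp hR _ (isReg_localMono x0 y0 i)]
    simp only [show -(k : ℤ) - 2 + 1 = -(k : ℤ) - 1 by ring,
      show -(l : ℤ) - 2 + 1 = -(l : ℤ) - 1 by ring]
    congr 1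
    refine sum_congr rfl fun j _ => ?_
    rw [L.ofReal_pairing_re sp, pairing_comm]
  rw [evalAt_coeffPoly, Finset.sum_product_right,
    show (u : ℤ) - k = (u + 1) + (-(k : ℤ) - 1) by ring,
    show (w : ℤ) - l = (w + 1) + (-(l : ℤ) - 1) by ring, zpow_add₀ hx, zpow_add₀ hy]
  push_cast
  simp only [h1, binomCoeff, Finset.mul_sum]
  refine sum_congr rfl fun i _ => sum_congr rfl fun j _ => ?_
  push_cast
  ring

lemma greenCoeff_natCast (K : ℂ) (q k l u w : ℕ) :
    L.greenCoeff K q 0 ((k : ℤ), (l : ℤ)) ((u : ℤ), (w : ℤ)) =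
      (K * L.symbolCoeff q 0 ((k : ℤ), (l : ℤ)) ((u : ℤ), (w : ℤ))).re :=
  if_pos ⟨⟨k.cast_nonneg, l.cast_nonneg⟩, ⟨u.cast_nonneg, w.cast_nonneg⟩⟩

lemma greenCoeff_eq [Finite (modelGroup M)] (sp : IsDominantSaddle M x0 y0) (K : ℝ) {q R : ℕ}
    (hR : 2 * q - 1 ≤ R + 1 + rotOrder M) (k l u w : ℕ) :
    L.greenCoeff K q 0 ((k : ℤ), (l : ℤ)) ((u : ℤ), (w : ℤ)) =
      x0 ^ ((u : ℤ) - k) * y0 ^ ((w : ℤ) - l) * evalAt (L.coeffPoly K q R) k l u w := by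
  rw [greenCoeff_natCast, L.mul_symbolCoeff_eq sp K hR, Complex.ofReal_re]

section Degree

variable [Finite (modelGroup M)]

lemma binomCoeff_ne_zero_iff (sp : IsDominantSaddle M x0 y0) {K : ℝ} (hK : K ≠ 0) (q : ℕ)
    (I : (ℕ × ℕ) × (ℕ × ℕ)) : L.binomCoeff K q I ≠ 0 ↔
      L.pairing q (localMono x0 y0 I.2) (localMono x0 y0 I.1) ≠ 0 := by
  have hc : (2 * rotOrder M : ℝ)⁻¹ ≠ 0 :=
    inv_ne_zero (mul_ne_zero two_ne_zero (Nat.cast_ne_zero.2 (rotOrder_pos M).ne'))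
  rw [← L.ofReal_pairing_re sp, Complex.ofReal_ne_zero, binomCoeff]
  exact ⟨right_ne_zero_of_mul, mul_ne_zero (mul_ne_zero hK hc)⟩

lemma le_of_binomCoeff_ne_zero (sp : IsDominantSaddle M x0 y0) {K : ℝ} (hK : K ≠ 0) {p : ℕ}
    {I : (ℕ × ℕ) × (ℕ × ℕ)}
    (h : L.binomCoeff K (rotOrder M + p) I ≠ 0) :
    I.1.1 + I.1.2 ≤ rotOrder M + 2 * p - 2 ∧ I.2.1 + I.2.2 ≤ rotOrder M + 2 * p - 2 ∧
      I.1.1 + I.1.2 + (I.2.1 + I.2.2) ≤ 2 * rotOrder M + 2 * p - 2 := by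
  rw [L.binomCoeff_ne_zero_iff sp hK] at h
  have hc := rotOrder_pos M
  refine ⟨?_, ?_, ?_⟩
  · by_contra hlt
    rw [pairing_comm] at h
    exact h (L.pairing_eq_zero_left sp (by omega) (localMono_mem x0 y0 I.1)
      (isReg_localMono x0 y0 I.2))
  · by_contra hlt
    exact h (L.pairing_eq_zero_left sp (by omega) (localMono_mem x0 y0 I.2)
      (isReg_localMono x0 y0 I.1))
  · by_contra hlt
    exact h (L.pairing_eq_zero sp (by omega) (localMono_mem x0 y0 I.2) (localMono_mem x0 y0 I.1))

lemma weightedTotalDegree_coeffPoly (sp : IsDominantSaddle M x0 y0) {K : ℝ} (hK : K ≠ 0) {p : ℕ}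
    (w : Fin 4 → ℕ) {d : ℕ}
    (hw : ∀ I : (ℕ × ℕ) × (ℕ × ℕ), I.1.1 + I.1.2 ≤ rotOrder M + 2 * p - 2 →
      I.2.1 + I.2.2 ≤ rotOrder M + 2 * p - 2 →
      I.1.1 + I.1.2 + (I.2.1 + I.2.2) ≤ 2 * rotOrder M + 2 * p - 2 → ∑ v, exponents I v * w v ≤ d)
    {J : (ℕ × ℕ) × (ℕ × ℕ)} (hJ : L.binomCoeff K (rotOrder M + p) J ≠ 0)
    (hT : J.1.1 + J.1.2 + (J.2.1 + J.2.2) = 2 * rotOrder M + 2 * p - 2)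
    (hd : ∑ v, exponents J v * w v = d) :
    (L.coeffPoly K (rotOrder M + p) (rotOrder M + 2 * p - 2)).weightedTotalDegree w = d := by
  have hs : ∀ I, ∑ v, exponents I v = I.1.1 + I.1.2 + (I.2.1 + I.2.2) := fun I => by
    simp [sum_univ_four, exponents, add_assoc]
  refine weightedTotalDegree_sum_prod exponents_injective factorPoly_ne_zero natDegree_factorPoly w
    (T := 2 * rotOrder M + 2 * p - 2) (fun I _ hI => ?_) (fun I _ hI => ?_) (J := J) ?_ hJ
    ((hs J).trans hT) hd
  · rw [hs]
    exact (L.le_of_binomCoeff_ne_zero sp hK hI).2.2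
  · obtain ⟨h1, h2, h3⟩ := L.le_of_binomCoeff_ne_zero sp hK hI
    exact hw I h1 h2 h3
  · obtain ⟨h1, h2, h3⟩ := L.le_of_binomCoeff_ne_zero sp hK hJ
    simp only [indexBox, Finset.mem_product, Finset.mem_range]
    omega

theorem degree_coeffPoly (sp : IsDominantSaddle M x0 y0) {K : ℝ} (hK : K ≠ 0) {p : ℕ}
    (hp : 1 ≤ p) :
    (L.coeffPoly K (rotOrder M + p) (rotOrder M + 2 * p - 2)).weightedTotalDegree ![1, 1, 0, 0] =
        rotOrder M + 2 * p - 2 ∧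
      (L.coeffPoly K (rotOrder M + p) (rotOrder M + 2 * p - 2)).weightedTotalDegree ![0, 0, 1, 1] =
        rotOrder M + 2 * p - 2 ∧
      (L.coeffPoly K (rotOrder M + p) (rotOrder M + 2 * p - 2)).totalDegree =
        2 * rotOrder M + 2 * p - 2 := by
  obtain ⟨i, j, hi, hj, hne⟩ := L.exists_pairing_ne_zero sp hp
  have hc := rotOrder_pos M
  have h1 : L.binomCoeff K (rotOrder M + p) (j, i) ≠ 0 :=
    (L.binomCoeff_ne_zero_iff sp hK _ _).2 hne
  have h2 : L.binomCoeff K (rotOrder M + p) (i, j) ≠ 0 :=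
    (L.binomCoeff_ne_zero_iff sp hK _ _).2 (by rwa [pairing_comm])
  refine ⟨L.weightedTotalDegree_coeffPoly sp hK _ (fun I a _ _ => ?_) h1 (by dsimp only; omega) ?_,
    L.weightedTotalDegree_coeffPoly sp hK _ (fun I _ a _ => ?_) h2 (by dsimp only; omega) ?_, ?_⟩
  · simpa [sum_univ_four, exponents] using a
  · simpa [sum_univ_four, exponents] using hj
  · simpa [sum_univ_four, exponents] using a
  · simpa [sum_univ_four, exponents] using hj
  · rw [← MvPolynomial.weightedTotalDegree_one]
    refine L.weightedTotalDegree_coeffPoly sp hK _ (fun I _ _ a => ?_) h1 (by dsimp only; omega) ?_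
    · simpa [sum_univ_four, exponents, add_assoc] using a
    · simp [sum_univ_four, exponents]
      omega

end Degree

end GaussFunctional

end

section

open scoped Real
open Finset (Ico mem_Ico mem_range mul_sum range sum_congr)
open MvPolynomial (aeval aeval_X eval eval_X funext_set)
open Polynomial (C X eval_C eval_add eval_mul eval_zero)
open Real (exp log)
variable {M : Model} {x0 y0 : ℝ}

/-! ### Zero drift -/

lemma zeroDrift_iff (sp : IsDominantSaddle M x0 y0) : ZeroDrift M ↔ x0 = 1 ∧ y0 = 1 := by
  constructor
  · rintro ⟨h1, h2⟩
    have hexp : ∀ s : ℤ × ℤ, x0 ^ s.1 * y0 ^ s.2 =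
        exp (log x0 * (s.1 : ℝ) + log y0 * (s.2 : ℝ)) := fun s => by
      rw [Real.exp_add, ← Real.rpow_def_of_pos sp.1, ← Real.rpow_def_of_pos sp.2.1,
        Real.rpow_intCast, Real.rpow_intCast]
    by_contra hne
    have hlog : (log x0, log y0) ≠ (0, 0) := fun h => by
      rw [Prod.mk.injEq] at h
      exact hne ⟨Real.eq_one_of_pos_of_log_eq_zero sp.1 h.1,
        Real.eq_one_of_pos_of_log_eq_zero sp.2.1 h.2⟩
    obtain ⟨t, ht, hneg⟩ := M.nondegenerate _ _ hlog
    have hmin := sp.2.2 1 1 one_pos one_pos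
    have hlt : ∑ s ∈ stepBox, M.weight s * (log x0 * (s.1 : ℝ) + log y0 * (s.2 : ℝ) + 1) <
        ∑ s ∈ stepBox, M.weight s * exp (log x0 * (s.1 : ℝ) + log y0 * (s.2 : ℝ)) :=
      Finset.sum_lt_sum
        (fun s _ => mul_le_mul_of_nonneg_left (Real.add_one_le_exp _) (M.weight_nonneg s))
        ⟨t, (M.small t ht).1, mul_lt_mul_of_pos_left (Real.add_one_lt_exp hneg.ne) (weight_pos M ht)⟩
    have hsum : ∑ s ∈ stepBox, M.weight s *
        (log x0 * (s.1 : ℝ) + log y0 * (s.2 : ℝ) + 1) = stepPoly M (1 : ℝ) 1 := by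
      have h3 : ∑ s ∈ stepBox, M.weight s * (log x0 * (s.1 : ℝ) + log y0 * (s.2 : ℝ) + 1) =
          log x0 * ∑ s ∈ stepBox, M.weight s * (s.1 : ℝ) +
            log y0 * ∑ s ∈ stepBox, M.weight s * (s.2 : ℝ) + ∑ s ∈ stepBox, M.weight s := by
        rw [mul_sum, mul_sum, ← Finset.sum_add_distrib, ← Finset.sum_add_distrib]
        exact sum_congr rfl fun s _ => by ring
      rw [h3, h1, h2, stepPoly_real]
      simp
    rw [hsum] at hlt
    refine absurd hmin (not_le.2 (hlt.trans_eq ?_))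
    rw [stepPoly_real]
    exact sum_congr rfl fun s _ => by rw [← hexp, mul_assoc]
  · rintro ⟨rfl, rfl⟩
    have h1 := sum_weight_fst sp
    have h2 := sum_weight_snd sp
    simp only [one_zpow, mul_one] at h1 h2
    exact ⟨h1, h2⟩

lemma exists_evalAt_ne_zero {P : MvPolynomial (Fin 4) ℝ} (hP : P ≠ 0) :
    ∃ k l u w : ℕ, evalAt P k l u w ≠ 0 := by
  by_contra! h
  refine hP (funext_set (fun _ => Set.range ((↑) : ℕ → ℝ))
    (fun _ => Set.infinite_range_of_injective Nat.cast_injective) fun x hx => ?_)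
  choose n hn using fun i => hx i (Set.mem_univ i)
  have h1 := h (n 0) (n 1) (n 2) (n 3)
  rw [evalAt] at h1
  rw [map_zero, ← h1]
  congr 2
  funext i
  fin_cases i <;> simp [← hn]

lemma eval_aeval (P : MvPolynomial (Fin 4) ℝ) (f : Fin 4 → Polynomial ℝ) (t : ℝ) :
    (aeval f P).eval t = eval (fun i => (f i).eval t) P := by
  induction P using MvPolynomial.induction_on with
  | C a => simp
  | add p q hp hq => rw [map_add, eval_add, hp, hq, map_add]
  | mul_X p i hp => rw [map_mul, eval_mul, hp, map_mul, aeval_X,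
      eval_X]

lemma eq_one_of_pow_mul_aeval_eq {x a : ℝ} (hx : 0 < x) {P R : MvPolynomial (Fin 4) ℝ}
    (f : Fin 4 → Polynomial ℝ) {m : ℕ} (hm : eval (fun i => (f i).eval (m : ℝ)) P ≠ 0)
    (h : ∀ n : ℕ, x ^ n * eval (fun i => (f i).eval (n : ℝ)) P =
      a * eval (fun i => (f i).eval (n : ℝ)) R) : x = 1 := by
  refine eq_one_of_pow_mul_eval_eq hx (p := aeval f P)
    (r := C a * aeval f R) (fun h0 => hm ?_) fun n => ?_
  · rw [← eval_aeval, h0, eval_zero]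
  · rw [eval_mul, eval_C, eval_aeval, eval_aeval, h]

lemma eq_one_of_exponential_polynomial (hx : 0 < x0) (hy : 0 < y0) {P R : MvPolynomial (Fin 4) ℝ}
    (hP : P ≠ 0) (h : ∀ k l u w : ℕ, x0 ^ ((u : ℤ) - k) * y0 ^ ((w : ℤ) - l) * evalAt P k l u w =
      evalAt R k l u w) : x0 = 1 ∧ y0 = 1 := by
  obtain ⟨k, l, u, w, hne⟩ := exists_evalAt_ne_zero hP
  have e2 : ∀ n : ℕ, (fun i => (![C (k : ℝ), C (l : ℝ), X,
      C (w : ℝ)] i).eval (n : ℝ)) = ![(k : ℝ), l, n, w] := by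
    intro n
    funext i
    fin_cases i <;> simp
  have e3 : ∀ n : ℕ, (fun i => (![C (k : ℝ), C (l : ℝ), C (u : ℝ),
      X] i).eval (n : ℝ)) = ![(k : ℝ), l, u, n] := by
    intro n
    funext i
    fin_cases i <;> simp
  constructor
  · refine eq_one_of_pow_mul_aeval_eq (R := R) (a := x0 ^ k * y0 ^ ((l : ℤ) - w)) hx _ (m := u)
      (by rw [e2]; exact hne) fun n => ?_
    rw [e2, ← evalAt, ← evalAt, ← h, zpow_sub₀ hx.ne', zpow_sub₀ hy.ne', zpow_sub₀ hy.ne']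
    simp only [zpow_natCast]
    field_simp
  · refine eq_one_of_pow_mul_aeval_eq (R := R) (a := y0 ^ l * x0 ^ ((k : ℤ) - u)) hy _ (m := w)
      (by rw [e3]; exact hne) fun n => ?_
    rw [e3, ← evalAt, ← evalAt, ← h, zpow_sub₀ hx.ne', zpow_sub₀ hy.ne', zpow_sub₀ hx.ne']
    simp only [zpow_natCast]
    field_simp

/-! ### The expansion of the number of walks -/

/-- The factor in front of the integrals over the torus. -/
def torusConst : ℝ := (4 * π ^ 2)⁻¹

lemma torusConst_ne_zero : torusConst ≠ 0 := by
  rw [torusConst]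
  positivity

lemma GaussFunctional.ofReal_greenCoeff (L : GaussFunctional M x0 y0) [Finite (modelGroup M)]
    (sp : IsDominantSaddle M x0 y0) (q k l u w : ℕ) :
    (L.greenCoeff torusConst q 0 ((k : ℤ), (l : ℤ)) ((u : ℤ), (w : ℤ)) : ℂ) =
      (4 * (π : ℂ) ^ 2)⁻¹ * L.toFun q (walkSymbol M u w k l) := by
  have h1 : L.toFun q (walkSymbol M u w k l) =
      L.symbolCoeff q 0 ((k : ℤ), (l : ℤ)) ((u : ℤ), (w : ℤ)) := by
    rw [walkSymbol_eq, GaussFunctional.symbolCoeff, pow_zero, one_mul]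
  have h2 : ((4 * (π : ℂ) ^ 2)⁻¹) = (torusConst : ℂ) := by
    rw [torusConst]
    push_cast
    rfl
  rw [L.greenCoeff_natCast, h1, h2, L.mul_symbolCoeff_eq sp torusConst (q := q) (R := 2 * q)
    (by omega), Complex.ofReal_re]

lemma sum_range_add_of_eq_zero {a : ℕ → ℂ} {c : ℕ} (h : ∀ p ≤ c, a p = 0) (m : ℕ) (x : ℂ) :
    ∑ p ∈ range (c + m), a p * x ^ p = x ^ c * ∑ p ∈ Ico 1 m, a (c + p) * x ^ p := by
  rw [Finset.sum_range_add, Finset.sum_eq_zero fun p hp => by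
    rw [h p (mem_range.1 hp).le, zero_mul], zero_add, mul_sum]
  rw [Finset.sum_subset (s₁ := Ico 1 m) (s₂ := range m)]
  · refine sum_congr rfl fun p _ => ?_
    ring
  · intro p hp
    rw [mem_Ico] at hp
    exact mem_range.2 hp.2
  · intro p hp hp'
    rw [mem_range] at hp
    rw [mem_Ico] at hp'
    rw [h (c + p) (by omega), zero_mul, mul_zero]

lemma isBigO_sum_unit {r : ℕ} (b ζ : Fin r → ℂ) (hζ : ∀ i, ‖ζ i‖ = 1) :
    (fun n : ℕ => ∑ i, b i * ζ i ^ n) =O[atTop] negPow 0 := by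
  refine IsBigO.of_bound (∑ i, ‖b i‖) (Eventually.of_forall fun n => ?_)
  rw [negPow_zero, norm_one, mul_one]
  refine norm_sum_le_of_le _ fun i _ => ?_
  rw [norm_mul, norm_pow, hζ, one_pow, mul_one]

theorem isBigO_walks_sub (hM : OrbitSummable M) [Finite (modelGroup M)]
    (sp : IsDominantSaddle M x0 y0) {L : GaussFunctional M x0 y0}
    (hL : ∀ f δ, IsGoodBox x0 y0 f δ → HasExpansion (boxInt M x0 y0 δ f) (fun p => L.toFun p f))
    {r : ℕ} {z : Fin r → ℂ × ℂ} (hinj : Function.Injective z)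
    (hz : Set.range z = saddlePoints M x0 y0) (u w k l m : ℕ) :
    (fun n : ℕ => ((walks M ((u : ℤ), (w : ℤ)) ((k : ℤ), (l : ℤ)) n : ℝ) : ℂ) -
      ((stepPoly M x0 y0 : ℝ) : ℂ) ^ n / (n : ℂ) ^ rotOrder M * ∑ p ∈ Ico 1 m,
        (L.greenCoeff torusConst (rotOrder M + p) 0 ((k : ℤ), (l : ℤ)) ((u : ℤ), (w : ℤ)) : ℂ) *
          (∑ i, ((z i).1 / x0) ^ ((u : ℤ) - k) * ((z i).2 / y0) ^ ((w : ℤ) - l) *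
            (stepPoly M (z i).1 (z i).2 / (stepPoly M x0 y0 : ℝ)) ^ n) / (n : ℂ) ^ p)
      =O[atTop] (fun n : ℕ => stepPoly M x0 y0 ^ n / (n : ℝ) ^ rotOrder M * (1 / (n : ℝ) ^ m)) := by
  obtain ⟨δ, hδ, hrapid⟩ := exists_isRapid_walks hM sp hinj hz u w k l
  set γ : ℝ := stepPoly M x0 y0 with hγ
  set c := rotOrder M with hc
  have hγ0 : (γ : ℂ) ≠ 0 := Complex.ofReal_ne_zero.2 sp.pos.ne'
  set osc : ℕ → ℂ := fun n => ∑ i, ((z i).1 / x0) ^ ((u : ℤ) - k) *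
    ((z i).2 / y0) ^ ((w : ℤ) - l) * (stepPoly M (z i).1 (z i).2 / (γ : ℂ)) ^ n with hosc
  have hosc1 : osc =O[atTop] negPow 0 := isBigO_sum_unit _ _ fun i => by
    have hi : z i ∈ saddlePoints M x0 y0 := hz ▸ Set.mem_range_self i
    rw [norm_div, hi.2.2, Complex.norm_real, Real.norm_of_nonneg sp.pos.le, div_self sp.pos.ne']
  have hzero : ∀ p ≤ c, L.toFun p (walkSymbol M u w k l) = 0 := by
    intro p hp
    rw [walkSymbol_eq, L.apply_altSum_mul sp p (isReg_shiftMono sp _)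
      (isReg_dualMono sp _), GaussFunctional.pairing, L.eq_zero_of_mem sp p (vanish_le
        (by omega) (mul_mem_vanish (altSum_mem_vanish_rotOrder sp (isReg_shiftMono sp _))
          (altSum_mem_vanish_rotOrder sp (isReg_dualMono sp _)))), mul_zero]
  have h1 := hL _ _ hδ (c + m)
  simp only [sum_range_add_of_eq_zero hzero] at h1
  have h2 := (hrapid (c + m)).add ((isBigO_mul_negPow hosc1 h1).const_mul_left
    ((4 * (π : ℂ) ^ 2)⁻¹) |>.congr_right fun n => by rw [zero_add])
  have h3 : (fun n : ℕ => (γ : ℂ) ^ n) =O[atTop] fun n : ℕ => γ ^ n := by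
    refine IsBigO.of_norm_le fun n => ?_
    rw [norm_pow, Complex.norm_real, Real.norm_of_nonneg sp.pos.le]
  refine (h3.mul h2).congr (fun n => ?_) fun n => ?_
  · have h4 : ∀ p, (L.greenCoeff torusConst (c + p) 0 ((k : ℤ), (l : ℤ)) ((u : ℤ), (w : ℤ)) : ℂ) *
        osc n / (n : ℂ) ^ p = (4 * (π : ℂ) ^ 2)⁻¹ * osc n *
          (L.toFun (c + p) (walkSymbol M u w k l) * ((n : ℂ)⁻¹) ^ p) := fun p => by
      rw [L.ofReal_greenCoeff sp, inv_pow, div_eq_mul_inv]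
      ring
    have h5 : ∑ p ∈ Ico 1 m, (L.greenCoeff torusConst (c + p) 0 ((k : ℤ), (l : ℤ))
        ((u : ℤ), (w : ℤ)) : ℂ) * osc n / (n : ℂ) ^ p = (4 * (π : ℂ) ^ 2)⁻¹ * osc n *
          ∑ p ∈ Ico 1 m, L.toFun (c + p) (walkSymbol M u w k l) * ((n : ℂ)⁻¹) ^ p := by
      rw [mul_sum]
      exact sum_congr rfl fun p _ => h4 p
    have h6 : ∀ W : ℂ, (γ : ℂ) ^ n * (W / (γ : ℂ) ^ n) = W := fun W =>
      mul_div_cancel₀ W (pow_ne_zero n hγ0)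
    rw [h5, ← Finset.sum_mul, mul_add, mul_sub, h6, inv_pow, div_eq_mul_inv]
    ring
  · rw [negPow, pow_add, mul_inv, div_eq_mul_inv, one_div, mul_assoc]

end

end QuadrantWalk

end

theorem theorem2 (M : QuadrantWalk.Model) (hM : QuadrantWalk.OrbitSummable M)
    (x₀ y₀ : ℝ) (h₀ : QuadrantWalk.IsDominantSaddle M x₀ y₀) :
    ∃ (c r : ℕ) (γ : ℝ) (α β ζ : Fin r → ℂ) (v : ℕ → ℤ × ℤ → ℤ × ℤ → ℝ)
      (P : ℕ → MvPolynomial (Fin 4) ℝ),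
      0 < γ ∧ γ = QuadrantWalk.stepPoly M x₀ y₀ ∧
      -- `(α i x₀, β i y₀)` runs through the saddle points, each taken once
      Function.Injective (fun i => (α i, β i)) ∧
      Set.range (fun i => (α i * (x₀ : ℂ), β i * (y₀ : ℂ))) =
        QuadrantWalk.saddlePoints M x₀ y₀ ∧
      (∀ i, QuadrantWalk.stepPoly M (α i * (x₀ : ℂ)) (β i * (y₀ : ℂ)) = ζ i * (γ : ℂ)) ∧
      -- the full asymptotic expansion
      (∀ (u w k l m : ℕ),
        (fun n : ℕ =>
          ((QuadrantWalk.walks M ((u : ℤ), (w : ℤ)) ((k : ℤ), (l : ℤ)) n : ℝ) : ℂ) -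
            (γ : ℂ) ^ n / (n : ℂ) ^ c *
              ∑ p ∈ Finset.Ico 1 m,
                (v p ((k : ℤ), (l : ℤ)) ((u : ℤ), (w : ℤ)) : ℂ) *
                  (∑ i, α i ^ ((u : ℤ) - (k : ℤ)) * β i ^ ((w : ℤ) - (l : ℤ)) * ζ i ^ n) /
                    (n : ℂ) ^ p)
          =O[atTop] (fun n : ℕ => γ ^ n / (n : ℝ) ^ c * (1 / (n : ℝ) ^ m))) ∧
      ∀ p : ℕ, 1 ≤ p →
        -- each coefficient is a polynomial, up to an exponential factor
        (∀ k l u w : ℕ, v p ((k : ℤ), (l : ℤ)) ((u : ℤ), (w : ℤ)) =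
          x₀ ^ ((u : ℤ) - (k : ℤ)) * y₀ ^ ((w : ℤ) - (l : ℤ)) *
            QuadrantWalk.evalAt (P p) k l u w) ∧
        -- it is a polynomial precisely if the drift is zero, and then it is `P p`
        ((∃ R : MvPolynomial (Fin 4) ℝ, ∀ k l u w : ℕ,
          v p ((k : ℤ), (l : ℤ)) ((u : ℤ), (w : ℤ)) = QuadrantWalk.evalAt R k l u w) ↔
            QuadrantWalk.ZeroDrift M) ∧
        (QuadrantWalk.ZeroDrift M → ∀ k l u w : ℕ,
          v p ((k : ℤ), (l : ℤ)) ((u : ℤ), (w : ℤ)) = QuadrantWalk.evalAt (P p) k l u w) ∧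
        -- the degree in the end point, the degree in the starting point, and the total degree
        (P p).weightedTotalDegree ![1, 1, 0, 0] = c + 2 * p - 2 ∧
        (P p).weightedTotalDegree ![0, 0, 1, 1] = c + 2 * p - 2 ∧
        (P p).totalDegree = 2 * c + 2 * p - 2 ∧
        QuadrantWalk.IsMultivariatePolyharmonic M.weight γ p (v p) := by
  have := QuadrantWalk.finite_modelGroup M hM.1
  obtain ⟨r, z, hinj, hz⟩ := (QuadrantWalk.finite_saddlePoints h₀).fin_param
  obtain ⟨L, hL⟩ := QuadrantWalk.exists_gaussFunctional h₀
  have hx : (x₀ : ℂ) ≠ 0 := Complex.ofReal_ne_zero.2 h₀.1.ne'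
  have hy : (y₀ : ℂ) ≠ 0 := Complex.ofReal_ne_zero.2 h₀.2.1.ne'
  have hγ : ((QuadrantWalk.stepPoly M x₀ y₀ : ℝ) : ℂ) ≠ 0 := Complex.ofReal_ne_zero.2 h₀.pos.ne'
  have hzx : ∀ i, (z i).1 / (x₀ : ℂ) * x₀ = (z i).1 := fun i => div_mul_cancel₀ _ hx
  have hzy : ∀ i, (z i).2 / (y₀ : ℂ) * y₀ = (z i).2 := fun i => div_mul_cancel₀ _ hy
  set c := QuadrantWalk.rotOrder M with hc
  have hform : ∀ p k l u w : ℕ, _ := fun p k l u w =>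
    L.greenCoeff_eq h₀ QuadrantWalk.torusConst (q := c + p) (R := c + 2 * p - 2) (by omega) k l u w
  refine ⟨c, r, QuadrantWalk.stepPoly M x₀ y₀, fun i => (z i).1 / x₀, fun i => (z i).2 / y₀,
    fun i => QuadrantWalk.stepPoly M (z i).1 (z i).2 / (QuadrantWalk.stepPoly M x₀ y₀ : ℝ),
    fun p => L.greenCoeff QuadrantWalk.torusConst (c + p) 0,
    fun p => L.coeffPoly QuadrantWalk.torusConst (c + p) (c + 2 * p - 2), h₀.pos, rfl,
    fun i j h => hinj ?_, ?_, fun i => ?_,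
    QuadrantWalk.isBigO_walks_sub hM h₀ hL hinj hz, fun p hp => ?_⟩
  · have h1 : (z i).1 / (x₀ : ℂ) = (z j).1 / x₀ := congrArg Prod.fst h
    have h2 : (z i).2 / (y₀ : ℂ) = (z j).2 / y₀ := congrArg Prod.snd h
    rw [← Prod.mk.eta (p := z i), ← Prod.mk.eta (p := z j), ← hzx i, ← hzy i, h1, h2, hzx, hzy]
  · simp only [hzx, hzy]
    exact hz
  · simp only [hzx, hzy]
    rw [div_mul_cancel₀ _ hγ]
  · obtain ⟨hd1, hd2, hd3⟩ := L.degree_coeffPoly h₀ QuadrantWalk.torusConst_ne_zero hp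
    have hP : L.coeffPoly QuadrantWalk.torusConst (c + p) (c + 2 * p - 2) ≠ 0 := by
      intro h
      rw [h, MvPolynomial.totalDegree_zero] at hd3
      have := QuadrantWalk.rotOrder_pos M
      omega
    have hdrift : QuadrantWalk.ZeroDrift M → ∀ k l u w : ℕ,
        L.greenCoeff QuadrantWalk.torusConst (c + p) 0 ((k : ℤ), (l : ℤ)) ((u : ℤ), (w : ℤ)) =
          QuadrantWalk.evalAt (L.coeffPoly QuadrantWalk.torusConst (c + p) (c + 2 * p - 2))
            k l u w := by
      intro h k l u w
      obtain ⟨h1, h2⟩ := (QuadrantWalk.zeroDrift_iff h₀).1 h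
      have h3 : x₀ ^ ((u : ℤ) - k) * y₀ ^ ((w : ℤ) - l) = 1 := by simp only [h1, h2, one_zpow, mul_one]
      rw [hform, h3, one_mul]
    refine ⟨hform p, ⟨?_, fun h => ⟨_, hdrift h⟩⟩, hdrift, hd1, hd2, hd3,
      L.isMultivariatePolyharmonic h₀ _ p⟩
    rintro ⟨R, hR⟩
    exact (QuadrantWalk.zeroDrift_iff h₀).2 (QuadrantWalk.eq_one_of_exponential_polynomial h₀.1
      h₀.2.1 hP fun k l u w =>
        (hform p k l u w).symm.trans (hR k l u w))
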